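/- Conventions. Let $\mathbf k$ be a field of characteristic zero. All vector spaces are $\mathbb Z$-graded over $\mathbf k$, differentials have degree $-1$, and tensor products of maps follow the Koszul sign rule. For complexes $(V,\partial),(W,\partial)$ and a multilinear map $f:V^{\otimes n}\to W$ of degree $p$ put $\delta f=\partial f-(-1)^{p}\sum_{s=0}^{n-1}f(1^{\otimes s}\otimes\partial\otimes1^{\otimes(n-s-1)})$. Let $K\in\{1,2,\dots\}\cup\{\infty\}$. An $A(K)$-algebra $(V,\partial,m_2,m_3,\dots,m_K)$ is a complex $(V,\partial)$ with maps $m_n:V^{\otimes n}\to V$ of degree $n-2$ $(2\le n\le K,\ n<\infty)$ such that for all these $n$ $$\delta m_n=\sum_{\substack{i+j=n+1\\ i,j\ge2}}\sum_{s=0}^{n-j}(-1)^{i+s(j+1)}\,m_i(1^{\otimes s}\otimes m_j\otimes1^{\otimes(i-s-1)}).$$ A morphism of $A(K)$-algebras $(V,\partial,m_2,\dots)\to(W,\partial,n_2,\dots)$ is a sequence of maps $F_n:V^{\otimes n}\to W$ of degree $n-1$ $(1\le n\le K,\ n<\infty)$ such that for all these $n$ $$\delta F_n=-\sum_{k=2}^{n}\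 \sum_{r_1+\dots+r_k=n}(-1)^{\sum_{a<b}r_a(r_b+1)}\,n_k(F_{r_1}\otimes\dots\otimes F_{r_k})-\sum_{\substack{i+j=n+1\\ i\ge1,\ j\ge2}}\sum_{s=0}^{n-j}(-1)^{i+s(j+1)}F_i(1^{\otimes s}\otimes m_j\otimes1^{\otimes(i-s-1)}),$$ where all $r_a\ge 1$. For a permutation $\sigma$ of homogeneous elements let $\chi(\sigma)$ be the product of $\operatorname{sgn}\sigma$ and of the Koszul sign of $\sigma$. A $C(K)$-algebra (balanced $A(K)$-algebra) is an $A(K)$-algebra each of whose operations $m_n$ vanishes on all graded shuffle products of $x_1\otimes\dots\otimes x_p$ and $x_{p+1}\otimes\dots\otimes x_n$, $0<p<n$ (the sums of all shuffles taken with the signs $\chi$); a morphism of $C(K)$-algebras is a morphism of $A(K)$-algebras each of whose components $F_n$ vanishes on these shuffle products. An $L(K)$-algebra $(V,\partial,m_2,\dots,m_K)$ is a complex $(V,\partial)$ with graded antisymmetric maps $m_n:V^{\otimes n}\to V$ of degree $n-2$ $(2\le n\le K,\ n<\infty)$ such that for all these $n$, with $m_1=\partial$, $$\sum_{i+j=n+1}(-1)^{j(i-1)}\sum_{\sigma}\chi(\sigma)\,m_i\big(m_j(x_{\sigma(1)},\dots,x_{\sigma(j)}),x_{\sigma(j+1)},\dots,x_{\sigma(n)}\big)=0,$$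 where $i,j\ge1$ and $\sigma$ runs over all $(j,n-j)$-unshuffles. A morphism of $L(K)$-algebras $(V,\partial,m_2,\dots)\to(W,\partial,n_2,\dots)$ is a sequence of graded antisymmetric maps $F_n:V^{\otimes n}\to W$ of degree $n-1$ $(1\le n\le K,\ n<\infty)$ such that for all these $n$, with $m_1=\partial$ and $n_1=\partial$, $$\sum_{k=1}^{n}\frac1{k!}\sum_{r_1+\dots+r_k=n}(-1)^{\sum_a(k-a)(r_a-1)}\sum_\sigma\chi(\sigma)\,n_k(F_{r_1}\otimes\dots\otimes F_{r_k})(x_{\sigma(1)},\dots,x_{\sigma(n)})$$ $$=\sum_{i+j=n+1}(-1)^{j(i-1)}\sum_\sigma\chi(\sigma)\,F_i\big(m_j(x_{\sigma(1)},\dots,x_{\sigma(j)}),x_{\sigma(j+1)},\dots,x_{\sigma(n)}\big),$$ where all $r_a,i,j\ge1$ and the inner sums run over the unshuffles of type $(r_1,\dots,r_k)$ and $(j,n-j)$, respectively. For $P\in\{A,C,L\}$, forgetting the operations of arity greater than $K$ turns a $P(\infty)$-algebra $\mathbf V$ into a $P(K)$-algebra $\mathbf V_K$. Theorem. Let $P\in\{A,C,L\}$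 and let $1\le K<\infty$. Let $\mathbf V=(V,\partial,m_2,m_3,\dots)$ be a $P(\infty)$-algebra, let $\mathbf W=(W,\partial,n_2,\dots,n_K)$ be a $P(K)$-algebra, and let $\{F_n:V^{\otimes n}\to W\}_{n\le K}:\mathbf V_K\to\mathbf W$ be a morphism of $P(K)$-algebras. Suppose that the chain map $F_1:(V,\partial)\to(W,\partial)$ is a quasi-isomorphism, that is, induces an isomorphism of homology. Then there are maps $n_{K+1},n_{K+2},\dots$ and $F_{K+1},F_{K+2},\dots$ such that $(W,\partial,n_2,\dots,n_K,n_{K+1},\dots)$ is a $P(\infty)$-algebra and $(F_1,\dots,F_K,F_{K+1},\dots)$ is a morphism of $P(\infty)$-algebras from $\mathbf V$ to it. -/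

import Mathlib

namespace StrongHomotopy

open Finset

/-! ### Graded vector spaces, complexes, quasi-isomorphisms

A graded vector space is a `𝕜`-module `V` with a decomposition `𝒱 : ℤ → Submodule 𝕜 V` into
homogeneous components.  Multilinear maps are evaluated on sequences `x : ℕ → V`, of which a map of
arity `n` sees the terms `x 0, …, x (n - 1)` only.  `d : ℕ → ℤ` always records the degrees of the
terms of a homogeneous sequence. -/

section Basic

variable {𝕜 : Type*} [Field 𝕜] {V : Type*} [AddCommGroup V] [Module 𝕜 V]
  {W : Type*} [AddCommGroup W] [Module 𝕜 W]

/-- A family of multilinear maps `V^{⊗ n} → W`, one for each arity. Which arities are part of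
the data is decided by the predicates below; the remaining members of the family are ignored. -/
abbrev Ops (𝕜 V W : Type*) [Field 𝕜] [AddCommGroup V] [Module 𝕜 V]
    [AddCommGroup W] [Module 𝕜 W] : Type _ :=
  ∀ n : ℕ, MultilinearMap 𝕜 (fun _ : Fin n => V) W

/-- The value `f (x 0, …, x (n - 1))`. -/
def ev {n : ℕ} (f : MultilinearMap 𝕜 (fun _ : Fin n => V) W) (x : ℕ → V) : W :=
  f fun t : Fin n => x t

/-- The terms of `x` are homogeneous, of degrees `d`. -/
def Homogeneous (𝒱 : ℤ → Submodule 𝕜 V) (d : ℕ → ℤ) (x : ℕ → V) : Prop :=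
  ∀ t, x t ∈ 𝒱 (d t)

/-- The multilinear map `f` is homogeneous of degree `p`. -/
def HasDegree (𝒱 : ℤ → Submodule 𝕜 V) (𝒲 : ℤ → Submodule 𝕜 W) {n : ℕ}
    (f : MultilinearMap 𝕜 (fun _ : Fin n => V) W) (p : ℤ) : Prop :=
  ∀ d x, Homogeneous 𝒱 d x → ev f x ∈ 𝒲 (∑ t ∈ range n, d t + p)

/-- `dV` is a differential of degree `-1` on the graded vector space `(V, 𝒱)`. -/
structure IsDifferential (𝒱 : ℤ → Submodule 𝕜 V) (dV : V →ₗ[𝕜] V) : Prop where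
  degree : ∀ e, ∀ v ∈ 𝒱 e, dV v ∈ 𝒱 (e - 1)
  sq_zero : ∀ v, dV (dV v) = 0

/-- The homology `ker dV / im dV`; it is the direct sum of the homologies in all degrees. -/
abbrev Homology (dV : V →ₗ[𝕜] V) : Type _ :=
  LinearMap.ker dV ⧸ (LinearMap.range dV).submoduleOf (LinearMap.ker dV)

/-- The map on cycles induced by a chain map. -/
def cyclesMap {dV : V →ₗ[𝕜] V} {dW : W →ₗ[𝕜] W} (f : V →ₗ[𝕜] W)
    (hf : ∀ v, dW (f v) = f (dV v)) : LinearMap.ker dV →ₗ[𝕜] LinearMap.ker dW :=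
  f.restrict fun v hv => by
    rw [LinearMap.mem_ker] at hv ⊢
    rw [hf, hv, map_zero]

/-- The map on homology induced by a chain map. -/
def homologyMap {dV : V →ₗ[𝕜] V} {dW : W →ₗ[𝕜] W} (f : V →ₗ[𝕜] W)
    (hf : ∀ v, dW (f v) = f (dV v)) : Homology dV →ₗ[𝕜] Homology dW :=
  Submodule.mapQ _ _ (cyclesMap f hf) (by
    rintro ⟨v, hv⟩ hvr
    rw [Submodule.submoduleOf, Submodule.mem_comap] at hvr
    obtain ⟨u, hu⟩ := hvr
    rw [Submodule.mem_comap, Submodule.submoduleOf, Submodule.mem_comap]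
    refine ⟨f u, ?_⟩
    rw [hf, hu]
    rfl)

/-- A chain map is a quasi-isomorphism if it induces an isomorphism of homology. -/
def IsQuasiIso (dV : V →ₗ[𝕜] V) (dW : W →ₗ[𝕜] W) (f : V →ₗ[𝕜] W) : Prop :=
  ∃ hf : ∀ v, dW (f v) = f (dV v), Function.Bijective (homologyMap f hf)

/-- The linear part `F_1` of a family of multilinear maps. -/
def linearPart (F : Ops 𝕜 V W) : V →ₗ[𝕜] W :=
  (MultilinearMap.ofSubsingleton 𝕜 V W (0 : Fin 1)).symm (F 1)

/-! ### Composition of multilinear maps with the Koszul sign convention -/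

/-- The value at `x`, of degrees `d`, of the differential
`dW ∘ f - (-1)^p ∑ₛ f ∘ (1^{⊗ s} ⊗ dV ⊗ 1^{⊗ (n - s - 1)})` of a map `f` of degree `p`
in the complex `Hom(V^{⊗ n}, W)`. -/
def homDiff (dV : V →ₗ[𝕜] V) (dW : W →ₗ[𝕜] W) {n : ℕ}
    (f : MultilinearMap 𝕜 (fun _ : Fin n => V) W) (p : ℤ) (d : ℕ → ℤ) (x : ℕ → V) : W :=
  dW (ev f x) - p.negOnePow • ∑ s ∈ range n,
    (∑ t ∈ range s, d t).negOnePow • ev f (Function.update x s (dV (x s)))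

/-- The sequence `x 0, …, x (s - 1), v, x (s + j), x (s + j + 1), …`. -/
def replaceBlock (x : ℕ → V) (s j : ℕ) (v : V) : ℕ → V :=
  fun t => if t < s then x t else if t = s then v else x (t + j - 1)

/-- The value at `x`, of degrees `d`, of `f ∘ (1^{⊗ s} ⊗ g ⊗ 1^{⊗ (i - s - 1)})`, where `g`
has degree `p`. -/
def insertOp {i j : ℕ} (f : MultilinearMap 𝕜 (fun _ : Fin i => V) W)
    (g : MultilinearMap 𝕜 (fun _ : Fin j => V) V) (p : ℤ) (s : ℕ) (d : ℕ → ℤ) (x : ℕ → V) : W :=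
  (p * ∑ t ∈ range s, d t).negOnePow • ev f (replaceBlock x s j (ev g fun t => x (s + t)))

/-- The value at `x`, of degrees `d`, of `g_k ∘ (F_{r_1} ⊗ ⋯ ⊗ F_{r_k})`, where `(r_1, …, r_k)` is
the composition `c` of `n` and `F_r` has degree `r - 1`. -/
def composeOps (g : Ops 𝕜 W W) (F : Ops 𝕜 V W) {n : ℕ} (c : Composition n)
    (d : ℕ → ℤ) (x : ℕ → V) : W :=
  (∑ a : Fin c.length, ((c.blocksFun a : ℤ) - 1) * ∑ t ∈ range (c.sizeUpTo a), d t).negOnePow •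
    g c.length fun a => ev (F (c.blocksFun a)) fun t => x (c.sizeUpTo a + t)

/-! ### Permutations -/

/-- The sequence `x (σ 0), …, x (σ (n - 1))`, continued by the remaining terms of `x`. -/
def permSeq {α : Type*} {n : ℕ} (σ : Equiv.Perm (Fin n)) (x : ℕ → α) : ℕ → α :=
  fun t => if h : t < n then x (σ ⟨t, h⟩) else x t

/-- The product `χ(σ)` of the signature of `σ` and of the Koszul sign of the rearrangement
`x 0, …, x (n - 1) ↦ x (σ 0), …, x (σ (n - 1))` of elements of degrees `d`. -/
def antiKoszulSign {n : ℕ} (σ : Equiv.Perm (Fin n)) (d : ℕ → ℤ) : ℤˣ :=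
  Equiv.Perm.sign σ * ∏ a : Fin n, ∏ b ∈ Finset.Ioi a,
    if σ b < σ a then (d (σ a) * d (σ b)).negOnePow else 1

open Classical in
/-- The permutations that are increasing on `{0, …, j - 1}` and on `{j, …, n - 1}`. -/
noncomputable def unshuffles (n j : ℕ) : Finset (Equiv.Perm (Fin n)) :=
  univ.filter fun σ => ∀ a b : Fin n, a < b → ((b : ℕ) < j ∨ j ≤ (a : ℕ)) → σ a < σ b

open Classical in
/-- The permutations that are increasing on each block of the composition `c`. -/
noncomputable def blockUnshuffles {n : ℕ} (c : Composition n) : Finset (Equiv.Perm (Fin n)) :=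
  univ.filter fun σ => ∀ a b : Fin n, a < b → c.index a = c.index b → σ a < σ b

/-- `f` vanishes on all graded shuffle products of `x 0 ⊗ ⋯ ⊗ x (p - 1)` and
`x p ⊗ ⋯ ⊗ x (n - 1)`, `0 < p < n`. -/
def VanishesOnShuffles (𝒱 : ℤ → Submodule 𝕜 V) {n : ℕ}
    (f : MultilinearMap 𝕜 (fun _ : Fin n => V) W) : Prop :=
  ∀ p, 0 < p → p < n → ∀ d x, Homogeneous 𝒱 d x →
    ∑ σ ∈ unshuffles n p, antiKoszulSign σ⁻¹ d • ev f (permSeq σ⁻¹ x) = 0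

/-- `f` is antisymmetric in the graded sense. -/
def GradedAntisymmetric (𝒱 : ℤ → Submodule 𝕜 V) {n : ℕ}
    (f : MultilinearMap 𝕜 (fun _ : Fin n => V) W) : Prop :=
  ∀ σ : Equiv.Perm (Fin n), ∀ d x, Homogeneous 𝒱 d x →
    ev f (permSeq σ x) = antiKoszulSign σ d • ev f x

end Basic

section Algebras

variable {𝕜 : Type*} [Field 𝕜] {V : Type*} [AddCommGroup V] [Module 𝕜 V]
  {W : Type*} [AddCommGroup W] [Module 𝕜 W]

/-! ### `A(K)`-algebras, `K = ⊤` being the case of `A(∞)`-algebras -/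

/-- `(V, dV, m_2, …, m_K)` is an `A(K)`-algebra: `m_n` has degree `n - 2`, and in each
arity `n ≤ K` the differential of `m_n` equals
`∑_{i + j = n + 1; i, j ≥ 2} ∑_{s < i} (-1)^{i + s (j + 1)} m_i (1^{⊗ s} ⊗ m_j ⊗ 1^{⊗ (i-s-1)})`. -/
structure IsAAlgebra (K : ℕ∞) (𝒱 : ℤ → Submodule 𝕜 V) (dV : V →ₗ[𝕜] V) (m : Ops 𝕜 V V) :
    Prop where
  differential : IsDifferential 𝒱 dV
  degree : ∀ n : ℕ, 2 ≤ n → (n : ℕ∞) ≤ K → HasDegree 𝒱 𝒱 (m n) ((n : ℤ) - 2)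
  relation : ∀ n : ℕ, 2 ≤ n → (n : ℕ∞) ≤ K → ∀ d x, Homogeneous 𝒱 d x →
    homDiff dV dV (m n) ((n : ℤ) - 2) d x =
      ∑ ij ∈ antidiagonal (n + 1) with 2 ≤ ij.1 ∧ 2 ≤ ij.2, ∑ s ∈ range ij.1,
        (-1 : ℤˣ) ^ (ij.1 + s * (ij.2 + 1)) •
          insertOp (m ij.1) (m ij.2) ((ij.2 : ℤ) - 2) s d x

/-- `(F_1, …, F_K)` is a morphism from `(V, dV, m_2, …, m_K)` to `(W, dW, l_2, …, l_K)`: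
`F_n` has degree `n - 1`, and in each arity `n ≤ K` the differential of `F_n` equals
`- ∑_{k ≥ 2} ∑_{r_1 + ⋯ + r_k = n} (-1)^{∑_{a < b} r_a (r_b + 1)} l_k (F_{r_1} ⊗ ⋯ ⊗ F_{r_k})`
`- ∑_{i + j = n + 1; i ≥ 1, j ≥ 2} ∑_{s < i} (-1)^{i + s (j + 1)}`
`F_i (1^{⊗ s} ⊗ m_j ⊗ 1^{⊗ (i-s-1)})`. -/
structure IsAMorphism (K : ℕ∞) (𝒱 : ℤ → Submodule 𝕜 V) (𝒲 : ℤ → Submodule 𝕜 W)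
    (dV : V →ₗ[𝕜] V) (dW : W →ₗ[𝕜] W) (m : Ops 𝕜 V V) (l : Ops 𝕜 W W) (F : Ops 𝕜 V W) :
    Prop where
  degree : ∀ n : ℕ, 1 ≤ n → (n : ℕ∞) ≤ K → HasDegree 𝒱 𝒲 (F n) ((n : ℤ) - 1)
  relation : ∀ n : ℕ, 1 ≤ n → (n : ℕ∞) ≤ K → ∀ d x, Homogeneous 𝒱 d x →
    homDiff dV dW (F n) ((n : ℤ) - 1) d x =
      - (∑ c : Composition n with 2 ≤ c.length,
          (-1 : ℤˣ) ^ (∑ a : Fin c.length, ∑ b ∈ Finset.Ioi a,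
            c.blocksFun a * (c.blocksFun b + 1)) • composeOps l F c d x)
      - ∑ ij ∈ antidiagonal (n + 1) with 1 ≤ ij.1 ∧ 2 ≤ ij.2, ∑ s ∈ range ij.1,
          (-1 : ℤˣ) ^ (ij.1 + s * (ij.2 + 1)) •
            insertOp (F ij.1) (m ij.2) ((ij.2 : ℤ) - 2) s d x

/-! ### `C(K)`-algebras (balanced `A(K)`-algebras) -/

/-- A balanced `A(K)`-algebra: the operations vanish on shuffle products. -/
structure IsCAlgebra (K : ℕ∞) (𝒱 : ℤ → Submodule 𝕜 V) (dV : V →ₗ[𝕜] V) (m : Ops 𝕜 V V) : Prop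
    extends IsAAlgebra K 𝒱 dV m where
  balanced : ∀ n : ℕ, 2 ≤ n → (n : ℕ∞) ≤ K → VanishesOnShuffles 𝒱 (m n)

/-- A morphism of balanced `A(K)`-algebras: its components vanish on shuffle products. -/
structure IsCMorphism (K : ℕ∞) (𝒱 : ℤ → Submodule 𝕜 V) (𝒲 : ℤ → Submodule 𝕜 W)
    (dV : V →ₗ[𝕜] V) (dW : W →ₗ[𝕜] W) (m : Ops 𝕜 V V) (l : Ops 𝕜 W W) (F : Ops 𝕜 V W) : Prop
    extends IsAMorphism K 𝒱 𝒲 dV dW m l F where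
  balanced : ∀ n : ℕ, 1 ≤ n → (n : ℕ∞) ≤ K → VanishesOnShuffles 𝒱 (F n)

/-! ### `L(K)`-algebras -/

/-- `(V, dV, m_2, …, m_K)` is an `L(K)`-algebra: `m_n` is antisymmetric of degree `n - 2`, and,
with `m_1 = dV`, in each arity `n ≤ K`
`∑_{i + j = n + 1} (-1)^{j (i - 1)} ∑_σ χ(σ) m_i (m_j (x_{σ 1}, …, x_{σ j}), x_{σ (j + 1)}, …) = 0`,
where `σ` runs over the `(j, n - j)`-unshuffles. The terms with `i = 1` or `j = 1` make up the
differential of `m_n`. -/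
structure IsLAlgebra (K : ℕ∞) (𝒱 : ℤ → Submodule 𝕜 V) (dV : V →ₗ[𝕜] V) (m : Ops 𝕜 V V) :
    Prop where
  differential : IsDifferential 𝒱 dV
  degree : ∀ n : ℕ, 2 ≤ n → (n : ℕ∞) ≤ K → HasDegree 𝒱 𝒱 (m n) ((n : ℤ) - 2)
  antisymm : ∀ n : ℕ, 2 ≤ n → (n : ℕ∞) ≤ K → GradedAntisymmetric 𝒱 (m n)
  relation : ∀ n : ℕ, 2 ≤ n → (n : ℕ∞) ≤ K → ∀ d x, Homogeneous 𝒱 d x →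
    homDiff dV dV (m n) ((n : ℤ) - 2) d x +
      ∑ ij ∈ antidiagonal (n + 1) with 2 ≤ ij.1 ∧ 2 ≤ ij.2,
        (-1 : ℤˣ) ^ (ij.2 * (ij.1 - 1)) • ∑ σ ∈ unshuffles n ij.2, antiKoszulSign σ d •
          insertOp (m ij.1) (m ij.2) ((ij.2 : ℤ) - 2) 0 (permSeq σ d) (permSeq σ x) = 0

/-- `(F_1, …, F_K)` is a morphism from `(V, dV, m_2, …, m_K)` to `(W, dW, l_2, …, l_K)`:
`F_n` is antisymmetric of degree `n - 1`, and, with `m_1 = dV` and `l_1 = dW`, in each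
arity `n ≤ K`
`∑_{k ≥ 1} (1 / k!) ∑_{r_1 + ⋯ + r_k = n} (-1)^{∑_a (k - a) (r_a - 1)} ∑_σ χ(σ)`
`l_k (F_{r_1} ⊗ ⋯ ⊗ F_{r_k}) (x_{σ 1}, …, x_{σ n})`
`= ∑_{i + j = n + 1} (-1)^{j (i - 1)} ∑_σ χ(σ) F_i (m_j (x_{σ 1}, …, x_{σ j}), x_{σ (j + 1)}, …)`,
the inner sums being over the unshuffles of type `(r_1, …, r_k)` and `(j, n - j)`. The terms with
`k = 1` or `j = 1` make up the differential of `F_n`. In the code the index `a` starts from `0`. -/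
structure IsLMorphism (K : ℕ∞) (𝒱 : ℤ → Submodule 𝕜 V) (𝒲 : ℤ → Submodule 𝕜 W)
    (dV : V →ₗ[𝕜] V) (dW : W →ₗ[𝕜] W) (m : Ops 𝕜 V V) (l : Ops 𝕜 W W) (F : Ops 𝕜 V W) :
    Prop where
  degree : ∀ n : ℕ, 1 ≤ n → (n : ℕ∞) ≤ K → HasDegree 𝒱 𝒲 (F n) ((n : ℤ) - 1)
  antisymm : ∀ n : ℕ, 1 ≤ n → (n : ℕ∞) ≤ K → GradedAntisymmetric 𝒱 (F n)
  relation : ∀ n : ℕ, 1 ≤ n → (n : ℕ∞) ≤ K → ∀ d x, Homogeneous 𝒱 d x →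
    homDiff dV dW (F n) ((n : ℤ) - 1) d x +
      ∑ c : Composition n with 2 ≤ c.length, ((c.length.factorial : 𝕜)⁻¹) •
        (-1 : ℤˣ) ^ (∑ a : Fin c.length, (c.length - 1 - (a : ℕ)) * (c.blocksFun a - 1)) •
          ∑ σ ∈ blockUnshuffles c, antiKoszulSign σ d •
            composeOps l F c (permSeq σ d) (permSeq σ x) =
      ∑ ij ∈ antidiagonal (n + 1) with 1 ≤ ij.1 ∧ 2 ≤ ij.2,
        (-1 : ℤˣ) ^ (ij.2 * (ij.1 - 1)) • ∑ σ ∈ unshuffles n ij.2, antiKoszulSign σ d •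
          insertOp (F ij.1) (m ij.2) ((ij.2 : ℤ) - 2) 0 (permSeq σ d) (permSeq σ x)

end Algebras

end StrongHomotopy

set_option autoImplicit false

namespace StrongHomotopy

open TensorProduct TensorAlgebra
open Finset.HasAntidiagonal (antidiagonal mem_antidiagonal)

section Convolution

variable {𝕜 : Type*} [Field 𝕜] {V : Type*} [AddCommGroup V] [Module 𝕜 V]
  {N : Type*} [AddCommGroup N] [Module 𝕜 N]
  {A : Type*} [Ring A] [Algebra 𝕜 A] {B : Type*} [Ring B] [Algebra 𝕜 B]

/-- The tensor (co)algebra of `V`. -/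
abbrev Tens (𝕜 V : Type*) [Field 𝕜] [AddCommGroup V] [Module 𝕜 V] : Type _ := TensorAlgebra 𝕜 V

theorem tens_induction {p : Tens 𝕜 V → Prop} (one : p 1) (zero : p 0)
    (add : ∀ a b, p a → p b → p (a + b)) (smul : ∀ (r : 𝕜) a, p a → p (r • a))
    (mul : ∀ x w, p w → p (ι 𝕜 x * w)) (w : Tens 𝕜 V) : p w := by
  have key : ∀ a w : Tens 𝕜 V, p w → p (a * w) := by
    intro a
    induction a using TensorAlgebra.induction with
    | algebraMap r => intro w hw; rw [← Algebra.smul_def]; exact smul r w hw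
    | ι x => exact fun w hw => mul x w hw
    | mul a b ha hb => intro w hw; rw [mul_assoc]; exact ha _ (hb _ hw)
    | add a b ha hb => intro w hw; rw [add_mul]; exact add _ _ (ha w hw) (hb w hw)
  simpa using key w 1 one

theorem tens_hom_ext {f g : Tens 𝕜 V →ₗ[𝕜] N} (one : f 1 = g 1)
    (mul : ∀ x w, f w = g w → f (ι 𝕜 x * w) = g (ι 𝕜 x * w)) : f = g := by
  ext w
  induction w using tens_induction with
  | one => exact one
  | zero => simp
  | add a b ha hb => simp [ha, hb]
  | smul r a ha => simp [ha]
  | mul x w hw => exact mul x w hw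

theorem exists_fold (n₀ : N) (h : V →ₗ[𝕜] (Tens 𝕜 V × N) →ₗ[𝕜] N) :
    ∃ r : Tens 𝕜 V →ₗ[𝕜] N, r 1 = n₀ ∧ ∀ x w, r (ι 𝕜 x * w) = h x (w, r w) := by
  let g : V →ₗ[𝕜] Module.End 𝕜 (Tens 𝕜 V × N) :=
    { toFun := fun x => LinearMap.prod (LinearMap.mulLeft 𝕜 (ι 𝕜 x) ∘ₗ LinearMap.fst _ _ _) (h x)
      map_add' := fun x y => by
        refine LinearMap.ext fun z => ?_
        simp [add_mul]
      map_smul' := fun r x => by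
        refine LinearMap.ext fun z => ?_
        simp }
  let s : Tens 𝕜 V →ₗ[𝕜] Tens 𝕜 V × N :=
    (LinearMap.applyₗ ((1, n₀) : Tens 𝕜 V × N)) ∘ₗ (lift 𝕜 g).toLinearMap
  have hs1 : s 1 = (1, n₀) := by simp [s]
  have hsx : ∀ x w, s (ι 𝕜 x * w) = (ι 𝕜 x * (s w).1, h x (s w)) := by
    intro x w
    simp [s, g]
  have hfst : ∀ w, (s w).1 = w := by
    intro w
    have : LinearMap.fst _ _ _ ∘ₗ s = LinearMap.id := by
      refine tens_hom_ext (by simp [hs1]) fun x w hw => ?_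
      simp only [LinearMap.comp_apply, LinearMap.fst_apply, LinearMap.id_apply] at hw ⊢
      rw [hsx, hw]
    exact LinearMap.congr_fun this w
  refine ⟨LinearMap.snd _ _ _ ∘ₗ s, by simp [hs1], fun x w => ?_⟩
  simp only [LinearMap.comp_apply, LinearMap.snd_apply, hsx]
  congr 1
  exact Prod.ext (hfst w) rfl

theorem exists_deconc : ∃ r : Tens 𝕜 V →ₗ[𝕜] Tens 𝕜 V ⊗[𝕜] Tens 𝕜 V, r 1 = 1 ⊗ₜ 1 ∧
    ∀ x w, r (ι 𝕜 x * w) = 1 ⊗ₜ (ι 𝕜 x * w) + (ι 𝕜 x ⊗ₜ 1) * r w := by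
  obtain ⟨r, hr1, hr⟩ := exists_fold (V := V) ((1 : Tens 𝕜 V) ⊗ₜ[𝕜] (1 : Tens 𝕜 V))
    (LinearMap.mk₂ 𝕜 (fun x wn => 1 ⊗ₜ (ι 𝕜 x * wn.1) + (ι 𝕜 x ⊗ₜ 1) * wn.2)
      (by intro x y w
          simp [add_mul, TensorProduct.tmul_add, TensorProduct.add_tmul]; abel)
      (by intro r x w
          simp [← TensorProduct.smul_tmul'])
      (by intro x y w
          simp [mul_add, TensorProduct.tmul_add]; abel)
      (by intro r x w
          simp))
  exact ⟨r, hr1, hr⟩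

/-- The deconcatenation coproduct. -/
noncomputable def deconc : Tens 𝕜 V →ₗ[𝕜] Tens 𝕜 V ⊗[𝕜] Tens 𝕜 V := exists_deconc.choose

@[simp] theorem deconc_one : deconc (1 : Tens 𝕜 V) = 1 ⊗ₜ 1 := exists_deconc.choose_spec.1

theorem deconc_ι_mul (x : V) (w : Tens 𝕜 V) :
    deconc (ι 𝕜 x * w) = 1 ⊗ₜ (ι 𝕜 x * w) + (ι 𝕜 x ⊗ₜ 1) * deconc w :=
  exists_deconc.choose_spec.2 x w

/-- The convolution product. -/
noncomputable def conv (f g : Tens 𝕜 V →ₗ[𝕜] A) : Tens 𝕜 V →ₗ[𝕜] A :=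
  LinearMap.mul' 𝕜 A ∘ₗ TensorProduct.map f g ∘ₗ deconc

theorem conv_apply (f g : Tens 𝕜 V →ₗ[𝕜] A) (w : Tens 𝕜 V) :
    conv f g w = LinearMap.mul' 𝕜 A (TensorProduct.map f g (deconc w)) := rfl

@[simp] theorem conv_one (f g : Tens 𝕜 V →ₗ[𝕜] A) : conv f g 1 = f 1 * g 1 := by
  simp [conv_apply]

theorem conv_ι_mul (f g : Tens 𝕜 V →ₗ[𝕜] A) (x : V) (w : Tens 𝕜 V) :
    conv f g (ι 𝕜 x * w) =
      f 1 * g (ι 𝕜 x * w) + conv (f ∘ₗ LinearMap.mulLeft 𝕜 (ι 𝕜 x)) g w := by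
  rw [conv_apply, conv_apply, deconc_ι_mul, map_add, map_add, TensorProduct.map_tmul,
    LinearMap.mul'_apply]
  congr 1
  generalize deconc w = z
  induction z using TensorProduct.induction_on with
  | zero => simp
  | tmul a b => simp
  | add a b ha hb => simp only [mul_add, map_add, ha, hb]

theorem add_conv (f f' g : Tens 𝕜 V →ₗ[𝕜] A) : conv (f + f') g = conv f g + conv f' g := by
  ext w; simp [conv_apply, TensorProduct.map_add_left]

theorem conv_add (f g g' : Tens 𝕜 V →ₗ[𝕜] A) : conv f (g + g') = conv f g + conv f g' := by
  ext w; simp [conv_apply, TensorProduct.map_add_right]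

theorem smul_conv (r : 𝕜) (f g : Tens 𝕜 V →ₗ[𝕜] A) : conv (r • f) g = r • conv f g := by
  ext w; simp [conv_apply, TensorProduct.map_smul_left]

theorem conv_smul (r : 𝕜) (f g : Tens 𝕜 V →ₗ[𝕜] A) : conv f (r • g) = r • conv f g := by
  ext w; simp [conv_apply, TensorProduct.map_smul_right]

@[simp] theorem zero_conv (g : Tens 𝕜 V →ₗ[𝕜] A) : conv 0 g = 0 := by
  simpa using smul_conv 0 0 g

@[simp] theorem conv_zero (f : Tens 𝕜 V →ₗ[𝕜] A) : conv f 0 = 0 := by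
  simpa using conv_smul 0 f 0

theorem neg_conv (f g : Tens 𝕜 V →ₗ[𝕜] A) : conv (-f) g = -conv f g :=
  eq_neg_of_add_eq_zero_left (by rw [← add_conv, neg_add_cancel, zero_conv])

theorem conv_neg (f g : Tens 𝕜 V →ₗ[𝕜] A) : conv f (-g) = -conv f g :=
  eq_neg_of_add_eq_zero_left (by rw [← conv_add, neg_add_cancel, conv_zero])

theorem sub_conv (f f' g : Tens 𝕜 V →ₗ[𝕜] A) : conv (f - f') g = conv f g - conv f' g := by
  simp [sub_eq_add_neg, add_conv, neg_conv]

theorem conv_sub (f g g' : Tens 𝕜 V →ₗ[𝕜] A) : conv f (g - g') = conv f g - conv f g' := by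
  simp [sub_eq_add_neg, conv_add, conv_neg]

theorem mulLeft_conv (a : A) (f g : Tens 𝕜 V →ₗ[𝕜] A) :
    conv (LinearMap.mulLeft 𝕜 a ∘ₗ f) g = LinearMap.mulLeft 𝕜 a ∘ₗ conv f g := by
  ext w
  simp only [conv_apply, LinearMap.comp_apply]
  generalize deconc w = z
  induction z using TensorProduct.induction_on with
  | zero => simp
  | tmul a b => simp [mul_assoc]
  | add a b ha hb => simp only [mul_add, map_add, ha, hb]

theorem conv_assoc (f g h : Tens 𝕜 V →ₗ[𝕜] A) : conv (conv f g) h = conv f (conv g h) := by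
  ext w
  induction w using tens_induction generalizing f with
  | one => simp [mul_assoc]
  | zero => simp
  | add a b ha hb => simp [ha, hb]
  | smul r a ha => simp [ha]
  | mul x w hw =>
    have : (conv f g) ∘ₗ LinearMap.mulLeft 𝕜 (ι 𝕜 x) =
        LinearMap.mulLeft 𝕜 (f 1) ∘ₗ (g ∘ₗ LinearMap.mulLeft 𝕜 (ι 𝕜 x)) +
          conv (f ∘ₗ LinearMap.mulLeft 𝕜 (ι 𝕜 x)) g := by
      ext u; simp [conv_ι_mul]
    rw [conv_ι_mul, this, add_conv, mulLeft_conv, LinearMap.add_apply, hw, conv_ι_mul f,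
      conv_ι_mul g]
    simp [mul_add, mul_assoc, add_assoc]

variable (A) in
/-- The unit for the convolution product. -/
noncomputable def cunit : Tens 𝕜 V →ₗ[𝕜] A :=
  Algebra.linearMap 𝕜 A ∘ₗ (algebraMapInv (R := 𝕜) (M := V)).toLinearMap

@[simp] theorem cunit_one : cunit A (1 : Tens 𝕜 V) = 1 := by simp [cunit]

@[simp] theorem cunit_ι_mul (x : V) (w : Tens 𝕜 V) : cunit A (ι 𝕜 x * w) = 0 := by
  simp [cunit, algebraMapInv]

@[simp] theorem cunit_conv (f : Tens 𝕜 V →ₗ[𝕜] A) : conv (cunit A) f = f := by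
  refine tens_hom_ext (by simp) fun x w _ => ?_
  have : cunit A ∘ₗ LinearMap.mulLeft 𝕜 (ι 𝕜 x : Tens 𝕜 V) = 0 := by ext u; simp
  simp [conv_ι_mul, this]

@[simp] theorem conv_cunit (f : Tens 𝕜 V →ₗ[𝕜] A) : conv f (cunit A) = f := by
  ext w
  induction w using tens_induction generalizing f with
  | one => simp
  | zero => simp
  | add a b ha hb => simp [ha, hb]
  | smul r a ha => simp [ha]
  | mul x w hw => simp [conv_ι_mul, hw]

theorem eq_zero_of_eq_conv {g X : Tens 𝕜 V →ₗ[𝕜] A} (hg : g 1 = 0) (hX : X = conv g X) :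
    X = 0 := by
  have key : ∀ w, ∀ f : Tens 𝕜 V →ₗ[𝕜] A, conv f X w = 0 := by
    intro w
    induction w using tens_induction with
    | one => intro f; rw [conv_one, hX]; simp [hg]
    | zero => simp
    | add a b ha hb => intro f; simp [ha, hb]
    | smul r a ha => intro f; simp [ha]
    | mul x w hw => intro f; rw [conv_ι_mul, hw, hX, conv_ι_mul, hw, hg]; simp
  ext w
  rw [hX, key]; rfl

theorem conv_solution_unique {g X X' Y : Tens 𝕜 V →ₗ[𝕜] A} (hg : g 1 = 0)
    (hX : X = Y + conv g X) (hX' : X' = Y + conv g X') : X = X' := by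
  rw [← sub_eq_zero]
  refine eq_zero_of_eq_conv hg ?_
  conv_lhs => rw [hX, hX']
  rw [conv_sub]; abel

theorem exists_conv_solution (g Y : Tens 𝕜 V →ₗ[𝕜] A) (hg : g 1 = 0) :
    ∃ X : Tens 𝕜 V →ₗ[𝕜] A, X = Y + conv g X := by
  let m : Tens 𝕜 V ⊗[𝕜] A →ₗ[𝕜] A := LinearMap.mul' 𝕜 A ∘ₗ TensorProduct.map g LinearMap.id
  obtain ⟨P, hP1, hP⟩ := exists_fold (V := V) ((1 : Tens 𝕜 V) ⊗ₜ[𝕜] Y 1)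
    (LinearMap.mk₂ 𝕜 (fun x wn => 1 ⊗ₜ (Y (ι 𝕜 x * wn.1) + m ((ι 𝕜 x ⊗ₜ 1) * wn.2)) +
      (ι 𝕜 x ⊗ₜ 1) * wn.2)
      (by intro x y w
          simp [add_mul, TensorProduct.tmul_add, TensorProduct.add_tmul]; abel)
      (by intro r x w
          simp [← TensorProduct.smul_tmul', TensorProduct.tmul_add])
      (by intro x y w
          simp [mul_add, TensorProduct.tmul_add]; abel)
      (by intro r x w
          simp [TensorProduct.tmul_add]))
  simp only [LinearMap.mk₂_apply] at hP
  let c : Tens 𝕜 V ⊗[𝕜] A →ₗ[𝕜] A := LinearMap.mul' 𝕜 A ∘ₗ TensorProduct.map (cunit A) LinearMap.id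
  obtain ⟨X, hXP⟩ : ∃ X, X = c ∘ₗ P := ⟨_, rfl⟩
  have hc : ∀ x z, c ((ι 𝕜 x ⊗ₜ 1) * z) = 0 := by
    intro x z
    induction z using TensorProduct.induction_on with
    | zero => simp
    | tmul a b => simp [c]
    | add a b ha hb => simp only [mul_add, map_add, ha, hb, add_zero]
  have hX1 : X 1 = Y 1 := by simp [hXP, hP1, c]
  have hX : ∀ x w, X (ι 𝕜 x * w) = Y (ι 𝕜 x * w) + m ((ι 𝕜 x ⊗ₜ 1) * P w) := by
    intro x w
    simp only [hXP, LinearMap.comp_apply, hP, map_add, hc, add_zero]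
    simp [c]
  have hPX : P = TensorProduct.map LinearMap.id X ∘ₗ deconc := by
    refine tens_hom_ext (by simp [hP1, hX1]) fun x w hw => ?_
    rw [hP, ← hX, hw, LinearMap.comp_apply, LinearMap.comp_apply, deconc_ι_mul, map_add,
      TensorProduct.map_tmul, LinearMap.id_apply]
    congr 1
    generalize deconc w = z
    induction z using TensorProduct.induction_on with
    | zero => simp
    | tmul a b => simp
    | add a b ha hb => simp only [mul_add, map_add, ha, hb]
  refine ⟨X, tens_hom_ext (by simp [hg, hX1]) fun x w _ => ?_⟩
  rw [hX, LinearMap.add_apply, conv_ι_mul, hg, zero_mul, zero_add,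
    LinearMap.congr_fun hPX w, conv_apply]
  congr 1
  change m ((ι 𝕜 x ⊗ₜ 1) * TensorProduct.map LinearMap.id X (deconc w)) = _
  generalize deconc w = z
  induction z using TensorProduct.induction_on with
  | zero => simp
  | tmul a b => simp [m]
  | add a b ha hb => simp only [mul_add, map_add, ha, hb]

theorem algHom_comp_conv (θ : A →ₐ[𝕜] B) (f g : Tens 𝕜 V →ₗ[𝕜] A) :
    θ.toLinearMap ∘ₗ conv f g = conv (θ.toLinearMap ∘ₗ f) (θ.toLinearMap ∘ₗ g) := by
  ext w
  simp only [conv_apply, LinearMap.comp_apply]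
  generalize deconc w = z
  induction z using TensorProduct.induction_on with
  | zero => simp
  | tmul a b => simp
  | add a b ha hb => simp only [map_add, ha, hb]

theorem algHom_comp_cunit (θ : A →ₐ[𝕜] B) :
    θ.toLinearMap ∘ₗ cunit A = (cunit B : Tens 𝕜 V →ₗ[𝕜] B) := by
  ext w; simp [cunit]

end Convolution

section Coderivations

variable {𝕜 : Type*} [Field 𝕜] {V : Type*} [AddCommGroup V] [Module 𝕜 V]
  {W : Type*} [AddCommGroup W] [Module 𝕜 W] {U : Type*} [AddCommGroup U] [Module 𝕜 U]
  {A : Type*} [Ring A] [Algebra 𝕜 A]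

/-- The counit of the tensor coalgebra. -/
noncomputable abbrev eps : Tens 𝕜 V →ₐ[𝕜] 𝕜 := algebraMapInv

theorem eps_ι_mul (x : V) (w : Tens 𝕜 V) : eps (ι 𝕜 x * w) = 0 := by
  simp [algebraMapInv]

theorem exists_proj1 : ∃ r : Tens 𝕜 V →ₗ[𝕜] V, r 1 = 0 ∧ ∀ x w, r (ι 𝕜 x * w) = eps w • x := by
  obtain ⟨r, hr1, hr⟩ := exists_fold (V := V) (0 : V)
    (LinearMap.mk₂ 𝕜 (fun x (wn : Tens 𝕜 V × V) => eps wn.1 • x)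
      (by simp) (by intro r x w; simp [smul_comm r]) (by simp [add_smul])
      (by intro r x w; simp [mul_smul]))
  exact ⟨r, hr1, hr⟩

/-- The projection to the letters. -/
noncomputable def proj1 : Tens 𝕜 V →ₗ[𝕜] V := exists_proj1.choose

@[simp] theorem proj1_one : proj1 (1 : Tens 𝕜 V) = 0 := exists_proj1.choose_spec.1

theorem proj1_ι_mul (x : V) (w : Tens 𝕜 V) : proj1 (ι 𝕜 x * w) = eps w • x :=
  exists_proj1.choose_spec.2 x w

@[simp] theorem proj1_ι (x : V) : proj1 (ι 𝕜 x) = x := by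
  simpa using proj1_ι_mul x (1 : Tens 𝕜 V)

theorem conv_proj1_ι_mul (θ : V →ₗ[𝕜] A) (g : Tens 𝕜 V →ₗ[𝕜] A) (x : V) (w : Tens 𝕜 V) :
    conv (θ ∘ₗ proj1) g (ι 𝕜 x * w) = θ x * g w := by
  have : (θ ∘ₗ proj1) ∘ₗ LinearMap.mulLeft 𝕜 (ι 𝕜 x : Tens 𝕜 V) =
      LinearMap.mulLeft 𝕜 (θ x) ∘ₗ cunit A := by
    ext u
    simp [proj1_ι_mul, cunit, Algebra.algebraMap_eq_smul_one]
  rw [conv_ι_mul, this, mulLeft_conv]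
  simp

/-- The map of tensor algebras induced by a linear map. -/
noncomputable def tmap (f : V →ₗ[𝕜] W) : Tens 𝕜 V →ₐ[𝕜] Tens 𝕜 W := lift 𝕜 (ι 𝕜 ∘ₗ f)

@[simp] theorem tmap_ι (f : V →ₗ[𝕜] W) (x : V) : tmap f (ι 𝕜 x) = ι 𝕜 (f x) := by simp [tmap]

theorem tmap_comp (g : W →ₗ[𝕜] U) (f : V →ₗ[𝕜] W) : tmap (g ∘ₗ f) = (tmap g).comp (tmap f) := by
  ext x; simp

theorem tmap_tmap (g : W →ₗ[𝕜] U) (f : V →ₗ[𝕜] W) (w : Tens 𝕜 V) :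
    tmap g (tmap f w) = tmap (g ∘ₗ f) w := by
  rw [tmap_comp]; rfl

theorem tmap_id : tmap (LinearMap.id : V →ₗ[𝕜] V) = AlgHom.id 𝕜 _ := by
  ext x; simp

theorem eps_tmap (f : V →ₗ[𝕜] W) (w : Tens 𝕜 V) : eps (tmap f w) = eps w := by
  have : (eps (𝕜 := 𝕜) (V := W)).comp (tmap f) = eps := by
    ext x; simp [algebraMapInv]
  exact congrArg (fun h : Tens 𝕜 V →ₐ[𝕜] 𝕜 => h w) this

theorem proj1_comp_tmap (f : V →ₗ[𝕜] W) : proj1 ∘ₗ (tmap f).toLinearMap = f ∘ₗ proj1 := by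
  refine tens_hom_ext (by simp) fun x w _ => ?_
  simp [proj1_ι_mul, eps_tmap]

theorem proj1_tmap (f : V →ₗ[𝕜] W) (w : Tens 𝕜 V) : proj1 (tmap f w) = f (proj1 w) :=
  LinearMap.congr_fun (proj1_comp_tmap f) w

theorem tmap_eq_conv (f : V →ₗ[𝕜] W) : (tmap f).toLinearMap =
    cunit _ + conv (ι 𝕜 ∘ₗ f ∘ₗ proj1) (tmap f).toLinearMap := by
  refine tens_hom_ext (by simp) fun x w _ => ?_
  have := conv_proj1_ι_mul (ι 𝕜 ∘ₗ f) (tmap f).toLinearMap x w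
  rw [LinearMap.comp_assoc] at this
  rw [LinearMap.add_apply, this]
  simp

theorem proj1_comp_conv (g : Tens 𝕜 V →ₗ[𝕜] W) (h : Tens 𝕜 V →ₗ[𝕜] Tens 𝕜 W) (r : 𝕜)
    (hh : eps.toLinearMap ∘ₗ h = r • eps.toLinearMap) : proj1 ∘ₗ conv (ι 𝕜 ∘ₗ g) h = r • g := by
  have key : ∀ z : Tens 𝕜 V ⊗[𝕜] Tens 𝕜 V,
      proj1 (LinearMap.mul' 𝕜 _ (TensorProduct.map (ι 𝕜 ∘ₗ g) h z)) =
        r • g (LinearMap.mul' 𝕜 _ (TensorProduct.map LinearMap.id (cunit _) z)) := by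
    intro z
    induction z using TensorProduct.induction_on with
    | zero => simp
    | tmul a b =>
      have hb := LinearMap.congr_fun hh b
      simp only [LinearMap.comp_apply, AlgHom.toLinearMap_apply, LinearMap.smul_apply,
        smul_eq_mul] at hb
      simp only [TensorProduct.map_tmul, LinearMap.mul'_apply, LinearMap.comp_apply, proj1_ι_mul,
        hb, cunit, LinearMap.id_apply]
      simp [mul_smul, Algebra.algebraMap_eq_smul_one]
    | add a b ha hb => simp only [map_add, ha, hb, smul_add]
  ext w
  rw [LinearMap.comp_apply, conv_apply, key, ← conv_apply, conv_cunit]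
  simp

theorem eps_comp_conv (g : Tens 𝕜 V →ₗ[𝕜] W) (h : Tens 𝕜 V →ₗ[𝕜] Tens 𝕜 W) :
    eps.toLinearMap ∘ₗ conv (ι 𝕜 ∘ₗ g) h = 0 := by
  ext w
  simp only [conv_apply, LinearMap.comp_apply, LinearMap.zero_apply]
  generalize deconc w = z
  induction z using TensorProduct.induction_on with
  | zero => simp
  | tmul a b => simp [algebraMapInv]
  | add a b ha hb => simp only [map_add, ha, hb, add_zero]

/-! ### Coderivations -/

theorem exists_cod (θ : V →ₗ[𝕜] V) (b : Tens 𝕜 V →ₗ[𝕜] V) : ∃ D : Tens 𝕜 V →ₗ[𝕜] Tens 𝕜 V,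
    D = conv (ι 𝕜 ∘ₗ b) LinearMap.id + conv (ι 𝕜 ∘ₗ θ ∘ₗ proj1) D :=
  exists_conv_solution _ _ (by simp)

/-- The coderivation with corestriction `b`, twisted by `θ`. -/
noncomputable def cod (θ : V →ₗ[𝕜] V) (b : Tens 𝕜 V →ₗ[𝕜] V) : Tens 𝕜 V →ₗ[𝕜] Tens 𝕜 V :=
  (exists_cod θ b).choose

theorem cod_eq (θ : V →ₗ[𝕜] V) (b : Tens 𝕜 V →ₗ[𝕜] V) : cod θ b =
    conv (ι 𝕜 ∘ₗ b) LinearMap.id + conv (ι 𝕜 ∘ₗ θ ∘ₗ proj1) (cod θ b) :=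
  (exists_cod θ b).choose_spec

theorem eq_cod {θ : V →ₗ[𝕜] V} {b : Tens 𝕜 V →ₗ[𝕜] V} {D : Tens 𝕜 V →ₗ[𝕜] Tens 𝕜 V}
    (h : D = conv (ι 𝕜 ∘ₗ b) LinearMap.id + conv (ι 𝕜 ∘ₗ θ ∘ₗ proj1) D) : D = cod θ b :=
  conv_solution_unique (by simp) h (cod_eq θ b)

theorem cod_ι_mul (θ : V →ₗ[𝕜] V) (b : Tens 𝕜 V →ₗ[𝕜] V) (x : V) (w : Tens 𝕜 V) :
    cod θ b (ι 𝕜 x * w) =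
      conv (ι 𝕜 ∘ₗ b) LinearMap.id (ι 𝕜 x * w) + ι 𝕜 (θ x) * cod θ b w := by
  conv_lhs => rw [cod_eq]
  rw [LinearMap.add_apply, ← LinearMap.comp_assoc, conv_proj1_ι_mul]
  rfl

@[simp] theorem cod_one (θ : V →ₗ[𝕜] V) (b : Tens 𝕜 V →ₗ[𝕜] V) : cod θ b 1 = ι 𝕜 (b 1) := by
  rw [cod_eq]; simp

theorem cod_add (θ : V →ₗ[𝕜] V) (b b' : Tens 𝕜 V →ₗ[𝕜] V) :
    cod θ (b + b') = cod θ b + cod θ b' := by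
  symm
  apply eq_cod
  conv_lhs => rw [cod_eq θ b, cod_eq θ b']
  rw [LinearMap.comp_add, add_conv, conv_add]; abel

theorem cod_smul (θ : V →ₗ[𝕜] V) (r : 𝕜) (b : Tens 𝕜 V →ₗ[𝕜] V) :
    cod θ (r • b) = r • cod θ b := by
  symm
  apply eq_cod
  conv_lhs => rw [cod_eq θ b]
  rw [LinearMap.comp_smul, smul_conv, conv_smul, smul_add]

theorem cod_sub (θ : V →ₗ[𝕜] V) (b b' : Tens 𝕜 V →ₗ[𝕜] V) :
    cod θ (b - b') = cod θ b - cod θ b' := by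
  rw [eq_sub_iff_add_eq, ← cod_add, sub_add_cancel]

@[simp] theorem cod_zero (θ : V →ₗ[𝕜] V) : cod θ (0 : Tens 𝕜 V →ₗ[𝕜] V) = 0 := by
  simpa using cod_smul θ 0 (0 : Tens 𝕜 V →ₗ[𝕜] V)

theorem cod_eq_conv (θ : V →ₗ[𝕜] V) (b : Tens 𝕜 V →ₗ[𝕜] V) : cod θ b =
    conv (tmap θ).toLinearMap (conv (ι 𝕜 ∘ₗ b) LinearMap.id) := by
  symm
  apply eq_cod
  conv_lhs => rw [tmap_eq_conv]
  rw [add_conv, cunit_conv, conv_assoc]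

theorem eps_comp_cod (θ : V →ₗ[𝕜] V) (b : Tens 𝕜 V →ₗ[𝕜] V) :
    eps.toLinearMap ∘ₗ cod θ b = 0 := by
  rw [cod_eq, LinearMap.comp_add, eps_comp_conv, eps_comp_conv, add_zero]

theorem cunit_comp_of_eps (h : Tens 𝕜 V →ₗ[𝕜] Tens 𝕜 W) (hh : eps.toLinearMap ∘ₗ h = 0) :
    cunit A ∘ₗ h = 0 := by
  rw [cunit, LinearMap.comp_assoc, hh, LinearMap.comp_zero]

theorem proj1_comp_cod (θ : V →ₗ[𝕜] V) (b : Tens 𝕜 V →ₗ[𝕜] V) : proj1 ∘ₗ cod θ b = b := by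
  rw [cod_eq, LinearMap.comp_add, proj1_comp_conv _ _ 1, proj1_comp_conv _ _ 0]
  · simp
  · rw [eps_comp_cod, zero_smul]
  · simp

/-! ### Compatibility with the coproduct -/

/-- The inclusion of the first factor. -/
noncomputable def tinl : Tens 𝕜 V →ₐ[𝕜] Tens 𝕜 V ⊗[𝕜] Tens 𝕜 V := Algebra.TensorProduct.includeLeft

/-- The inclusion of the second factor. -/
noncomputable def tinr : Tens 𝕜 V →ₐ[𝕜] Tens 𝕜 V ⊗[𝕜] Tens 𝕜 V := Algebra.TensorProduct.includeRight

theorem map_comp_deconc (a b : Tens 𝕜 V →ₗ[𝕜] Tens 𝕜 W) : TensorProduct.map a b ∘ₗ deconc =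
    conv (tinl.toLinearMap ∘ₗ a) (tinr.toLinearMap ∘ₗ b) := by
  ext w
  simp only [conv_apply, LinearMap.comp_apply]
  generalize deconc w = z
  induction z using TensorProduct.induction_on with
  | zero => simp
  | tmul a b => simp [tinl, tinr]
  | add a b ha hb => simp only [map_add, ha, hb]

theorem deconc_eq_conv : (deconc : Tens 𝕜 V →ₗ[𝕜] _) =
    conv tinl.toLinearMap tinr.toLinearMap := by
  simpa using map_comp_deconc (LinearMap.id : Tens 𝕜 V →ₗ[𝕜] _) LinearMap.id

theorem deconc_comp_conv (g : Tens 𝕜 V →ₗ[𝕜] W) (h : Tens 𝕜 V →ₗ[𝕜] Tens 𝕜 W) :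
    deconc ∘ₗ conv (ι 𝕜 ∘ₗ g) h = tinr.toLinearMap ∘ₗ conv (ι 𝕜 ∘ₗ g) h +
      conv (tinl.toLinearMap ∘ₗ ι 𝕜 ∘ₗ g) (deconc ∘ₗ h) := by
  ext w
  simp only [conv_apply, LinearMap.comp_apply, LinearMap.add_apply]
  generalize deconc w = z
  induction z using TensorProduct.induction_on with
  | zero => simp
  | tmul a b => simp [deconc_ι_mul, tinl, tinr]
  | add a b ha hb => simp only [map_add, ha, hb]; abel

theorem deconc_comp_cod (θ : V →ₗ[𝕜] V) (b : Tens 𝕜 V →ₗ[𝕜] V) :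
    deconc ∘ₗ cod θ b = TensorProduct.map (cod θ b) LinearMap.id ∘ₗ deconc +
      TensorProduct.map (tmap θ).toLinearMap (cod θ b) ∘ₗ deconc := by
  have h0 : (tinl.toLinearMap ∘ₗ ι 𝕜 ∘ₗ θ ∘ₗ proj1 : Tens 𝕜 V →ₗ[𝕜] _) 1 = 0 := by simp
  refine conv_solution_unique (Y := tinr.toLinearMap ∘ₗ cod θ b +
    conv (tinl.toLinearMap ∘ₗ ι 𝕜 ∘ₗ b) deconc) h0 ?_ ?_
  · conv_lhs => rw [cod_eq, LinearMap.comp_add, deconc_comp_conv, deconc_comp_conv]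
    conv_rhs => enter [1, 1]; rw [cod_eq, LinearMap.comp_add]
    rw [LinearMap.comp_id]; abel
  · rw [map_comp_deconc, map_comp_deconc]
    conv_lhs => enter [1, 1]; rw [cod_eq, LinearMap.comp_add, algHom_comp_conv, algHom_comp_conv]
    conv_lhs => enter [2, 1]; rw [tmap_eq_conv, LinearMap.comp_add, algHom_comp_conv,
      algHom_comp_cunit]
    rw [add_conv, add_conv, cunit_conv, conv_assoc, conv_assoc, conv_assoc, conv_add,
      LinearMap.comp_id, LinearMap.comp_id, ← deconc_eq_conv]
    abel

theorem conv_comp_cod (f g : Tens 𝕜 V →ₗ[𝕜] A) (θ : V →ₗ[𝕜] V) (b : Tens 𝕜 V →ₗ[𝕜] V) :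
    conv f g ∘ₗ cod θ b = conv (f ∘ₗ cod θ b) g +
      conv (f ∘ₗ (tmap θ).toLinearMap) (g ∘ₗ cod θ b) := by
  ext w
  have := LinearMap.congr_fun (deconc_comp_cod θ b) w
  simp only [LinearMap.comp_apply, LinearMap.add_apply] at this
  simp only [conv_apply, LinearMap.comp_apply, this, LinearMap.add_apply]
  generalize deconc w = z
  induction z using TensorProduct.induction_on with
  | zero => simp
  | tmul a b => simp
  | add a b ha hb =>
    simp only [map_add] at ha hb ⊢
    rw [add_add_add_comm, ha, hb, add_add_add_comm]

theorem cod_comp_cod (θ θ' : V →ₗ[𝕜] V) (b b' : Tens 𝕜 V →ₗ[𝕜] V) :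
    cod θ b ∘ₗ cod θ' b' = conv (ι 𝕜 ∘ₗ b ∘ₗ cod θ' b') LinearMap.id +
      conv (ι 𝕜 ∘ₗ b ∘ₗ (tmap θ').toLinearMap) (cod θ' b') +
      conv (ι 𝕜 ∘ₗ θ ∘ₗ b') (cod θ b) +
      conv (ι 𝕜 ∘ₗ (θ ∘ₗ θ') ∘ₗ proj1) (cod θ b ∘ₗ cod θ' b') := by
  conv_lhs => rw [cod_eq θ b]
  rw [LinearMap.add_comp, conv_comp_cod, conv_comp_cod]
  simp only [LinearMap.comp_assoc, LinearMap.id_comp, proj1_comp_cod, proj1_comp_tmap]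
  abel

/-! ### Coalgebra maps -/

/-- A morphism of coalgebras. -/
def IsCoalgMap (φ : Tens 𝕜 V →ₗ[𝕜] Tens 𝕜 W) : Prop :=
  deconc ∘ₗ φ = TensorProduct.map φ φ ∘ₗ deconc

theorem IsCoalgMap.conv_comp {φ : Tens 𝕜 V →ₗ[𝕜] Tens 𝕜 W} (hφ : IsCoalgMap φ)
    (f g : Tens 𝕜 W →ₗ[𝕜] A) : conv f g ∘ₗ φ = conv (f ∘ₗ φ) (g ∘ₗ φ) := by
  ext w
  have := LinearMap.congr_fun hφ w
  simp only [LinearMap.comp_apply] at this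
  simp only [conv_apply, LinearMap.comp_apply, this]
  generalize deconc w = z
  induction z using TensorProduct.induction_on with
  | zero => simp
  | tmul a b => simp
  | add a b ha hb => simp only [map_add, ha, hb]

theorem exists_coext (f : Tens 𝕜 V →ₗ[𝕜] W) (hf : f 1 = 0) : ∃ φ : Tens 𝕜 V →ₗ[𝕜] Tens 𝕜 W,
    φ = cunit _ + conv (ι 𝕜 ∘ₗ f) φ :=
  exists_conv_solution _ _ (by simp [hf])

theorem isCoalgMap_of_eq {f : Tens 𝕜 V →ₗ[𝕜] W} (hf : f 1 = 0) {φ : Tens 𝕜 V →ₗ[𝕜] Tens 𝕜 W}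
    (hφ : φ = cunit _ + conv (ι 𝕜 ∘ₗ f) φ) : IsCoalgMap φ := by
  have h0 : (tinl.toLinearMap ∘ₗ ι 𝕜 ∘ₗ f : Tens 𝕜 V →ₗ[𝕜] _) 1 = 0 := by simp [hf]
  have h1 : (deconc : Tens 𝕜 W →ₗ[𝕜] _) ∘ₗ (cunit (Tens 𝕜 W)) =
      (cunit _ : Tens 𝕜 V →ₗ[𝕜] _) := by
    ext w
    simp only [cunit, LinearMap.comp_apply, Algebra.linearMap_apply]
    simp [Algebra.algebraMap_eq_smul_one, Algebra.TensorProduct.one_def]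
  refine conv_solution_unique (Y := tinr.toLinearMap ∘ₗ φ) h0 ?_ ?_
  · conv_lhs => rw [hφ, LinearMap.comp_add, deconc_comp_conv, h1]
    conv_rhs => enter [1]; rw [hφ, LinearMap.comp_add, algHom_comp_cunit]
    abel
  · rw [map_comp_deconc]
    conv_lhs => enter [1]; rw [hφ, LinearMap.comp_add, algHom_comp_conv, algHom_comp_cunit]
    rw [add_conv, cunit_conv, conv_assoc]

theorem isCoalgMap_tmap (f : V →ₗ[𝕜] W) : IsCoalgMap (tmap f).toLinearMap :=
  isCoalgMap_of_eq (f := f ∘ₗ proj1) (by simp) (tmap_eq_conv f)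

theorem eps_comp_coext {f : Tens 𝕜 V →ₗ[𝕜] W} {φ : Tens 𝕜 V →ₗ[𝕜] Tens 𝕜 W}
    (hφ : φ = cunit _ + conv (ι 𝕜 ∘ₗ f) φ) : eps.toLinearMap ∘ₗ φ = eps.toLinearMap := by
  rw [hφ, LinearMap.comp_add, eps_comp_conv, add_zero]
  ext w; simp [cunit, AlgHom.commutes]

theorem proj1_comp_coext {f : Tens 𝕜 V →ₗ[𝕜] W} {φ : Tens 𝕜 V →ₗ[𝕜] Tens 𝕜 W}
    (hφ : φ = cunit _ + conv (ι 𝕜 ∘ₗ f) φ) : proj1 ∘ₗ φ = f := by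
  rw [hφ, LinearMap.comp_add, proj1_comp_conv _ _ 1]
  · ext w; simp [cunit, Algebra.algebraMap_eq_smul_one]
  · rw [eps_comp_coext hφ, one_smul]

/-! ### The structure equations -/

theorem cod_sq_eq {β : V →ₗ[𝕜] V} (hβ : β ∘ₗ β = LinearMap.id) {b : Tens 𝕜 V →ₗ[𝕜] V}
    (hb : b ∘ₗ (tmap β).toLinearMap = -(β ∘ₗ b)) : cod β b ∘ₗ cod β b =
      conv (ι 𝕜 ∘ₗ b ∘ₗ cod β b) LinearMap.id + conv (ι 𝕜 ∘ₗ proj1) (cod β b ∘ₗ cod β b) := by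
  conv_lhs => rw [cod_comp_cod]
  rw [hb, hβ, LinearMap.comp_neg, neg_conv, LinearMap.id_comp]
  abel

theorem cod_anticomm {β : V →ₗ[𝕜] V} (hβ : β ∘ₗ β = LinearMap.id) {b b' : Tens 𝕜 V →ₗ[𝕜] V}
    (hb : b ∘ₗ (tmap β).toLinearMap = -(β ∘ₗ b))
    (hb' : b' ∘ₗ (tmap β).toLinearMap = -(β ∘ₗ b')) :
    cod β b ∘ₗ cod β b' + cod β b' ∘ₗ cod β b =
      cod LinearMap.id (b ∘ₗ cod β b' + b' ∘ₗ cod β b) := by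
  apply eq_cod
  conv_lhs => rw [cod_comp_cod, cod_comp_cod β β b' b]
  rw [hb, hb', hβ, LinearMap.comp_neg, neg_conv, LinearMap.comp_neg, neg_conv, LinearMap.id_comp,
    LinearMap.comp_add, add_conv, conv_add]
  abel

theorem cod_comm {β δ : V →ₗ[𝕜] V} (hβ : β ∘ₗ δ = δ ∘ₗ β) (b : Tens 𝕜 V →ₗ[𝕜] V) :
    cod LinearMap.id (δ ∘ₗ proj1) ∘ₗ cod β b - cod β b ∘ₗ cod LinearMap.id (δ ∘ₗ proj1) =
      cod β (δ ∘ₗ b - b ∘ₗ cod LinearMap.id (δ ∘ₗ proj1)) := by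
  apply eq_cod
  conv_lhs => rw [cod_comp_cod, cod_comp_cod β]
  simp only [tmap_id, LinearMap.id_comp, LinearMap.comp_id, LinearMap.comp_assoc, proj1_comp_tmap,
    proj1_comp_cod, AlgHom.toLinearMap_id, LinearMap.comp_sub, sub_conv, conv_sub]
  have h : β ∘ₗ δ ∘ₗ (proj1 : Tens 𝕜 V →ₗ[𝕜] V) = δ ∘ₗ β ∘ₗ proj1 := by
    rw [← LinearMap.comp_assoc, hβ, LinearMap.comp_assoc]
  rw [h]
  abel

theorem cod_coext_sub {β : V →ₗ[𝕜] V} {β' : W →ₗ[𝕜] W} {b : Tens 𝕜 V →ₗ[𝕜] V}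
    {c : Tens 𝕜 W →ₗ[𝕜] W} {f : Tens 𝕜 V →ₗ[𝕜] W} (hf1 : f 1 = 0)
    (hf : f ∘ₗ (tmap β).toLinearMap = β' ∘ₗ f) {φ : Tens 𝕜 V →ₗ[𝕜] Tens 𝕜 W}
    (hφ : φ = cunit _ + conv (ι 𝕜 ∘ₗ f) φ) :
    cod β' c ∘ₗ φ - φ ∘ₗ cod β b = conv (ι 𝕜 ∘ₗ (c ∘ₗ φ - f ∘ₗ cod β b)) φ +
      conv (ι 𝕜 ∘ₗ β' ∘ₗ f) (cod β' c ∘ₗ φ - φ ∘ₗ cod β b) := by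
  conv_lhs =>
    enter [1]
    rw [cod_eq, LinearMap.add_comp, (isCoalgMap_of_eq hf1 hφ).conv_comp,
      (isCoalgMap_of_eq hf1 hφ).conv_comp]
  conv_lhs =>
    enter [2]
    rw [hφ, LinearMap.add_comp, cunit_comp_of_eps _ (eps_comp_cod _ _), zero_add, conv_comp_cod]
  simp only [LinearMap.comp_assoc, LinearMap.id_comp, proj1_comp_coext hφ, hf, LinearMap.comp_sub,
    sub_conv, conv_sub]
  abel

theorem tmap_comp_cod {θ : V →ₗ[𝕜] V} {θ' : W →ₗ[𝕜] W} {δ : V →ₗ[𝕜] W} {b : Tens 𝕜 V →ₗ[𝕜] V}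
    {b' : Tens 𝕜 W →ₗ[𝕜] W} (hθ : δ ∘ₗ θ = θ' ∘ₗ δ)
    (hb : δ ∘ₗ b = b' ∘ₗ (tmap δ).toLinearMap) :
    (tmap δ).toLinearMap ∘ₗ cod θ b = cod θ' b' ∘ₗ (tmap δ).toLinearMap := by
  rw [cod_eq_conv, cod_eq_conv, algHom_comp_conv, algHom_comp_conv,
    (isCoalgMap_tmap δ).conv_comp, (isCoalgMap_tmap δ).conv_comp]
  have h1 : ((tmap δ).toLinearMap ∘ₗ (tmap θ).toLinearMap : Tens 𝕜 V →ₗ[𝕜] _) =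
      (tmap θ').toLinearMap ∘ₗ (tmap δ).toLinearMap := by
    ext w; simp [tmap_tmap, hθ]
  have h2 : (tmap δ).toLinearMap ∘ₗ ι 𝕜 ∘ₗ b = (ι 𝕜 ∘ₗ b') ∘ₗ (tmap δ).toLinearMap := by
    rw [LinearMap.comp_assoc, ← hb]; ext w; simp
  rw [h1, h2, LinearMap.comp_id, LinearMap.id_comp]

end Coderivations

section Length

variable {𝕜 : Type*} [Field 𝕜] {V : Type*} [AddCommGroup V] [Module 𝕜 V]
  {W : Type*} [AddCommGroup W] [Module 𝕜 W] {N : Type*} [AddCommGroup N] [Module 𝕜 N]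

variable (𝕜 V) in
/-- The tensors of length `n`. -/
noncomputable def lenSub (n : ℕ) : Submodule 𝕜 (Tens 𝕜 V) :=
  (LinearMap.range (ι 𝕜 : V →ₗ[𝕜] Tens 𝕜 V)) ^ n

theorem mem_lenSub_zero {t : Tens 𝕜 V} : t ∈ lenSub 𝕜 V 0 ↔ ∃ r : 𝕜, t = r • 1 := by
  rw [lenSub, pow_zero, Submodule.mem_one]
  simp [Algebra.algebraMap_eq_smul_one, eq_comm]

theorem one_mem_lenSub : (1 : Tens 𝕜 V) ∈ lenSub 𝕜 V 0 := mem_lenSub_zero.2 ⟨1, by simp⟩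

theorem lenSub_mul_mem {i j : ℕ} {a b : Tens 𝕜 V} (ha : a ∈ lenSub 𝕜 V i)
    (hb : b ∈ lenSub 𝕜 V j) : a * b ∈ lenSub 𝕜 V (i + j) := by
  rw [lenSub, pow_add]; exact Submodule.mul_mem_mul ha hb

theorem ι_mem_lenSub (x : V) : ι 𝕜 x ∈ lenSub 𝕜 V 1 := by
  rw [lenSub, pow_one]; exact ⟨x, rfl⟩

theorem ι_mul_mem_lenSub {n : ℕ} (x : V) {w : Tens 𝕜 V} (hw : w ∈ lenSub 𝕜 V n) :
    ι 𝕜 x * w ∈ lenSub 𝕜 V (n + 1) := by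
  rw [add_comm]; exact lenSub_mul_mem (ι_mem_lenSub x) hw

theorem lenSub_succ_le {n : ℕ} {Q : Submodule 𝕜 (Tens 𝕜 V)}
    (h : ∀ x, ∀ w ∈ lenSub 𝕜 V n, ι 𝕜 x * w ∈ Q) : lenSub 𝕜 V (n + 1) ≤ Q := by
  rw [lenSub, pow_succ', Submodule.mul_le]
  rintro _ ⟨x, rfl⟩ w hw
  exact h x w hw

/-- The span of the first `n` members of a sequence of subspaces. -/
def flt (S : ℕ → Submodule 𝕜 (Tens 𝕜 V)) (n : ℕ) : Submodule 𝕜 (Tens 𝕜 V) :=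
  ⨆ k, ⨆ (_ : k < n), S k

theorem le_flt (S : ℕ → Submodule 𝕜 (Tens 𝕜 V)) {k n : ℕ} (h : k < n) : S k ≤ flt S n :=
  le_iSup₂_of_le k h le_rfl

theorem flt_le {S : ℕ → Submodule 𝕜 (Tens 𝕜 V)} {n : ℕ} {Q : Submodule 𝕜 (Tens 𝕜 V)}
    (h : ∀ k < n, S k ≤ Q) : flt S n ≤ Q := iSup₂_le h

theorem flt_mono (S : ℕ → Submodule 𝕜 (Tens 𝕜 V)) {m n : ℕ} (h : m ≤ n) : flt S m ≤ flt S n :=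
  flt_le fun _ hk => le_flt S (hk.trans_le h)

theorem lenSub_mul_flt {i n : ℕ} {a b : Tens 𝕜 V} (ha : a ∈ lenSub 𝕜 V i)
    (hb : b ∈ flt (lenSub 𝕜 V) n) : a * b ∈ flt (lenSub 𝕜 V) (i + n) := by
  have : flt (lenSub 𝕜 V) n ≤ (flt (lenSub 𝕜 V) (i + n)).comap (LinearMap.mulLeft 𝕜 a) :=
    flt_le fun k hk b hb => le_flt _ (by lia) (lenSub_mul_mem ha hb)
  exact this hb

/-- A sequence of spaces of homogeneous tensors that form a subcoalgebra. -/
structure IsSubcoalg (S : ℕ → Submodule 𝕜 (Tens 𝕜 V)) : Prop where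
  le : ∀ n, S n ≤ lenSub 𝕜 V n
  deconc_mem : ∀ n, ∀ t ∈ S n, deconc t ∈
    ⨆ p ∈ antidiagonal n, Submodule.map₂ (TensorProduct.mk 𝕜 _ _) (S p.1) (S p.2)

theorem IsSubcoalg.apply_deconc_mem {S : ℕ → Submodule 𝕜 (Tens 𝕜 V)} (hS : IsSubcoalg S)
    (L : Tens 𝕜 V ⊗[𝕜] Tens 𝕜 V →ₗ[𝕜] N) (Q : Submodule 𝕜 N) {n : ℕ}
    (h : ∀ i j, i + j = n → ∀ a ∈ S i, ∀ b ∈ S j, L (a ⊗ₜ b) ∈ Q) {t : Tens 𝕜 V} (ht : t ∈ S n) :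
    L (deconc t) ∈ Q := by
  have : (⨆ p ∈ antidiagonal n, Submodule.map₂ (TensorProduct.mk 𝕜 _ _) (S p.1) (S p.2)) ≤
      Q.comap L := by
    refine iSup₂_le fun p hp => Submodule.map₂_le.2 fun a ha b hb => ?_
    exact h p.1 p.2 (mem_antidiagonal.1 hp) a ha b hb
  exact this (hS.deconc_mem n t ht)

theorem IsSubcoalg.apply_deconc_eq_zero {S : ℕ → Submodule 𝕜 (Tens 𝕜 V)} (hS : IsSubcoalg S)
    (L : Tens 𝕜 V ⊗[𝕜] Tens 𝕜 V →ₗ[𝕜] N) {n : ℕ}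
    (h : ∀ i j, i + j = n → ∀ a ∈ S i, ∀ b ∈ S j, L (a ⊗ₜ b) = 0) {t : Tens 𝕜 V} (ht : t ∈ S n) :
    L (deconc t) = 0 := by
  simpa using hS.apply_deconc_mem L ⊥ (by simpa using h) ht

theorem isSubcoalg_lenSub : IsSubcoalg (lenSub 𝕜 V) where
  le _ := le_rfl
  deconc_mem := by
    intro n
    have mem : ∀ {i j n : ℕ} {a b : Tens 𝕜 V}, i + j = n → a ∈ lenSub 𝕜 V i → b ∈ lenSub 𝕜 V j →
        a ⊗ₜ[𝕜] b ∈ ⨆ p ∈ antidiagonal n,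
          Submodule.map₂ (TensorProduct.mk 𝕜 _ _) (lenSub 𝕜 V p.1) (lenSub 𝕜 V p.2) := by
      intro i j n a b h ha hb
      exact Submodule.mem_iSup_of_mem (i, j) (Submodule.mem_iSup_of_mem
        (mem_antidiagonal.2 h) (Submodule.apply_mem_map₂ _ ha hb))
    induction n with
    | zero =>
      intro t ht
      obtain ⟨r, rfl⟩ := mem_lenSub_zero.1 ht
      rw [map_smul, deconc_one]
      exact Submodule.smul_mem _ _ (mem rfl one_mem_lenSub one_mem_lenSub)
    | succ n ih =>
      refine lenSub_succ_le (Q := (⨆ p ∈ antidiagonal (n + 1),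
        Submodule.map₂ (TensorProduct.mk 𝕜 _ _) (lenSub 𝕜 V p.1) (lenSub 𝕜 V p.2)).comap deconc) fun x w hw => ?_
      rw [Submodule.mem_comap, deconc_ι_mul]
      refine Submodule.add_mem _ (mem (by simp) one_mem_lenSub (ι_mul_mem_lenSub x hw)) ?_
      have : (⨆ p ∈ antidiagonal n, Submodule.map₂ (TensorProduct.mk 𝕜 _ _)
          (lenSub 𝕜 V p.1) (lenSub 𝕜 V p.2)) ≤ (⨆ p ∈ antidiagonal (n + 1),
          Submodule.map₂ (TensorProduct.mk 𝕜 _ _) (lenSub 𝕜 V p.1) (lenSub 𝕜 V p.2)).comap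
          (LinearMap.mulLeft 𝕜 (ι 𝕜 x ⊗ₜ 1)) := by
        refine iSup₂_le fun p hp => Submodule.map₂_le.2 fun a ha b hb => ?_
        have := mem_antidiagonal.1 hp
        simp only [mk_apply, Submodule.mem_comap, LinearMap.mulLeft_apply,
          Algebra.TensorProduct.tmul_mul_tmul, one_mul]
        exact mem (by lia) (ι_mul_mem_lenSub x ha) hb
      exact this (ih w hw)

/-! ### Components of a given length -/

noncomputable instance : GradedAlgebra (lenSub 𝕜 V) := TensorAlgebra.gradedAlgebra

theorem proj_mem_of_mem_iSup {S : ℕ → Submodule 𝕜 (Tens 𝕜 V)} (hS : ∀ n, S n ≤ lenSub 𝕜 V n)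
    {t : Tens 𝕜 V} (ht : t ∈ ⨆ k, S k) (n : ℕ) :
    GradedRing.proj (lenSub 𝕜 V) n t ∈ S n := by
  induction ht using Submodule.iSup_induction' with
  | mem k x hx =>
    rw [GradedRing.proj_apply]
    by_cases h : k = n
    · subst h; rwa [DirectSum.decompose_of_mem_same _ (hS k hx)]
    · rw [DirectSum.decompose_of_mem_ne _ (hS k hx) h]; exact zero_mem _
  | zero => simp
  | add x y _ _ hx hy => rw [map_add]; exact add_mem hx hy

theorem mem_flt_of_mem {S : ℕ → Submodule 𝕜 (Tens 𝕜 V)} (hS : ∀ n, S n ≤ lenSub 𝕜 V n)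
    {t : Tens 𝕜 V} (ht : t ∈ ⨆ k, S k) {n : ℕ} (hn : t ∈ flt (lenSub 𝕜 V) n) : t ∈ flt S n := by
  classical
  rw [← DirectSum.sum_support_decompose (lenSub 𝕜 V) t]
  refine Submodule.sum_mem _ fun k _ => ?_
  by_cases h : k < n
  · exact le_flt S h (proj_mem_of_mem_iSup hS ht k)
  · have : GradedRing.proj (lenSub 𝕜 V) k t = 0 := by
      have h' : t ∈ ⨆ j, (if j < n then lenSub 𝕜 V j else ⊥) := by
        refine (flt_le fun j hj => ?_ : flt (lenSub 𝕜 V) n ≤ _) hn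
        exact le_iSup_of_le j (by rw [if_pos hj])
      have := proj_mem_of_mem_iSup (S := fun j => if j < n then lenSub 𝕜 V j else ⊥)
        (fun j => by split_ifs <;> simp) h' k
      simpa [h] using this
    rw [GradedRing.proj_apply] at this
    rw [this]; exact zero_mem _

theorem mem_of_mem_iSup {S : ℕ → Submodule 𝕜 (Tens 𝕜 V)} (hS : ∀ n, S n ≤ lenSub 𝕜 V n)
    {t : Tens 𝕜 V} (ht : t ∈ ⨆ k, S k) {n : ℕ} (hn : t ∈ lenSub 𝕜 V n) : t ∈ S n := by
  have := proj_mem_of_mem_iSup hS ht n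
  rwa [GradedRing.proj_apply, DirectSum.decompose_of_mem_same _ hn] at this

theorem iSup_lenSub : ⨆ k, lenSub 𝕜 V k = ⊤ :=
  (DirectSum.Decomposition.isInternal
    (lenSub 𝕜 V)).submodule_iSup_eq_top

/-! ### Behaviour of coderivations and of coalgebra maps -/

theorem conv_id_mem_flt {b : Tens 𝕜 V →ₗ[𝕜] V} {n : ℕ}
    (hb : ∀ k < 2, ∀ t ∈ lenSub 𝕜 V k, b t = 0) {t : Tens 𝕜 V} (ht : t ∈ lenSub 𝕜 V n) :
    conv (ι 𝕜 ∘ₗ b) LinearMap.id t ∈ flt (lenSub 𝕜 V) n := by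
  rw [conv_apply, ← LinearMap.comp_apply]
  refine isSubcoalg_lenSub.apply_deconc_mem _ _ (fun i j hij a ha w hw => ?_) ht
  simp only [LinearMap.comp_apply, map_tmul, LinearMap.mul'_apply, LinearMap.id_apply]
  by_cases hi : i < 2
  · rw [hb i hi a ha]; simp
  · exact le_flt _ (by lia : j + 1 < n) (ι_mul_mem_lenSub _ hw)

theorem cod_mem_flt (θ : V →ₗ[𝕜] V) {b : Tens 𝕜 V →ₗ[𝕜] V} {n : ℕ}
    (hb : ∀ k < 2, ∀ t ∈ lenSub 𝕜 V k, b t = 0) {t : Tens 𝕜 V} (ht : t ∈ lenSub 𝕜 V n) :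
    cod θ b t ∈ flt (lenSub 𝕜 V) n := by
  induction n generalizing t with
  | zero =>
    obtain ⟨r, rfl⟩ := mem_lenSub_zero.1 ht
    rw [map_smul, cod_one, hb 0 (by simp) 1 one_mem_lenSub]; simp
  | succ n ih =>
    refine lenSub_succ_le (Q := (flt (lenSub 𝕜 V) (n + 1)).comap (cod θ b)) (fun x w hw => ?_) ht
    rw [Submodule.mem_comap, cod_ι_mul]
    refine add_mem (conv_id_mem_flt hb (ι_mul_mem_lenSub x hw)) ?_
    rw [add_comm]; exact lenSub_mul_flt (ι_mem_lenSub _) (ih hw)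

theorem cod_linear_ι_mul (θ g : V →ₗ[𝕜] V) (x : V) (w : Tens 𝕜 V) :
    cod θ (g ∘ₗ proj1) (ι 𝕜 x * w) = ι 𝕜 (g x) * w + ι 𝕜 (θ x) * cod θ (g ∘ₗ proj1) w := by
  rw [cod_ι_mul, ← LinearMap.comp_assoc, conv_proj1_ι_mul]; rfl

theorem cod_linear_mem (θ g : V →ₗ[𝕜] V) {n : ℕ} {t : Tens 𝕜 V} (ht : t ∈ lenSub 𝕜 V n) :
    cod θ (g ∘ₗ proj1) t ∈ lenSub 𝕜 V n := by
  induction n generalizing t with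
  | zero =>
    obtain ⟨r, rfl⟩ := mem_lenSub_zero.1 ht
    simp
  | succ n ih =>
    refine lenSub_succ_le (Q := (lenSub 𝕜 V (n + 1)).comap (cod θ (g ∘ₗ proj1))) (fun x w hw => ?_) ht
    rw [Submodule.mem_comap, cod_linear_ι_mul]
    exact add_mem (ι_mul_mem_lenSub _ hw) (ι_mul_mem_lenSub _ (ih hw))

theorem tmap_mem (g : V →ₗ[𝕜] W) {n : ℕ} {t : Tens 𝕜 V} (ht : t ∈ lenSub 𝕜 V n) :
    tmap g t ∈ lenSub 𝕜 W n := by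
  induction n generalizing t with
  | zero =>
    obtain ⟨r, rfl⟩ := mem_lenSub_zero.1 ht
    rw [map_smul, map_one]; exact mem_lenSub_zero.2 ⟨r, rfl⟩
  | succ n ih =>
    refine lenSub_succ_le (Q := (lenSub 𝕜 W (n + 1)).comap (tmap g).toLinearMap) (fun x w hw => ?_) ht
    rw [Submodule.mem_comap, AlgHom.toLinearMap_apply, map_mul, tmap_ι]
    exact ι_mul_mem_lenSub _ (ih hw)

theorem cunit_of_mem {A : Type*} [Ring A] [Algebra 𝕜 A] {n : ℕ} (hn : n ≠ 0) {t : Tens 𝕜 V}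
    (ht : t ∈ lenSub 𝕜 V n) : cunit A t = 0 := by
  obtain ⟨n, rfl⟩ := Nat.exists_eq_succ_of_ne_zero hn
  exact lenSub_succ_le (Q := LinearMap.ker (cunit A)) (fun x w _ => by simp) ht

theorem proj1_of_mem {n : ℕ} (hn : n ≠ 1) {t : Tens 𝕜 V} (ht : t ∈ lenSub 𝕜 V n) :
    proj1 t = 0 := by
  match n with
  | 0 => obtain ⟨r, rfl⟩ := mem_lenSub_zero.1 ht; simp
  | 1 => exact absurd rfl hn
  | n + 2 =>
    refine lenSub_succ_le (Q := LinearMap.ker proj1) (fun x w hw => ?_) ht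
    rw [LinearMap.mem_ker, proj1_ι_mul]
    have : eps w = 0 := by simpa [cunit] using cunit_of_mem (A := 𝕜) (by simp) hw
    rw [this, zero_smul]

theorem ι_proj1_of_mem {t : Tens 𝕜 V} (ht : t ∈ lenSub 𝕜 V 1) : ι 𝕜 (proj1 t) = t := by
  rw [lenSub, pow_one] at ht
  obtain ⟨x, rfl⟩ := ht; simp

theorem coext_sub_tmap_mem {f : Tens 𝕜 V →ₗ[𝕜] W} {φ : Tens 𝕜 V →ₗ[𝕜] Tens 𝕜 W}
    (hf1 : f 1 = 0) (hφ : φ = cunit _ + conv (ι 𝕜 ∘ₗ f) φ) {n : ℕ} {t : Tens 𝕜 V}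
    (ht : t ∈ lenSub 𝕜 V n) : φ t - tmap (f ∘ₗ ι 𝕜) t ∈ flt (lenSub 𝕜 W) n := by
  have hφ1 : φ 1 = 1 := by rw [hφ]; simp [hf1]
  induction n using Nat.strong_induction_on generalizing t with
  | _ n ih =>
  match n with
  | 0 =>
    obtain ⟨r, rfl⟩ := mem_lenSub_zero.1 ht
    simp [hφ1]
  | n + 1 =>
    have h1 : φ t - tmap (f ∘ₗ ι 𝕜) t = (LinearMap.mul' 𝕜 _ ∘ₗ
        (TensorProduct.map (ι 𝕜 ∘ₗ f) φ - TensorProduct.map (ι 𝕜 ∘ₗ (f ∘ₗ ι 𝕜) ∘ₗ proj1)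
          (tmap (f ∘ₗ ι 𝕜)).toLinearMap)) (deconc t) := by
      have h2 := LinearMap.congr_fun hφ t
      have h3 := LinearMap.congr_fun (tmap_eq_conv (f ∘ₗ ι 𝕜)) t
      rw [LinearMap.add_apply, cunit_of_mem (by simp) ht, zero_add] at h2 h3
      rw [AlgHom.toLinearMap_apply] at h3
      rw [h2, h3]
      simp [conv_apply]
    rw [h1]
    refine isSubcoalg_lenSub.apply_deconc_mem _ _ (fun i j hij a ha b hb => ?_) ht
    simp only [LinearMap.comp_apply, LinearMap.sub_apply, map_tmul, map_sub, LinearMap.mul'_apply,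
      AlgHom.toLinearMap_apply]
    match i with
    | 0 =>
      obtain ⟨r, rfl⟩ := mem_lenSub_zero.1 ha
      simp [hf1]
    | 1 =>
      rw [ι_proj1_of_mem ha, ← mul_sub, show n + 1 = 1 + n by lia]
      exact lenSub_mul_flt (ι_mem_lenSub _) (by
        have := ih j (by lia) hb
        rwa [show j = n by lia] at this)
    | i + 2 =>
      rw [proj1_of_mem (by lia) ha]
      simp only [map_zero, zero_mul, sub_zero]
      have h4 : φ b ∈ flt (lenSub 𝕜 W) (j + 1) := by
        rw [← sub_add_cancel (φ b) (tmap (f ∘ₗ ι 𝕜) b)]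
        exact add_mem (flt_mono _ (by lia) (ih j (by lia) hb)) (le_flt _ (by lia) (tmap_mem _ hb))
      exact flt_mono _ (by lia) (lenSub_mul_flt (ι_mem_lenSub _) h4)

end Length

section Obstruction

variable {𝕜 : Type*} [Field 𝕜] {V : Type*} [AddCommGroup V] [Module 𝕜 V]
  {W : Type*} [AddCommGroup W] [Module 𝕜 W]

theorem IsSubcoalg.eq_ι_of_conv_eq {S : ℕ → Submodule 𝕜 (Tens 𝕜 V)} (hS : IsSubcoalg S)
    {e g : Tens 𝕜 V →ₗ[𝕜] W} {h X : Tens 𝕜 V →ₗ[𝕜] Tens 𝕜 W}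
    (hX : X = conv (ι 𝕜 ∘ₗ e) h + conv (ι 𝕜 ∘ₗ g) X) (hh : h 1 = 1) (hg : g 1 = 0) {n : ℕ}
    (he : ∀ k < n, ∀ t ∈ S k, e t = 0) {k : ℕ} (hk : k ≤ n) {t : Tens 𝕜 V} (ht : t ∈ S k) :
    X t = ι 𝕜 (e t) := by
  induction k using Nat.strong_induction_on generalizing t with
  | _ k ih =>
  rw [← sub_eq_zero]
  have h1 : X t - ι 𝕜 (e t) = (LinearMap.mul' 𝕜 _ ∘ₗ
      (TensorProduct.map (ι 𝕜 ∘ₗ e) (h - cunit _) + TensorProduct.map (ι 𝕜 ∘ₗ g) X)) (deconc t) := by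
    have h2 := LinearMap.congr_fun hX t
    have h3 := LinearMap.congr_fun (conv_cunit (ι 𝕜 ∘ₗ e)) t
    rw [LinearMap.comp_apply] at h3
    rw [← h3, h2, LinearMap.add_apply, add_sub_right_comm, ← LinearMap.sub_apply, ← conv_sub,
      LinearMap.comp_apply, LinearMap.add_apply, map_add]
    rfl
  rw [h1]
  refine hS.apply_deconc_eq_zero _ (fun i j hij a ha b hb => ?_) ht
  simp only [LinearMap.comp_apply, LinearMap.add_apply, map_tmul, map_add, LinearMap.mul'_apply,
    LinearMap.sub_apply]
  have e1 : ι 𝕜 (e a) * (h b - cunit _ b) = 0 := by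
    by_cases hi : i < n
    · rw [he i hi a ha]; simp
    · obtain rfl : j = 0 := by lia
      obtain ⟨r, rfl⟩ := mem_lenSub_zero.1 (hS.le _ hb)
      simp [hh]
  have e2 : ι 𝕜 (g a) * X b = 0 := by
    by_cases hi : i = 0
    · subst hi
      obtain ⟨r, rfl⟩ := mem_lenSub_zero.1 (hS.le _ ha)
      simp [hg]
    · rw [ih j (by lia) (by lia) hb, he j (by lia) b hb]; simp
  rw [e1, e2, add_zero]

/-- The structure that the obstruction argument uses: subcoalgebras of the tensor coalgebras of
`V` and of `W` that are compatible with coderivations and with coalgebra maps. -/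
structure IsStable (β : V →ₗ[𝕜] V) (S : ℕ → Submodule 𝕜 (Tens 𝕜 V)) : Prop
    extends IsSubcoalg S where
  cod_mem : ∀ b : Tens 𝕜 V →ₗ[𝕜] V, b ∘ₗ (tmap β).toLinearMap = -(β ∘ₗ b) →
    ∀ n, ∀ t ∈ S n, cod β b t ∈ ⨆ k, S k

/-- Compatibility of subcoalgebras with all even coalgebra maps. -/
def IsCompatible (β : V →ₗ[𝕜] V) (β' : W →ₗ[𝕜] W) (S : ℕ → Submodule 𝕜 (Tens 𝕜 V))
    (S' : ℕ → Submodule 𝕜 (Tens 𝕜 W)) : Prop :=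
  ∀ (f : Tens 𝕜 V →ₗ[𝕜] W) (φ : Tens 𝕜 V →ₗ[𝕜] Tens 𝕜 W), f 1 = 0 →
    f ∘ₗ (tmap β).toLinearMap = β' ∘ₗ f → φ = cunit _ + conv (ι 𝕜 ∘ₗ f) φ →
    ∀ n, ∀ t ∈ S n, φ t ∈ ⨆ k, S' k

variable {β : V →ₗ[𝕜] V} {S : ℕ → Submodule 𝕜 (Tens 𝕜 V)}
  {β' : W →ₗ[𝕜] W} {S' : ℕ → Submodule 𝕜 (Tens 𝕜 W)}

theorem comp_proj1_comp_tmap (g : V →ₗ[𝕜] W) (f : V →ₗ[𝕜] V) :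
    (g ∘ₗ proj1) ∘ₗ (tmap f).toLinearMap = (g ∘ₗ f) ∘ₗ proj1 := by
  rw [LinearMap.comp_assoc, proj1_comp_tmap, LinearMap.comp_assoc]

theorem IsStable.cod_linear_mem (hS : IsStable β S) {g : V →ₗ[𝕜] V} (hg : g ∘ₗ β = -(β ∘ₗ g))
    {n : ℕ} {t : Tens 𝕜 V} (ht : t ∈ S n) : cod β (g ∘ₗ proj1) t ∈ S n :=
  mem_of_mem_iSup hS.le (hS.cod_mem _ (by
    rw [comp_proj1_comp_tmap, hg, LinearMap.neg_comp, LinearMap.comp_assoc]) n t ht)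
    (StrongHomotopy.cod_linear_mem _ _ (hS.le _ ht))

theorem IsStable.cod_sub_mem (hS : IsStable β S) {b : Tens 𝕜 V →ₗ[𝕜] V}
    (hb : b ∘ₗ (tmap β).toLinearMap = -(β ∘ₗ b)) (hb1 : b 1 = 0) {n : ℕ} {t : Tens 𝕜 V}
    (ht : t ∈ S n) : cod β b t - cod β ((b ∘ₗ ι 𝕜) ∘ₗ proj1) t ∈ flt S n := by
  have hg : (b ∘ₗ ι 𝕜) ∘ₗ β = -(β ∘ₗ (b ∘ₗ ι 𝕜)) := by
    ext x
    have := LinearMap.congr_fun hb (ι 𝕜 x)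
    simpa using this
  rw [← LinearMap.sub_apply, ← cod_sub]
  refine mem_flt_of_mem hS.le (hS.cod_mem _ ?_ n t ht) (cod_mem_flt β ?_ (hS.le _ ht))
  · rw [LinearMap.sub_comp, hb, comp_proj1_comp_tmap, hg]
    ext w; simp; abel
  · intro k hk t ht
    match k with
    | 0 => obtain ⟨r, rfl⟩ := mem_lenSub_zero.1 ht; simp [hb1]
    | 1 => simp [ι_proj1_of_mem ht]

theorem IsCompatible.tmap_mem (h : IsCompatible β β' S S') (hS : IsStable β S)
    (hS' : IsStable β' S') {g : V →ₗ[𝕜] W} (hg : g ∘ₗ β = β' ∘ₗ g) {n : ℕ} {t : Tens 𝕜 V}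
    (ht : t ∈ S n) : tmap g t ∈ S' n :=
  mem_of_mem_iSup hS'.le (h (g ∘ₗ proj1) (tmap g).toLinearMap (by simp)
    (by rw [comp_proj1_comp_tmap, hg, LinearMap.comp_assoc])
    (by rw [← tmap_eq_conv]) n t ht) (StrongHomotopy.tmap_mem g (hS.le _ ht))

theorem IsCompatible.sub_tmap_mem (h : IsCompatible β β' S S') (hS : IsStable β S)
    (hS' : IsStable β' S') {f : Tens 𝕜 V →ₗ[𝕜] W} {φ : Tens 𝕜 V →ₗ[𝕜] Tens 𝕜 W}
    (hf1 : f 1 = 0) (hf : f ∘ₗ (tmap β).toLinearMap = β' ∘ₗ f)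
    (hφ : φ = cunit _ + conv (ι 𝕜 ∘ₗ f) φ) {n : ℕ} {t : Tens 𝕜 V} (ht : t ∈ S n) :
    φ t - tmap (f ∘ₗ ι 𝕜) t ∈ flt S' n := by
  have hg : (f ∘ₗ ι 𝕜) ∘ₗ β = β' ∘ₗ (f ∘ₗ ι 𝕜) := by
    ext x
    have := LinearMap.congr_fun hf (ι 𝕜 x)
    simpa using this
  refine mem_flt_of_mem hS'.le (sub_mem (h f φ hf1 hf hφ n t ht) ?_)
    (coext_sub_tmap_mem hf1 hφ (hS.le _ ht))
  exact Submodule.mem_iSup_of_mem n (h.tmap_mem hS hS' hg ht)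

theorem eq_zero_of_mem_flt {M : Type*} [AddCommGroup M] [Module 𝕜 M] {e : Tens 𝕜 V →ₗ[𝕜] M}
    {n : ℕ} (he : ∀ k < n, ∀ t ∈ S k, e t = 0) {t : Tens 𝕜 V} (ht : t ∈ flt S n) : e t = 0 :=
  (flt_le fun k hk t ht => he k hk t ht : flt S n ≤ LinearMap.ker e) ht

theorem cod_cod_eq_ι (hS : IsStable β S) (hβ : β ∘ₗ β = LinearMap.id) {b : Tens 𝕜 V →ₗ[𝕜] V}
    (hb : b ∘ₗ (tmap β).toLinearMap = -(β ∘ₗ b)) {n : ℕ}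
    (he : ∀ k < n, ∀ t ∈ S k, b (cod β b t) = 0) {t : Tens 𝕜 V} (ht : t ∈ S n) :
    cod β b (cod β b t) = ι 𝕜 (b (cod β b t)) :=
  hS.eq_ι_of_conv_eq (e := b ∘ₗ cod β b) (cod_sq_eq hβ hb) rfl (by simp) he le_rfl ht

theorem obstruction_cycle (hS : IsStable β S) (hβ : β ∘ₗ β = LinearMap.id) {b : Tens 𝕜 V →ₗ[𝕜] V}
    (hb : b ∘ₗ (tmap β).toLinearMap = -(β ∘ₗ b)) (hb1 : b 1 = 0) {n : ℕ}
    (he : ∀ k < n, ∀ t ∈ S k, b (cod β b t) = 0) {t : Tens 𝕜 V} (ht : t ∈ S n) :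
    b (ι 𝕜 (b (cod β b t))) = b (cod β b (cod β ((b ∘ₗ ι 𝕜) ∘ₗ proj1) t)) := by
  rw [← cod_cod_eq_ι hS hβ hb he ht, ← sub_eq_zero, ← map_sub, ← map_sub]
  exact eq_zero_of_mem_flt (e := b ∘ₗ cod β b) he (hS.cod_sub_mem hb hb1 ht)

theorem obstruction_morphism (hS : IsStable β S) (hS' : IsStable β' S')
    (hSS : IsCompatible β β' S S') (hβ : β ∘ₗ β = LinearMap.id)
    {b : Tens 𝕜 V →ₗ[𝕜] V} (hb : b ∘ₗ (tmap β).toLinearMap = -(β ∘ₗ b)) (hb1 : b 1 = 0)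
    (hbb : ∀ k, ∀ t ∈ S k, b (cod β b t) = 0)
    {c : Tens 𝕜 W →ₗ[𝕜] W} {n : ℕ} (hc : ∀ k < n, ∀ t ∈ S' k, c (cod β' c t) = 0)
    {f : Tens 𝕜 V →ₗ[𝕜] W} {φ : Tens 𝕜 V →ₗ[𝕜] Tens 𝕜 W} (hf1 : f 1 = 0)
    (hf : f ∘ₗ (tmap β).toLinearMap = β' ∘ₗ f) (hφ : φ = cunit _ + conv (ι 𝕜 ∘ₗ f) φ)
    (hr : ∀ k < n, ∀ t ∈ S k, c (φ t) - f (cod β b t) = 0) {t : Tens 𝕜 V} (ht : t ∈ S n) :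
    c (ι 𝕜 (c (φ t) - f (cod β b t))) = c (cod β' c (tmap (f ∘ₗ ι 𝕜) t)) -
      (c (φ (cod β ((b ∘ₗ ι 𝕜) ∘ₗ proj1) t)) - f (cod β b (cod β ((b ∘ₗ ι 𝕜) ∘ₗ proj1) t))) := by
  have hφ1 : φ 1 = 1 := by rw [hφ]; simp [hf1]
  have h1 : cod β' c (φ t) - φ (cod β b t) = ι 𝕜 (c (φ t) - f (cod β b t)) :=
    hS.eq_ι_of_conv_eq (e := c ∘ₗ φ - f ∘ₗ cod β b) (cod_coext_sub hf1 hf hφ) hφ1 (by simp [hf1])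
      hr le_rfl ht
  have h2 : cod β b (cod β b t) = 0 := by
    rw [cod_cod_eq_ι hS hβ hb (fun k _ => hbb k) ht, hbb n t ht, map_zero]
  have h3 : c (cod β' c (φ t)) = c (cod β' c (tmap (f ∘ₗ ι 𝕜) t)) := by
    rw [← sub_eq_zero, ← map_sub, ← map_sub]
    exact eq_zero_of_mem_flt (e := c ∘ₗ cod β' c) hc (hSS.sub_tmap_mem hS hS' hf1 hf hφ ht)
  have h4 : (c ∘ₗ φ - f ∘ₗ cod β b) (cod β b t) =
      (c ∘ₗ φ - f ∘ₗ cod β b) (cod β ((b ∘ₗ ι 𝕜) ∘ₗ proj1) t) := by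
    rw [← sub_eq_zero, ← map_sub]
    exact eq_zero_of_mem_flt hr (hS.cod_sub_mem hb hb1 ht)
  simp only [LinearMap.sub_apply, LinearMap.comp_apply, h2, map_zero, sub_zero] at h4
  rw [← h1, map_sub, h3, h4]

end Obstruction

section Graded

variable {𝕜 : Type*} [Field 𝕜] {V : Type*} [AddCommGroup V] [Module 𝕜 V]
  {W : Type*} [AddCommGroup W] [Module 𝕜 W]
  {U : Type*} [AddCommGroup U] [Module 𝕜 U]
  (𝒱 : ℤ → Submodule 𝕜 V) [DirectSum.Decomposition 𝒱]
  (𝒲 : ℤ → Submodule 𝕜 W) [DirectSum.Decomposition 𝒲] (𝒰 : ℤ → Submodule 𝕜 U)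

/-- The homogeneous component of degree `e`. -/
noncomputable def hcomp (e : ℤ) : V →ₗ[𝕜] V :=
  (𝒱 e).subtype ∘ₗ DirectSum.component 𝕜 ℤ (fun i => 𝒱 i) e ∘ₗ
    (DirectSum.decomposeLinearEquiv 𝒱).toLinearMap

theorem hcomp_apply (e : ℤ) (v : V) : hcomp 𝒱 e v = (DirectSum.decompose 𝒱 v e : V) := rfl

theorem hcomp_mem (e : ℤ) (v : V) : hcomp 𝒱 e v ∈ 𝒱 e := (DirectSum.decompose 𝒱 v e).2

theorem hcomp_of_mem {e : ℤ} {v : V} (hv : v ∈ 𝒱 e) : hcomp 𝒱 e v = v :=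
  DirectSum.decompose_of_mem_same 𝒱 hv

theorem hcomp_of_mem_ne {e e' : ℤ} {v : V} (hv : v ∈ 𝒱 e) (h : e ≠ e') : hcomp 𝒱 e' v = 0 :=
  DirectSum.decompose_of_mem_ne 𝒱 hv h

variable {𝒱} in
theorem graded_induction {p : V → Prop} (zero : p 0) (add : ∀ v w, p v → p w → p (v + w))
    (mem : ∀ e, ∀ v ∈ 𝒱 e, p v) (v : V) : p v :=
  DirectSum.Decomposition.inductionOn 𝒱 zero (fun m => mem _ _ m.2) (fun v w => add v w) v

variable {𝒱} in
theorem graded_ext {N : Type*} [AddCommGroup N] [Module 𝕜 N] {f g : V →ₗ[𝕜] N}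
    (h : ∀ e, ∀ v ∈ 𝒱 e, f v = g v) : f = g := by
  ext v
  induction v using graded_induction (𝒱 := 𝒱) with
  | zero => simp
  | add v w hv hw => simp [hv, hw]
  | mem e v hv => exact h e v hv

theorem eq_zero_of_hcomp {v : V} (h : ∀ e, hcomp 𝒱 e v = 0) : v = 0 := by
  have : DirectSum.decompose 𝒱 v = 0 := by
    ext e; simpa [hcomp_apply] using h e
  exact (DirectSum.decompose 𝒱).injective (this.trans (DirectSum.decompose_zero 𝒱).symm)

/-- The linear map given on the component of degree `e` by `φ e`. -/
noncomputable def gradedMap (φ : ℤ → V →ₗ[𝕜] W) : V →ₗ[𝕜] W :=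
  DirectSum.toModule 𝕜 ℤ W (fun e => φ e ∘ₗ (𝒱 e).subtype) ∘ₗ
    (DirectSum.decomposeLinearEquiv 𝒱).toLinearMap

theorem gradedMap_of_mem (φ : ℤ → V →ₗ[𝕜] W) {e : ℤ} {v : V} (hv : v ∈ 𝒱 e) :
    gradedMap 𝒱 φ v = φ e v := by
  have : DirectSum.decompose 𝒱 v = DirectSum.lof 𝕜 ℤ (fun i => 𝒱 i) e ⟨v, hv⟩ :=
    DirectSum.decompose_of_mem 𝒱 hv
  simp only [gradedMap, LinearMap.comp_apply, LinearEquiv.coe_coe,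
    DirectSum.decomposeLinearEquiv_apply, this]
  rw [DirectSum.toModule_lof]; rfl

/-- The parity operator of the suspension. -/
noncomputable def par : V →ₗ[𝕜] V := gradedMap 𝒱 fun e => ((Int.negOnePow (e + 1) : ℤ) : 𝕜) • LinearMap.id

/-- The degree operator of the suspension. -/
noncomputable def dgr : V →ₗ[𝕜] V := gradedMap 𝒱 fun e => ((e + 1 : ℤ) : 𝕜) • LinearMap.id

variable {𝒱} in
theorem par_of_mem {e : ℤ} {v : V} (hv : v ∈ 𝒱 e) :
    par 𝒱 v = ((Int.negOnePow (e + 1) : ℤ) : 𝕜) • v := by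
  rw [par, gradedMap_of_mem 𝒱 _ hv]; rfl

variable {𝒱} in
theorem dgr_of_mem {e : ℤ} {v : V} (hv : v ∈ 𝒱 e) : dgr 𝒱 v = ((e + 1 : ℤ) : 𝕜) • v := by
  rw [dgr, gradedMap_of_mem 𝒱 _ hv]; rfl

/-- A linear map of degree `p`. -/
def IsHom (p : ℤ) (g : V →ₗ[𝕜] W) : Prop := ∀ e, ∀ v ∈ 𝒱 e, g v ∈ 𝒲 (e + p)

theorem negOnePow_cast_mul_self (a : ℤ) :
    ((Int.negOnePow a : ℤ) : 𝕜) * ((Int.negOnePow a : ℤ) : 𝕜) = 1 := by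
  rw [← Int.cast_mul, ← Units.val_mul, ← Int.negOnePow_add, ← two_mul, Int.negOnePow_two_mul]
  simp

theorem par_par : par 𝒱 ∘ₗ par 𝒱 = LinearMap.id := by
  refine graded_ext (𝒱 := 𝒱) fun e v hv => ?_
  rw [LinearMap.comp_apply, par_of_mem hv, map_smul, par_of_mem hv, smul_smul,
    negOnePow_cast_mul_self, one_smul, LinearMap.id_apply]

theorem dgr_par : dgr 𝒱 ∘ₗ par 𝒱 = par 𝒱 ∘ₗ dgr 𝒱 := by
  refine graded_ext (𝒱 := 𝒱) fun e v hv => ?_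
  rw [LinearMap.comp_apply, LinearMap.comp_apply, par_of_mem hv, map_smul, dgr_of_mem hv, map_smul,
    par_of_mem hv, smul_comm]

variable {𝒱 𝒲 𝒰}

theorem IsHom.comp_par {p : ℤ} {g : V →ₗ[𝕜] W} (hg : IsHom 𝒱 𝒲 p g) :
    g ∘ₗ par 𝒱 = ((Int.negOnePow p : ℤ) : 𝕜) • (par 𝒲 ∘ₗ g) := by
  refine graded_ext (𝒱 := 𝒱) fun e v hv => ?_
  simp only [LinearMap.comp_apply, LinearMap.smul_apply, par_of_mem hv, par_of_mem (hg e v hv),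
    map_smul, smul_smul]
  rw [add_right_comm, Int.negOnePow_add (e + 1) p, Units.val_mul, Int.cast_mul,
    mul_left_comm, negOnePow_cast_mul_self, mul_one]

theorem IsHom.comp_par_odd {p : ℤ} {g : V →ₗ[𝕜] W} (hg : IsHom 𝒱 𝒲 p g) (hp : Odd p) :
    g ∘ₗ par 𝒱 = -(par 𝒲 ∘ₗ g) := by
  rw [hg.comp_par, Int.negOnePow_odd p hp]; simp

theorem IsHom.comp_par_even {g : V →ₗ[𝕜] W} (hg : IsHom 𝒱 𝒲 0 g) :
    g ∘ₗ par 𝒱 = par 𝒲 ∘ₗ g := by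
  rw [hg.comp_par]; simp

theorem IsHom.dgr_comp {p : ℤ} {g : V →ₗ[𝕜] W} (hg : IsHom 𝒱 𝒲 p g) :
    dgr 𝒲 ∘ₗ g - g ∘ₗ dgr 𝒱 = (p : 𝕜) • g := by
  refine graded_ext (𝒱 := 𝒱) fun e v hv => ?_
  simp only [LinearMap.comp_apply, LinearMap.sub_apply, LinearMap.smul_apply, dgr_of_mem hv,
    dgr_of_mem (hg e v hv), map_smul, ← sub_smul]
  congr 1
  push_cast; ring

omit [DirectSum.Decomposition 𝒱] [DirectSum.Decomposition 𝒲] in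
theorem IsHom.comp {p q : ℤ} {f : W →ₗ[𝕜] U} {g : V →ₗ[𝕜] W} (hf : IsHom 𝒲 𝒰 q f)
    (hg : IsHom 𝒱 𝒲 p g) : IsHom 𝒱 𝒰 (p + q) (f ∘ₗ g) := fun e v hv => by
  rw [← add_assoc]; exact hf _ _ (hg e v hv)

omit [DirectSum.Decomposition 𝒱] [DirectSum.Decomposition 𝒲] in
theorem IsHom.add {p : ℤ} {f g : V →ₗ[𝕜] W} (hf : IsHom 𝒱 𝒲 p f) (hg : IsHom 𝒱 𝒲 p g) :
    IsHom 𝒱 𝒲 p (f + g) := fun e v hv => add_mem (hf e v hv) (hg e v hv)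

omit [DirectSum.Decomposition 𝒱] [DirectSum.Decomposition 𝒲] in
theorem IsHom.sub {p : ℤ} {f g : V →ₗ[𝕜] W} (hf : IsHom 𝒱 𝒲 p f) (hg : IsHom 𝒱 𝒲 p g) :
    IsHom 𝒱 𝒲 p (f - g) := fun e v hv => sub_mem (hf e v hv) (hg e v hv)

omit [DirectSum.Decomposition 𝒱] in
theorem isHom_id : IsHom 𝒱 𝒱 0 LinearMap.id := fun e v hv => by simpa using hv

theorem IsHom.hcomp_comm {p : ℤ} {g : V →ₗ[𝕜] W} (hg : IsHom 𝒱 𝒲 p g) (e : ℤ) (v : V) :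
    hcomp 𝒲 (e + p) (g v) = g (hcomp 𝒱 e v) := by
  induction v using graded_induction (𝒱 := 𝒱) with
  | zero => simp
  | add v w hv hw => simp [hv, hw]
  | mem e' v hv =>
    by_cases h : e' = e
    · subst h; rw [hcomp_of_mem 𝒱 hv, hcomp_of_mem 𝒲 (hg _ _ hv)]
    · rw [hcomp_of_mem_ne 𝒱 hv h, hcomp_of_mem_ne 𝒲 (hg _ _ hv) (by simpa using h), map_zero]

variable (𝒱 𝒲) in
/-- The part of degree `p` of a linear map. -/
noncomputable def homPart (p : ℤ) (g : V →ₗ[𝕜] W) : V →ₗ[𝕜] W :=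
  gradedMap 𝒱 fun e => hcomp 𝒲 (e + p) ∘ₗ g

theorem homPart_of_mem (p : ℤ) (g : V →ₗ[𝕜] W) {e : ℤ} {v : V} (hv : v ∈ 𝒱 e) :
    homPart 𝒱 𝒲 p g v = hcomp 𝒲 (e + p) (g v) := gradedMap_of_mem 𝒱 _ hv

theorem isHom_homPart (p : ℤ) (g : V →ₗ[𝕜] W) : IsHom 𝒱 𝒲 p (homPart 𝒱 𝒲 p g) := by
  intro e v hv
  rw [homPart_of_mem p g hv]; exact hcomp_mem _ _ _

end Graded

section Homotopy

variable {𝕜 : Type*} [Field 𝕜] {V : Type*} [AddCommGroup V] [Module 𝕜 V]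
  {W : Type*} [AddCommGroup W] [Module 𝕜 W]
  {𝒱 : ℤ → Submodule 𝕜 V} [DirectSum.Decomposition 𝒱]
  {𝒲 : ℤ → Submodule 𝕜 W} [DirectSum.Decomposition 𝒲]

omit [DirectSum.Decomposition 𝒱] in
theorem IsDifferential.isHom {dV : V →ₗ[𝕜] V} (h : IsDifferential 𝒱 dV) : IsHom 𝒱 𝒱 (-1) dV :=
  h.degree

theorem exists_splitting {dV : V →ₗ[𝕜] V} (hd : IsDifferential 𝒱 dV) :
    ∃ h : V →ₗ[𝕜] V, IsHom 𝒱 𝒱 1 h ∧ ∀ v, dV (h (dV v)) = dV v := by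
  obtain ⟨s, hs⟩ := LinearMap.exists_rightInverse_of_surjective dV.rangeRestrict
    (LinearMap.range_rangeRestrict dV)
  obtain ⟨h, hh⟩ := LinearMap.exists_extend s
  have h1 : ∀ v, dV (h (dV v)) = dV v := by
    intro v
    have e1 : h (dV v) = s ⟨dV v, v, rfl⟩ := LinearMap.congr_fun hh ⟨dV v, v, rfl⟩
    have e2 := LinearMap.congr_fun hs ⟨dV v, v, rfl⟩
    rw [e1]
    exact congrArg Subtype.val e2
  refine ⟨homPart 𝒱 𝒱 1 h, isHom_homPart 1 h, fun v => ?_⟩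
  induction v using graded_induction (𝒱 := 𝒱) with
  | zero => simp
  | add v w hv hw => simp [hv, hw]
  | mem e v hv =>
    have hdv := hd.degree e v hv
    rw [homPart_of_mem 1 h hdv, ← hd.isHom.hcomp_comm, h1,
      hcomp_of_mem 𝒱 (by simpa [sub_eq_add_neg] using hdv)]

theorem exists_nullhomotopy {dV : V →ₗ[𝕜] V} (hd : IsDifferential 𝒱 dV) {K : V →ₗ[𝕜] V}
    (hK : IsHom 𝒱 𝒱 0 K) (hKd : ∀ v, K (dV v) = dV (K v))
    (hKz : ∀ v, dV v = 0 → ∃ u, K v = dV u) :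
    ∃ k : V →ₗ[𝕜] V, IsHom 𝒱 𝒱 1 k ∧ K = dV ∘ₗ k + k ∘ₗ dV := by
  obtain ⟨h, hh, hdh⟩ := exists_splitting hd
  refine ⟨K ∘ₗ h + h ∘ₗ K ∘ₗ (LinearMap.id - h ∘ₗ dV - dV ∘ₗ h), ?_, ?_⟩
  · have h1 : IsHom 𝒱 𝒱 0 (h ∘ₗ dV) := hh.comp hd.isHom
    have h2 : IsHom 𝒱 𝒱 0 (dV ∘ₗ h) := hd.isHom.comp hh
    exact (hK.comp hh).add (hh.comp (hK.comp ((isHom_id.sub h1).sub h2)))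
  · ext v
    have e1 : dV (h (K (v - h (dV v) - dV (h v)))) = K (v - h (dV v) - dV (h v)) := by
      obtain ⟨u, hu⟩ := hKz (v - h (dV v) - dV (h v)) (by simp [hdh, hd.sq_zero])
      rw [hu, hdh]
    simp only [LinearMap.add_apply, LinearMap.comp_apply, LinearMap.sub_apply, LinearMap.id_apply,
      map_add, e1]
    simp only [map_sub, hd.sq_zero, hdh, hKd, map_zero, sub_self, sub_zero, add_zero]
    abel

theorem IsQuasiIso.exists_inverse {dV : V →ₗ[𝕜] V} {dW : W →ₗ[𝕜] W} (hV : IsDifferential 𝒱 dV)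
    (hW : IsDifferential 𝒲 dW) {F : V →ₗ[𝕜] W} (hF : IsHom 𝒱 𝒲 0 F)
    (hq : IsQuasiIso dV dW F) :
    ∃ (G : W →ₗ[𝕜] V) (k : V →ₗ[𝕜] V) (k' : W →ₗ[𝕜] W), IsHom 𝒲 𝒱 0 G ∧ IsHom 𝒱 𝒱 1 k ∧
      IsHom 𝒲 𝒲 1 k' ∧ (∀ w, G (dW w) = dV (G w)) ∧ (∀ w, G (F (G w)) = G w) ∧
      LinearMap.id - G ∘ₗ F = dV ∘ₗ k + k ∘ₗ dV ∧
      LinearMap.id - F ∘ₗ G = dW ∘ₗ k' + k' ∘ₗ dW := by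
  obtain ⟨hFd, hinj, hsurj⟩ := hq
  have inj : ∀ v, dV v = 0 → (∃ u, F v = dW u) → ∃ u, v = dV u := by
    rintro v hv ⟨u, hu⟩
    have h0 : homologyMap F hFd (Submodule.Quotient.mk ⟨v, hv⟩) = 0 := by
      rw [homologyMap, Submodule.mapQ_apply, Submodule.Quotient.mk_eq_zero]
      exact ⟨u, hu.symm⟩
    have h1 := hinj (h0.trans (map_zero _).symm)
    rw [Submodule.Quotient.mk_eq_zero] at h1
    obtain ⟨u', hu'⟩ := h1
    exact ⟨u', hu'.symm⟩
  let q : LinearMap.ker dV →ₗ[𝕜] Homology dW := Submodule.mkQ _ ∘ₗ cyclesMap F hFd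
  have hq : LinearMap.range q = ⊤ := by
    rw [LinearMap.range_eq_top]
    intro y
    obtain ⟨x, rfl⟩ := hsurj y
    obtain ⟨x, rfl⟩ := Submodule.Quotient.mk_surjective _ x
    exact ⟨x, rfl⟩
  obtain ⟨s, hs⟩ := q.exists_rightInverse_of_surjective hq
  obtain ⟨g, hg⟩ := LinearMap.exists_extend ((LinearMap.ker dV).subtype ∘ₗ s ∘ₗ Submodule.mkQ _)
  have hg' : ∀ w (hw : dW w = 0), g w = s (Submodule.Quotient.mk ⟨w, hw⟩) :=
    fun w hw => LinearMap.congr_fun hg ⟨w, hw⟩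
  have g1 : ∀ w, dW w = 0 → dV (g w) = 0 := by
    intro w hw; rw [hg' w hw]; exact (s _).2
  have g2 : ∀ w, dW w = 0 → ∃ u, F (g w) - w = dW u := by
    intro w hw
    have h1 := LinearMap.congr_fun hs (Submodule.Quotient.mk ⟨w, hw⟩)
    have h2 : (Submodule.Quotient.mk (cyclesMap F hFd (s (Submodule.Quotient.mk ⟨w, hw⟩))) :
        Homology dW) = Submodule.Quotient.mk ⟨w, hw⟩ := h1
    rw [Submodule.Quotient.eq] at h2
    obtain ⟨u, hu⟩ := h2
    refine ⟨u, ?_⟩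
    rw [hg' w hw, hu]; rfl
  have g3 : ∀ w, g (dW w) = 0 := by
    intro w
    rw [hg' (dW w) (hW.sq_zero w)]
    have : (Submodule.Quotient.mk ⟨dW w, hW.sq_zero w⟩ : Homology dW) = 0 := by
      rw [Submodule.Quotient.mk_eq_zero]; exact ⟨w, rfl⟩
    rw [this, map_zero]; rfl
  have cyc : ∀ w, dW w = 0 → ∀ e, dW (hcomp 𝒲 e w) = 0 := by
    intro w hw e; rw [← hW.isHom.hcomp_comm, hw, map_zero]
  let g0 := homPart 𝒲 𝒱 0 g
  have hg0 : IsHom 𝒲 𝒱 0 g0 := isHom_homPart 0 g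
  have g0comp : ∀ e w, hcomp 𝒱 e (g0 w) = hcomp 𝒱 e (g (hcomp 𝒲 e w)) := by
    intro e w
    have := hg0.hcomp_comm e w
    rw [add_zero] at this
    rw [this, homPart_of_mem 0 g (hcomp_mem 𝒲 e w), add_zero]
  have k1 : ∀ w, dW w = 0 → dV (g0 w) = 0 := by
    intro w hw
    refine eq_zero_of_hcomp 𝒱 fun e => ?_
    have := hV.isHom.hcomp_comm (e + 1) (g0 w)
    rw [add_neg_cancel_right] at this
    rw [this, g0comp, ← hV.isHom.hcomp_comm, g1 _ (cyc w hw _), map_zero]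
  have k3 : ∀ w, g0 (dW w) = 0 := by
    intro w
    refine eq_zero_of_hcomp 𝒱 fun e => ?_
    have := hW.isHom.hcomp_comm (e + 1) w
    rw [add_neg_cancel_right] at this
    rw [g0comp, this, g3, map_zero]
  obtain ⟨h, hh, hdh⟩ := exists_splitting hW
  have k2 : ∀ w, dW w = 0 → ∃ u, F (g0 w) - w = dW u := by
    intro w hw
    refine ⟨h (F (g0 w) - w), ?_⟩
    rw [← sub_eq_zero]
    refine eq_zero_of_hcomp 𝒲 fun e => ?_
    have hF0 : ∀ v, hcomp 𝒲 e (F v) = F (hcomp 𝒱 e v) := fun v => by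
      have := hF.hcomp_comm e v
      rwa [add_zero] at this
    have hh0 : ∀ v, hcomp 𝒲 e (dW (h v)) = dW (h (hcomp 𝒲 e v)) := fun v => by
      have h0 : IsHom 𝒲 𝒲 0 (dW ∘ₗ h) := hW.isHom.comp hh
      have := h0.hcomp_comm e v
      rwa [add_zero] at this
    obtain ⟨u, hu⟩ := g2 _ (cyc w hw e)
    have e1 : hcomp 𝒲 e (F (g0 w) - w) = dW (hcomp 𝒲 (e + 1) u) := by
      have := hW.isHom.hcomp_comm (e + 1) u
      rw [add_neg_cancel_right] at this
      rw [map_sub, hF0, g0comp, ← hF0, ← this, ← hu, map_sub, hcomp_of_mem 𝒲 (hcomp_mem 𝒲 e w)]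
    rw [map_sub, hh0, e1, hdh, sub_self]
  have hG : ∀ w, ∃ u, F (g0 (w - h (dW w))) = w - h (dW w) + dW u := by
    intro w
    obtain ⟨u, hu⟩ := k2 (w - h (dW w)) (by simp [hdh])
    exact ⟨u, by rw [← hu]; abel⟩
  let G := g0 ∘ₗ (LinearMap.id - h ∘ₗ dW)
  have hGa : ∀ w, G w = g0 (w - h (dW w)) := fun w => rfl
  have hGz : ∀ w, dW w = 0 → G w = g0 w := fun w hw => by rw [hGa, hw]; simp
  have hdG : ∀ w, dV (G w) = 0 := fun w => k1 _ (by simp [hdh])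
  have hGd : ∀ w, G (dW w) = 0 := fun w => by rw [hGz _ (hW.sq_zero w), k3]
  have hGhom : IsHom 𝒲 𝒱 0 G := by
    have h1 : IsHom 𝒲 𝒲 0 (h ∘ₗ dW) := hh.comp hW.isHom
    exact hg0.comp (isHom_id.sub h1)
  have hFG0 : IsHom 𝒲 𝒲 0 (F ∘ₗ G) := hF.comp hGhom
  have hGF0 : IsHom 𝒱 𝒱 0 (G ∘ₗ F) := hGhom.comp hF
  obtain ⟨k, hk, hk'⟩ := exists_nullhomotopy hV (K := LinearMap.id - G ∘ₗ F)
    (isHom_id.sub hGF0) (fun v => by simp [← hFd, hGd, hdG]) (fun v hv => by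
      refine inj _ (by simp [hv, hdG]) ?_
      obtain ⟨u, hu⟩ := k2 (F v) (by rw [hFd, hv, map_zero])
      refine ⟨-u, ?_⟩
      rw [map_neg, ← hu]
      simp [hGz (F v) (by rw [hFd, hv, map_zero])])
  obtain ⟨l, hl, hl'⟩ := exists_nullhomotopy hW (K := LinearMap.id - F ∘ₗ G)
    (isHom_id.sub hFG0) (fun v => by simp [hGd, hFd, hdG]) (fun v hv => by
      obtain ⟨u, hu⟩ := k2 v hv
      refine ⟨-u, ?_⟩
      rw [map_neg, ← hu]
      simp [hGz v hv])
  refine ⟨G, k, l, hGhom, hk, hl, fun w => by rw [hGd, hdG], fun w => ?_, hk', hl'⟩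
  obtain ⟨u, hu⟩ := hG w
  conv_lhs => rw [hGa w, hu]
  rw [map_add, hGd, add_zero, hGz _ (by simp [hdh]), hGa]

end Homotopy

section Solve

variable {𝕜 : Type*} [Field 𝕜] [CharZero 𝕜] {A : Type*} [AddCommGroup A] [Module 𝕜 A]
  {B : Type*} [AddCommGroup B] [Module 𝕜 B] {W : Type*} [AddCommGroup W] [Module 𝕜 W]

/-- The product of the operators `1 - N / q` for `q = 1, …, n`. -/
noncomputable def killProd (N : A →ₗ[𝕜] A) : ℕ → A →ₗ[𝕜] A
  | 0 => LinearMap.id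
  | n + 1 => (LinearMap.id - ((n + 1 : ℕ) : 𝕜)⁻¹ • N) ∘ₗ killProd N n

omit [CharZero 𝕜] in
theorem killProd_succ_apply (N : A →ₗ[𝕜] A) (n : ℕ) (a : A) :
    killProd N (n + 1) a = killProd N n a - ((n + 1 : ℕ) : 𝕜)⁻¹ • N (killProd N n a) := rfl

/-- A complex with a contracting homotopy `H` of the operator `N`, a subcomplex `s` on which the
identities hold, and a class `P` of cochains. -/
structure IsContraction (s : Submodule 𝕜 A) (P : ℤ → Submodule 𝕜 (A →ₗ[𝕜] W))
    (d H N : A →ₗ[𝕜] A) : Prop where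
  d_mem : ∀ a ∈ s, d a ∈ s
  H_mem : ∀ a ∈ s, H a ∈ s
  d_d : ∀ a ∈ s, d (d a) = 0
  eq : ∀ a ∈ s, N a = d (H a) + H (d a)
  comp_H : ∀ p, ∀ f ∈ P p, f ∘ₗ H ∈ P (p + 1)
  comp_N : ∀ p, ∀ f ∈ P p, f ∘ₗ N ∈ P p

omit [CharZero 𝕜] in
theorem IsContraction.exists_homotopy {s : Submodule 𝕜 A} {P : ℤ → Submodule 𝕜 (A →ₗ[𝕜] W)}
    {d H N : A →ₗ[𝕜] A} (h : IsContraction s P d H N) (dW : W →ₗ[𝕜] W) {r : 𝕜} (hr : r * r = 1)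
    {p : ℤ} (n : ℕ) {f : A →ₗ[𝕜] W} (hf : f ∈ P p) (hfd : ∀ a ∈ s, dW (f a) = r • f (d a)) :
    ∃ X ∈ P (p + 1), ∀ a ∈ s, f a - f (killProd N n a) = dW (X a) + r • X (d a) := by
  have hN : ∀ a ∈ s, N a ∈ s := fun a ha => by
    rw [h.eq a ha]; exact add_mem (h.d_mem _ (h.H_mem a ha)) (h.H_mem _ (h.d_mem a ha))
  induction n generalizing f with
  | zero => exact ⟨0, zero_mem _, fun a _ => by simp [killProd]⟩
  | succ n ih =>
    set q : 𝕜 := ((n + 1 : ℕ) : 𝕜)⁻¹ with hq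
    have hNd : ∀ a ∈ s, N (d a) = d (N a) := fun a ha => by
      rw [h.eq a ha, h.eq _ (h.d_mem a ha), h.d_d a ha, map_add, h.d_d _ (h.H_mem a ha)]
      simp
    obtain ⟨X, hX, hXe⟩ := ih (f := f - q • (f ∘ₗ N))
      (sub_mem hf (Submodule.smul_mem _ _ (h.comp_N p f hf))) (fun a ha => by
        simp only [LinearMap.sub_apply, LinearMap.smul_apply, LinearMap.comp_apply, map_sub,
          map_smul, hfd a ha, hfd _ (hN a ha), hNd a ha, smul_sub, smul_comm q r])
    refine ⟨X + (q * r) • (f ∘ₗ H), add_mem hX (Submodule.smul_mem _ _ (h.comp_H p f hf)),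
      fun a ha => ?_⟩
    have e1 := hXe a ha
    have e2 : f (killProd N (n + 1) a) = (f - q • (f ∘ₗ N)) (killProd N n a) := by
      rw [killProd_succ_apply]; simp [hq]
    have e3 : f (N a) = r • dW (f (H a)) + f (H (d a)) := by
      rw [h.eq a ha, map_add, hfd _ (h.H_mem a ha), smul_smul, hr, one_smul]
    rw [e2]
    have e4 : (f - q • (f ∘ₗ N)) a = f a - q • f (N a) := rfl
    rw [e4, e3, smul_add, smul_smul] at e1
    simp only [LinearMap.add_apply, LinearMap.smul_apply, LinearMap.comp_apply, map_add, map_smul,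
      smul_add, smul_smul]
    rw [show r * (q * r) = q by rw [mul_left_comm, hr, mul_one]]
    have e5 : f a = f a - ((q * r) • dW (f (H a)) + q • f (H (d a))) +
      ((q * r) • dW (f (H a)) + q • f (H (d a))) := by abel
    rw [e5, add_sub_right_comm, e1]
    abel

omit [CharZero 𝕜] in
theorem exists_extension {s : Submodule 𝕜 A} {P : ℤ → Submodule 𝕜 (A →ₗ[𝕜] W)}
    {d H N : A →ₗ[𝕜] A} (h : IsContraction s P d H N)
    {s' : Submodule 𝕜 B} {P' : ℤ → Submodule 𝕜 (B →ₗ[𝕜] W)}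
    {d' H' N' : B →ₗ[𝕜] B} (h' : IsContraction s' P' d' H' N') (dW : W →ₗ[𝕜] W)
    (Φ : B →ₗ[𝕜] A) (Γ : A →ₗ[𝕜] B) (hΦ : ∀ b ∈ s', Φ b ∈ s) (hΓ : ∀ a ∈ s, Γ a ∈ s')
    (hΦd : ∀ b ∈ s', Φ (d' b) = d (Φ b)) (hΓd : ∀ a ∈ s, Γ (d a) = d' (Γ a))
    (hPΦ : ∀ p, ∀ f ∈ P p, f ∘ₗ Φ ∈ P' p) (hPΓ : ∀ p, ∀ f ∈ P' p, f ∘ₗ Γ ∈ P p) (n : ℕ)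
    (hn : ∀ a ∈ s, killProd N n a = Φ (Γ a)) (hn' : ∀ b ∈ s', killProd N' n b = Γ (Φ b))
    {e : A →ₗ[𝕜] W} {R : B →ₗ[𝕜] W} (he : e ∈ P (-2)) (hR : R ∈ P' (-1))
    (hed : ∀ a ∈ s, dW (e a) = e (d a)) (hRd : ∀ b ∈ s', dW (R b) = e (Φ b) - R (d' b)) :
    ∃ c ∈ P (-1), ∃ f ∈ P' 0, (∀ a ∈ s, dW (c a) + c (d a) + e a = 0) ∧
      ∀ b ∈ s', R b + c (Φ b) + dW (f b) - f (d' b) = 0 := by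
  obtain ⟨X, hX, hXe⟩ := h.exists_homotopy dW (r := 1) (by simp) n he (by simpa using hed)
  simp only [one_smul] at hXe
  have hc : ∀ a ∈ s, dW ((-(R ∘ₗ Γ + X)) a) + (-(R ∘ₗ Γ + X)) (d a) + e a = 0 := by
    intro a ha
    have e1 := hXe a ha
    have e2 := hRd _ (hΓ a ha)
    rw [hn a ha] at e1
    simp only [LinearMap.neg_apply, LinearMap.add_apply, LinearMap.comp_apply, map_neg, map_add,
      hΓd a ha, e2]
    have e3 : e a = dW (X a) + X (d a) + e (Φ (Γ a)) := by rw [← e1]; abel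
    rw [e3]; abel
  have hcP : -(R ∘ₗ Γ + X) ∈ P (-1) := neg_mem (add_mem (hPΓ _ R hR) (by simpa using hX))
  generalize -(R ∘ₗ Γ + X) = c at hc hcP
  have hY : ∀ b ∈ s', dW ((R + c ∘ₗ Φ) b) = (-1 : 𝕜) • (R + c ∘ₗ Φ) (d' b) := by
    intro b hb
    have e1 := hc _ (hΦ b hb)
    have e2 := hRd b hb
    simp only [LinearMap.add_apply, LinearMap.comp_apply, map_add, hΦd b hb, neg_smul, one_smul]
    have e3 : dW (c (Φ b)) = -(c (d (Φ b))) - e (Φ b) := by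
      rw [← sub_eq_zero, ← e1]; abel
    rw [e2, e3]; abel
  have hYP : R + c ∘ₗ Φ ∈ P' (-1) := add_mem hR (hPΦ _ c hcP)
  obtain ⟨Z, hZ, hZe⟩ := h'.exists_homotopy dW (r := -1) (by simp) n hYP hY
  refine ⟨c - (R + c ∘ₗ Φ) ∘ₗ Γ, sub_mem hcP (hPΓ _ _ hYP), -Z, neg_mem (by simpa using hZ),
    fun a ha => ?_, fun b hb => ?_⟩
  · have e1 := hc a ha
    have e2 := hY _ (hΓ a ha)
    rw [LinearMap.sub_apply, LinearMap.sub_apply, map_sub, LinearMap.comp_apply,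
      LinearMap.comp_apply, hΓd a ha, e2, neg_smul, one_smul, ← e1]
    abel
  · have e1 := hZe b hb
    rw [hn' b hb] at e1
    rw [LinearMap.sub_apply, LinearMap.comp_apply (R + c ∘ₗ Φ) Γ, LinearMap.neg_apply,
      LinearMap.neg_apply, map_neg]
    have e2 : R b + (c (Φ b) - (R + c ∘ₗ Φ) (Γ (Φ b))) =
      (R + c ∘ₗ Φ) b - (R + c ∘ₗ Φ) (Γ (Φ b)) := by
      simp only [LinearMap.add_apply, LinearMap.comp_apply]; abel
    rw [e2, e1, neg_smul, one_smul]; abel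

variable {V : Type*} [AddCommGroup V] [Module 𝕜 V]

theorem killProd_eq_tmap {P Q : V →ₗ[𝕜] V} (hPQ : ∀ x, P x + Q x = x) (hP : ∀ x, P (P x) = P x)
    {n : ℕ} {t : Tens 𝕜 V} (ht : t ∈ lenSub 𝕜 V n) :
    killProd (cod LinearMap.id (P ∘ₗ proj1)) n t = tmap Q t := by
  set N := cod LinearMap.id (P ∘ₗ proj1) with hN
  have hNx : ∀ x w, N (ι 𝕜 x * w) = ι 𝕜 (P x) * w + ι 𝕜 x * N w := fun x w =>
    cod_linear_ι_mul LinearMap.id P x w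
  have hPQ0 : ∀ x, P (Q x) = 0 := fun x => by
    have := congrArg P (hPQ x)
    rw [map_add, hP] at this
    simpa using this
  have hNQ : ∀ w, N (tmap Q w) = 0 := by
    intro w
    induction w using tens_induction with
    | one => simp [hN]
    | zero => simp
    | add a b ha hb => simp [ha, hb]
    | smul r a ha => simp [ha]
    | mul x w hw => rw [map_mul, tmap_ι, hNx, hw, hPQ0]; simp
  have hQ : ∀ m x w, killProd N m (ι 𝕜 (Q x) * w) = ι 𝕜 (Q x) * killProd N m w := by
    intro m x w
    induction m with
    | zero => rfl
    | succ m ih =>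
      rw [killProd_succ_apply, killProd_succ_apply, ih, hNx, hPQ0, mul_sub]; simp
  have hPm : ∀ m x w, killProd N (m + 1) (ι 𝕜 (P x) * w) =
      -((m + 1 : ℕ) : 𝕜)⁻¹ • (ι 𝕜 (P x) * N (killProd N m w)) := by
    intro m x w
    induction m with
    | zero => rw [killProd_succ_apply]; simp [killProd, hNx, hP]
    | succ m ih =>
      have h1 : ((m + 1 : ℕ) : 𝕜) ≠ 0 := Nat.cast_ne_zero.2 (by simp)
      have h2 : ((m + 1 + 1 : ℕ) : 𝕜) ≠ 0 := Nat.cast_ne_zero.2 (by simp)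
      rw [killProd_succ_apply N (m + 1), ih, killProd_succ_apply N m, map_smul, hNx, hP, map_sub,
        map_smul, mul_sub, mul_smul_comm]
      set u := ι 𝕜 (P x) * N (killProd N m w)
      set v := ι 𝕜 (P x) * N (N (killProd N m w))
      simp only [smul_add, smul_sub, smul_smul, ← sub_sub, ← sub_smul]
      congr 2
      · field_simp
        push_cast; ring
      · field_simp
  induction n generalizing t with
  | zero =>
    obtain ⟨r, rfl⟩ := mem_lenSub_zero.1 ht
    simp [killProd]
  | succ n ih =>
    refine lenSub_succ_le (Q := LinearMap.eqLocus (killProd N (n + 1)) (tmap Q).toLinearMap)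
      (fun x w hw => ?_) ht
    rw [LinearMap.mem_eqLocus, AlgHom.toLinearMap_apply]
    conv_lhs => rw [← hPQ x, map_add, add_mul, map_add, hPm, hQ, killProd_succ_apply, ih hw, hNQ]
    simp

end Solve

section Degree

variable {𝕜 : Type*} [Field 𝕜] {V : Type*} [AddCommGroup V] [Module 𝕜 V]
  {W : Type*} [AddCommGroup W] [Module 𝕜 W]
  {U : Type*} [AddCommGroup U] [Module 𝕜 U]

/-- `(-1)^p` as an element of the ground field. -/
def sgn (𝕜 : Type*) [Field 𝕜] (p : ℤ) : 𝕜 := ((Int.negOnePow p : ℤ) : 𝕜)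

theorem sgn_add (p q : ℤ) : sgn 𝕜 (p + q) = sgn 𝕜 p * sgn 𝕜 q := by
  simp [sgn, Int.negOnePow_add]

theorem sgn_mul_self (p : ℤ) : sgn 𝕜 p * sgn 𝕜 p = 1 := negOnePow_cast_mul_self p

@[simp] theorem sgn_zero : sgn 𝕜 0 = 1 := by simp [sgn]

theorem sgn_even {p : ℤ} (hp : Even p) : sgn 𝕜 p = 1 := by simp [sgn, Int.negOnePow_even p hp]

theorem sgn_odd {p : ℤ} (hp : Odd p) : sgn 𝕜 p = -1 := by simp [sgn, Int.negOnePow_odd p hp]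

theorem units_smul_eq_sgn (p : ℤ) (v : V) : p.negOnePow • v = sgn 𝕜 p • v := by
  rcases Int.even_or_odd p with h | h
  · rw [Int.negOnePow_even p h, sgn_even h, one_smul, one_smul]
  · rw [Int.negOnePow_odd p h, sgn_odd h, neg_smul, one_smul, Units.neg_smul, one_smul]

/-- A linear map has degree `p` with respect to degree operators `δ`, `δ'` and parity operators
`β`, `β'`. -/
structure IsDeg (δ β : V →ₗ[𝕜] V) (δ' β' : W →ₗ[𝕜] W) (p : ℤ) (g : V →ₗ[𝕜] W) : Prop where
  deg : δ' ∘ₗ g - g ∘ₗ δ = (p : 𝕜) • g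
  par : g ∘ₗ β = sgn 𝕜 p • (β' ∘ₗ g)

variable {δ β : V →ₗ[𝕜] V} {δ' β' : W →ₗ[𝕜] W} {δ'' β'' : U →ₗ[𝕜] U}

theorem IsDeg.deg_apply {p : ℤ} {g : V →ₗ[𝕜] W} (hg : IsDeg δ β δ' β' p g) (v : V) :
    δ' (g v) = g (δ v) + (p : 𝕜) • g v := by
  have := LinearMap.congr_fun hg.deg v
  simp only [LinearMap.sub_apply, LinearMap.comp_apply, LinearMap.smul_apply] at this
  rw [← this]; abel

theorem IsDeg.par_apply {p : ℤ} {g : V →ₗ[𝕜] W} (hg : IsDeg δ β δ' β' p g) (v : V) :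
    g (β v) = sgn 𝕜 p • β' (g v) := LinearMap.congr_fun hg.par v

theorem IsDeg.par_odd {p : ℤ} {g : V →ₗ[𝕜] W} (hg : IsDeg δ β δ' β' p g) (hp : Odd p) :
    g ∘ₗ β = -(β' ∘ₗ g) := by rw [hg.par, sgn_odd hp, neg_smul, one_smul]

theorem IsDeg.par_even {g : V →ₗ[𝕜] W} (hg : IsDeg δ β δ' β' 0 g) :
    g ∘ₗ β = β' ∘ₗ g := by rw [hg.par, sgn_zero, one_smul]

theorem IsDeg.comp {p q : ℤ} {f : W →ₗ[𝕜] U} {g : V →ₗ[𝕜] W} (hf : IsDeg δ' β' δ'' β'' q f)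
    (hg : IsDeg δ β δ' β' p g) : IsDeg δ β δ'' β'' (p + q) (f ∘ₗ g) where
  deg := by
    ext v
    simp only [LinearMap.sub_apply, LinearMap.comp_apply, LinearMap.smul_apply, hf.deg_apply,
      hg.deg_apply, map_add, map_smul, Int.cast_add, add_smul, LinearMap.add_apply]
    abel
  par := by
    ext v
    simp only [LinearMap.comp_apply, LinearMap.smul_apply, hf.par_apply, hg.par_apply, map_smul,
      smul_smul, sgn_add]

theorem IsDeg.add {p : ℤ} {f g : V →ₗ[𝕜] W} (hf : IsDeg δ β δ' β' p f)
    (hg : IsDeg δ β δ' β' p g) : IsDeg δ β δ' β' p (f + g) where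
  deg := by rw [LinearMap.comp_add, LinearMap.add_comp, smul_add, ← hf.deg, ← hg.deg]; abel
  par := by rw [LinearMap.comp_add, LinearMap.add_comp, smul_add, ← hf.par, ← hg.par]

theorem IsDeg.smul {p : ℤ} {f : V →ₗ[𝕜] W} (hf : IsDeg δ β δ' β' p f) (r : 𝕜) :
    IsDeg δ β δ' β' p (r • f) where
  deg := by rw [LinearMap.comp_smul, LinearMap.smul_comp, smul_comm, ← hf.deg, smul_sub]
  par := by rw [LinearMap.comp_smul, LinearMap.smul_comp, smul_comm, ← hf.par]

theorem IsDeg.neg {p : ℤ} {f : V →ₗ[𝕜] W} (hf : IsDeg δ β δ' β' p f) :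
    IsDeg δ β δ' β' p (-f) := by simpa using hf.smul (-1)

theorem IsDeg.sub {p : ℤ} {f g : V →ₗ[𝕜] W} (hf : IsDeg δ β δ' β' p f)
    (hg : IsDeg δ β δ' β' p g) : IsDeg δ β δ' β' p (f - g) := by
  rw [sub_eq_add_neg]; exact hf.add hg.neg

theorem isDeg_zero (p : ℤ) : IsDeg δ β δ' β' p 0 := ⟨by simp, by simp⟩

theorem IsHom.isDeg {𝒱 : ℤ → Submodule 𝕜 V} [DirectSum.Decomposition 𝒱]
    {𝒲 : ℤ → Submodule 𝕜 W} [DirectSum.Decomposition 𝒲] {p : ℤ} {g : V →ₗ[𝕜] W}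
    (hg : IsHom 𝒱 𝒲 p g) : IsDeg (dgr 𝒱) (par 𝒱) (dgr 𝒲) (par 𝒲) p g :=
  ⟨hg.dgr_comp, hg.comp_par⟩

/-- The derivation of the tensor algebra that extends `δ`. -/
noncomputable abbrev der (δ : V →ₗ[𝕜] V) : Tens 𝕜 V →ₗ[𝕜] Tens 𝕜 V :=
  cod LinearMap.id (δ ∘ₗ proj1)

/-- A linear map from the tensor algebra has degree `p`. -/
abbrev IsTDeg (δ β : V →ₗ[𝕜] V) (δ' β' : W →ₗ[𝕜] W) (p : ℤ) (g : Tens 𝕜 V →ₗ[𝕜] W) : Prop :=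
  IsDeg (der δ) (tmap β).toLinearMap δ' β' p g

/-- A linear map between tensor algebras has degree `p`. -/
abbrev IsTTDeg (δ β : V →ₗ[𝕜] V) (δ' β' : W →ₗ[𝕜] W) (p : ℤ) (g : Tens 𝕜 V →ₗ[𝕜] Tens 𝕜 W) : Prop :=
  IsDeg (der δ) (tmap β).toLinearMap (der δ') (tmap β').toLinearMap p g

theorem isTDeg_proj1 : IsTDeg δ β δ β 0 proj1 where
  deg := by rw [proj1_comp_cod]; simp
  par := by rw [proj1_comp_tmap]; simp

theorem IsTDeg.cod_odd (hδβ : δ ∘ₗ β = β ∘ₗ δ) {p : ℤ} (hp : Odd p) {b : Tens 𝕜 V →ₗ[𝕜] V}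
    (hb : IsTDeg δ β δ β p b) : IsTTDeg δ β δ β p (cod β b) where
  deg := by rw [cod_comm hδβ.symm, hb.deg, cod_smul]
  par := by
    rw [tmap_comp_cod (θ' := β) (b' := -b) rfl, sgn_odd hp, ← neg_one_smul 𝕜 b, cod_smul,
      LinearMap.smul_comp, smul_smul]
    · simp
    · rw [LinearMap.neg_comp, hb.par_odd hp, neg_neg]

theorem IsTDeg.cod_even (hδβ : δ ∘ₗ β = β ∘ₗ δ) {b : Tens 𝕜 V →ₗ[𝕜] V}
    (hb : IsTDeg δ β δ β 0 b) : IsTTDeg δ β δ β 0 (cod LinearMap.id b) where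
  deg := by rw [cod_comm (by simp), hb.deg, cod_smul]
  par := by
    rw [tmap_comp_cod (θ' := LinearMap.id) (b' := b) (by simp), sgn_zero, one_smul]
    rw [hb.par_even]

theorem IsTDeg.coext {f : Tens 𝕜 V →ₗ[𝕜] W} (hf : IsTDeg δ β δ' β' 0 f) (hf1 : f 1 = 0)
    {φ : Tens 𝕜 V →ₗ[𝕜] Tens 𝕜 W} (hφ : φ = cunit _ + conv (ι 𝕜 ∘ₗ f) φ) :
    IsTTDeg δ β δ' β' 0 φ where
  deg := by
    have h1 := cod_coext_sub (β := LinearMap.id) (β' := LinearMap.id) (b := δ ∘ₗ proj1)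
      (c := δ' ∘ₗ proj1) hf1 (by ext w; simp [tmap_id]) hφ
    have h2 := hf.deg
    rw [Int.cast_zero, zero_smul] at h2
    rw [LinearMap.comp_assoc, proj1_comp_coext hφ, h2, LinearMap.comp_zero, zero_conv, zero_add,
      LinearMap.id_comp] at h1
    rw [Int.cast_zero, zero_smul]
    exact eq_zero_of_eq_conv (by simp [hf1]) h1
  par := by
    rw [sgn_zero, one_smul]
    refine conv_solution_unique (Y := cunit _) (g := ι 𝕜 ∘ₗ f ∘ₗ (tmap β).toLinearMap)
      (by simp [hf1]) ?_ ?_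
    · conv_lhs => rw [hφ, LinearMap.add_comp, (isCoalgMap_tmap β).conv_comp]
      congr 1
      ext w
      simp [cunit, eps_tmap]
    · conv_lhs => rw [hφ, LinearMap.comp_add, algHom_comp_conv, algHom_comp_cunit]
      rw [hf.par_even]
      congr 2
      ext w; simp

theorem proj_of_mem {n : ℕ} {t : Tens 𝕜 V} (ht : t ∈ lenSub 𝕜 V n) :
    GradedAlgebra.proj (lenSub 𝕜 V) n t = t := by
  rw [GradedAlgebra.proj_apply, DirectSum.decompose_of_mem_same _ ht]

theorem proj_of_mem_ne {k n : ℕ} (h : k ≠ n) {t : Tens 𝕜 V} (ht : t ∈ lenSub 𝕜 V k) :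
    GradedAlgebra.proj (lenSub 𝕜 V) n t = 0 := by
  rw [GradedAlgebra.proj_apply, DirectSum.decompose_of_mem_ne _ ht h]

theorem len_induction {p : Tens 𝕜 V → Prop} (zero : p 0) (add : ∀ v w, p v → p w → p (v + w))
    (mem : ∀ k, ∀ v ∈ lenSub 𝕜 V k, p v) (v : Tens 𝕜 V) : p v :=
  DirectSum.Decomposition.inductionOn (lenSub 𝕜 V) zero (fun m => mem _ _ m.2)
    (fun v w => add v w) v

theorem len_ext {N : Type*} [AddCommGroup N] [Module 𝕜 N] {f g : Tens 𝕜 V →ₗ[𝕜] N}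
    (h : ∀ k, ∀ t ∈ lenSub 𝕜 V k, f t = g t) : f = g := by
  ext v
  induction v using len_induction with
  | zero => simp
  | add v w hv hw => simp [hv, hw]
  | mem e v hv => exact h e v hv

theorem proj_comp_eq {g : Tens 𝕜 V →ₗ[𝕜] Tens 𝕜 W}
    (hg : ∀ k, ∀ t ∈ lenSub 𝕜 V k, g t ∈ lenSub 𝕜 W k) (n : ℕ) :
    GradedAlgebra.proj (lenSub 𝕜 W) n ∘ₗ g = g ∘ₗ GradedAlgebra.proj (lenSub 𝕜 V) n := by
  refine len_ext fun k t ht => ?_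
  simp only [LinearMap.comp_apply]
  by_cases h : k = n
  · subst h; rw [proj_of_mem ht, proj_of_mem (hg _ _ ht)]
  · rw [proj_of_mem_ne h ht, proj_of_mem_ne h (hg _ _ ht), map_zero]

theorem isTTDeg_proj (n : ℕ) :
    IsTTDeg δ β δ β 0 (GradedAlgebra.proj (lenSub 𝕜 V) n) where
  deg := by
    rw [proj_comp_eq fun k t ht => cod_linear_mem _ _ ht]; simp
  par := by
    rw [proj_comp_eq (g := (tmap β).toLinearMap) fun k t ht => tmap_mem _ ht]; simp

theorem isTTDeg_tmap {g : V →ₗ[𝕜] W} (hg : IsDeg δ β δ' β' 0 g) :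
    IsTTDeg δ β δ' β' 0 (tmap g).toLinearMap :=
  IsTDeg.coext (f := g ∘ₗ proj1) (by simpa using hg.comp isTDeg_proj1) (by simp) (tmap_eq_conv g)

end Degree

section Step

variable {𝕜 : Type*} [Field 𝕜] {V : Type*} [AddCommGroup V] [Module 𝕜 V]
  {W : Type*} [AddCommGroup W] [Module 𝕜 W]

/-- A subcoalgebra `S` on which structure equations are imposed, and a space `I` on which
operations are required to vanish. -/
structure IsAdmissible (β : V →ₗ[𝕜] V) (S : ℕ → Submodule 𝕜 (Tens 𝕜 V))
    (I : Submodule 𝕜 (Tens 𝕜 V)) : Prop extends IsStable β S where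
  proj_mem : ∀ n, ∀ t ∈ I, GradedAlgebra.proj (lenSub 𝕜 V) n t ∈ I
  proj1_eq_zero : ∀ t ∈ I, proj1 t = 0
  cod_mem_of : ∀ b : Tens 𝕜 V →ₗ[𝕜] V, b ∘ₗ (tmap β).toLinearMap = -(β ∘ₗ b) → b 1 = 0 →
    (∀ t ∈ I, b t = 0) → ∀ t ∈ I, cod β b t ∈ I
  cod_linear_mem_of : ∀ g : V →ₗ[𝕜] V, g ∘ₗ β = β ∘ₗ g → ∀ t ∈ I, cod LinearMap.id (g ∘ₗ proj1) t ∈ I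

/-- Compatibility of admissible pairs of subspaces with coalgebra maps. -/
structure IsAdmissibleMap (β : V →ₗ[𝕜] V) (β' : W →ₗ[𝕜] W) (S : ℕ → Submodule 𝕜 (Tens 𝕜 V))
    (S' : ℕ → Submodule 𝕜 (Tens 𝕜 W)) (I : Submodule 𝕜 (Tens 𝕜 V))
    (I' : Submodule 𝕜 (Tens 𝕜 W)) : Prop where
  compatible : IsCompatible β β' S S'
  mem_of : ∀ (f : Tens 𝕜 V →ₗ[𝕜] W) (φ : Tens 𝕜 V →ₗ[𝕜] Tens 𝕜 W), f 1 = 0 →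
    f ∘ₗ (tmap β).toLinearMap = β' ∘ₗ f → φ = cunit _ + conv (ι 𝕜 ∘ₗ f) φ →
    (∀ t ∈ I, f t = 0) → ∀ t ∈ I, φ t ∈ I'

/-- The cochains of arity `n` and degree `p` that vanish on `I`. -/
def cochains (δ β : V →ₗ[𝕜] V) (δ' β' : W →ₗ[𝕜] W) (I : Submodule 𝕜 (Tens 𝕜 V)) (n : ℕ) (p : ℤ) :
    Submodule 𝕜 (Tens 𝕜 V →ₗ[𝕜] W) where
  carrier := {g | IsTDeg δ β δ' β' p g ∧ (∀ k ≠ n, ∀ t ∈ lenSub 𝕜 V k, g t = 0) ∧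
    ∀ t ∈ I, g t = 0}
  add_mem' := fun {f g} hf hg => ⟨hf.1.add hg.1,
    fun k hk t ht => by rw [LinearMap.add_apply, hf.2.1 k hk t ht, hg.2.1 k hk t ht, add_zero],
    fun t ht => by rw [LinearMap.add_apply, hf.2.2 t ht, hg.2.2 t ht, add_zero]⟩
  zero_mem' := ⟨isDeg_zero p, by simp, by simp⟩
  smul_mem' := fun r f hf => ⟨hf.1.smul r,
    fun k hk t ht => by rw [LinearMap.smul_apply, hf.2.1 k hk t ht, smul_zero],
    fun t ht => by rw [LinearMap.smul_apply, hf.2.2 t ht, smul_zero]⟩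

theorem comp_mem_cochains {U : Type*} [AddCommGroup U] [Module 𝕜 U] {δ β : V →ₗ[𝕜] V}
    {δ' β' : W →ₗ[𝕜] W} {δ'' β'' : U →ₗ[𝕜] U} {I : Submodule 𝕜 (Tens 𝕜 V)}
    {I' : Submodule 𝕜 (Tens 𝕜 W)} {n : ℕ} {p q r : ℤ} {f : Tens 𝕜 W →ₗ[𝕜] U}
    (hf : f ∈ cochains δ' β' δ'' β'' I' n p) {g : Tens 𝕜 V →ₗ[𝕜] Tens 𝕜 W}
    (hg : IsTTDeg δ β δ' β' q g) (hgl : ∀ k, ∀ t ∈ lenSub 𝕜 V k, g t ∈ lenSub 𝕜 W k)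
    (hgI : ∀ t ∈ I, g t ∈ I') (hr : q + p = r) : f ∘ₗ g ∈ cochains δ β δ'' β'' I n r :=
  ⟨hr ▸ hf.1.comp hg, fun k hk t ht => hf.2.1 k hk _ (hgl k t ht), fun t ht => hf.2.2 _ (hgI t ht)⟩

theorem comp_proj_mem_cochains {δ β : V →ₗ[𝕜] V}
    {δ' β' : W →ₗ[𝕜] W} {I : Submodule 𝕜 (Tens 𝕜 V)}
    (hI : ∀ n, ∀ t ∈ I, GradedAlgebra.proj (lenSub 𝕜 V) n t ∈ I) {n : ℕ} {p : ℤ}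
    {f : Tens 𝕜 V →ₗ[𝕜] W} (hf : IsTDeg δ β δ' β' p f) (hfI : ∀ t ∈ I, f t = 0) :
    f ∘ₗ GradedAlgebra.proj (lenSub 𝕜 V) n ∈ cochains δ β δ' β' I n p :=
  ⟨by simpa using hf.comp (isTTDeg_proj n), fun k hk t ht => by
    rw [LinearMap.comp_apply, proj_of_mem_ne hk ht, map_zero], fun t ht => hfI _ (hI n t ht)⟩

theorem cod_linear_sq {β d : V →ₗ[𝕜] V} (hβ : β ∘ₗ β = LinearMap.id) (hd : d ∘ₗ β = -(β ∘ₗ d))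
    (hdd : ∀ v, d (d v) = 0) (t : Tens 𝕜 V) :
    cod β (d ∘ₗ proj1) (cod β (d ∘ₗ proj1) t) = 0 := by
  have h := cod_sq_eq hβ (b := d ∘ₗ proj1) (by
    rw [comp_proj1_comp_tmap, hd, LinearMap.neg_comp, LinearMap.comp_assoc])
  have h0 : d ∘ₗ d ∘ₗ proj1 = (0 : Tens 𝕜 V →ₗ[𝕜] V) := LinearMap.ext fun t => hdd _
  rw [LinearMap.comp_assoc, proj1_comp_cod, h0, LinearMap.comp_zero, zero_conv, zero_add] at h
  exact LinearMap.congr_fun (eq_zero_of_eq_conv (by simp) h) t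

theorem cod_linear_homotopy {β d h : V →ₗ[𝕜] V} (hβ : β ∘ₗ β = LinearMap.id)
    (hd : d ∘ₗ β = -(β ∘ₗ d)) (hh : h ∘ₗ β = -(β ∘ₗ h)) {P : V →ₗ[𝕜] V} (hP : P = d ∘ₗ h + h ∘ₗ d)
    (t : Tens 𝕜 V) : cod LinearMap.id (P ∘ₗ proj1) t =
      cod β (d ∘ₗ proj1) (cod β (h ∘ₗ proj1) t) + cod β (h ∘ₗ proj1) (cod β (d ∘ₗ proj1) t) := by
  have h := cod_anticomm hβ (b := d ∘ₗ proj1) (b' := h ∘ₗ proj1)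
    (by rw [comp_proj1_comp_tmap, hd, LinearMap.neg_comp, LinearMap.comp_assoc])
    (by rw [comp_proj1_comp_tmap, hh, LinearMap.neg_comp, LinearMap.comp_assoc])
  rw [LinearMap.comp_assoc, proj1_comp_cod, LinearMap.comp_assoc, proj1_comp_cod,
    ← LinearMap.comp_assoc, ← LinearMap.comp_assoc, ← LinearMap.add_comp, ← hP] at h
  rw [← h]; rfl

theorem isContraction_cod {U : Type*} [AddCommGroup U] [Module 𝕜 U]
    {𝒱 : ℤ → Submodule 𝕜 V} [DirectSum.Decomposition 𝒱]
    {δ' β' : U →ₗ[𝕜] U}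
    {S : ℕ → Submodule 𝕜 (Tens 𝕜 V)} {I : Submodule 𝕜 (Tens 𝕜 V)}
    (hS : IsAdmissible (par 𝒱) S I) {d h P : V →ₗ[𝕜] V} (hd : IsDifferential 𝒱 d)
    (hh : IsHom 𝒱 𝒱 1 h) (hP : P = d ∘ₗ h + h ∘ₗ d) (n : ℕ) :
    IsContraction (S n) (cochains (dgr 𝒱) (par 𝒱) δ' β' I n) (cod (par 𝒱) (d ∘ₗ proj1))
      (cod (par 𝒱) (h ∘ₗ proj1)) (cod LinearMap.id (P ∘ₗ proj1)) := by
  have hd' := hd.isHom.comp_par_odd (by decide)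
  have hh' := hh.comp_par_odd (by decide)
  have hP0 : IsHom 𝒱 𝒱 0 P := by
    have h1 : IsHom 𝒱 𝒱 0 (d ∘ₗ h) := hd.isHom.comp hh
    have h2 : IsHom 𝒱 𝒱 0 (h ∘ₗ d) := hh.comp hd.isHom
    rw [hP]; exact h1.add h2
  refine ⟨fun t ht => hS.toIsStable.cod_linear_mem hd' ht, fun t ht => hS.toIsStable.cod_linear_mem hh' ht,
    fun t _ => cod_linear_sq (par_par 𝒱) hd' hd.sq_zero t,
    fun t _ => cod_linear_homotopy (par_par 𝒱) hd' hh' hP t, fun p f hf => ?_, fun p f hf => ?_⟩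
  · refine comp_mem_cochains hf (q := 1) (IsTDeg.cod_odd (dgr_par 𝒱) (by decide) ?_)
      (fun k t ht => cod_linear_mem _ _ ht) (hS.cod_mem_of _ ?_ (by simp)
        fun t ht => by simp [hS.proj1_eq_zero t ht]) (add_comm _ _)
    · simpa using hh.isDeg.comp isTDeg_proj1
    · rw [comp_proj1_comp_tmap, hh', LinearMap.neg_comp, LinearMap.comp_assoc]
  · refine comp_mem_cochains hf (q := 0) (IsTDeg.cod_even (dgr_par 𝒱) ?_)
      (fun k t ht => cod_linear_mem _ _ ht) (hS.cod_linear_mem_of _ hP0.comp_par_even) (zero_add _)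
    simpa using hP0.isDeg.comp isTDeg_proj1

theorem cod_eq_ι_of_mem {θ : V →ₗ[𝕜] V} {b : Tens 𝕜 V →ₗ[𝕜] V} {n : ℕ}
    (hb : ∀ k < n, ∀ t ∈ lenSub 𝕜 V k, b t = 0) {k : ℕ} (hk : k ≤ n) {t : Tens 𝕜 V}
    (ht : t ∈ lenSub 𝕜 V k) : cod θ b t = ι 𝕜 (b t) :=
  isSubcoalg_lenSub.eq_ι_of_conv_eq (cod_eq θ b) rfl (by simp) hb hk ht

theorem cod_sub_linear_mem_flt (θ : V →ₗ[𝕜] V) {b : Tens 𝕜 V →ₗ[𝕜] V} (hb1 : b 1 = 0) {n : ℕ}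
    {t : Tens 𝕜 V} (ht : t ∈ lenSub 𝕜 V n) :
    cod θ b t - cod θ ((b ∘ₗ ι 𝕜) ∘ₗ proj1) t ∈ flt (lenSub 𝕜 V) n := by
  rw [← LinearMap.sub_apply, ← cod_sub]
  refine cod_mem_flt θ (fun k hk t ht => ?_) ht
  match k with
  | 0 => obtain ⟨r, rfl⟩ := mem_lenSub_zero.1 ht; simp [hb1]
  | 1 => simp [ι_proj1_of_mem ht]

variable [CharZero 𝕜]

theorem exists_arity_extension {𝒱 : ℤ → Submodule 𝕜 V} [DirectSum.Decomposition 𝒱]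
    {𝒲 : ℤ → Submodule 𝕜 W} [DirectSum.Decomposition 𝒲]
    {S : ℕ → Submodule 𝕜 (Tens 𝕜 V)} {I : Submodule 𝕜 (Tens 𝕜 V)}
    {S' : ℕ → Submodule 𝕜 (Tens 𝕜 W)} {I' : Submodule 𝕜 (Tens 𝕜 W)}
    (hS : IsAdmissible (par 𝒱) S I) (hS' : IsAdmissible (par 𝒲) S' I')
    (hSS : IsAdmissibleMap (par 𝒱) (par 𝒲) S S' I I')
    (hSS' : IsAdmissibleMap (par 𝒲) (par 𝒱) S' S I' I)
    {b : Tens 𝕜 V →ₗ[𝕜] V} {c : Tens 𝕜 W →ₗ[𝕜] W} {f : Tens 𝕜 V →ₗ[𝕜] W}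
    (hb : IsTDeg (dgr 𝒱) (par 𝒱) (dgr 𝒱) (par 𝒱) (-1) b) (hb1 : b 1 = 0) (hbI : ∀ t ∈ I, b t = 0)
    (hc : IsTDeg (dgr 𝒲) (par 𝒲) (dgr 𝒲) (par 𝒲) (-1) c) (hc1 : c 1 = 0) (hcI : ∀ t ∈ I', c t = 0)
    (hf : IsTDeg (dgr 𝒱) (par 𝒱) (dgr 𝒲) (par 𝒲) 0 f) (hf1 : f 1 = 0) (hfI : ∀ t ∈ I, f t = 0)
    {dV : V →ₗ[𝕜] V} {dW : W →ₗ[𝕜] W} {F : V →ₗ[𝕜] W} (hV : IsDifferential 𝒱 dV)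
    (hW : IsDifferential 𝒲 dW) (hF : IsHom 𝒱 𝒲 0 F) (hq : IsQuasiIso dV dW F)
    (hbι : b ∘ₗ ι 𝕜 = dV) (hcι : c ∘ₗ ι 𝕜 = dW) (hfι : f ∘ₗ ι 𝕜 = F)
    (hbb : ∀ k, ∀ t ∈ S k, b (cod (par 𝒱) b t) = 0) {n : ℕ} (hn : 2 ≤ n)
    (hcc : ∀ k < n, ∀ t ∈ S' k, c (cod (par 𝒲) c t) = 0)
    {φ : Tens 𝕜 V →ₗ[𝕜] Tens 𝕜 W} (hφ : φ = cunit _ + conv (ι 𝕜 ∘ₗ f) φ)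
    (hr : ∀ k < n, ∀ t ∈ S k, c (φ t) - f (cod (par 𝒱) b t) = 0) :
    ∃ c' ∈ cochains (dgr 𝒲) (par 𝒲) (dgr 𝒲) (par 𝒲) I' n (-1),
      ∃ f' ∈ cochains (dgr 𝒱) (par 𝒱) (dgr 𝒲) (par 𝒲) I n 0,
      (∀ t ∈ S' n, (c + c') (cod (par 𝒲) (c + c') t) = 0) ∧
      ∀ φ' : Tens 𝕜 V →ₗ[𝕜] Tens 𝕜 W, φ' = cunit _ + conv (ι 𝕜 ∘ₗ (f + f')) φ' →
        ∀ t ∈ S n, (c + c') (φ' t) - (f + f') (cod (par 𝒱) b t) = 0 := by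
  obtain ⟨G, k, k', hG, hk, hk', hGd, hGFG, hGF, hFG⟩ := hq.exists_inverse hV hW hF
  have hFd : ∀ v, dW (F v) = F (dV v) := hq.choose
  have hbp := hb.par_odd (by decide)
  have hcp := hc.par_odd (by decide)
  have hcD := hc.cod_odd (dgr_par 𝒲) (by decide)
  have hbD := hb.cod_odd (dgr_par 𝒱) (by decide)
  have hcz : (c ∘ₗ cod (par 𝒲) c) ∘ₗ GradedAlgebra.proj (lenSub 𝕜 W) n ∈
      cochains (dgr 𝒲) (par 𝒲) (dgr 𝒲) (par 𝒲) I' n (-2) :=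
    comp_proj_mem_cochains hS'.proj_mem (hc.comp hcD)
      fun t ht => hcI _ (hS'.cod_mem_of c hcp hc1 hcI t ht)
  have hRz : (c ∘ₗ φ - f ∘ₗ cod (par 𝒱) b) ∘ₗ GradedAlgebra.proj (lenSub 𝕜 V) n ∈
      cochains (dgr 𝒱) (par 𝒱) (dgr 𝒲) (par 𝒲) I n (-1) := by
    refine comp_proj_mem_cochains hS.proj_mem ?_ fun t ht => ?_
    · have h1 := hc.comp (hf.coext hf1 hφ)
      have h2 := hf.comp hbD
      simp only [zero_add, add_zero] at h1 h2
      exact h1.sub h2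
    · rw [LinearMap.sub_apply, LinearMap.comp_apply, LinearMap.comp_apply,
        hcI _ (hSS.mem_of f φ hf1 hf.par_even hφ hfI t ht),
        hfI _ (hS.cod_mem_of b hbp hb1 hbI t ht), sub_zero]
  have hΦd : ∀ t, tmap F (cod (par 𝒱) (dV ∘ₗ proj1) t) = cod (par 𝒲) (dW ∘ₗ proj1) (tmap F t) :=
    LinearMap.congr_fun (tmap_comp_cod hF.comp_par_even (by
      refine LinearMap.ext fun t => ?_; simp [proj1_tmap, hFd]))
  have hΓd : ∀ t, tmap G (cod (par 𝒲) (dW ∘ₗ proj1) t) = cod (par 𝒱) (dV ∘ₗ proj1) (tmap G t) :=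
    LinearMap.congr_fun (tmap_comp_cod hG.comp_par_even (by
      refine LinearMap.ext fun t => ?_; simp [proj1_tmap, hGd]))
  have tmapI : ∀ t ∈ I, tmap F t ∈ I' := hSS.mem_of (F ∘ₗ proj1) _ (by simp)
    (by rw [comp_proj1_comp_tmap, hF.comp_par_even]; rfl) (tmap_eq_conv F)
    fun t ht => by simp [hS.proj1_eq_zero t ht]
  have tmapI' : ∀ t ∈ I', tmap G t ∈ I := hSS'.mem_of (G ∘ₗ proj1) _ (by simp)
    (by rw [comp_proj1_comp_tmap, hG.comp_par_even]; rfl) (tmap_eq_conv G)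
    fun t ht => by simp [hS'.proj1_eq_zero t ht]
  obtain ⟨c', hc', f', hf', hcc', hff'⟩ := exists_extension
    (isContraction_cod hS' hW hk' hFG n) (isContraction_cod hS hV hk hGF n)
    dW (tmap F).toLinearMap (tmap G).toLinearMap
    (fun t ht => hSS.compatible.tmap_mem hS.toIsStable hS'.toIsStable hF.comp_par_even ht)
    (fun t ht => hSS'.compatible.tmap_mem hS'.toIsStable hS.toIsStable hG.comp_par_even ht)
    (fun t _ => hΦd t) (fun t _ => hΓd t)
    (fun p g hg => comp_mem_cochains hg (isTTDeg_tmap hF.isDeg) (fun _ t ht => tmap_mem F ht)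
      tmapI (zero_add _))
    (fun p g hg => comp_mem_cochains hg (isTTDeg_tmap hG.isDeg) (fun _ t ht => tmap_mem G ht)
      tmapI' (zero_add _)) n
    (fun t ht => by
      rw [killProd_eq_tmap (Q := F ∘ₗ G) (fun x => by simp) (fun x => by simp [hGFG])
        (hS'.le n ht), AlgHom.toLinearMap_apply, AlgHom.toLinearMap_apply, tmap_tmap])
    (fun t ht => by
      rw [killProd_eq_tmap (Q := G ∘ₗ F) (fun x => by simp) (fun x => by simp [hGFG])
        (hS.le n ht), AlgHom.toLinearMap_apply, AlgHom.toLinearMap_apply, tmap_tmap])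
    hcz hRz
    (fun t ht => by
      have h1 := obstruction_cycle hS'.toIsStable (par_par 𝒲) hcp hc1 hcc ht
      simp only [LinearMap.comp_apply]
      rw [proj_of_mem (hS'.le n ht), proj_of_mem (cod_linear_mem _ _ (hS'.le n ht)), ← hcι]
      exact h1)
    (fun t ht => by
      have h1 := obstruction_morphism hS.toIsStable hS'.toIsStable hSS.compatible (par_par 𝒱)
        hbp hb1 hbb hcc hf1 hf.par_even hφ hr ht
      simp only [LinearMap.comp_apply, LinearMap.sub_apply, AlgHom.toLinearMap_apply]
      rw [proj_of_mem (hS.le n ht), proj_of_mem (cod_linear_mem _ _ (hS.le n ht)),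
        proj_of_mem (tmap_mem _ (hS.le n ht)), ← hcι, ← hbι, ← hfι]
      exact h1)
  have cflt : ∀ t ∈ flt (lenSub 𝕜 W) n, c' t = 0 := fun t ht =>
    eq_zero_of_mem_flt (fun k hk => hc'.2.1 k hk.ne) ht
  have fflt : ∀ t ∈ flt (lenSub 𝕜 V) n, f' t = 0 := fun t ht =>
    eq_zero_of_mem_flt (fun k hk => hf'.2.1 k hk.ne) ht
  refine ⟨c', hc', f', hf', fun t ht => ?_, fun φ' hφ' t ht => ?_⟩
  · have ht' := hS'.le n ht
    have h1 := hcc' t ht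
    simp only [LinearMap.comp_apply] at h1
    rw [proj_of_mem ht', ← hcι, LinearMap.comp_apply] at h1
    have h2 := cflt _ (cod_sub_linear_mem_flt (par 𝒲) hc1 ht')
    rw [map_sub, sub_eq_zero] at h2
    rw [cod_add, LinearMap.add_apply, LinearMap.add_apply, map_add, map_add,
      cod_eq_ι_of_mem (fun k hk => hc'.2.1 k hk.ne) le_rfl ht', h2,
      hc'.2.1 1 (by lia) _ (ι_mem_lenSub _), add_zero, ← h1]
    abel
  · have ht' := hS.le n ht
    have h1 := hff' t ht
    simp only [LinearMap.comp_apply, LinearMap.sub_apply, AlgHom.toLinearMap_apply] at h1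
    rw [proj_of_mem ht', ← hcι, ← hbι, ← hfι, LinearMap.comp_apply] at h1
    have h2 : φ' t - φ t = ι 𝕜 (f' t) :=
      isSubcoalg_lenSub.eq_ι_of_conv_eq (X := φ' - φ) (g := f) (h := φ') (by
        conv_lhs => rw [hφ, hφ']
        rw [LinearMap.comp_add, add_conv, conv_sub]; abel)
        (by rw [hφ']; simp [hf1, hf'.2.1 0 (by lia) 1 one_mem_lenSub]) hf1
        (fun k hk => hf'.2.1 k hk.ne) le_rfl ht'
    rw [sub_eq_iff_eq_add] at h2
    have h3 := cflt _ (coext_sub_tmap_mem hf1 hφ ht')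
    rw [map_sub, sub_eq_zero] at h3
    have h4 := fflt _ (cod_sub_linear_mem_flt (par 𝒱) hb1 ht')
    rw [map_sub, sub_eq_zero] at h4
    rw [LinearMap.add_apply, LinearMap.add_apply, h4, h2, map_add, map_add, h3,
      hc'.2.1 1 (by lia) _ (ι_mem_lenSub _), zero_add, ← h1]
    abel

end Step

section Shuffle

variable {𝕜 : Type*} [Field 𝕜] {V : Type*} [AddCommGroup V] [Module 𝕜 V]
  {W : Type*} [AddCommGroup W] [Module 𝕜 W] {A : Type*} [Ring A] [Algebra 𝕜 A]

/-- The even part of a vector. -/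
noncomputable def evenPart (β : V →ₗ[𝕜] V) : V →ₗ[𝕜] V := (2 : 𝕜)⁻¹ • (LinearMap.id + β)

/-- The odd part of a vector. -/
noncomputable def oddPart (β : V →ₗ[𝕜] V) : V →ₗ[𝕜] V := (2 : 𝕜)⁻¹ • (LinearMap.id - β)

theorem evenPart_apply (β : V →ₗ[𝕜] V) (v : V) : evenPart β v = (2 : 𝕜)⁻¹ • (v + β v) := rfl

theorem oddPart_apply (β : V →ₗ[𝕜] V) (v : V) : oddPart β v = (2 : 𝕜)⁻¹ • (v - β v) := rfl

theorem evenPart_add_oddPart [CharZero 𝕜] (β : V →ₗ[𝕜] V) (v : V) :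
    evenPart β v + oddPart β v = v := by
  rw [evenPart_apply, oddPart_apply, ← smul_add, add_add_sub_cancel, ← two_smul 𝕜 v, smul_smul,
    inv_mul_cancel₀ two_ne_zero, one_smul]

theorem evenPart_comp {β : V →ₗ[𝕜] V} {β' : W →ₗ[𝕜] W} {g : V →ₗ[𝕜] W} (hg : g ∘ₗ β = β' ∘ₗ g)
    (v : V) : evenPart β' (g v) = g (evenPart β v) := by
  have := LinearMap.congr_fun hg v
  simp only [LinearMap.comp_apply] at this
  simp only [evenPart_apply, map_smul, map_add, this]

theorem oddPart_comp {β : V →ₗ[𝕜] V} {β' : W →ₗ[𝕜] W} {g : V →ₗ[𝕜] W} (hg : g ∘ₗ β = β' ∘ₗ g)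
    (v : V) : oddPart β' (g v) = g (oddPart β v) := by
  have := LinearMap.congr_fun hg v
  simp only [LinearMap.comp_apply] at this
  simp only [oddPart_apply, map_smul, map_sub, this]

theorem evenPart_comp_odd {β : V →ₗ[𝕜] V} {β' : W →ₗ[𝕜] W} {g : V →ₗ[𝕜] W}
    (hg : g ∘ₗ β = -(β' ∘ₗ g)) (v : V) : evenPart β' (g v) = g (oddPart β v) := by
  have := LinearMap.congr_fun hg v
  simp only [LinearMap.comp_apply, LinearMap.neg_apply] at this
  simp only [oddPart_apply, evenPart_apply, map_smul, map_sub, this, sub_neg_eq_add]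

theorem oddPart_comp_odd {β : V →ₗ[𝕜] V} {β' : W →ₗ[𝕜] W} {g : V →ₗ[𝕜] W}
    (hg : g ∘ₗ β = -(β' ∘ₗ g)) (v : V) : oddPart β' (g v) = g (evenPart β v) := by
  have := LinearMap.congr_fun hg v
  simp only [LinearMap.comp_apply, LinearMap.neg_apply] at this
  simp only [oddPart_apply, evenPart_apply, map_smul, map_add, this, sub_eq_add_neg]

theorem apply_evenPart {β : V →ₗ[𝕜] V} (hβ : β ∘ₗ β = LinearMap.id) (v : V) :
    β (evenPart β v) = evenPart β v := by
  have : β (β v) = v := LinearMap.congr_fun hβ v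
  rw [evenPart_apply, map_smul, map_add, this, add_comm]

theorem apply_oddPart {β : V →ₗ[𝕜] V} (hβ : β ∘ₗ β = LinearMap.id) (v : V) :
    β (oddPart β v) = -oddPart β v := by
  have : β (β v) = v := LinearMap.congr_fun hβ v
  rw [oddPart_apply, map_smul, map_sub, this, ← smul_neg, neg_sub]

theorem evenPart_of_even [CharZero 𝕜] {β : V →ₗ[𝕜] V} {v : V} (h : β v = v) : evenPart β v = v := by
  rw [evenPart_apply, h, ← two_smul 𝕜 v, smul_smul, inv_mul_cancel₀ two_ne_zero, one_smul]

theorem oddPart_of_even {β : V →ₗ[𝕜] V} {v : V} (h : β v = v) : oddPart β v = 0 := by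
  rw [oddPart_apply, h, sub_self, smul_zero]

theorem oddPart_of_odd [CharZero 𝕜] {β : V →ₗ[𝕜] V} {v : V} (h : β v = -v) : oddPart β v = v := by
  rw [oddPart_apply, h, sub_neg_eq_add, ← two_smul 𝕜 v, smul_smul, inv_mul_cancel₀ two_ne_zero,
    one_smul]

theorem evenPart_of_odd {β : V →ₗ[𝕜] V} {v : V} (h : β v = -v) : evenPart β v = 0 := by
  rw [evenPart_apply, h, add_neg_cancel, smul_zero]

theorem tmap_par_par {β : V →ₗ[𝕜] V} (hβ : β ∘ₗ β = LinearMap.id) :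
    (tmap β).toLinearMap ∘ₗ (tmap β).toLinearMap = LinearMap.id := by
  ext t; simp [tmap_tmap, hβ, tmap_id]

theorem evenPart_ι_mul [CharZero 𝕜] {β : V →ₗ[𝕜] V} (hβ : β ∘ₗ β = LinearMap.id) (y : V)
    (w : Tens 𝕜 V) : evenPart (tmap β).toLinearMap (ι 𝕜 y * w) =
      ι 𝕜 (evenPart β y) * evenPart (tmap β).toLinearMap w +
        ι 𝕜 (oddPart β y) * oddPart (tmap β).toLinearMap w := by
  conv_lhs => rw [← evenPart_add_oddPart β y]
  rw [map_add, add_mul, map_add]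
  simp only [evenPart_apply (tmap β).toLinearMap, oddPart_apply (tmap β).toLinearMap,
    AlgHom.toLinearMap_apply, map_mul, tmap_ι, apply_evenPart hβ, apply_oddPart hβ, map_neg,
    mul_smul_comm, mul_add, mul_neg, neg_mul, sub_eq_add_neg]

theorem oddPart_ι_mul [CharZero 𝕜] {β : V →ₗ[𝕜] V} (hβ : β ∘ₗ β = LinearMap.id) (y : V)
    (w : Tens 𝕜 V) : oddPart (tmap β).toLinearMap (ι 𝕜 y * w) =
      ι 𝕜 (evenPart β y) * oddPart (tmap β).toLinearMap w +
        ι 𝕜 (oddPart β y) * evenPart (tmap β).toLinearMap w := by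
  conv_lhs => rw [← evenPart_add_oddPart β y]
  rw [map_add, add_mul, map_add]
  simp only [evenPart_apply (tmap β).toLinearMap, oddPart_apply (tmap β).toLinearMap,
    AlgHom.toLinearMap_apply, map_mul, tmap_ι, apply_evenPart hβ, apply_oddPart hβ, map_neg,
    mul_smul_comm, mul_add, mul_sub, neg_mul, sub_neg_eq_add]

/-- `R ↦ Y ∘ R ∘ Q`. -/
def sandwich {M N P Q : Type*} [AddCommGroup M] [Module 𝕜 M] [AddCommGroup N] [Module 𝕜 N]
    [AddCommGroup P] [Module 𝕜 P] [AddCommGroup Q] [Module 𝕜 Q] (y : P →ₗ[𝕜] Q) (z : M →ₗ[𝕜] N) :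
    (N →ₗ[𝕜] P) →ₗ[𝕜] (M →ₗ[𝕜] Q) where
  toFun r := y ∘ₗ r ∘ₗ z
  map_add' r s := by ext; simp
  map_smul' a r := by ext; simp

@[simp] theorem sandwich_apply {M N P Q : Type*} [AddCommGroup M] [Module 𝕜 M] [AddCommGroup N]
    [Module 𝕜 N] [AddCommGroup P] [Module 𝕜 P] [AddCommGroup Q] [Module 𝕜 Q] (y : P →ₗ[𝕜] Q)
    (z : M →ₗ[𝕜] N) (r : N →ₗ[𝕜] P) : sandwich y z r = y ∘ₗ r ∘ₗ z := rfl

/-- Multiplication by a letter on the left, with the Koszul sign that results from moving the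
letter past the argument. -/
noncomputable def twist (β : V →ₗ[𝕜] V) (β' : W →ₗ[𝕜] W) :
    W →ₗ[𝕜] (Tens 𝕜 V →ₗ[𝕜] Tens 𝕜 W) →ₗ[𝕜] (Tens 𝕜 V →ₗ[𝕜] Tens 𝕜 W) :=
  LinearMap.mk₂ 𝕜 (fun y R => LinearMap.mulLeft 𝕜 (ι 𝕜 (evenPart β' y)) ∘ₗ R +
    LinearMap.mulLeft 𝕜 (ι 𝕜 (oddPart β' y)) ∘ₗ R ∘ₗ (tmap β).toLinearMap)
    (by intro x y R; ext w; simp [add_mul]; abel)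
    (by intro r x R; ext w; simp)
    (by intro x R S; ext w; simp [mul_add]; abel)
    (by intro r x R; ext w; simp)

theorem twist_apply (β : V →ₗ[𝕜] V) (β' : W →ₗ[𝕜] W) (y : W) (R : Tens 𝕜 V →ₗ[𝕜] Tens 𝕜 W) :
    twist β β' y R = LinearMap.mulLeft 𝕜 (ι 𝕜 (evenPart β' y)) ∘ₗ R +
      LinearMap.mulLeft 𝕜 (ι 𝕜 (oddPart β' y)) ∘ₗ R ∘ₗ (tmap β).toLinearMap := rfl

theorem twist_even [CharZero 𝕜] {β : V →ₗ[𝕜] V} {β' : W →ₗ[𝕜] W} {y : W} (hy : β' y = y)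
    (R : Tens 𝕜 V →ₗ[𝕜] Tens 𝕜 W) : twist β β' y R = LinearMap.mulLeft 𝕜 (ι 𝕜 y) ∘ₗ R := by
  rw [twist_apply, evenPart_of_even hy, oddPart_of_even hy]; ext; simp

theorem twist_odd [CharZero 𝕜] {β : V →ₗ[𝕜] V} {β' : W →ₗ[𝕜] W} {y : W} (hy : β' y = -y)
    (R : Tens 𝕜 V →ₗ[𝕜] Tens 𝕜 W) : twist β β' y R =
      LinearMap.mulLeft 𝕜 (ι 𝕜 y) ∘ₗ R ∘ₗ (tmap β).toLinearMap := by
  rw [twist_apply, evenPart_of_odd hy, oddPart_of_odd hy]; ext; simp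

/-- The sum over the coproduct `v₁ ⊗ v₂` of the maps `twist (f v₁) (R v₂)`. -/
noncomputable def twistConv (β : V →ₗ[𝕜] V) (β' : W →ₗ[𝕜] W) (f : Tens 𝕜 V →ₗ[𝕜] W)
    (R : Tens 𝕜 V →ₗ[𝕜] Tens 𝕜 V →ₗ[𝕜] Tens 𝕜 W) : Tens 𝕜 V →ₗ[𝕜] Tens 𝕜 V →ₗ[𝕜] Tens 𝕜 W :=
  TensorProduct.lift ((twist β β').compl₁₂ f R) ∘ₗ deconc

theorem twistConv_apply (β : V →ₗ[𝕜] V) (β' : W →ₗ[𝕜] W) (f : Tens 𝕜 V →ₗ[𝕜] W)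
    (R : Tens 𝕜 V →ₗ[𝕜] Tens 𝕜 V →ₗ[𝕜] Tens 𝕜 W) (v : Tens 𝕜 V) : twistConv β β' f R v =
      TensorProduct.lift ((twist β β').compl₁₂ f R) (deconc v) := rfl

theorem twistConv_sub (β : V →ₗ[𝕜] V) (β' : W →ₗ[𝕜] W) (f : Tens 𝕜 V →ₗ[𝕜] W)
    (R S : Tens 𝕜 V →ₗ[𝕜] Tens 𝕜 V →ₗ[𝕜] Tens 𝕜 W) :
    twistConv β β' f (R - S) = twistConv β β' f R - twistConv β β' f S := by
  refine LinearMap.ext fun v => ?_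
  simp only [LinearMap.sub_apply, twistConv_apply]
  generalize deconc v = z
  induction z using TensorProduct.induction_on with
  | zero => simp
  | tmul a b => simp
  | add a b ha hb => simp only [map_add, ha, hb]; abel

theorem eq_zero_of_twistConv {β : V →ₗ[𝕜] V} {β' : W →ₗ[𝕜] W} {f g : Tens 𝕜 V →ₗ[𝕜] W}
    (hf : f 1 = 0) (hg : g 1 = 0) {X : Tens 𝕜 V →ₗ[𝕜] Tens 𝕜 V →ₗ[𝕜] Tens 𝕜 W}
    (hX : ∀ v, X v = conv (ι 𝕜 ∘ₗ g) (X v) + twistConv β β' f X v) : X = 0 := by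
  refine len_ext fun n => ?_
  induction n using Nat.strong_induction_on with
  | _ n ih =>
  intro v hv
  refine eq_zero_of_eq_conv (g := ι 𝕜 ∘ₗ g) (by simp [hg]) ?_
  conv_lhs => rw [hX v]
  rw [add_eq_left, twistConv_apply]
  refine isSubcoalg_lenSub.apply_deconc_eq_zero _ (fun i j hij a ha b hb => ?_) hv
  rw [TensorProduct.lift.tmul, LinearMap.compl₁₂_apply]
  by_cases hi : i = 0
  · subst hi
    obtain ⟨r, rfl⟩ := mem_lenSub_zero.1 ha
    simp [hf]
  · rw [ih j (by lia) b hb]; simp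

theorem exists_shuffleRight (β : V →ₗ[𝕜] V) : ∃ r : Tens 𝕜 V →ₗ[𝕜] Tens 𝕜 V →ₗ[𝕜] Tens 𝕜 V,
    r 1 = LinearMap.id ∧ ∀ y v, r (ι 𝕜 y * v) = conv LinearMap.id (twist β β y (r v)) :=
  exists_fold LinearMap.id (LinearMap.mk₂ 𝕜
    (fun y (z : Tens 𝕜 V × (Tens 𝕜 V →ₗ[𝕜] Tens 𝕜 V)) => conv LinearMap.id (twist β β y z.2))
    (by intro x y z; simp [conv_add]) (by intro r x z; simp [conv_smul])
    (by intro x y z; simp [conv_add]) (by intro r x z; simp [conv_smul]))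

/-- The right multiplication by `v` for the graded shuffle product: `shuffleRight β v u` is the
product of `u` and `v`. -/
noncomputable def shuffleRight (β : V →ₗ[𝕜] V) : Tens 𝕜 V →ₗ[𝕜] Tens 𝕜 V →ₗ[𝕜] Tens 𝕜 V :=
  (exists_shuffleRight β).choose

@[simp] theorem shuffleRight_one (β : V →ₗ[𝕜] V) : shuffleRight β 1 = LinearMap.id :=
  (exists_shuffleRight β).choose_spec.1

theorem shuffleRight_ι_mul (β : V →ₗ[𝕜] V) (y : V) (v : Tens 𝕜 V) :
    shuffleRight β (ι 𝕜 y * v) = conv LinearMap.id (twist β β y (shuffleRight β v)) :=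
  (exists_shuffleRight β).choose_spec.2 y v

theorem id_eq_conv : (LinearMap.id : Tens 𝕜 V →ₗ[𝕜] Tens 𝕜 V) =
    cunit _ + conv (ι 𝕜 ∘ₗ proj1) LinearMap.id := by
  have := tmap_eq_conv (LinearMap.id : V →ₗ[𝕜] V)
  rwa [tmap_id] at this

theorem lift_eps_left {N : Type*} [AddCommGroup N] [Module 𝕜 N] (R : Tens 𝕜 V →ₗ[𝕜] N)
    (v : Tens 𝕜 V) :
    TensorProduct.lift ((LinearMap.lsmul 𝕜 N).compl₁₂ eps.toLinearMap R) (deconc v) = R v := by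
  have h : ∀ w : Tens 𝕜 V ⊗[𝕜] Tens 𝕜 V, LinearMap.mul' 𝕜 _ (TensorProduct.map (cunit (Tens 𝕜 V)) LinearMap.id w) =
      TensorProduct.lift ((LinearMap.lsmul 𝕜 _).compl₁₂ eps.toLinearMap LinearMap.id) w := by
    intro w
    induction w using TensorProduct.induction_on with
    | zero => simp
    | tmul a b => simp [cunit, Algebra.smul_def]
    | add a b ha hb => simp only [map_add, ha, hb]
  have h1 := LinearMap.congr_fun (cunit_conv (LinearMap.id : Tens 𝕜 V →ₗ[𝕜] _)) v
  rw [conv_apply, h] at h1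
  conv_rhs => rw [← LinearMap.id_apply (R := 𝕜) v, ← h1]
  generalize deconc v = z
  induction z using TensorProduct.induction_on with
  | zero => simp
  | tmul a b => simp
  | add a b ha hb => simp only [map_add, ha, hb]

theorem shuffleRight_eq (β : V →ₗ[𝕜] V) (v : Tens 𝕜 V) : shuffleRight β v =
    eps v • cunit _ + conv (ι 𝕜 ∘ₗ proj1) (shuffleRight β v) +
      twistConv β β proj1 (shuffleRight β) v := by
  induction v using tens_induction with
  | one => rw [shuffleRight_one, twistConv_apply]; simpa using id_eq_conv
  | zero => simp
  | add a b ha hb => conv_lhs => rw [map_add, ha, hb]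
                     simp only [map_add, add_smul, conv_add]; abel
  | smul r a ha => conv_lhs => rw [map_smul, ha]
                   simp only [map_smul, smul_add, conv_smul, smul_smul, smul_eq_mul]
  | mul y w hw =>
    have h1 : twistConv β β proj1 (shuffleRight β) (ι 𝕜 y * w) =
        twist β β y (shuffleRight β w) := by
      rw [twistConv_apply, deconc_ι_mul, map_add]
      conv_rhs => rw [← lift_eps_left (shuffleRight β) w]
      have : TensorProduct.lift ((twist β β).compl₁₂ proj1 (shuffleRight β))
        (1 ⊗ₜ[𝕜] (ι 𝕜 y * w)) = 0 := by simp
      rw [this, zero_add]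
      generalize deconc w = z
      induction z using TensorProduct.induction_on with
      | zero => simp
      | tmul a b => simp [proj1_ι_mul]
      | add a b ha hb => simp only [mul_add, map_add, ha, hb]
    rw [h1, eps_ι_mul, zero_smul, zero_add, shuffleRight_ι_mul, ← conv_assoc]
    conv_lhs => rw [id_eq_conv, add_conv, cunit_conv, add_comm]

theorem eps_comp_shuffleRight (β : V →ₗ[𝕜] V) (v : Tens 𝕜 V) :
    (eps (𝕜 := 𝕜) (V := V)).toLinearMap ∘ₗ shuffleRight β v = eps v • eps.toLinearMap := by
  induction v using tens_induction with
  | one => simp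
  | zero => simp
  | add a b ha hb => rw [map_add, LinearMap.comp_add, ha, hb, map_add, add_smul]
  | smul r a ha => rw [map_smul, LinearMap.comp_smul, ha, map_smul, smul_eq_mul, smul_smul]
  | mul y w hw =>
    have : (eps (𝕜 := 𝕜) (V := V)).toLinearMap ∘ₗ twist β β y (shuffleRight β w) = 0 := by
      ext u; simp [twist_apply, eps_ι_mul]
    rw [shuffleRight_ι_mul, algHom_comp_conv, this, conv_zero, eps_ι_mul, zero_smul]

variable (𝕜 V A) in
/-- Convolution as a bilinear map. -/
noncomputable def convB : (Tens 𝕜 V →ₗ[𝕜] A) →ₗ[𝕜] (Tens 𝕜 V →ₗ[𝕜] A) →ₗ[𝕜] (Tens 𝕜 V →ₗ[𝕜] A) :=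
  LinearMap.mk₂ 𝕜 conv add_conv smul_conv conv_add conv_smul

@[simp] theorem convB_apply (f g : Tens 𝕜 V →ₗ[𝕜] A) : convB 𝕜 V A f g = conv f g := rfl

/-- The composition of a convolution product with a shuffle multiplication, in terms of the
coproduct of the multiplier. -/
noncomputable def shuffleConv (β : V →ₗ[𝕜] V) (f g : Tens 𝕜 V →ₗ[𝕜] A) :
    Tens 𝕜 V →ₗ[𝕜] Tens 𝕜 V →ₗ[𝕜] Tens 𝕜 V →ₗ[𝕜] A :=
  (convB 𝕜 V A).compl₁₂ (sandwich f LinearMap.id ∘ₗ shuffleRight β ∘ₗ evenPart (tmap β).toLinearMap)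
      (sandwich g LinearMap.id ∘ₗ shuffleRight β) +
    (convB 𝕜 V A).compl₁₂ (sandwich f LinearMap.id ∘ₗ shuffleRight β ∘ₗ oddPart (tmap β).toLinearMap)
      (sandwich g (tmap β).toLinearMap ∘ₗ shuffleRight β)

theorem shuffleConv_apply (β : V →ₗ[𝕜] V) (f g : Tens 𝕜 V →ₗ[𝕜] A) (a b : Tens 𝕜 V) :
    shuffleConv β f g a b =
      conv (f ∘ₗ shuffleRight β (evenPart (tmap β).toLinearMap a)) (g ∘ₗ shuffleRight β b) +
        conv (f ∘ₗ shuffleRight β (oddPart (tmap β).toLinearMap a))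
          (g ∘ₗ shuffleRight β b ∘ₗ (tmap β).toLinearMap) := rfl

theorem deconc_mul_ι_mul (a : Tens 𝕜 V) (y : V) (w : Tens 𝕜 V) : deconc (a * (ι 𝕜 y * w)) =
    deconc a * tinr (ι 𝕜 y * w) + tinl (a * ι 𝕜 y) * deconc w := by
  induction a using tens_induction with
  | one => rw [one_mul, deconc_one, deconc_ι_mul, one_mul]; simp [tinr, tinl]
  | zero => simp
  | add a b ha hb => simp only [add_mul, map_add, ha, hb]; abel
  | smul r a ha => simp only [smul_mul_assoc, map_smul, ha, smul_add]
  | mul x u hu =>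
    rw [mul_assoc, deconc_ι_mul, hu, deconc_ι_mul]
    simp only [tinl, tinr, mul_add, add_mul, Algebra.TensorProduct.includeLeft_apply,
      Algebra.TensorProduct.includeRight_apply, Algebra.TensorProduct.tmul_mul_tmul, one_mul,
      ← mul_assoc]
    abel

theorem deconc_comp_conv_ι_mul (f g : Tens 𝕜 V →ₗ[𝕜] Tens 𝕜 V) (y : V) :
    deconc ∘ₗ conv f (LinearMap.mulLeft 𝕜 (ι 𝕜 y) ∘ₗ g) =
      conv (deconc ∘ₗ f) (tinr.toLinearMap ∘ₗ LinearMap.mulLeft 𝕜 (ι 𝕜 y) ∘ₗ g) +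
        conv (tinl.toLinearMap ∘ₗ f) (LinearMap.mulLeft 𝕜 (tinl (ι 𝕜 y)) ∘ₗ deconc ∘ₗ g) := by
  ext w
  simp only [conv_apply, LinearMap.comp_apply, LinearMap.add_apply]
  generalize deconc w = z
  induction z using TensorProduct.induction_on with
  | zero => simp
  | tmul a b =>
    simp only [map_tmul, LinearMap.mul'_apply, LinearMap.comp_apply, LinearMap.mulLeft_apply,
      deconc_mul_ι_mul, AlgHom.toLinearMap_apply, map_mul, mul_assoc]
  | add a b ha hb => simp only [map_add, ha, hb]; abel

theorem tinl_comp_conv_mulLeft (f g : Tens 𝕜 V →ₗ[𝕜] Tens 𝕜 V) (y : V)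
    (h : Tens 𝕜 V →ₗ[𝕜] Tens 𝕜 V ⊗[𝕜] Tens 𝕜 V) :
    conv (tinl.toLinearMap ∘ₗ conv f (LinearMap.mulLeft 𝕜 (ι 𝕜 y) ∘ₗ g)) h =
      conv (tinl.toLinearMap ∘ₗ f)
        (LinearMap.mulLeft 𝕜 (tinl (ι 𝕜 y)) ∘ₗ conv (tinl.toLinearMap ∘ₗ g) h) := by
  have : tinl.toLinearMap ∘ₗ LinearMap.mulLeft 𝕜 (ι 𝕜 y) ∘ₗ g =
      LinearMap.mulLeft 𝕜 (tinl (ι 𝕜 y)) ∘ₗ tinl.toLinearMap ∘ₗ g := by ext; simp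
  rw [algHom_comp_conv, conv_assoc, this, mulLeft_conv]

variable [CharZero 𝕜] {β : V →ₗ[𝕜] V}

theorem one_shuffleRight (v : Tens 𝕜 V) : shuffleRight β v 1 = v := by
  induction v using tens_induction with
  | one => simp
  | zero => simp
  | add a b ha hb => rw [map_add, LinearMap.add_apply, ha, hb]
  | smul r a ha => rw [map_smul, LinearMap.smul_apply, ha]
  | mul y w hw =>
    rw [shuffleRight_ι_mul, conv_one, twist_apply]
    simp only [LinearMap.add_apply, LinearMap.comp_apply, LinearMap.mulLeft_apply, hw,
      LinearMap.id_apply, AlgHom.toLinearMap_apply, map_one, one_mul, ← add_mul, ← map_add,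
      evenPart_add_oddPart]

theorem shuffleRight_even_ι_mul {y : V} (hy : β y = y) (v : Tens 𝕜 V) :
    shuffleRight β (ι 𝕜 y * v) =
      conv LinearMap.id (LinearMap.mulLeft 𝕜 (ι 𝕜 y) ∘ₗ shuffleRight β v) := by
  rw [shuffleRight_ι_mul, twist_even hy]

theorem shuffleRight_odd_ι_mul {y : V} (hy : β y = -y) (v : Tens 𝕜 V) :
    shuffleRight β (ι 𝕜 y * v) = conv LinearMap.id
      (LinearMap.mulLeft 𝕜 (ι 𝕜 y) ∘ₗ shuffleRight β v ∘ₗ (tmap β).toLinearMap) := by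
  rw [shuffleRight_ι_mul, twist_odd hy]

/-- Induction on words of even and odd letters. -/
theorem parity_induction (hβ : β ∘ₗ β = LinearMap.id) {p : Tens 𝕜 V → Prop} (one : p 1) (zero : p 0)
    (add : ∀ a b, p a → p b → p (a + b)) (smul : ∀ (r : 𝕜) a, p a → p (r • a))
    (even : ∀ x w, β x = x → p w → p (ι 𝕜 x * w)) (odd : ∀ x w, β x = -x → p w → p (ι 𝕜 x * w))
    (w : Tens 𝕜 V) : p w := by
  induction w using tens_induction with
  | one => exact one
  | zero => exact zero
  | add a b ha hb => exact add a b ha hb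
  | smul r a ha => exact smul r a ha
  | mul x w hw =>
    rw [← evenPart_add_oddPart β x, map_add, add_mul]
    exact add _ _ (even _ _ (apply_evenPart hβ x) hw) (odd _ _ (apply_oddPart hβ x) hw)

theorem deconc_comp_shuffleRight (hβ : β ∘ₗ β = LinearMap.id) (v : Tens 𝕜 V) :
    deconc ∘ₗ shuffleRight β v =
      TensorProduct.lift (shuffleConv β tinl.toLinearMap tinr.toLinearMap) (deconc v) := by
  have B1 : evenPart (tmap β).toLinearMap (1 : Tens 𝕜 V) = 1 := evenPart_of_even (by simp)
  have B2 : oddPart (tmap β).toLinearMap (1 : Tens 𝕜 V) = 0 := oddPart_of_even (by simp)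
  have h1 : ∀ w : Tens 𝕜 V, shuffleConv β tinl.toLinearMap tinr.toLinearMap 1 w =
      conv tinl.toLinearMap (tinr.toLinearMap ∘ₗ shuffleRight β w) := by
    intro w
    rw [shuffleConv_apply, B1, B2]
    simp
  have h2 : ∀ g, conv deconc (tinr.toLinearMap ∘ₗ g) =
      conv tinl.toLinearMap (tinr.toLinearMap ∘ₗ conv (LinearMap.id : Tens 𝕜 V →ₗ[𝕜] _) g) := by
    intro g
    rw [deconc_eq_conv, conv_assoc, algHom_comp_conv, LinearMap.comp_id]
  have hBB := tmap_par_par (𝕜 := 𝕜) hβ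
  induction v using parity_induction hβ with
  | one => rw [deconc_one, TensorProduct.lift.tmul, h1]; simp [deconc_eq_conv]
  | zero => simp
  | add a b ha hb => rw [map_add, LinearMap.comp_add, ha, hb, map_add, map_add]
  | smul r a ha => rw [map_smul, LinearMap.comp_smul, ha, map_smul, map_smul]
  | even y w hy hw =>
    rw [deconc_ι_mul, map_add, TensorProduct.lift.tmul, h1, shuffleRight_even_ι_mul hy,
      deconc_comp_conv_ι_mul, LinearMap.comp_id, h2, hw, LinearMap.comp_id]
    congr 1
    generalize deconc w = z
    induction z using TensorProduct.induction_on with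
    | zero => simp
    | add a b ha hb => simp only [mul_add, map_add, LinearMap.comp_add, conv_add, ha, hb]
    | tmul a b =>
      rw [Algebra.TensorProduct.tmul_mul_tmul, one_mul, TensorProduct.lift.tmul,
        TensorProduct.lift.tmul, shuffleConv_apply, shuffleConv_apply, evenPart_ι_mul hβ,
        oddPart_ι_mul hβ, evenPart_of_even hy, oddPart_of_even hy]
      simp only [map_zero, zero_mul, add_zero]
      rw [shuffleRight_even_ι_mul hy, shuffleRight_even_ι_mul hy, tinl_comp_conv_mulLeft,
        tinl_comp_conv_mulLeft, LinearMap.comp_add, conv_add]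
      simp only [LinearMap.comp_id]
  | odd y w hy hw =>
    rw [deconc_ι_mul, map_add, TensorProduct.lift.tmul, h1, shuffleRight_odd_ι_mul hy,
      deconc_comp_conv_ι_mul, LinearMap.comp_id, h2, ← LinearMap.comp_assoc _ _ deconc, hw,
      LinearMap.comp_id]
    congr 1
    generalize deconc w = z
    induction z using TensorProduct.induction_on with
    | zero => simp
    | add a b ha hb =>
      simp only [mul_add, map_add, LinearMap.comp_add, LinearMap.add_comp, conv_add, ha, hb]
    | tmul a b =>
      rw [Algebra.TensorProduct.tmul_mul_tmul, one_mul, TensorProduct.lift.tmul,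
        TensorProduct.lift.tmul, shuffleConv_apply, shuffleConv_apply, evenPart_ι_mul hβ,
        oddPart_ι_mul hβ, evenPart_of_odd hy, oddPart_of_odd hy]
      simp only [map_zero, zero_mul, zero_add]
      rw [shuffleRight_odd_ι_mul hy, shuffleRight_odd_ι_mul hy, tinl_comp_conv_mulLeft,
        tinl_comp_conv_mulLeft, LinearMap.add_comp, LinearMap.comp_add, conv_add,
        (isCoalgMap_tmap β).conv_comp, (isCoalgMap_tmap β).conv_comp]
      simp only [LinearMap.comp_id, LinearMap.comp_assoc, hBB]
      rw [add_comm]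

theorem conv_comp_shuffleRight (hβ : β ∘ₗ β = LinearMap.id) (f g : Tens 𝕜 V →ₗ[𝕜] A)
    (v : Tens 𝕜 V) : conv f g ∘ₗ shuffleRight β v =
      TensorProduct.lift (shuffleConv β f g) (deconc v) := by
  have key : ∀ a b : Tens 𝕜 V →ₗ[𝕜] Tens 𝕜 V, LinearMap.mul' 𝕜 A ∘ₗ TensorProduct.map f g ∘ₗ
      conv (tinl.toLinearMap ∘ₗ a) (tinr.toLinearMap ∘ₗ b) = conv (f ∘ₗ a) (g ∘ₗ b) := by
    intro a b
    rw [← map_comp_deconc, ← LinearMap.comp_assoc _ _ (TensorProduct.map f g),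
      ← TensorProduct.map_comp]
    rfl
  have h : conv f g ∘ₗ shuffleRight β v = LinearMap.mul' 𝕜 A ∘ₗ TensorProduct.map f g ∘ₗ
      (deconc ∘ₗ shuffleRight β v) := rfl
  rw [h, deconc_comp_shuffleRight hβ]
  generalize deconc v = z
  induction z using TensorProduct.induction_on with
  | zero => simp
  | tmul a b =>
    rw [TensorProduct.lift.tmul, TensorProduct.lift.tmul, shuffleConv_apply, shuffleConv_apply,
      LinearMap.comp_add, LinearMap.comp_add, key, key]
  | add a b ha hb => simp only [map_add, LinearMap.comp_add, ha, hb]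

end Shuffle

section ShuffleIdeal

variable {𝕜 : Type*} [Field 𝕜] {V : Type*} [AddCommGroup V] [Module 𝕜 V]
  {W : Type*} [AddCommGroup W] [Module 𝕜 W] {N : Type*} [AddCommGroup N] [Module 𝕜 N]

/-- The span of the shuffle products of tensors of positive length. -/
def posShuffles (β : V →ₗ[𝕜] V) : Submodule 𝕜 (Tens 𝕜 V) :=
  Submodule.span 𝕜 {t | ∃ u v, eps u = 0 ∧ eps v = 0 ∧ t = shuffleRight β v u}

theorem shuffleRight_mem_posShuffles (β : V →ₗ[𝕜] V) {u v : Tens 𝕜 V} (hu : eps u = 0)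
    (hv : eps v = 0) : shuffleRight β v u ∈ posShuffles β :=
  Submodule.subset_span ⟨u, v, hu, hv, rfl⟩

theorem posShuffles_le {β : V →ₗ[𝕜] V} {Q : Submodule 𝕜 (Tens 𝕜 V)}
    (h : ∀ u v, eps u = 0 → eps v = 0 → shuffleRight β v u ∈ Q) : posShuffles β ≤ Q := by
  refine Submodule.span_le.2 ?_
  rintro _ ⟨u, v, hu, hv, rfl⟩
  exact h u v hu hv

variable [CharZero 𝕜] {β : V →ₗ[𝕜] V} {β' : W →ₗ[𝕜] W}

theorem apply_shuffleRight {h : Tens 𝕜 V →ₗ[𝕜] N} (h1 : h 1 = 0)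
    (hI : ∀ t ∈ posShuffles β, h t = 0) (u v : Tens 𝕜 V) :
    h (shuffleRight β v u) = eps v • h u + eps u • h v := by
  have e1 : h (shuffleRight β (v - eps v • 1) (u - eps u • 1)) = 0 :=
    hI _ (shuffleRight_mem_posShuffles β (by simp) (by simp))
  simp only [map_sub, map_smul, LinearMap.sub_apply, LinearMap.smul_apply, shuffleRight_one,
    LinearMap.id_apply, one_shuffleRight, h1, smul_zero, sub_zero] at e1
  have e2 : h (shuffleRight β v u) = (h (shuffleRight β v u) - eps v • h u - eps u • h v) +
    (eps v • h u + eps u • h v) := by abel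
  rw [e2]
  have e3 : h (shuffleRight β v u) - eps v • h u - eps u • h v = 0 := by rw [← e1]
  rw [e3, zero_add]

/-- `h` has a parity, and `θ` is the power of the parity operator that accounts for it. -/
def HasParity (β : V →ₗ[𝕜] V) (β' : W →ₗ[𝕜] W) (θ : V →ₗ[𝕜] V) (h : Tens 𝕜 V →ₗ[𝕜] W) : Prop :=
  (θ = LinearMap.id ∧ h ∘ₗ (tmap β).toLinearMap = β' ∘ₗ h) ∨
    (θ = β ∧ h ∘ₗ (tmap β).toLinearMap = -(β' ∘ₗ h))

theorem conv_comp_shuffleRight_of_parity (hβ : β ∘ₗ β = LinearMap.id) {h : Tens 𝕜 V →ₗ[𝕜] W}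
    (h1 : h 1 = 0) (hI : ∀ t ∈ posShuffles β, h t = 0) {θ : V →ₗ[𝕜] V}
    (hθ : HasParity β β' θ h) (Y : Tens 𝕜 V →ₗ[𝕜] Tens 𝕜 W) (v : Tens 𝕜 V) :
    conv (ι 𝕜 ∘ₗ h) Y ∘ₗ shuffleRight β v = conv (ι 𝕜 ∘ₗ h) (Y ∘ₗ shuffleRight β v) +
      twistConv β β' h (sandwich Y (tmap θ).toLinearMap ∘ₗ shuffleRight β) v := by
  have e1 := lift_eps_left (convB 𝕜 V _ (ι 𝕜 ∘ₗ h) ∘ₗ sandwich Y LinearMap.id ∘ₗ shuffleRight β) v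
  simp only [LinearMap.comp_apply, sandwich_apply, LinearMap.comp_id, convB_apply] at e1
  rw [conv_comp_shuffleRight hβ, ← e1, twistConv_apply]
  have e2 : ∀ w, (ι 𝕜 ∘ₗ h) ∘ₗ shuffleRight β w =
      eps w • (ι 𝕜 ∘ₗ h) + LinearMap.mulLeft 𝕜 (ι 𝕜 (h w)) ∘ₗ cunit _ := by
    intro w
    ext u
    simp [apply_shuffleRight h1 hI, cunit, Algebra.algebraMap_eq_smul_one]
  have e3 : ∀ w Z, conv ((ι 𝕜 ∘ₗ h) ∘ₗ shuffleRight β w) Z =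
      eps w • conv (ι 𝕜 ∘ₗ h) Z + LinearMap.mulLeft 𝕜 (ι 𝕜 (h w)) ∘ₗ Z := by
    intro w Z
    rw [e2, add_conv, smul_conv, mulLeft_conv, cunit_conv]
  have e4 : ∀ a : Tens 𝕜 V, eps (evenPart (tmap β).toLinearMap a) = eps a := by
    intro a
    rw [evenPart_apply, map_smul, map_add, AlgHom.toLinearMap_apply, eps_tmap, ← two_smul 𝕜,
      smul_smul, inv_mul_cancel₀ two_ne_zero, one_smul]
  have e5 : ∀ a : Tens 𝕜 V, eps (oddPart (tmap β).toLinearMap a) = 0 := by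
    intro a
    rw [oddPart_apply, map_smul, map_sub, AlgHom.toLinearMap_apply, eps_tmap, sub_self, smul_zero]
  generalize deconc v = z
  induction z using TensorProduct.induction_on with
  | zero => simp
  | add a b ha hb => simp only [map_add, ha, hb]; abel
  | tmul a b =>
    simp only [TensorProduct.lift.tmul, shuffleConv_apply, LinearMap.compl₁₂_apply, e3, e4, e5,
      zero_smul, zero_add, LinearMap.comp_apply, sandwich_apply, LinearMap.comp_id, convB_apply,
      AlgHom.toLinearMap_apply, LinearMap.lsmul_apply, twist_apply, add_assoc]
    congr 1
    rcases hθ with ⟨rfl, hθ⟩ | ⟨rfl, hθ⟩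
    · rw [evenPart_comp hθ, oddPart_comp hθ, tmap_id]; rfl
    · rw [evenPart_comp_odd hθ, oddPart_comp_odd hθ, add_comm]
      simp only [LinearMap.comp_assoc, tmap_par_par hβ, LinearMap.comp_id]

omit [CharZero 𝕜] in
theorem proj1_of_mem_posShuffles {t : Tens 𝕜 V} (ht : t ∈ posShuffles β) : proj1 t = 0 := by
  refine posShuffles_le (Q := LinearMap.ker proj1) (fun u v hu hv => ?_) ht
  rw [LinearMap.mem_ker, shuffleRight_eq]
  have h1 := LinearMap.congr_fun (proj1_comp_conv (proj1 : Tens 𝕜 V →ₗ[𝕜] V) (shuffleRight β v)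
    (eps v) (eps_comp_shuffleRight β v)) u
  simp only [LinearMap.comp_apply, LinearMap.smul_apply, hv, zero_smul] at h1
  rw [hv, zero_smul, zero_add, LinearMap.add_apply, map_add, h1, LinearMap.zero_apply, zero_add,
    twistConv_apply]
  have h2 : ∀ w, eps (shuffleRight β w u) = 0 := fun w => by
    have := LinearMap.congr_fun (eps_comp_shuffleRight β w) u
    simpa [hu] using this
  have h3 : ∀ w, eps (shuffleRight β w (tmap β u)) = 0 := fun w => by
    have := LinearMap.congr_fun (eps_comp_shuffleRight β w) (tmap β u)
    simpa [hu, eps_tmap] using this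
  generalize deconc v = z
  induction z using TensorProduct.induction_on with
  | zero => simp
  | add a b ha hb => simp only [map_add, LinearMap.add_apply, ha, hb, add_zero]
  | tmul a b => simp [twist_apply, proj1_ι_mul, h2, h3]

omit [CharZero 𝕜] in
theorem cunit_comp_shuffleRight {A : Type*} [Ring A] [Algebra 𝕜 A] (v : Tens 𝕜 V) :
    cunit A ∘ₗ shuffleRight β v = eps v • cunit A := by
  have := eps_comp_shuffleRight β v
  rw [cunit, LinearMap.comp_assoc, this, LinearMap.comp_smul]

theorem coext_shuffleRight (hβ : β ∘ₗ β = LinearMap.id) {f : Tens 𝕜 V →ₗ[𝕜] W}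
    {φ : Tens 𝕜 V →ₗ[𝕜] Tens 𝕜 W} (hf1 : f 1 = 0) (hf : f ∘ₗ (tmap β).toLinearMap = β' ∘ₗ f)
    (hφ : φ = cunit _ + conv (ι 𝕜 ∘ₗ f) φ) (hI : ∀ t ∈ posShuffles β, f t = 0) (u v : Tens 𝕜 V) :
    φ (shuffleRight β v u) = shuffleRight β' (φ v) (φ u) := by
  have hφB : φ ∘ₗ (tmap β).toLinearMap = (tmap β').toLinearMap ∘ₗ φ := by
    have : IsTDeg (0 : V →ₗ[𝕜] V) β (0 : W →ₗ[𝕜] W) β' 0 f := ⟨by simp [der], by simpa using hf⟩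
    exact (this.coext hf1 hφ).par_even
  have hcφ := isCoalgMap_of_eq hf1 hφ
  have h1 : ∀ v, φ ∘ₗ shuffleRight β v = eps v • cunit _ + conv (ι 𝕜 ∘ₗ f) (φ ∘ₗ shuffleRight β v) +
      twistConv β β' f (sandwich φ LinearMap.id ∘ₗ shuffleRight β) v := by
    intro v
    have e := conv_comp_shuffleRight_of_parity hβ hf1 hI (Or.inl ⟨rfl, hf⟩) φ v
    rw [tmap_id] at e
    conv_lhs => rw [hφ, LinearMap.add_comp, cunit_comp_shuffleRight, e]
    rw [← add_assoc]; rfl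
  have h2 : ∀ v, shuffleRight β' (φ v) ∘ₗ φ = eps v • cunit _ +
      conv (ι 𝕜 ∘ₗ f) (shuffleRight β' (φ v) ∘ₗ φ) +
      twistConv β β' f (sandwich LinearMap.id φ ∘ₗ shuffleRight β' ∘ₗ φ) v := by
    intro v
    have e1 : eps (φ v) = eps v := LinearMap.congr_fun (eps_comp_coext hφ) v
    have e2 : cunit (Tens 𝕜 W) ∘ₗ φ = cunit _ := by
      rw [cunit, LinearMap.comp_assoc, eps_comp_coext hφ]; rfl
    have e3 : twistConv β' β' proj1 (shuffleRight β') (φ v) ∘ₗ φ =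
        twistConv β β' f (sandwich LinearMap.id φ ∘ₗ shuffleRight β' ∘ₗ φ) v := by
      have : deconc (φ v) = TensorProduct.map φ φ (deconc v) := LinearMap.congr_fun hcφ v
      rw [twistConv_apply, twistConv_apply, this]
      generalize deconc v = z
      induction z using TensorProduct.induction_on with
      | zero => simp
      | add a b ha hb => simp only [map_add, LinearMap.add_comp, ha, hb]
      | tmul a b =>
        have e4 : proj1 (φ a) = f a := LinearMap.congr_fun (proj1_comp_coext hφ) a
        simp only [map_tmul, TensorProduct.lift.tmul, LinearMap.compl₁₂_apply, e4, twist_apply,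
          LinearMap.add_comp, LinearMap.comp_assoc, sandwich_apply, LinearMap.comp_apply, hφB,
          LinearMap.id_comp]
    conv_lhs => rw [shuffleRight_eq]
    rw [LinearMap.add_comp, LinearMap.add_comp, LinearMap.smul_comp, e1, e2, hcφ.conv_comp, e3,
      LinearMap.comp_assoc, proj1_comp_coext hφ]
  have h3 : sandwich φ LinearMap.id ∘ₗ shuffleRight β -
      sandwich LinearMap.id φ ∘ₗ shuffleRight β' ∘ₗ φ = 0 := by
    refine eq_zero_of_twistConv (β := β) (β' := β') hf1 hf1 fun v => ?_
    rw [twistConv_sub]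
    simp only [LinearMap.sub_apply, LinearMap.comp_apply, sandwich_apply, LinearMap.comp_id,
      LinearMap.id_comp, conv_sub]
    conv_lhs => rw [h1 v, h2 v]
    abel
  have h4 := LinearMap.congr_fun (LinearMap.congr_fun h3 v) u
  simpa [sub_eq_zero] using h4

theorem cod_shuffleRight (hβ : β ∘ₗ β = LinearMap.id) {b : Tens 𝕜 V →ₗ[𝕜] V} (hb1 : b 1 = 0)
    (hI : ∀ t ∈ posShuffles β, b t = 0) {θ : V →ₗ[𝕜] V} (hθ : HasParity β β θ b)
    (u v : Tens 𝕜 V) : cod θ b (shuffleRight β v u) =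
      shuffleRight β v (cod θ b u) + shuffleRight β (cod θ b v) (tmap θ u) := by
  have hθβ : θ ∘ₗ β = β ∘ₗ θ := by rcases hθ with ⟨rfl, _⟩ | ⟨rfl, _⟩ <;> rfl
  have hTθ : (tmap θ).toLinearMap ∘ₗ (tmap β).toLinearMap =
      (tmap β).toLinearMap ∘ₗ (tmap θ).toLinearMap := by ext t; simp [tmap_tmap, hθβ]
  set D := cod θ b with hD
  set R := shuffleRight β with hR
  have heD : (eps (𝕜 := 𝕜) (V := V)).toLinearMap ∘ₗ D = 0 := eps_comp_cod θ b
  have hpD : proj1 ∘ₗ D = b := proj1_comp_cod θ b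
  have htw : ∀ (a : V) (X : Tens 𝕜 V →ₗ[𝕜] Tens 𝕜 V), twist β β a X ∘ₗ D =
      twist β β (θ a) (X ∘ₗ D) := by
    intro a X
    rcases hθ with ⟨rfl, hθ⟩ | ⟨rfl, hθ⟩
    · have : (tmap β).toLinearMap ∘ₗ D = D ∘ₗ (tmap β).toLinearMap :=
        tmap_comp_cod (by simp) hθ.symm
      simp only [twist_apply, LinearMap.add_comp, LinearMap.comp_assoc, this, LinearMap.id_apply]
    · have : (tmap θ).toLinearMap ∘ₗ D = -(D ∘ₗ (tmap θ).toLinearMap) := by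
        rw [hD, tmap_comp_cod (θ' := θ) (b' := -b) rfl (by rw [LinearMap.neg_comp, hθ, neg_neg]),
          ← neg_one_smul 𝕜 b, cod_smul]
        ext; simp
      simp only [twist_apply, LinearMap.add_comp, LinearMap.comp_assoc, this,
        evenPart_comp (rfl : θ ∘ₗ θ = θ ∘ₗ θ), oddPart_comp (rfl : θ ∘ₗ θ = θ ∘ₗ θ),
        apply_evenPart hβ, apply_oddPart hβ]
      ext; simp
  have h1 : ∀ v, D ∘ₗ R v = conv (ι 𝕜 ∘ₗ b) (R v) +
      twistConv β β b (sandwich LinearMap.id (tmap θ).toLinearMap ∘ₗ R) v +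
      (conv (ι 𝕜 ∘ₗ θ ∘ₗ proj1) (D ∘ₗ R v) +
        twistConv β β (θ ∘ₗ proj1) (sandwich D LinearMap.id ∘ₗ R) v) := by
    intro v
    have e1 := conv_comp_shuffleRight_of_parity hβ hb1 hI hθ LinearMap.id v
    have e2 := conv_comp_shuffleRight_of_parity hβ (h := θ ∘ₗ proj1) (β' := β) (by simp)
      (fun t ht => by simp [proj1_of_mem_posShuffles ht]) (Or.inl ⟨rfl, by
        rw [comp_proj1_comp_tmap, hθβ, LinearMap.comp_assoc]⟩) D v
    rw [tmap_id] at e2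
    conv_lhs => rw [hD, cod_eq, LinearMap.add_comp, e1, ← hD, e2]
    rw [LinearMap.id_comp]
    rfl
  have h2 : ∀ v, R v ∘ₗ D = conv (ι 𝕜 ∘ₗ b) (R v) + conv (ι 𝕜 ∘ₗ θ ∘ₗ proj1) (R v ∘ₗ D) +
      twistConv β β (θ ∘ₗ proj1) (sandwich LinearMap.id D ∘ₗ R) v := by
    intro v
    have e1 : twistConv β β proj1 R v ∘ₗ D =
        twistConv β β (θ ∘ₗ proj1) (sandwich LinearMap.id D ∘ₗ R) v := by
      rw [twistConv_apply, twistConv_apply]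
      generalize deconc v = z
      induction z using TensorProduct.induction_on with
      | zero => simp
      | add a b ha hb => simp only [map_add, LinearMap.add_comp, ha, hb]
      | tmul a b => simp [htw]
    conv_lhs => rw [hR, shuffleRight_eq, ← hR, LinearMap.add_comp, LinearMap.add_comp,
      LinearMap.smul_comp, cunit_comp_of_eps D heD, smul_zero, zero_add, e1, hD, conv_comp_cod,
      LinearMap.comp_assoc, LinearMap.comp_assoc, ← hD, hpD, proj1_comp_tmap]
  have h3 : ∀ v, R (D v) ∘ₗ (tmap θ).toLinearMap =
      conv (ι 𝕜 ∘ₗ θ ∘ₗ proj1) (R (D v) ∘ₗ (tmap θ).toLinearMap) +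
      (twistConv β β b (sandwich LinearMap.id (tmap θ).toLinearMap ∘ₗ R) v +
      twistConv β β (θ ∘ₗ proj1) (sandwich LinearMap.id (tmap θ).toLinearMap ∘ₗ R ∘ₗ D) v) := by
    intro v
    have e0 : eps (D v) = 0 := LinearMap.congr_fun heD v
    have e2 : ∀ (a : V) (X : Tens 𝕜 V →ₗ[𝕜] Tens 𝕜 V), twist β β a X ∘ₗ (tmap θ).toLinearMap =
        twist β β a (X ∘ₗ (tmap θ).toLinearMap) := by
      intro a X
      simp only [twist_apply, LinearMap.add_comp, LinearMap.comp_assoc, hTθ]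
    have e1 : twistConv β β proj1 R (D v) ∘ₗ (tmap θ).toLinearMap =
        twistConv β β b (sandwich LinearMap.id (tmap θ).toLinearMap ∘ₗ R) v +
        twistConv β β (θ ∘ₗ proj1) (sandwich LinearMap.id (tmap θ).toLinearMap ∘ₗ R ∘ₗ D) v := by
      have : deconc (D v) = TensorProduct.map D LinearMap.id (deconc v) +
        TensorProduct.map (tmap θ).toLinearMap D (deconc v) :=
        LinearMap.congr_fun (deconc_comp_cod θ b) v
      rw [twistConv_apply, twistConv_apply, twistConv_apply, this, map_add, LinearMap.add_comp]
      generalize deconc v = z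
      induction z using TensorProduct.induction_on with
      | zero => simp
      | add a b ha hb =>
        simp only [map_add, LinearMap.add_comp]
        rw [add_add_add_comm, ha, hb]; abel
      | tmul a c =>
        have e3 : proj1 (D a) = b a := LinearMap.congr_fun hpD a
        simp [e2, e3, proj1_tmap]
    conv_lhs => rw [hR, shuffleRight_eq, ← hR, LinearMap.add_comp, LinearMap.add_comp,
      LinearMap.smul_comp, e0, zero_smul, zero_add, e1, (isCoalgMap_tmap θ).conv_comp,
      LinearMap.comp_assoc, proj1_comp_tmap]
  have h4 : sandwich D LinearMap.id ∘ₗ R - sandwich LinearMap.id D ∘ₗ R -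
      sandwich LinearMap.id (tmap θ).toLinearMap ∘ₗ R ∘ₗ D = 0 := by
    refine eq_zero_of_twistConv (β := β) (β' := β) (f := θ ∘ₗ proj1) (g := θ ∘ₗ proj1) (by simp)
      (by simp) fun v => ?_
    rw [twistConv_sub, twistConv_sub]
    simp only [LinearMap.sub_apply, LinearMap.comp_apply, sandwich_apply, LinearMap.comp_id,
      LinearMap.id_comp, conv_sub]
    conv_lhs => rw [h1 v, h2 v, h3 v]
    abel
  have h5 := LinearMap.congr_fun (LinearMap.congr_fun h4 v) u
  simp only [LinearMap.sub_apply, LinearMap.comp_apply, sandwich_apply, LinearMap.comp_id,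
      LinearMap.id_comp, LinearMap.zero_apply, AlgHom.toLinearMap_apply, sub_sub, sub_eq_zero] at h5
  exact h5

/-! ### Admissibility -/

omit [CharZero 𝕜] in
theorem isStable_lenSub (β : V →ₗ[𝕜] V) : IsStable β (lenSub 𝕜 V) where
  toIsSubcoalg := isSubcoalg_lenSub
  cod_mem := by intros; rw [iSup_lenSub]; trivial

omit [CharZero 𝕜] in
theorem isCompatible_lenSub (β : V →ₗ[𝕜] V) (β' : W →ₗ[𝕜] W) :
    IsCompatible β β' (lenSub 𝕜 V) (lenSub 𝕜 W) := by
  intro f φ _ _ _ n t _; rw [iSup_lenSub]; trivial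

omit [CharZero 𝕜] in
theorem IsStable.isAdmissible_bot {β : V →ₗ[𝕜] V} {S : ℕ → Submodule 𝕜 (Tens 𝕜 V)}
    (hS : IsStable β S) : IsAdmissible β S ⊥ where
  toIsStable := hS
  proj_mem := by rintro n t rfl; simp
  proj1_eq_zero := by rintro t rfl; simp
  cod_mem_of := by rintro b _ _ _ t rfl; simp
  cod_linear_mem_of := by rintro b _ t rfl; simp

omit [CharZero 𝕜] in
theorem IsCompatible.isAdmissibleMap_bot {S : ℕ → Submodule 𝕜 (Tens 𝕜 V)}
    {S' : ℕ → Submodule 𝕜 (Tens 𝕜 W)} (h : IsCompatible β β' S S') :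
    IsAdmissibleMap β β' S S' ⊥ ⊥ where
  compatible := h
  mem_of := by rintro f φ _ _ _ _ t rfl; simp

omit [CharZero 𝕜] in
theorem shuffleRight_mem_lenSub (β : V →ₗ[𝕜] V) {i j : ℕ} {u v : Tens 𝕜 V}
    (hu : u ∈ lenSub 𝕜 V i) (hv : v ∈ lenSub 𝕜 V j) : shuffleRight β v u ∈ lenSub 𝕜 V (i + j) := by
  induction j generalizing i u v with
  | zero =>
    obtain ⟨r, rfl⟩ := mem_lenSub_zero.1 hv
    simpa using Submodule.smul_mem _ r hu
  | succ j ih =>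
    refine lenSub_succ_le (Q := (lenSub 𝕜 V (i + (j + 1))).comap
      ((LinearMap.applyₗ u) ∘ₗ shuffleRight β)) (fun y w hw => ?_) hv
    rw [Submodule.mem_comap, LinearMap.comp_apply, LinearMap.applyₗ_apply_apply,
      shuffleRight_ι_mul, conv_apply, ← LinearMap.comp_apply]
    refine isSubcoalg_lenSub.apply_deconc_mem _ _ (fun k l hkl a ha c hc => ?_) hu
    simp only [LinearMap.comp_apply, map_tmul, LinearMap.mul'_apply, LinearMap.id_apply,
      twist_apply, LinearMap.add_apply, LinearMap.mulLeft_apply, mul_add, AlgHom.toLinearMap_apply]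
    rw [show i + (j + 1) = k + (l + j + 1) by lia]
    exact add_mem (lenSub_mul_mem ha (ι_mul_mem_lenSub _ (ih hc hw)))
      (lenSub_mul_mem ha (ι_mul_mem_lenSub _ (ih (tmap_mem _ hc) hw)))

omit [CharZero 𝕜] in
theorem eps_of_mem {n : ℕ} (hn : n ≠ 0) {t : Tens 𝕜 V} (ht : t ∈ lenSub 𝕜 V n) : eps t = 0 := by
  simpa [cunit] using cunit_of_mem (A := 𝕜) hn ht

omit [CharZero 𝕜] in
theorem eps_proj {u : Tens 𝕜 V} (hu : eps u = 0) (n : ℕ) :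
    eps (GradedAlgebra.proj (lenSub 𝕜 V) n u) = 0 := by
  by_cases hn : n = 0
  · subst hn
    rw [← hu]
    have : (eps (𝕜 := 𝕜) (V := V)).toLinearMap ∘ₗ GradedAlgebra.proj (lenSub 𝕜 V) 0 =
        eps.toLinearMap := by
      refine len_ext fun k t ht => ?_
      by_cases hk : k = 0
      · subst hk; rw [LinearMap.comp_apply, proj_of_mem ht]
      · rw [LinearMap.comp_apply, proj_of_mem_ne hk ht, map_zero, AlgHom.toLinearMap_apply,
          eps_of_mem hk ht]
    exact LinearMap.congr_fun this u
  · exact eps_of_mem hn (by rw [GradedAlgebra.proj_apply]; exact SetLike.coe_mem _)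

omit [CharZero 𝕜] in
theorem proj_mem_posShuffles (n : ℕ) {t : Tens 𝕜 V} (ht : t ∈ posShuffles β) :
    GradedAlgebra.proj (lenSub 𝕜 V) n t ∈ posShuffles β := by
  classical
  refine posShuffles_le (Q := (posShuffles β).comap (GradedAlgebra.proj (lenSub 𝕜 V) n))
    (fun u v hu hv => ?_) ht
  rw [← DirectSum.sum_support_decompose (lenSub 𝕜 V) u,
    ← DirectSum.sum_support_decompose (lenSub 𝕜 V) v, map_sum]
  refine Submodule.sum_mem _ fun i _ => ?_
  rw [map_sum, LinearMap.sum_apply]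
  refine Submodule.sum_mem _ fun j _ => ?_
  have hi := eps_proj hu i
  have hj := eps_proj hv j
  rw [GradedAlgebra.proj_apply] at hi hj
  have hm := shuffleRight_mem_lenSub β (SetLike.coe_mem (DirectSum.decompose (lenSub 𝕜 V) u i))
    (SetLike.coe_mem (DirectSum.decompose (lenSub 𝕜 V) v j))
  rw [Submodule.mem_comap]
  by_cases h : i + j = n
  · subst h
    rw [proj_of_mem hm]
    exact shuffleRight_mem_posShuffles β hi hj
  · rw [proj_of_mem_ne h hm]; exact zero_mem _

theorem cod_mem_posShuffles (hβ : β ∘ₗ β = LinearMap.id) {b : Tens 𝕜 V →ₗ[𝕜] V} (hb1 : b 1 = 0)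
    (hI : ∀ t ∈ posShuffles β, b t = 0) {θ : V →ₗ[𝕜] V} (hθ : HasParity β β θ b) {t : Tens 𝕜 V}
    (ht : t ∈ posShuffles β) : cod θ b t ∈ posShuffles β := by
  refine posShuffles_le (Q := (posShuffles β).comap (cod θ b)) (fun u v hu hv => ?_) ht
  have h : ∀ w, eps (cod θ b w) = 0 := LinearMap.congr_fun (eps_comp_cod θ b)
  rw [Submodule.mem_comap, cod_shuffleRight hβ hb1 hI hθ]
  exact add_mem (shuffleRight_mem_posShuffles β (h u) hv)
    (shuffleRight_mem_posShuffles β (by rw [eps_tmap, hu]) (h v))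

theorem isAdmissible_posShuffles (hβ : β ∘ₗ β = LinearMap.id) :
    IsAdmissible β (lenSub 𝕜 V) (posShuffles β) where
  toIsStable := isStable_lenSub β
  proj_mem n _ := proj_mem_posShuffles n
  proj1_eq_zero _ := proj1_of_mem_posShuffles
  cod_mem_of b hb hb1 hI _ := cod_mem_posShuffles hβ hb1 hI (Or.inr ⟨rfl, hb⟩)
  cod_linear_mem_of g hg _ := cod_mem_posShuffles hβ (by simp)
    (fun t ht => by simp [proj1_of_mem_posShuffles ht])
    (Or.inl ⟨rfl, by rw [comp_proj1_comp_tmap, hg, LinearMap.comp_assoc]⟩)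

theorem isAdmissibleMap_posShuffles (hβ : β ∘ₗ β = LinearMap.id) :
    IsAdmissibleMap β β' (lenSub 𝕜 V) (lenSub 𝕜 W) (posShuffles β) (posShuffles β') where
  compatible := isCompatible_lenSub β β'
  mem_of f φ hf1 hf hφ hI t ht := by
    refine posShuffles_le (Q := (posShuffles β').comap φ) (fun u v hu hv => ?_) ht
    have h : ∀ w, eps (φ w) = eps w := LinearMap.congr_fun (eps_comp_coext hφ)
    rw [Submodule.mem_comap, coext_shuffleRight hβ hf1 hf hφ hI]
    exact shuffleRight_mem_posShuffles β' (by rw [h, hu]) (by rw [h, hv])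

end ShuffleIdeal

section Symmetric

variable {𝕜 : Type*} [Field 𝕜] {V : Type*} [AddCommGroup V] [Module 𝕜 V]
  {W : Type*} [AddCommGroup W] [Module 𝕜 W] {N : Type*} [AddCommGroup N] [Module 𝕜 N]

theorem cod_comp_cod_sub {θ θ' : V →ₗ[𝕜] V} {b b' : Tens 𝕜 V →ₗ[𝕜] V} {s : 𝕜} (hs : s * s = 1)
    (hθ : θ' ∘ₗ θ = θ ∘ₗ θ') (hb : b ∘ₗ (tmap θ').toLinearMap = s • (θ' ∘ₗ b))
    (hb' : b' ∘ₗ (tmap θ).toLinearMap = s • (θ ∘ₗ b')) :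
    cod θ b ∘ₗ cod θ' b' - s • (cod θ' b' ∘ₗ cod θ b) =
      cod (θ ∘ₗ θ') (b ∘ₗ cod θ' b' - s • (b' ∘ₗ cod θ b)) := by
  apply eq_cod
  conv_lhs => rw [cod_comp_cod, cod_comp_cod θ' θ]
  rw [hb, hb', hθ]
  simp only [LinearMap.comp_sub, LinearMap.comp_smul, sub_conv, conv_sub, smul_conv, conv_smul,
    smul_add, smul_smul, hs, one_smul]
  abel

/-- The linear map `w ↦ eps w • y`. -/
noncomputable def epsSmul (y : V) : Tens 𝕜 V →ₗ[𝕜] V :=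
  LinearMap.toSpanSingleton 𝕜 V y ∘ₗ eps.toLinearMap

theorem epsSmul_apply (y : V) (w : Tens 𝕜 V) : epsSmul y w = eps w • y := rfl

/-- The shuffle product with the letter `y` on the left. -/
noncomputable def insertLetter (θ : V →ₗ[𝕜] V) (y : V) : Tens 𝕜 V →ₗ[𝕜] Tens 𝕜 V :=
  cod θ (epsSmul y)

theorem conv_epsSmul (y : V) (g : Tens 𝕜 V →ₗ[𝕜] Tens 𝕜 V) :
    conv (ι 𝕜 ∘ₗ epsSmul y) g = LinearMap.mulLeft 𝕜 (ι 𝕜 y) ∘ₗ g := by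
  have : ι 𝕜 ∘ₗ epsSmul y = LinearMap.mulLeft 𝕜 (ι 𝕜 y) ∘ₗ (cunit (Tens 𝕜 V)) := by
    ext w; simp [epsSmul_apply, cunit, Algebra.algebraMap_eq_smul_one]
  rw [this, mulLeft_conv, cunit_conv]

theorem insertLetter_one (θ : V →ₗ[𝕜] V) (y : V) : insertLetter θ y 1 = ι 𝕜 y := by
  simp [insertLetter, epsSmul_apply]

theorem insertLetter_ι_mul (θ : V →ₗ[𝕜] V) (y x : V) (w : Tens 𝕜 V) :
    insertLetter θ y (ι 𝕜 x * w) = ι 𝕜 y * (ι 𝕜 x * w) + ι 𝕜 (θ x) * insertLetter θ y w := by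
  rw [insertLetter, cod_ι_mul, conv_epsSmul]; rfl

theorem insertLetter_eq_conv (θ : V →ₗ[𝕜] V) (y : V) : insertLetter θ y =
    conv (tmap θ).toLinearMap (LinearMap.mulLeft 𝕜 (ι 𝕜 y)) := by
  rw [insertLetter, cod_eq_conv, conv_epsSmul, LinearMap.comp_id]

theorem insertLetter_mem (θ : V →ₗ[𝕜] V) (y : V) {n : ℕ} {w : Tens 𝕜 V} (hw : w ∈ lenSub 𝕜 V n) :
    insertLetter θ y w ∈ lenSub 𝕜 V (n + 1) := by
  induction n generalizing w with
  | zero =>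
    obtain ⟨r, rfl⟩ := mem_lenSub_zero.1 hw
    rw [map_smul, insertLetter_one]
    exact Submodule.smul_mem _ _ (ι_mem_lenSub y)
  | succ n ih =>
    refine lenSub_succ_le (Q := (lenSub 𝕜 V (n + 2)).comap (insertLetter θ y)) (fun x w hw => ?_) hw
    rw [Submodule.mem_comap, insertLetter_ι_mul]
    exact add_mem (ι_mul_mem_lenSub _ (ι_mul_mem_lenSub _ hw)) (ι_mul_mem_lenSub _ (ih hw))

/-- `y` is even or odd, and `θ` is the corresponding power of the parity operator. -/
def IsParity (β : V →ₗ[𝕜] V) (θ : V →ₗ[𝕜] V) (y : V) : Prop :=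
  (θ = LinearMap.id ∧ β y = y) ∨ (θ = β ∧ β y = -y)

/-- The symmetric tensors of length `n`. -/
noncomputable def symTens (β : V →ₗ[𝕜] V) : ℕ → Submodule 𝕜 (Tens 𝕜 V)
  | 0 => lenSub 𝕜 V 0
  | n + 1 => Submodule.span 𝕜 {t | ∃ θ y, IsParity β θ y ∧ ∃ s ∈ symTens β n, t = insertLetter θ y s}

variable {β : V →ₗ[𝕜] V} {β' : W →ₗ[𝕜] W}

theorem insertLetter_mem_symTens {θ : V →ₗ[𝕜] V} {y : V} (hy : IsParity β θ y) {n : ℕ}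
    {s : Tens 𝕜 V} (hs : s ∈ symTens β n) : insertLetter θ y s ∈ symTens β (n + 1) :=
  Submodule.subset_span ⟨θ, y, hy, s, hs, rfl⟩

theorem symTens_succ_le {n : ℕ} {Q : Submodule 𝕜 (Tens 𝕜 V)}
    (h : ∀ θ y, IsParity β θ y → ∀ s ∈ symTens β n, insertLetter θ y s ∈ Q) :
    symTens β (n + 1) ≤ Q := by
  refine Submodule.span_le.2 ?_
  rintro _ ⟨θ, y, hy, s, hs, rfl⟩
  exact h θ y hy s hs

theorem symTens_le (n : ℕ) : symTens β n ≤ lenSub 𝕜 V n := by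
  induction n with
  | zero => exact le_rfl
  | succ n ih => exact symTens_succ_le fun θ y _ s hs => insertLetter_mem θ y (ih hs)

theorem insertLetter_mem_iSup {θ : V →ₗ[𝕜] V} {y : V} (hy : IsParity β θ y)
    {s : Tens 𝕜 V} (hs : s ∈ ⨆ k, symTens β k) : insertLetter θ y s ∈ ⨆ k, symTens β k := by
  have : ⨆ k, symTens β k ≤ (⨆ k, symTens β k).comap (insertLetter θ y) :=
    iSup_le fun k s hs => Submodule.mem_iSup_of_mem (k + 1) (insertLetter_mem_symTens hy hs)
  exact this hs

theorem tmap_insertLetter {δ θ : V →ₗ[𝕜] V} (h : δ ∘ₗ θ = θ ∘ₗ δ) (y : V) (w : Tens 𝕜 V) :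
    tmap δ (insertLetter θ y w) = insertLetter θ (δ y) (tmap δ w) :=
  LinearMap.congr_fun (tmap_comp_cod h (by ext w; simp [epsSmul_apply, eps_tmap])) w

theorem insertLetter_neg (θ : V →ₗ[𝕜] V) (y : V) : insertLetter θ (-y) = -insertLetter θ y := by
  have : (epsSmul (-y) : Tens 𝕜 V →ₗ[𝕜] V) = (-1 : 𝕜) • epsSmul y := by ext; simp [epsSmul_apply]
  rw [insertLetter, this, cod_smul]; ext w; simp [insertLetter]

theorem IsParity.comm {θ : V →ₗ[𝕜] V} {y : V} (hy : IsParity β θ y) : β ∘ₗ θ = θ ∘ₗ β := by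
  rcases hy with ⟨rfl, _⟩ | ⟨rfl, _⟩ <;> rfl

theorem tmap_par_mem_symTens {n : ℕ} {t : Tens 𝕜 V} (ht : t ∈ symTens β n) :
    tmap β t ∈ symTens β n := by
  induction n generalizing t with
  | zero => exact tmap_mem _ ht
  | succ n ih =>
    refine symTens_succ_le (Q := (symTens β (n + 1)).comap (tmap β).toLinearMap)
      (fun θ y hy s hs => ?_) ht
    rw [Submodule.mem_comap, AlgHom.toLinearMap_apply, tmap_insertLetter hy.comm]
    rcases hy with ⟨rfl, hy⟩ | ⟨rfl, hy⟩
    · rw [hy]; exact insertLetter_mem_symTens (Or.inl ⟨rfl, hy⟩) (ih hs)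
    · rw [hy, insertLetter_neg]
      exact neg_mem (insertLetter_mem_symTens (Or.inr ⟨rfl, hy⟩) (ih hs))

theorem tmap_mem_symTens {θ : V →ₗ[𝕜] V} {y : V} (hy : IsParity β θ y) {n : ℕ} {t : Tens 𝕜 V}
    (ht : t ∈ symTens β n) : tmap θ t ∈ symTens β n := by
  rcases hy with ⟨rfl, _⟩ | ⟨rfl, _⟩
  · rw [tmap_id]; exact ht
  · exact tmap_par_mem_symTens ht

theorem deconc_insertLetter (θ : V →ₗ[𝕜] V) (y : V) (t : Tens 𝕜 V) : deconc (insertLetter θ y t) =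
    TensorProduct.map (insertLetter θ y) LinearMap.id (deconc t) +
      TensorProduct.map (tmap θ).toLinearMap (insertLetter θ y) (deconc t) :=
  LinearMap.congr_fun (deconc_comp_cod θ (epsSmul y)) t

theorem isSubcoalg_symTens : IsSubcoalg (symTens β) where
  le := symTens_le
  deconc_mem n := by
    have mem : ∀ {i j n : ℕ} {a b : Tens 𝕜 V}, i + j = n → a ∈ symTens β i → b ∈ symTens β j →
        a ⊗ₜ[𝕜] b ∈ ⨆ p ∈ antidiagonal n,
          Submodule.map₂ (TensorProduct.mk 𝕜 _ _) (symTens β p.1) (symTens β p.2) := by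
      intro i j n a b h ha hb
      exact Submodule.mem_iSup_of_mem (i, j) (Submodule.mem_iSup_of_mem
        (mem_antidiagonal.2 h) (Submodule.apply_mem_map₂ _ ha hb))
    induction n with
    | zero =>
      intro t ht
      obtain ⟨r, rfl⟩ := mem_lenSub_zero.1 ht
      rw [map_smul, deconc_one]
      have h1 : (1 : Tens 𝕜 V) ∈ symTens β 0 := one_mem_lenSub
      exact Submodule.smul_mem _ _ (mem rfl h1 h1)
    | succ n ih =>
      refine symTens_succ_le (Q := (⨆ p ∈ antidiagonal (n + 1),
          Submodule.map₂ (TensorProduct.mk 𝕜 _ _) (symTens β p.1) (symTens β p.2)).comap deconc)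
        fun θ y hy s hs => ?_
      rw [Submodule.mem_comap, deconc_insertLetter, ← LinearMap.add_apply]
      have : (⨆ p ∈ antidiagonal n, Submodule.map₂ (TensorProduct.mk 𝕜 _ _)
          (symTens β p.1) (symTens β p.2)) ≤ (⨆ p ∈ antidiagonal (n + 1),
          Submodule.map₂ (TensorProduct.mk 𝕜 _ _) (symTens β p.1) (symTens β p.2)).comap
          (TensorProduct.map (insertLetter θ y) LinearMap.id +
            TensorProduct.map (tmap θ).toLinearMap (insertLetter θ y)) := by
        refine iSup₂_le fun p hp => Submodule.map₂_le.2 fun a ha b hb => ?_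
        have := mem_antidiagonal.1 hp
        rw [Submodule.mem_comap, mk_apply, LinearMap.add_apply, map_tmul, map_tmul]
        exact add_mem (mem (by lia) (insertLetter_mem_symTens hy ha) hb)
          (mem (by lia) (tmap_mem_symTens hy ha) (insertLetter_mem_symTens hy hb))
      exact this (ih s hs)

theorem cod_mem_symTens (hβ : β ∘ₗ β = LinearMap.id) {n : ℕ} {θ : V →ₗ[𝕜] V}
    {b : Tens 𝕜 V →ₗ[𝕜] V} (hb : HasParity β β θ b) {t : Tens 𝕜 V} (ht : t ∈ symTens β n) :
    cod θ b t ∈ ⨆ k, symTens β k := by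
  induction n generalizing θ b t with
  | zero =>
    obtain ⟨r, rfl⟩ := mem_lenSub_zero.1 ht
    have h1 : IsParity β θ (b 1) := by
      rcases hb with ⟨h, hb⟩ | ⟨h, hb⟩
      · refine Or.inl ⟨h, ?_⟩
        simpa using (LinearMap.congr_fun hb 1).symm
      · refine Or.inr ⟨h, ?_⟩
        have := LinearMap.congr_fun hb 1
        simp only [LinearMap.comp_apply, AlgHom.toLinearMap_apply, map_one,
          LinearMap.neg_apply] at this
        exact (neg_eq_iff_eq_neg.2 this).symm
    rw [map_smul, cod_one, ← insertLetter_one θ]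
    exact Submodule.smul_mem _ _ (Submodule.mem_iSup_of_mem 1
      (insertLetter_mem_symTens h1 one_mem_lenSub))
  | succ n ih =>
    refine symTens_succ_le (Q := (⨆ k, symTens β k).comap (cod θ b)) (fun θ' y hy s hs => ?_) ht
    rw [Submodule.mem_comap]
    have key : ∀ r : 𝕜, r * r = 1 → θ' ∘ₗ θ = θ ∘ₗ θ' →
        b ∘ₗ (tmap θ').toLinearMap = r • (θ' ∘ₗ b) → θ y = r • y →
        HasParity β β (θ ∘ₗ θ') (b ∘ₗ insertLetter θ' y) →
        cod θ b (insertLetter θ' y s) ∈ ⨆ k, symTens β k := by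
      intro r hr h1 h2 h3 h4
      have h := LinearMap.congr_fun (cod_comp_cod_sub (b' := epsSmul y) hr h1 h2 (by
        ext w
        simp only [epsSmul_apply, eps_tmap, h3, LinearMap.comp_apply, LinearMap.smul_apply,
          AlgHom.toLinearMap_apply, map_smul, smul_smul]
        rw [mul_left_comm, hr, mul_one])) s
      have h0 : epsSmul y ∘ₗ cod θ b = 0 := by
        rw [epsSmul, LinearMap.comp_assoc, eps_comp_cod, LinearMap.comp_zero]
      rw [h0, smul_zero, sub_zero, LinearMap.sub_apply, sub_eq_iff_eq_add] at h
      have h5 : cod θ b (insertLetter θ' y s) = _ := h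
      rw [h5]
      exact add_mem (ih h4 hs) (Submodule.smul_mem _ r (insertLetter_mem_iSup hy (ih hb hs)))
    have hB : ∀ w, insertLetter θ' y (tmap β w) = tmap β (insertLetter θ' (β y) w) := by
      intro w
      rw [tmap_insertLetter hy.comm]
      have : β (β y) = y := LinearMap.congr_fun hβ y
      rw [this]
    rcases hb with ⟨rfl, hb⟩ | ⟨rfl, hb⟩ <;> rcases hy with ⟨rfl, hy⟩ | ⟨rfl, hy⟩
    · refine key 1 (by simp) rfl (by ext; simp [tmap_id]) (by simp) (Or.inl ⟨rfl, ?_⟩)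
      ext w
      have := LinearMap.congr_fun hb (insertLetter LinearMap.id y w)
      simp only [LinearMap.comp_apply, AlgHom.toLinearMap_apply] at this ⊢
      rw [hB, hy, this]
    · refine key 1 (by simp) rfl (by rw [hb, one_smul]) (by simp) (Or.inr ⟨rfl, ?_⟩)
      ext w
      have := LinearMap.congr_fun hb (insertLetter θ' y w)
      simp only [LinearMap.comp_apply, AlgHom.toLinearMap_apply, LinearMap.neg_apply] at this ⊢
      rw [hB, hy, insertLetter_neg, LinearMap.neg_apply, map_neg, map_neg, this]
    · refine key 1 (by simp) rfl (by ext; simp [tmap_id]) (by rw [hy, one_smul]) (Or.inr ⟨rfl, ?_⟩)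
      ext w
      have := LinearMap.congr_fun hb (insertLetter LinearMap.id y w)
      simp only [LinearMap.comp_apply, AlgHom.toLinearMap_apply, LinearMap.neg_apply] at this ⊢
      rw [hB, hy, this]
    · refine key (-1) (by simp) rfl (by rw [hb, neg_smul, one_smul]) (by rw [hy, neg_smul, one_smul])
        (Or.inl ⟨hβ, ?_⟩)
      ext w
      have := LinearMap.congr_fun hb (insertLetter θ' y w)
      simp only [LinearMap.comp_apply, AlgHom.toLinearMap_apply, LinearMap.neg_apply] at this ⊢
      rw [hB, hy, insertLetter_neg, LinearMap.neg_apply, map_neg, map_neg, this, neg_neg]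

theorem isStable_symTens (hβ : β ∘ₗ β = LinearMap.id) : IsStable β (symTens β) where
  toIsSubcoalg := isSubcoalg_symTens
  cod_mem _ hb _ _ ht := cod_mem_symTens hβ (Or.inr ⟨rfl, hb⟩) ht

/-! ### Cocommutativity -/

/-- The graded flip. -/
noncomputable def gflip (β : V →ₗ[𝕜] V) : Tens 𝕜 V ⊗[𝕜] Tens 𝕜 V →ₗ[𝕜] Tens 𝕜 V ⊗[𝕜] Tens 𝕜 V :=
  (TensorProduct.comm 𝕜 _ _).toLinearMap ∘ₗ
    (TensorProduct.map (evenPart (tmap β).toLinearMap) LinearMap.id +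
      TensorProduct.map (oddPart (tmap β).toLinearMap) (tmap β).toLinearMap)

theorem gflip_tmul (β : V →ₗ[𝕜] V) (a b : Tens 𝕜 V) : gflip β (a ⊗ₜ b) =
    b ⊗ₜ evenPart (tmap β).toLinearMap a + tmap β b ⊗ₜ oddPart (tmap β).toLinearMap a := by
  simp [gflip]

theorem evenPart_insertLetter {y : V} (hy : β y = y) (w : Tens 𝕜 V) :
    evenPart (tmap β).toLinearMap (insertLetter LinearMap.id y w) =
      insertLetter LinearMap.id y (evenPart (tmap β).toLinearMap w) ∧
    oddPart (tmap β).toLinearMap (insertLetter LinearMap.id y w) =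
      insertLetter LinearMap.id y (oddPart (tmap β).toLinearMap w) := by
  have : insertLetter LinearMap.id y ∘ₗ (tmap β).toLinearMap =
      (tmap β).toLinearMap ∘ₗ insertLetter LinearMap.id y := by
    ext w; simp [tmap_insertLetter (δ := β) (θ := LinearMap.id) rfl, hy]
  exact ⟨evenPart_comp this w, oddPart_comp this w⟩

theorem oddPart_insertLetter {y : V} (hy : β y = -y) (w : Tens 𝕜 V) :
    evenPart (tmap β).toLinearMap (insertLetter β y w) =
      insertLetter β y (oddPart (tmap β).toLinearMap w) ∧
    oddPart (tmap β).toLinearMap (insertLetter β y w) =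
      insertLetter β y (evenPart (tmap β).toLinearMap w) := by
  have : insertLetter β y ∘ₗ (tmap β).toLinearMap =
      -((tmap β).toLinearMap ∘ₗ insertLetter β y) := by
    ext w; simp [tmap_insertLetter (δ := β) (θ := β) rfl, hy, insertLetter_neg]
  exact ⟨evenPart_comp_odd this w, oddPart_comp_odd this w⟩

theorem gflip_deconc [CharZero 𝕜] (hβ : β ∘ₗ β = LinearMap.id) {n : ℕ} {t : Tens 𝕜 V}
    (ht : t ∈ symTens β n) : gflip β (deconc t) = deconc t := by
  induction n generalizing t with
  | zero =>
    obtain ⟨r, rfl⟩ := mem_lenSub_zero.1 ht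
    rw [map_smul, deconc_one, map_smul, gflip_tmul, evenPart_of_even (by simp),
      oddPart_of_even (by simp), tmul_zero, add_zero]
  | succ n ih =>
    refine symTens_succ_le (Q := LinearMap.eqLocus (gflip β ∘ₗ deconc) deconc)
      (fun θ y hy s hs => ?_) ht
    rw [LinearMap.mem_eqLocus, LinearMap.comp_apply, deconc_insertLetter, map_add]
    have h1 : ∀ z, gflip β (TensorProduct.map (insertLetter θ y) LinearMap.id z) =
        TensorProduct.map (tmap θ).toLinearMap (insertLetter θ y) (gflip β z) := by
      intro z
      induction z using TensorProduct.induction_on with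
      | zero => simp
      | add a b ha hb => simp only [map_add, ha, hb]
      | tmul a b =>
        rw [map_tmul, gflip_tmul, gflip_tmul, map_add, map_tmul, map_tmul, LinearMap.id_apply]
        rcases hy with ⟨rfl, hy⟩ | ⟨rfl, hy⟩
        · rw [(evenPart_insertLetter hy a).1, (evenPart_insertLetter hy a).2, tmap_id]; rfl
        · rw [(oddPart_insertLetter hy a).1, (oddPart_insertLetter hy a).2, add_comm,
            AlgHom.toLinearMap_apply, AlgHom.toLinearMap_apply, tmap_tmap, hβ, tmap_id]; rfl
    have h2 : ∀ z, gflip β (TensorProduct.map (tmap θ).toLinearMap (insertLetter θ y) z) =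
        TensorProduct.map (insertLetter θ y) LinearMap.id (gflip β z) := by
      intro z
      induction z using TensorProduct.induction_on with
      | zero => simp
      | add a b ha hb => simp only [map_add, ha, hb]
      | tmul a b =>
        rw [map_tmul, gflip_tmul, gflip_tmul, map_add, map_tmul, map_tmul, LinearMap.id_apply]
        rcases hy with ⟨rfl, hy⟩ | ⟨rfl, hy⟩
        · rw [tmap_id, AlgHom.toLinearMap_id, LinearMap.id_apply,
            tmap_insertLetter (δ := β) (θ := LinearMap.id) rfl, hy, LinearMap.id_apply]
        · have h : (tmap θ).toLinearMap ∘ₗ (tmap θ).toLinearMap =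
            (tmap θ).toLinearMap ∘ₗ (tmap θ).toLinearMap := rfl
          have hh := tmap_par_par (𝕜 := 𝕜) hβ
          rw [evenPart_comp h, oddPart_comp h, apply_evenPart hh, apply_oddPart hh,
            tmap_insertLetter rfl, hy, insertLetter_neg, tmul_neg, LinearMap.neg_apply, neg_tmul,
            neg_neg, LinearMap.id_apply]
    rw [h1, h2, ih hs, add_comm]

theorem deconc_coassoc (t : Tens 𝕜 V) : TensorProduct.map deconc LinearMap.id (deconc t) =
    (TensorProduct.assoc 𝕜 _ _ _).symm (TensorProduct.map LinearMap.id deconc (deconc t)) := by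
  induction t using tens_induction with
  | one => simp
  | zero => simp
  | add a b ha hb => simp only [map_add, ha, hb]
  | smul r a ha => simp only [map_smul, ha]
  | mul x w hw =>
    have h1 : ∀ z : Tens 𝕜 V ⊗[𝕜] Tens 𝕜 V, TensorProduct.map deconc LinearMap.id
        ((ι 𝕜 x ⊗ₜ 1) * z) = (TensorProduct.assoc 𝕜 _ _ _).symm (1 ⊗ₜ ((ι 𝕜 x ⊗ₜ 1) * z)) +
          ((ι 𝕜 x ⊗ₜ 1) ⊗ₜ 1) * TensorProduct.map deconc LinearMap.id z := by
      intro z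
      induction z using TensorProduct.induction_on with
      | zero => simp
      | add a b ha hb => simp only [mul_add, tmul_add, map_add, ha, hb]; abel
      | tmul a b => simp [deconc_ι_mul, add_tmul]
    have h2 : ∀ z : Tens 𝕜 V ⊗[𝕜] Tens 𝕜 V, (TensorProduct.assoc 𝕜 _ _ _).symm
        (TensorProduct.map LinearMap.id deconc ((ι 𝕜 x ⊗ₜ 1) * z)) = ((ι 𝕜 x ⊗ₜ 1) ⊗ₜ 1) *
          (TensorProduct.assoc 𝕜 _ _ _).symm (TensorProduct.map LinearMap.id deconc z) := by
      intro z
      induction z using TensorProduct.induction_on with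
      | zero => simp
      | add a b ha hb => simp only [mul_add, map_add, ha, hb]
      | tmul a b =>
        rw [Algebra.TensorProduct.tmul_mul_tmul, one_mul, map_tmul, map_tmul]
        generalize deconc b = z
        induction z using TensorProduct.induction_on with
        | zero => simp
        | add a b ha hb => simp only [tmul_add, mul_add, map_add, ha, hb]
        | tmul c d => simp
    rw [deconc_ι_mul, map_add, map_add, map_add, h1, h2, hw, map_tmul, map_tmul, deconc_ι_mul,
      tmul_add, map_add, deconc_one]
    simp only [LinearMap.id_apply, TensorProduct.assoc_symm_tmul]
    abel

/-! ### Coalgebra maps preserve symmetric tensors -/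

/-- The shuffle product with a letter on the left, as a bilinear map. -/
noncomputable def insertLin (β : V →ₗ[𝕜] V) : V →ₗ[𝕜] Tens 𝕜 V →ₗ[𝕜] Tens 𝕜 V :=
  LinearMap.mk₂ 𝕜 (fun y w => conv LinearMap.id (LinearMap.mulLeft 𝕜 (ι 𝕜 (evenPart β y))) w +
    conv (tmap β).toLinearMap (LinearMap.mulLeft 𝕜 (ι 𝕜 (oddPart β y))) w)
    (by
      intro x y w
      have : ∀ a b : Tens 𝕜 V, LinearMap.mulLeft 𝕜 (a + b) = LinearMap.mulLeft 𝕜 a +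
        LinearMap.mulLeft 𝕜 b := fun a b => by ext; simp [add_mul]
      simp only [map_add, this, conv_add, LinearMap.add_apply]; abel)
    (by
      intro r y w
      have : ∀ a : Tens 𝕜 V, LinearMap.mulLeft 𝕜 (r • a) = r • LinearMap.mulLeft 𝕜 a :=
        fun a => by ext; simp
      simp only [map_smul, this, conv_smul, LinearMap.smul_apply, smul_add])
    (by intro y w w'; simp only [map_add]; abel)
    (by intro r y w; simp only [map_smul, smul_add])

theorem insertLin_apply (β : V →ₗ[𝕜] V) (y : V) : insertLin β y =
    conv LinearMap.id (LinearMap.mulLeft 𝕜 (ι 𝕜 (evenPart β y))) +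
    conv (tmap β).toLinearMap (LinearMap.mulLeft 𝕜 (ι 𝕜 (oddPart β y))) := rfl

theorem insertLin_eq (β : V →ₗ[𝕜] V) (y : V) (w : Tens 𝕜 V) : insertLin β y w =
    insertLetter LinearMap.id (evenPart β y) w + insertLetter β (oddPart β y) w := by
  rw [insertLetter_eq_conv, insertLetter_eq_conv, insertLin_apply, tmap_id]; rfl

theorem length_cod {n : ℕ} {t : Tens 𝕜 V} (ht : t ∈ lenSub 𝕜 V n) :
    cod LinearMap.id proj1 t = (n : 𝕜) • t := by
  induction n generalizing t with
  | zero => obtain ⟨r, rfl⟩ := mem_lenSub_zero.1 ht; simp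
  | succ n ih =>
    refine lenSub_succ_le (Q := LinearMap.eqLocus (cod LinearMap.id proj1)
      (((n + 1 : ℕ) : 𝕜) • LinearMap.id)) (fun x w hw => ?_) ht
    have := cod_linear_ι_mul LinearMap.id (LinearMap.id : V →ₗ[𝕜] V) x w
    rw [LinearMap.id_comp] at this
    rw [LinearMap.mem_eqLocus, this, ih hw]
    simp [add_smul, add_comm]

variable [CharZero 𝕜]

theorem conv_conv_apply_symTens (hβ : β ∘ₗ β = LinearMap.id) {f : Tens 𝕜 V →ₗ[𝕜] W}
    {φ : Tens 𝕜 V →ₗ[𝕜] Tens 𝕜 W} (hcφ : IsCoalgMap φ)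
    (hφB : φ ∘ₗ (tmap β).toLinearMap = (tmap β').toLinearMap ∘ₗ φ) {θ : W →ₗ[𝕜] W}
    (hf : (θ = LinearMap.id ∧ f ∘ₗ (tmap β).toLinearMap = β' ∘ₗ f) ∨
      (θ = β' ∧ f ∘ₗ (tmap β).toLinearMap = -(β' ∘ₗ f)))
    {n : ℕ} {t : Tens 𝕜 V} (ht : t ∈ symTens β n) :
    conv (conv ((tmap θ).toLinearMap ∘ₗ φ) (ι 𝕜 ∘ₗ f)) φ t =
      TensorProduct.lift ((insertLin β').compl₁₂ f φ) (deconc t) := by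
  let M : (Tens 𝕜 V ⊗[𝕜] Tens 𝕜 V) ⊗[𝕜] Tens 𝕜 V →ₗ[𝕜] Tens 𝕜 W := LinearMap.mul' 𝕜 _ ∘ₗ
    TensorProduct.map (LinearMap.mul' 𝕜 _ ∘ₗ
      TensorProduct.map ((tmap θ).toLinearMap ∘ₗ φ) (ι 𝕜 ∘ₗ f)) φ
  have h1 : conv (conv ((tmap θ).toLinearMap ∘ₗ φ) (ι 𝕜 ∘ₗ f)) φ t =
      M (TensorProduct.map deconc LinearMap.id (deconc t)) := by
    rw [conv_apply]
    generalize deconc t = z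
    induction z using TensorProduct.induction_on with
    | zero => simp
    | add a b ha hb => simp only [map_add, ha, hb]
    | tmul a b => simp [M, conv_apply]
  have h2 : M (TensorProduct.map deconc LinearMap.id (deconc t)) =
      M (TensorProduct.map (gflip β) LinearMap.id
        (TensorProduct.map deconc LinearMap.id (deconc t))) := by
    rw [← sub_eq_zero]
    refine isSubcoalg_symTens.apply_deconc_eq_zero (S := symTens β) (M ∘ₗ
      TensorProduct.map deconc LinearMap.id - M ∘ₗ TensorProduct.map (gflip β) LinearMap.id ∘ₗ
        TensorProduct.map deconc LinearMap.id) (fun i j _ a ha b _ => ?_) ht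
    simp only [LinearMap.sub_apply, LinearMap.comp_apply, map_tmul, LinearMap.id_apply,
      gflip_deconc hβ ha, sub_self]
  rw [h1, h2, deconc_coassoc]
  generalize deconc t = z
  induction z using TensorProduct.induction_on with
  | zero => simp
  | add a b ha hb => simp only [map_add, ha, hb]
  | tmul a c =>
    rw [TensorProduct.lift.tmul, LinearMap.compl₁₂_apply, insertLin_apply, map_tmul]
    have e1 : ∀ (g h : Tens 𝕜 W →ₗ[𝕜] Tens 𝕜 W), conv g h (φ c) = conv (g ∘ₗ φ) (h ∘ₗ φ) c :=
      fun g h => LinearMap.congr_fun (hcφ.conv_comp g h) c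
    rw [LinearMap.add_apply, e1, e1, ← hφB, conv_apply, conv_apply]
    generalize deconc c = z
    induction z using TensorProduct.induction_on with
    | zero => simp
    | add a b ha hb => simp only [map_add, tmul_add, ha, hb]; abel
    | tmul b d =>
      rcases hf with ⟨rfl, hf⟩ | ⟨rfl, hf⟩
      · simp only [LinearMap.id_apply, TensorProduct.assoc_symm_tmul, map_tmul, gflip_tmul, add_tmul,
          map_add, M, LinearMap.comp_apply, LinearMap.mul'_apply, evenPart_comp hf, oddPart_comp hf,
          LinearMap.mulLeft_apply, mul_assoc, AlgHom.toLinearMap_apply, tmap_id, AlgHom.id_apply]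
      · have hBB : ∀ w, tmap β (tmap β w) = w := fun w => by rw [tmap_tmap, hβ, tmap_id]; rfl
        simp only [← hφB, LinearMap.id_apply, TensorProduct.assoc_symm_tmul, map_tmul, gflip_tmul,
          add_tmul, map_add, M, LinearMap.comp_apply, LinearMap.mul'_apply, evenPart_comp_odd hf,
          oddPart_comp_odd hf, LinearMap.mulLeft_apply, mul_assoc, AlgHom.toLinearMap_apply, hBB]
        rw [add_comm]

theorem length_coext (hβ : β ∘ₗ β = LinearMap.id) {f : Tens 𝕜 V →ₗ[𝕜] W}
    {φ : Tens 𝕜 V →ₗ[𝕜] Tens 𝕜 W} (hf1 : f 1 = 0) (hf : f ∘ₗ (tmap β).toLinearMap = β' ∘ₗ f)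
    (hφ : φ = cunit _ + conv (ι 𝕜 ∘ₗ f) φ) {n : ℕ} {t : Tens 𝕜 V} (ht : t ∈ symTens β n) :
    cod LinearMap.id proj1 (φ t) =
      TensorProduct.lift ((insertLin β').compl₁₂ f φ) (deconc t) := by
  have hφB : φ ∘ₗ (tmap β).toLinearMap = (tmap β').toLinearMap ∘ₗ φ := by
    have : IsTDeg (0 : V →ₗ[𝕜] V) β (0 : W →ₗ[𝕜] W) β' 0 f := ⟨by simp [der], by simpa using hf⟩
    exact (this.coext hf1 hφ).par_even
  have hcφ := isCoalgMap_of_eq hf1 hφ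
  rw [← conv_conv_apply_symTens hβ hcφ hφB (Or.inl ⟨rfl, hf⟩) ht, ← LinearMap.comp_apply,
    cod_eq_conv, hcφ.conv_comp, hcφ.conv_comp, tmap_id, conv_assoc, LinearMap.comp_assoc,
    proj1_comp_coext hφ]
  rfl

/-- A coderivation inserts its value in all places of a symmetric tensor. -/
theorem cod_apply_symTens (hβ : β ∘ₗ β = LinearMap.id) {b : Tens 𝕜 V →ₗ[𝕜] V}
    (hb : b ∘ₗ (tmap β).toLinearMap = -(β ∘ₗ b)) {n : ℕ} {t : Tens 𝕜 V} (ht : t ∈ symTens β n) :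
    cod β b t = TensorProduct.lift ((insertLin β).compl₁₂ b LinearMap.id) (deconc t) := by
  have h : IsCoalgMap (LinearMap.id : Tens 𝕜 V →ₗ[𝕜] Tens 𝕜 V) := by
    have := isCoalgMap_tmap (LinearMap.id : V →ₗ[𝕜] V)
    rwa [tmap_id] at this
  rw [← conv_conv_apply_symTens hβ h rfl (Or.inr ⟨rfl, hb⟩) ht, cod_eq_conv, conv_assoc]
  rfl

theorem isCompatible_symTens (hβ : β ∘ₗ β = LinearMap.id) (hβ' : β' ∘ₗ β' = LinearMap.id) :
    IsCompatible β β' (symTens β) (symTens β') := by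
  classical
  intro f φ hf1 hf hφ n
  have hins : ∀ y, ∀ w ∈ ⨆ k, symTens β' k, insertLin β' y w ∈ ⨆ k, symTens β' k := by
    intro y w hw
    rw [insertLin_eq]
    exact add_mem (insertLetter_mem_iSup (Or.inl ⟨rfl, apply_evenPart hβ' y⟩) hw)
      (insertLetter_mem_iSup (Or.inr ⟨rfl, apply_oddPart hβ' y⟩) hw)
  induction n using Nat.strong_induction_on with
  | _ n ih =>
  intro t ht
  have h1 : cod LinearMap.id proj1 (φ t) ∈ ⨆ k, symTens β' k := by
    rw [length_coext hβ hf1 hf hφ ht]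
    refine isSubcoalg_symTens.apply_deconc_mem (S := symTens β) _ _ (fun i j hij a ha b hb => ?_) ht
    rw [TensorProduct.lift.tmul, LinearMap.compl₁₂_apply]
    by_cases hi : i = 0
    · subst hi
      obtain ⟨r, rfl⟩ := mem_lenSub_zero.1 ha
      simp [hf1]
    · exact hins _ _ (ih j (by lia) b hb)
  rw [← DirectSum.sum_support_decompose (lenSub 𝕜 W) (φ t)]
  refine Submodule.sum_mem _ fun k _ => Submodule.mem_iSup_of_mem k ?_
  by_cases hk : k = 0
  · subst hk; exact SetLike.coe_mem _
  have h2 := proj_mem_of_mem_iSup symTens_le h1 k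
  have h3 : GradedAlgebra.proj (lenSub 𝕜 W) k (cod LinearMap.id proj1 (φ t)) =
      (k : 𝕜) • GradedAlgebra.proj (lenSub 𝕜 W) k (φ t) := by
    have e1 := LinearMap.congr_fun (proj_comp_eq (g := cod LinearMap.id (proj1 : Tens 𝕜 W →ₗ[𝕜] W))
      (fun k t ht => by rw [length_cod ht]; exact Submodule.smul_mem _ _ ht) k) (φ t)
    rw [LinearMap.comp_apply, LinearMap.comp_apply] at e1
    rw [e1, length_cod (n := k)]
    rw [GradedAlgebra.proj_apply]; exact SetLike.coe_mem _
  have h4 : GradedAlgebra.proj (lenSub 𝕜 W) k (cod LinearMap.id proj1 (φ t)) ∈ symTens β' k := h2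
  rw [h3] at h4
  have h5 := Submodule.smul_mem _ ((k : 𝕜)⁻¹) h4
  rwa [smul_smul, inv_mul_cancel₀ (Nat.cast_ne_zero.2 hk), one_smul,
    GradedAlgebra.proj_apply] at h5

end Symmetric

section Limit

variable {𝕜 : Type*} [Field 𝕜] {V : Type*} [AddCommGroup V] [Module 𝕜 V]
  {W : Type*} [AddCommGroup W] [Module 𝕜 W]

theorem IsSubcoalg.cod_congr {S : ℕ → Submodule 𝕜 (Tens 𝕜 V)} (hS : IsSubcoalg S) (θ : V →ₗ[𝕜] V)
    {b b' : Tens 𝕜 V →ₗ[𝕜] V} {n : ℕ} (h : ∀ k ≤ n, ∀ t ∈ S k, b t = b' t) {t : Tens 𝕜 V}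
    (ht : t ∈ S n) : cod θ b t = cod θ b' t := by
  have h1 := hS.eq_ι_of_conv_eq (cod_eq θ (b - b')) rfl (by simp) (n := n + 1)
    (fun k hk t ht => by rw [LinearMap.sub_apply, h k (by lia) t ht, sub_self]) (Nat.le_succ n) ht
  rw [cod_sub, LinearMap.sub_apply, LinearMap.sub_apply, h n le_rfl t ht, sub_self, map_zero,
    sub_eq_zero] at h1
  exact h1

theorem IsSubcoalg.coext_congr {S : ℕ → Submodule 𝕜 (Tens 𝕜 V)} (hS : IsSubcoalg S)
    {f f' : Tens 𝕜 V →ₗ[𝕜] W} (hf : f 1 = 0) (hf' : f' 1 = 0) {φ φ' : Tens 𝕜 V →ₗ[𝕜] Tens 𝕜 W}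
    (hφ : φ = cunit _ + conv (ι 𝕜 ∘ₗ f) φ) (hφ' : φ' = cunit _ + conv (ι 𝕜 ∘ₗ f') φ') {n : ℕ}
    (h : ∀ k ≤ n, ∀ t ∈ S k, f t = f' t) {t : Tens 𝕜 V} (ht : t ∈ S n) : φ t = φ' t := by
  have h1 := hS.eq_ι_of_conv_eq (e := f - f') (g := f) (h := φ') (X := φ - φ') (by
    conv_lhs => rw [hφ, hφ']
    rw [LinearMap.comp_sub, sub_conv, conv_sub]; abel) (by rw [hφ']; simp [hf']) hf (n := n + 1)
    (fun k hk t ht => by rw [LinearMap.sub_apply, h k (by lia) t ht, sub_self]) (Nat.le_succ n) ht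
  rw [LinearMap.sub_apply, LinearMap.sub_apply, h n le_rfl t ht, sub_self, map_zero,
    sub_eq_zero] at h1
  exact h1

/-- The linear map that agrees with `g k` on the tensors of length `k`. -/
noncomputable def glue (g : ℕ → Tens 𝕜 V →ₗ[𝕜] W) : Tens 𝕜 V →ₗ[𝕜] W :=
  DirectSum.toModule 𝕜 ℕ W (fun k => g k ∘ₗ (lenSub 𝕜 V k).subtype) ∘ₗ
    (DirectSum.decomposeLinearEquiv (lenSub 𝕜 V)).toLinearMap

theorem glue_of_mem (g : ℕ → Tens 𝕜 V →ₗ[𝕜] W) {k : ℕ} {t : Tens 𝕜 V} (ht : t ∈ lenSub 𝕜 V k) :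
    glue g t = g k t := by
  have : DirectSum.decompose (lenSub 𝕜 V) t =
      DirectSum.lof 𝕜 ℕ (fun i => lenSub 𝕜 V i) k ⟨t, ht⟩ := DirectSum.decompose_of_mem _ ht
  simp only [glue, LinearMap.comp_apply, LinearEquiv.coe_coe,
    DirectSum.decomposeLinearEquiv_apply, this]
  rw [DirectSum.toModule_lof]; rfl

theorem isTDeg_glue {δ β : V →ₗ[𝕜] V} {δ' β' : W →ₗ[𝕜] W} {p : ℤ} {g : ℕ → Tens 𝕜 V →ₗ[𝕜] W}
    (hg : ∀ k, IsTDeg δ β δ' β' p (g k)) : IsTDeg δ β δ' β' p (glue g) where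
  deg := len_ext fun k t ht => by
    have := LinearMap.congr_fun (hg k).deg t
    simp only [LinearMap.sub_apply, LinearMap.comp_apply, LinearMap.smul_apply] at this ⊢
    rw [glue_of_mem g ht, glue_of_mem g (cod_linear_mem _ _ ht), this]
  par := len_ext fun k t ht => by
    have := LinearMap.congr_fun (hg k).par t
    simp only [LinearMap.comp_apply, LinearMap.smul_apply, AlgHom.toLinearMap_apply] at this ⊢
    rw [glue_of_mem g ht, glue_of_mem g (tmap_mem _ ht), this]

theorem exists_sequence {σ : Type*} (P : ℕ → σ → Prop) (R : ℕ → σ → σ → Prop) {s : σ} {K : ℕ}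
    (hs : P K s) (h : ∀ n ≥ K, ∀ s, P n s → ∃ s', P (n + 1) s' ∧ R n s s') :
    ∃ u : ℕ → σ, u 0 = s ∧ (∀ i, P (K + i) (u i)) ∧ ∀ i, R (K + i) (u i) (u (i + 1)) := by
  choose! g hg hg' using h
  let u : ℕ → σ := fun i => Nat.rec s (fun i s => g (K + i) s) i
  have hu : ∀ i, P (K + i) (u i) := by
    intro i
    induction i with
    | zero => exact hs
    | succ i ih => exact hg (K + i) (by lia) _ ih
  exact ⟨u, rfl, hu, fun i => hg' (K + i) (by lia) _ (hu i)⟩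

theorem cod_mem_flt_succ (θ : V →ₗ[𝕜] V) {a : Tens 𝕜 V →ₗ[𝕜] V} (ha : a 1 = 0) {n : ℕ}
    {t : Tens 𝕜 V} (ht : t ∈ lenSub 𝕜 V n) : cod θ a t ∈ flt (lenSub 𝕜 V) (n + 1) := by
  have := add_mem (flt_mono _ n.le_succ (cod_sub_linear_mem_flt θ ha ht))
    (le_flt _ n.lt_succ_self (cod_linear_mem θ (a ∘ₗ ι 𝕜) ht))
  rwa [sub_add_cancel] at this

theorem coext_mem_flt_succ {f : Tens 𝕜 V →ₗ[𝕜] W} (hf : f 1 = 0) {φ : Tens 𝕜 V →ₗ[𝕜] Tens 𝕜 W}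
    (hφ : φ = cunit _ + conv (ι 𝕜 ∘ₗ f) φ) {n : ℕ} {t : Tens 𝕜 V} (ht : t ∈ lenSub 𝕜 V n) :
    φ t ∈ flt (lenSub 𝕜 W) (n + 1) := by
  have := add_mem (flt_mono _ n.le_succ (coext_sub_tmap_mem hf hφ ht))
    (le_flt _ n.lt_succ_self (tmap_mem (f ∘ₗ ι 𝕜) ht))
  rwa [sub_add_cancel] at this

/-- `g` and `g'` have the same components of length at most `n`. -/
def AgreeUpTo (n : ℕ) (g g' : Tens 𝕜 V →ₗ[𝕜] W) : Prop :=
  ∀ k ≤ n, ∀ t ∈ lenSub 𝕜 V k, g t = g' t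

theorem AgreeUpTo.mono {n k : ℕ} {g g' : Tens 𝕜 V →ₗ[𝕜] W} (h : AgreeUpTo n g g') (hk : k ≤ n) :
    AgreeUpTo k g g' := fun j hj => h j (hj.trans hk)

theorem AgreeUpTo.one {n : ℕ} {g g' : Tens 𝕜 V →ₗ[𝕜] W} (h : AgreeUpTo n g g') : g 1 = g' 1 :=
  h 0 (Nat.zero_le n) 1 one_mem_lenSub

theorem AgreeUpTo.flt {n : ℕ} {g g' : Tens 𝕜 V →ₗ[𝕜] W} (h : AgreeUpTo n g g') {t : Tens 𝕜 V}
    (ht : t ∈ flt (lenSub 𝕜 V) (n + 1)) : g t = g' t :=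
  (flt_le fun k hk t ht => h k (by lia) t ht : StrongHomotopy.flt (lenSub 𝕜 V) (n + 1) ≤
    LinearMap.eqLocus g g') ht

theorem AgreeUpTo.cod_sq_eq_zero {n : ℕ} {c c' : Tens 𝕜 V →ₗ[𝕜] V} (h : AgreeUpTo n c' c)
    (hc1 : c 1 = 0) {θ : V →ₗ[𝕜] V} {t : Tens 𝕜 V} (ht : t ∈ lenSub 𝕜 V n)
    (h0 : c (cod θ c t) = 0) : c' (cod θ c' t) = 0 := by
  rw [h.flt (cod_mem_flt_succ θ (h.one.trans hc1) ht), isSubcoalg_lenSub.cod_congr _ h ht, h0]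

theorem AgreeUpTo.coext_eq {n : ℕ} {c c' : Tens 𝕜 W →ₗ[𝕜] W} {f f' : Tens 𝕜 V →ₗ[𝕜] W}
    {b : Tens 𝕜 V →ₗ[𝕜] V} (h : AgreeUpTo n c' c) (h' : AgreeUpTo n f' f)
    (hf1 : f 1 = 0) (hb1 : b 1 = 0) {θ : V →ₗ[𝕜] V} {t : Tens 𝕜 V} (ht : t ∈ lenSub 𝕜 V n)
    (h0 : ∀ φ : Tens 𝕜 V →ₗ[𝕜] Tens 𝕜 W, φ = cunit _ + conv (ι 𝕜 ∘ₗ f) φ →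
      c (φ t) = f (cod θ b t)) {φ : Tens 𝕜 V →ₗ[𝕜] Tens 𝕜 W}
    (hφ : φ = cunit _ + conv (ι 𝕜 ∘ₗ f') φ) : c' (φ t) = f' (cod θ b t) := by
  obtain ⟨ψ, hψ⟩ := exists_coext f hf1
  rw [isSubcoalg_lenSub.coext_congr (h'.one.trans hf1) hf1 hφ hψ h' ht,
    h.flt (coext_mem_flt_succ hf1 hψ ht), h'.flt (cod_mem_flt_succ θ hb1 ht), h0 ψ hψ]

/-- The operation `c` and the morphism `f` satisfy the structure equations in lengths up to `n`. -/
structure IsPartial (𝒱 : ℤ → Submodule 𝕜 V) [DirectSum.Decomposition 𝒱]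
    (𝒲 : ℤ → Submodule 𝕜 W) [DirectSum.Decomposition 𝒲]
    (S : ℕ → Submodule 𝕜 (Tens 𝕜 V)) (I : Submodule 𝕜 (Tens 𝕜 V))
    (S' : ℕ → Submodule 𝕜 (Tens 𝕜 W)) (I' : Submodule 𝕜 (Tens 𝕜 W)) (b : Tens 𝕜 V →ₗ[𝕜] V)
    (dW : W →ₗ[𝕜] W) (F : V →ₗ[𝕜] W) (n : ℕ) (c : Tens 𝕜 W →ₗ[𝕜] W) (f : Tens 𝕜 V →ₗ[𝕜] W) :
    Prop where
  c_deg : IsTDeg (dgr 𝒲) (par 𝒲) (dgr 𝒲) (par 𝒲) (-1) c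
  f_deg : IsTDeg (dgr 𝒱) (par 𝒱) (dgr 𝒲) (par 𝒲) 0 f
  c_vanish : ∀ t ∈ I', c t = 0
  f_vanish : ∀ t ∈ I, f t = 0
  c_one : c 1 = 0
  f_one : f 1 = 0
  c_ι : c ∘ₗ ι 𝕜 = dW
  f_ι : f ∘ₗ ι 𝕜 = F
  c_sq : ∀ k ≤ n, ∀ t ∈ S' k, c (cod (par 𝒲) c t) = 0
  f_map : ∀ k ≤ n, ∀ t ∈ S k, ∀ φ : Tens 𝕜 V →ₗ[𝕜] Tens 𝕜 W, φ = cunit _ + conv (ι 𝕜 ∘ₗ f) φ →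
    c (φ t) = f (cod (par 𝒱) b t)

section

variable [CharZero 𝕜] {𝒱 : ℤ → Submodule 𝕜 V} [DirectSum.Decomposition 𝒱]
  {𝒲 : ℤ → Submodule 𝕜 W} [DirectSum.Decomposition 𝒲]
  {S : ℕ → Submodule 𝕜 (Tens 𝕜 V)} {I : Submodule 𝕜 (Tens 𝕜 V)}
  {S' : ℕ → Submodule 𝕜 (Tens 𝕜 W)} {I' : Submodule 𝕜 (Tens 𝕜 W)}

theorem IsPartial.exists_succ
    (hS : IsAdmissible (par 𝒱) S I) (hS' : IsAdmissible (par 𝒲) S' I')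
    (hSS : IsAdmissibleMap (par 𝒱) (par 𝒲) S S' I I')
    (hSS' : IsAdmissibleMap (par 𝒲) (par 𝒱) S' S I' I) {b : Tens 𝕜 V →ₗ[𝕜] V}
    (hb : IsTDeg (dgr 𝒱) (par 𝒱) (dgr 𝒱) (par 𝒱) (-1) b) (hb1 : b 1 = 0) (hbI : ∀ t ∈ I, b t = 0)
    {dV : V →ₗ[𝕜] V} {dW : W →ₗ[𝕜] W} {F : V →ₗ[𝕜] W} (hV : IsDifferential 𝒱 dV)
    (hW : IsDifferential 𝒲 dW) (hF : IsHom 𝒱 𝒲 0 F) (hq : IsQuasiIso dV dW F)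
    (hbι : b ∘ₗ ι 𝕜 = dV) (hbb : ∀ k, ∀ t ∈ S k, b (cod (par 𝒱) b t) = 0) {n : ℕ} (hn : 1 ≤ n)
    {c : Tens 𝕜 W →ₗ[𝕜] W} {f : Tens 𝕜 V →ₗ[𝕜] W}
    (h : IsPartial 𝒱 𝒲 S I S' I' b dW F n c f) :
    ∃ c' f', IsPartial 𝒱 𝒲 S I S' I' b dW F (n + 1) c' f' ∧ AgreeUpTo n c' c ∧
      AgreeUpTo n f' f := by
  obtain ⟨φ, hφ⟩ := exists_coext f h.f_one
  obtain ⟨c', hc', f', hf', hcc', hr'⟩ := exists_arity_extension hS hS' hSS hSS' hb hb1 hbI h.c_deg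
    h.c_one h.c_vanish h.f_deg h.f_one h.f_vanish hV hW hF hq hbι h.c_ι h.f_ι hbb (n := n + 1)
    (by lia) (fun k hk => h.c_sq k (by lia)) hφ
    (fun k hk t ht => sub_eq_zero.2 (h.f_map k (by lia) t ht φ hφ))
  have hR : AgreeUpTo n (c + c') c := fun k hk t ht => by simp [hc'.2.1 k (by lia) t ht]
  have hR' : AgreeUpTo n (f + f') f := fun k hk t ht => by simp [hf'.2.1 k (by lia) t ht]
  refine ⟨c + c', f + f', ⟨h.c_deg.add hc'.1, h.f_deg.add hf'.1, fun t ht => ?_, fun t ht => ?_,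
    hR.one.trans h.c_one, hR'.one.trans h.f_one, ?_, ?_, fun k hk t ht => ?_,
    fun k hk t ht φ hφ => ?_⟩, hR, hR'⟩
  · rw [LinearMap.add_apply, h.c_vanish t ht, hc'.2.2 t ht, add_zero]
  · rw [LinearMap.add_apply, h.f_vanish t ht, hf'.2.2 t ht, add_zero]
  · rw [← h.c_ι]; ext x; exact hR 1 (by lia) _ (ι_mem_lenSub x)
  · rw [← h.f_ι]; ext x; exact hR' 1 (by lia) _ (ι_mem_lenSub x)
  · rcases Nat.lt_or_ge n k with hnk | hnk
    · obtain rfl : k = n + 1 := by lia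
      exact hcc' t ht
    · exact (hR.mono hnk).cod_sq_eq_zero h.c_one (hS'.le k ht) (h.c_sq k hnk t ht)
  · rcases Nat.lt_or_ge n k with hnk | hnk
    · obtain rfl : k = n + 1 := by lia
      exact sub_eq_zero.1 (hr' φ hφ t ht)
    · exact (hR.mono hnk).coext_eq (hR'.mono hnk) h.f_one hb1 (hS.le k ht)
        (fun φ hφ => h.f_map k hnk t ht φ hφ) hφ

theorem exists_infinite_extension
    (hS : IsAdmissible (par 𝒱) S I) (hS' : IsAdmissible (par 𝒲) S' I')
    (hSS : IsAdmissibleMap (par 𝒱) (par 𝒲) S S' I I')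
    (hSS' : IsAdmissibleMap (par 𝒲) (par 𝒱) S' S I' I) {b : Tens 𝕜 V →ₗ[𝕜] V}
    (hb : IsTDeg (dgr 𝒱) (par 𝒱) (dgr 𝒱) (par 𝒱) (-1) b) (hb1 : b 1 = 0) (hbI : ∀ t ∈ I, b t = 0)
    {dV : V →ₗ[𝕜] V} {dW : W →ₗ[𝕜] W} {F : V →ₗ[𝕜] W} (hV : IsDifferential 𝒱 dV)
    (hW : IsDifferential 𝒲 dW) (hF : IsHom 𝒱 𝒲 0 F) (hq : IsQuasiIso dV dW F)
    (hbι : b ∘ₗ ι 𝕜 = dV) (hbb : ∀ k, ∀ t ∈ S k, b (cod (par 𝒱) b t) = 0) {K : ℕ} (hK : 1 ≤ K)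
    {c : Tens 𝕜 W →ₗ[𝕜] W} {f : Tens 𝕜 V →ₗ[𝕜] W}
    (h : IsPartial 𝒱 𝒲 S I S' I' b dW F K c f) :
    ∃ c' f', (∀ n, IsPartial 𝒱 𝒲 S I S' I' b dW F n c' f') ∧ AgreeUpTo K c' c ∧
      AgreeUpTo K f' f := by
  classical
  obtain ⟨u, hu0, huP, huR⟩ := exists_sequence
    (fun n (s : (Tens 𝕜 W →ₗ[𝕜] W) × (Tens 𝕜 V →ₗ[𝕜] W)) =>
      IsPartial 𝒱 𝒲 S I S' I' b dW F n s.1 s.2)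
    (fun n s s' => AgreeUpTo n s'.1 s.1 ∧ AgreeUpTo n s'.2 s.2) (s := (c, f)) (K := K) h
    (fun n hn s hs => by
      obtain ⟨c', f', h', hR⟩ := hs.exists_succ hS hS' hSS hSS' hb hb1 hbI hV hW hF hq hbι hbb
        (hK.trans hn)
      exact ⟨(c', f'), h', hR⟩)
  have stab : ∀ i j, AgreeUpTo (K + i) (u (i + j)).1 (u i).1 ∧
      AgreeUpTo (K + i) (u (i + j)).2 (u i).2 := by
    intro i j
    induction j with
    | zero => exact ⟨fun _ _ _ _ => rfl, fun _ _ _ _ => rfl⟩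
    | succ j ih =>
      have h := huR (i + j)
      exact ⟨fun k hk t ht => (h.1 k (by lia) t ht).trans (ih.1 k hk t ht),
        fun k hk t ht => (h.2 k (by lia) t ht).trans (ih.2 k hk t ht)⟩
  have hs1 : ∀ n, AgreeUpTo n (glue fun k => (u k).1) (u n).1 := fun n k hk t ht => by
    have := (stab k (n - k)).1 k (by lia) t ht
    rw [Nat.add_sub_cancel' hk] at this
    rw [this]
    exact glue_of_mem _ ht
  have hs2 : ∀ n, AgreeUpTo n (glue fun k => (u k).2) (u n).2 := fun n k hk t ht => by
    have := (stab k (n - k)).2 k (by lia) t ht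
    rw [Nat.add_sub_cancel' hk] at this
    rw [this]
    exact glue_of_mem _ ht
  refine ⟨glue fun k => (u k).1, glue fun k => (u k).2, fun n => ⟨isTDeg_glue fun k => (huP k).c_deg,
    isTDeg_glue fun k => (huP k).f_deg, fun t ht => ?_, fun t ht => ?_, ?_, ?_, ?_, ?_,
    fun k _ t ht => ?_, fun k _ t ht φ hφ => ?_⟩, fun k hk t ht => ?_, fun k hk t ht => ?_⟩
  · rw [← DirectSum.sum_support_decompose (lenSub 𝕜 W) t, map_sum]
    refine Finset.sum_eq_zero fun k _ => ?_
    have h := hS'.proj_mem k t ht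
    rw [GradedAlgebra.proj_apply] at h
    exact (glue_of_mem _ (SetLike.coe_mem _)).trans ((huP k).c_vanish _ h)
  · rw [← DirectSum.sum_support_decompose (lenSub 𝕜 V) t, map_sum]
    refine Finset.sum_eq_zero fun k _ => ?_
    have h := hS.proj_mem k t ht
    rw [GradedAlgebra.proj_apply] at h
    exact (glue_of_mem _ (SetLike.coe_mem _)).trans ((huP k).f_vanish _ h)
  · exact (hs1 0).one.trans (huP 0).c_one
  · exact (hs2 0).one.trans (huP 0).f_one
  · rw [← (huP 1).c_ι]; ext x; exact hs1 1 1 le_rfl _ (ι_mem_lenSub x)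
  · rw [← (huP 1).f_ι]; ext x; exact hs2 1 1 le_rfl _ (ι_mem_lenSub x)
  · exact (hs1 k).cod_sq_eq_zero (huP k).c_one (hS'.le k ht) ((huP k).c_sq k (by lia) t ht)
  · exact (hs1 k).coext_eq (hs2 k) (huP k).f_one hb1 (hS.le k ht)
      ((huP k).f_map k (by lia) t ht) hφ
  · have h := (stab 0 k).1 k (by lia) t ht
    rw [zero_add, hu0] at h
    exact (hs1 k k le_rfl t ht).trans h
  · have h := (stab 0 k).2 k (by lia) t ht
    rw [zero_add, hu0] at h
    exact (hs2 k k le_rfl t ht).trans h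

end

end Limit

section Words

/-- The sequence `x s, x (s + 1), …`. -/
def shift {α : Type*} (s : ℕ) (x : ℕ → α) : ℕ → α := fun t => x (s + t)

@[simp] theorem shift_zero {α : Type*} (x : ℕ → α) : shift 0 x = x := by
  funext t; simp [shift]

theorem shift_shift {α : Type*} (r s : ℕ) (x : ℕ → α) : shift r (shift s x) = shift (s + r) x := by
  funext t; simp [shift, add_assoc]

/-- The sequence `v, x 0, x 1, …`. -/
def consSeq {α : Type*} (v : α) (x : ℕ → α) : ℕ → α := fun t => Nat.casesOn t v x

@[simp] theorem consSeq_zero {α : Type*} (v : α) (x : ℕ → α) : consSeq v x 0 = v := rfl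

@[simp] theorem shift_one_consSeq {α : Type*} (v : α) (x : ℕ → α) : shift 1 (consSeq v x) = x := by
  funext t; rw [shift, add_comm]; rfl

variable {𝕜 : Type*} [Field 𝕜] {V : Type*} [AddCommGroup V] [Module 𝕜 V]
  {W : Type*} [AddCommGroup W] [Module 𝕜 W]

variable (𝕜) in
/-- The tensor `x 0 ⊗ ⋯ ⊗ x (n - 1)`. -/
noncomputable def word : ℕ → (ℕ → V) → Tens 𝕜 V
  | 0, _ => 1
  | n + 1, x => ι 𝕜 (x 0) * word n (shift 1 x)

@[simp] theorem word_zero (x : ℕ → V) : word 𝕜 0 x = 1 := rfl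

theorem word_succ (n : ℕ) (x : ℕ → V) : word 𝕜 (n + 1) x = ι 𝕜 (x 0) * word 𝕜 n (shift 1 x) := rfl

@[simp] theorem word_one (x : ℕ → V) : word 𝕜 1 x = ι 𝕜 (x 0) := by simp [word_succ]

theorem word_mem (n : ℕ) (x : ℕ → V) : word 𝕜 n x ∈ lenSub 𝕜 V n := by
  induction n generalizing x with
  | zero => exact one_mem_lenSub
  | succ n ih => exact ι_mul_mem_lenSub _ (ih _)

theorem word_add (m n : ℕ) (x : ℕ → V) :
    word 𝕜 (m + n) x = word 𝕜 m x * word 𝕜 n (shift m x) := by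
  induction m generalizing x with
  | zero => simp
  | succ m ih => rw [add_right_comm, word_succ, word_succ, ih, mul_assoc, shift_shift, add_comm 1 m]

theorem word_congr {n : ℕ} {x y : ℕ → V} (h : ∀ t < n, x t = y t) : word 𝕜 n x = word 𝕜 n y := by
  induction n generalizing x y with
  | zero => rfl
  | succ n ih =>
    rw [word_succ, word_succ, h 0 n.succ_pos,
      ih (x := shift 1 x) (y := shift 1 y) fun t ht => h (1 + t) (by lia)]

theorem tprod_eq_word (n : ℕ) (x : ℕ → V) : tprod 𝕜 V n (fun t : Fin n => x t) = word 𝕜 n x := by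
  rw [TensorAlgebra.tprod_apply]
  induction n generalizing x with
  | zero => rfl
  | succ n ih =>
    rw [List.ofFn_succ, List.prod_cons, word_succ, ← ih]
    simp [shift, add_comm]

theorem deconc_word (n : ℕ) (x : ℕ → V) : deconc (word 𝕜 n x) =
    ∑ p ∈ antidiagonal n, word 𝕜 p.1 x ⊗ₜ word 𝕜 p.2 (shift p.1 x) := by
  induction n generalizing x with
  | zero => simp
  | succ n ih =>
    rw [word_succ, deconc_ι_mul, ih, Finset.Nat.sum_antidiagonal_succ, Finset.mul_sum]
    simp [word_succ, shift_shift, add_comm 1]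

theorem conv_word {A : Type*} [Ring A] [Algebra 𝕜 A] (f g : Tens 𝕜 V →ₗ[𝕜] A) (n : ℕ) (x : ℕ → V) :
    conv f g (word 𝕜 n x) = ∑ p ∈ antidiagonal n,
      f (word 𝕜 p.1 x) * g (word 𝕜 p.2 (shift p.1 x)) := by
  simp [conv_apply, deconc_word]

theorem word_replaceBlock (x : ℕ → V) (s j r : ℕ) (v : V) :
    word 𝕜 (s + (1 + r)) (replaceBlock x s j v) =
      word 𝕜 s x * (ι 𝕜 v * word 𝕜 r (shift (s + j) x)) := by
  have h1 : word 𝕜 s (replaceBlock x s j v) = word 𝕜 s x :=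
    word_congr fun t ht => by simp [replaceBlock, ht]
  have h2 : word 𝕜 r (shift 1 (shift s (replaceBlock x s j v))) = word 𝕜 r (shift (s + j) x) := by
    refine word_congr fun t _ => ?_
    simp only [shift, replaceBlock]
    rw [if_neg (by lia), if_neg (by lia)]
    congr 1; lia
  have h3 : shift s (replaceBlock x s j v) 0 = v := by simp [shift, replaceBlock]
  rw [word_add, word_add, word_one, h1, h2, h3]

end Words

section Graded

variable {𝕜 : Type*} [Field 𝕜] {V : Type*} [AddCommGroup V] [Module 𝕜 V]
  {W : Type*} [AddCommGroup W] [Module 𝕜 W] {𝒱 : ℤ → Submodule 𝕜 V} {𝒲 : ℤ → Submodule 𝕜 W}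

theorem Homogeneous.shift {d : ℕ → ℤ} {x : ℕ → V} (h : Homogeneous 𝒱 d x) (s : ℕ) :
    Homogeneous 𝒱 (StrongHomotopy.shift s d) (StrongHomotopy.shift s x) := fun t => h (s + t)

theorem Homogeneous.consSeq {d : ℕ → ℤ} {x : ℕ → V} (h : Homogeneous 𝒱 d x) {e : ℤ} {v : V}
    (hv : v ∈ 𝒱 e) : Homogeneous 𝒱 (consSeq e d) (StrongHomotopy.consSeq v x)
  | 0 => hv
  | t + 1 => h t

theorem Homogeneous.replaceBlock {d : ℕ → ℤ} {x : ℕ → V} (h : Homogeneous 𝒱 d x) (s j : ℕ) {e : ℤ}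
    {v : V} (hv : v ∈ 𝒱 e) :
    Homogeneous 𝒱 (replaceBlock d s j e) (StrongHomotopy.replaceBlock x s j v) := by
  intro t
  simp only [StrongHomotopy.replaceBlock]
  split_ifs
  exacts [h t, hv, h _]

variable [DirectSum.Decomposition 𝒱] [DirectSum.Decomposition 𝒲]

theorem lenSub_le_of_word {n : ℕ} {Q : Submodule 𝕜 (Tens 𝕜 V)}
    (h : ∀ d x, Homogeneous 𝒱 d x → word 𝕜 n x ∈ Q) : lenSub 𝕜 V n ≤ Q := by
  induction n generalizing Q with
  | zero =>
    intro t ht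
    obtain ⟨r, rfl⟩ := mem_lenSub_zero.1 ht
    exact Q.smul_mem _ (h 0 0 fun t => zero_mem _)
  | succ n ih =>
    refine lenSub_succ_le fun x w hw => ?_
    induction x using graded_induction (𝒱 := 𝒱) with
    | zero => simp
    | add v v' hv hv' => rw [map_add, add_mul]; exact add_mem hv hv'
    | mem e v hv =>
      refine ih (Q := Q.comap (LinearMap.mulLeft 𝕜 (ι 𝕜 v))) (fun d x hx => ?_) hw
      have := h _ _ (hx.consSeq hv)
      rwa [word_succ, shift_one_consSeq] at this

theorem forall_mem_lenSub_iff {N : Type*} [AddCommGroup N] [Module 𝕜 N] {g h : Tens 𝕜 V →ₗ[𝕜] N}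
    {n : ℕ} : (∀ t ∈ lenSub 𝕜 V n, g t = h t) ↔
      ∀ d x, Homogeneous 𝒱 d x → g (word 𝕜 n x) = h (word 𝕜 n x) :=
  ⟨fun H _ x _ => H _ (word_mem n x), lenSub_le_of_word (Q := LinearMap.eqLocus g h)⟩

variable (𝒱) in
theorem word_ext {N : Type*} [AddCommGroup N] [Module 𝕜 N] {f g : Tens 𝕜 V →ₗ[𝕜] N}
    (h : ∀ n d x, Homogeneous 𝒱 d x → f (word 𝕜 n x) = g (word 𝕜 n x)) : f = g :=
  len_ext fun n => forall_mem_lenSub_iff.2 (h n)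

theorem par_apply_of_mem {e : ℤ} {v : V} (hv : v ∈ 𝒱 e) : par 𝒱 v = sgn 𝕜 (e + 1) • v :=
  par_of_mem hv

theorem tmap_par_word {d : ℕ → ℤ} {x : ℕ → V} (hx : Homogeneous 𝒱 d x) (n : ℕ) :
    tmap (par 𝒱) (word 𝕜 n x) = sgn 𝕜 (∑ t ∈ Finset.range n, (d t + 1)) • word 𝕜 n x := by
  induction n generalizing d x with
  | zero => simp [sgn_zero]
  | succ n ih =>
    rw [Finset.sum_range_succ', sgn_add, word_succ, map_mul, tmap_ι, par_apply_of_mem (hx 0),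
      ih (hx.shift 1), map_smul, smul_mul_smul_comm, mul_comm]
    simp only [shift, add_comm 1]

theorem der_dgr_word {d : ℕ → ℤ} {x : ℕ → V} (hx : Homogeneous 𝒱 d x) (n : ℕ) :
    der (dgr 𝒱) (word 𝕜 n x) =
      ((∑ t ∈ Finset.range n, (d t + 1) : ℤ) : 𝕜) • word 𝕜 n x := by
  induction n generalizing d x with
  | zero => simp [der]
  | succ n ih =>
    have h := cod_linear_ι_mul LinearMap.id (dgr 𝒱) (x 0) (word 𝕜 n (shift 1 x))
    have h' := ih (hx.shift 1)
    unfold der at h' ⊢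
    rw [Finset.sum_range_succ', Int.cast_add, add_smul, word_succ, h, h', dgr_of_mem (hx 0), add_comm,
      map_smul, smul_mul_assoc, LinearMap.id_apply, mul_smul_comm]
    simp only [shift, add_comm 1]

theorem mem_of_dgr_eq [CharZero 𝕜] {v : V} {e : ℤ} (h : dgr 𝒱 v = ((e + 1 : ℤ) : 𝕜) • v) :
    v ∈ 𝒱 e := by
  have h0 : v - hcomp 𝒱 e v = 0 := by
    refine eq_zero_of_hcomp (𝒱 := 𝒱) fun k => ?_
    by_cases hk : k = e
    · subst hk; rw [map_sub, hcomp_of_mem 𝒱 (hcomp_mem 𝒱 k v), sub_self]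
    rw [map_sub, hcomp_of_mem_ne 𝒱 (hcomp_mem 𝒱 e v) (Ne.symm hk), sub_zero]
    have h1 : hcomp 𝒱 k (dgr 𝒱 v) = ((k + 1 : ℤ) : 𝕜) • hcomp 𝒱 k v := by
      have : hcomp 𝒱 k ∘ₗ dgr 𝒱 = ((k + 1 : ℤ) : 𝕜) • hcomp 𝒱 k := by
        refine graded_ext (𝒱 := 𝒱) fun e v hv => ?_
        rw [LinearMap.comp_apply, dgr_of_mem hv, map_smul, LinearMap.smul_apply]
        by_cases he : e = k
        · rw [he]
        · rw [hcomp_of_mem_ne 𝒱 hv he, smul_zero, smul_zero]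
      exact LinearMap.congr_fun this v
    rw [h, map_smul, ← sub_eq_zero, ← sub_smul, smul_eq_zero, ← Int.cast_sub, Int.cast_eq_zero] at h1
    exact h1.resolve_left (by lia)
  rw [sub_eq_zero.1 h0]
  exact hcomp_mem 𝒱 e v

/-! ### Operations and linear maps on the tensor algebra -/

/-- The exponent of the sign relating an operation to its suspension. -/
def tw (n : ℕ) (d : ℕ → ℤ) : ℤ := ∑ t ∈ Finset.range n, ((n : ℤ) - 1 - t) * d t

theorem tw_add (m n : ℕ) (d : ℕ → ℤ) :
    tw (m + n) d = tw m d + n * ∑ t ∈ Finset.range m, d t + tw n (shift m d) := by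
  unfold tw shift
  rw [Finset.sum_range_add, Finset.mul_sum, ← Finset.sum_add_distrib]
  congr 1
  · refine Finset.sum_congr rfl fun t _ => ?_
    push_cast; ring
  · refine Finset.sum_congr rfl fun t _ => ?_
    push_cast; ring

theorem tw_congr {n : ℕ} {d d' : ℕ → ℤ} (h : ∀ t < n, d t = d' t) : tw n d = tw n d' :=
  Finset.sum_congr rfl fun t ht => by rw [h t (Finset.mem_range.1 ht)]

@[simp] theorem tw_one (d : ℕ → ℤ) : tw 1 d = 0 := by simp [tw]

@[simp] theorem tw_zero (d : ℕ → ℤ) : tw 0 d = 0 := by simp [tw]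

theorem tw_replaceBlock (d : ℕ → ℤ) (s j r : ℕ) (e : ℤ) (hj : 1 ≤ j) :
    tw (s + (1 + r)) (replaceBlock d s j e) = tw s d + (1 + r) * ∑ t ∈ Finset.range s, d t +
      r * e + tw r (shift (s + j) d) := by
  have h1 : ∀ t < s, replaceBlock d s j e t = d t := fun t ht => by simp [replaceBlock, ht]
  have h2 : tw r (shift 1 (shift s (replaceBlock d s j e))) = tw r (shift (s + j) d) := by
    refine tw_congr fun t _ => ?_
    simp only [shift, replaceBlock]
    rw [if_neg (by lia), if_neg (by lia)]
    congr 1; lia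
  have h3 : shift s (replaceBlock d s j e) 0 = e := by simp [shift, replaceBlock]
  rw [tw_add, tw_add, tw_congr h1, h2, tw_one, Finset.sum_range_one, h3,
    Finset.sum_congr rfl fun t ht => h1 t (Finset.mem_range.1 ht)]
  push_cast; ring

/-- `f` is the linear map on the tensor algebra of the suspension of `V` whose component of
length `n` corresponds to `κ n` times the operation `F n`. -/
def Represents (𝒱 : ℤ → Submodule 𝕜 V) (κ : ℕ → 𝕜) (F : Ops 𝕜 V W) (f : Tens 𝕜 V →ₗ[𝕜] W) : Prop :=
  ∀ n d x, Homogeneous 𝒱 d x → f (word 𝕜 n x) = (κ n * sgn 𝕜 (tw n d)) • ev (F n) x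

variable (𝒱) in
/-- The signs that twist a multilinear map by the suspension. -/
noncomputable def twistOp {n : ℕ} (F : MultilinearMap 𝕜 (fun _ : Fin n => V) W) :
    MultilinearMap 𝕜 (fun _ : Fin n => V) W :=
  F.compLinearMap fun t => ((-par 𝒱 : V →ₗ[𝕜] V) : Module.End 𝕜 V) ^ (n - 1 - (t : ℕ))

theorem neg_par_pow {e : ℤ} {v : V} (hv : v ∈ 𝒱 e) (k : ℕ) :
    (((-par 𝒱 : V →ₗ[𝕜] V) : Module.End 𝕜 V) ^ k) v = sgn 𝕜 (k * e) • v := by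
  induction k with
  | zero => simp [sgn_zero]
  | succ k ih =>
    rw [pow_succ', Module.End.mul_apply, ih, map_smul, LinearMap.neg_apply, par_apply_of_mem hv,
      Nat.cast_succ, add_mul, one_mul, sgn_add, sgn_add, sgn_odd odd_one, mul_neg_one, neg_smul,
      neg_neg, smul_smul]

theorem ev_twistOp {n : ℕ} (F : MultilinearMap 𝕜 (fun _ : Fin n => V) W) {d : ℕ → ℤ} {x : ℕ → V}
    (hx : Homogeneous 𝒱 d x) : ev (twistOp 𝒱 F) x = sgn 𝕜 (tw n d) • ev F x := by
  have hs : ∀ (s : Finset (Fin n)) (g : Fin n → ℤ), sgn 𝕜 (∑ t ∈ s, g t) = ∏ t ∈ s, sgn 𝕜 (g t) := by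
    intro s g
    classical
    induction s using Finset.induction_on with
    | empty => simp [sgn_zero]
    | insert a s ha ih => rw [Finset.sum_insert ha, Finset.prod_insert ha, sgn_add, ih]
  unfold ev twistOp
  rw [MultilinearMap.compLinearMap_apply, tw, Finset.sum_range, hs, ← MultilinearMap.map_smul_univ]
  congr 1
  funext t
  rw [neg_par_pow (hx t)]
  congr 2
  have := t.2
  rw [Nat.cast_sub (by lia), Nat.cast_sub (by lia)]; push_cast; ring

theorem exists_represents (κ : ℕ → 𝕜) (F : Ops 𝕜 V W) :
    ∃ f : Tens 𝕜 V →ₗ[𝕜] W, Represents 𝒱 κ F f := by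
  refine ⟨DirectSum.toModule 𝕜 ℕ W (fun n => κ n • PiTensorProduct.lift (twistOp 𝒱 (F n))) ∘ₗ
    (TensorAlgebra.toDirectSum (R := 𝕜) (M := V)).toLinearMap, fun n d x hx => ?_⟩
  rw [LinearMap.comp_apply, AlgHom.toLinearMap_apply, ← tprod_eq_word,
    TensorAlgebra.toDirectSum_tensorPower_tprod, ← DirectSum.lof_eq_of 𝕜, DirectSum.toModule_lof,
    LinearMap.smul_apply, PiTensorProduct.lift.tprod, mul_smul, ← ev_twistOp _ hx]
  rfl

variable (𝒱) in
/-- The operations given by a linear map on the tensor algebra. -/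
noncomputable def toOps (κ : ℕ → 𝕜) (f : Tens 𝕜 V →ₗ[𝕜] W) : Ops 𝕜 V W := fun n =>
  κ n • twistOp 𝒱 (f.compMultilinearMap (tprod 𝕜 V n))

theorem ev_toOps (κ : ℕ → 𝕜) (f : Tens 𝕜 V →ₗ[𝕜] W) (n : ℕ) {d : ℕ → ℤ} {x : ℕ → V}
    (hx : Homogeneous 𝒱 d x) :
    ev (toOps 𝒱 κ f n) x = (κ n * sgn 𝕜 (tw n d)) • f (word 𝕜 n x) := by
  rw [mul_smul, ← tprod_eq_word]
  exact congrArg (κ n • ·) (ev_twistOp (f.compMultilinearMap (tprod 𝕜 V n)) hx)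

variable {κ κ' : ℕ → 𝕜} {F : Ops 𝕜 V W} {f : Tens 𝕜 V →ₗ[𝕜] W}

theorem Represents.mem (hf : Represents 𝒱 κ F f) {n : ℕ} {e : ℤ} (hF : HasDegree 𝒱 𝒲 (F n) e)
    {d : ℕ → ℤ} {x : ℕ → V} (hx : Homogeneous 𝒱 d x) :
    f (word 𝕜 n x) ∈ 𝒲 (∑ t ∈ Finset.range n, d t + e) := by
  rw [hf n d x hx]; exact Submodule.smul_mem _ _ (hF d x hx)

theorem isTDeg_of_mem {p : ℤ} (h : ∀ n d x, Homogeneous 𝒱 d x →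
    f (word 𝕜 n x) ∈ 𝒲 (∑ t ∈ Finset.range n, d t + (n - 1 + p))) :
    IsTDeg (dgr 𝒱) (par 𝒱) (dgr 𝒲) (par 𝒲) p f where
  deg := word_ext 𝒱 fun n d x hx => by
    rw [LinearMap.sub_apply, LinearMap.comp_apply, LinearMap.comp_apply, LinearMap.smul_apply,
      der_dgr_word hx, dgr_of_mem (h n d x hx), map_smul, ← sub_smul, ← Int.cast_sub,
      Finset.sum_add_distrib]
    congr 2; simp; ring
  par := word_ext 𝒱 fun n d x hx => by
    rw [LinearMap.comp_apply, LinearMap.smul_apply, LinearMap.comp_apply, AlgHom.toLinearMap_apply,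
      tmap_par_word hx, par_apply_of_mem (h n d x hx), map_smul, smul_smul, Finset.sum_add_distrib]
    congr 1
    have : ∑ t ∈ Finset.range n, d t + ((n : ℤ) - 1 + p) + 1 = ∑ t ∈ Finset.range n, d t +
        ∑ t ∈ Finset.range n, 1 + p := by simp; ring
    rw [this, sgn_add _ p, mul_comm, mul_assoc, sgn_mul_self, mul_one]

theorem mem_of_isTDeg [CharZero 𝕜] {p : ℤ} (hf : IsTDeg (dgr 𝒱) (par 𝒱) (dgr 𝒲) (par 𝒲) p f)
    {n : ℕ} {d : ℕ → ℤ} {x : ℕ → V} (hx : Homogeneous 𝒱 d x) :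
    f (word 𝕜 n x) ∈ 𝒲 (∑ t ∈ Finset.range n, d t + (n - 1 + p)) := by
  refine mem_of_dgr_eq ?_
  rw [hf.deg_apply, der_dgr_word hx, map_smul, ← add_smul, ← Int.cast_add, Finset.sum_add_distrib]
  congr 2; simp; ring

theorem Represents.isTDeg (hf : Represents 𝒱 κ F f) {p : ℤ}
    (hF : ∀ n : ℕ, HasDegree 𝒱 𝒲 (F n) (n - 1 + p)) :
    IsTDeg (dgr 𝒱) (par 𝒱) (dgr 𝒲) (par 𝒲) p f :=
  isTDeg_of_mem fun n _ _ hx => hf.mem (hF n) hx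

theorem Represents.apply_one (hf : Represents 𝒱 κ F f) (h0 : F 0 = 0) : f 1 = 0 := by
  have := hf 0 0 0 fun _ => zero_mem _
  simpa [h0, ev] using this

end Graded

section Insertions

theorem sum_antidiagonal_antidiagonal {M : Type*} [AddCommMonoid M] (n : ℕ) {T : ℕ → ℕ → ℕ → M}
    (h0 : ∀ s r, T s 0 r = 0) :
    ∑ p ∈ antidiagonal n, ∑ q ∈ antidiagonal p.2,
      T p.1 q.1 q.2 = ∑ ij ∈ antidiagonal (n + 1) with 1 ≤ ij.1 ∧ 1 ≤ ij.2,
        ∑ s ∈ Finset.range ij.1, T s ij.2 (ij.1 - 1 - s) := by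
  have h1 : ∀ p : ℕ × ℕ, ∑ q ∈ antidiagonal p.2, T p.1 q.1 q.2 =
      ∑ q ∈ antidiagonal p.2 with 1 ≤ q.1, T p.1 q.1 q.2 := by
    intro p
    rw [Finset.sum_filter]
    refine Finset.sum_congr rfl fun q _ => ?_
    split_ifs with h
    · rfl
    · rw [show q.1 = 0 by lia, h0]
  simp only [h1]
  rw [Finset.sum_sigma', Finset.sum_sigma']
  refine Finset.sum_nbij' (fun a => ⟨(a.1.1 + 1 + a.2.2, a.2.1), a.1.1⟩)
    (fun a => ⟨(a.2, n - a.2), (a.1.2, a.1.1 - 1 - a.2)⟩) ?_ ?_ ?_ ?_ ?_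
  · rintro ⟨⟨a, b⟩, c, d⟩ h
    simp only [Finset.mem_sigma, mem_antidiagonal, Finset.mem_filter, Finset.mem_range] at *
    lia
  · rintro ⟨⟨a, b⟩, c⟩ h
    simp only [Finset.mem_sigma, mem_antidiagonal, Finset.mem_filter, Finset.mem_range] at *
    lia
  · rintro ⟨⟨a, b⟩, c, d⟩ h
    simp only [Finset.mem_sigma, mem_antidiagonal, Finset.mem_filter] at h
    simp only [Sigma.mk.injEq, Prod.mk.injEq, heq_eq_eq, true_and]
    lia
  · rintro ⟨⟨a, b⟩, c⟩ h
    simp only [Finset.mem_sigma, mem_antidiagonal, Finset.mem_filter, Finset.mem_range] at h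
    simp only [Sigma.mk.injEq, Prod.mk.injEq, heq_eq_eq, and_true]
    lia
  · rintro ⟨⟨a, b⟩, c, d⟩ h
    congr 1
    simp only
    lia

variable {𝕜 : Type*} [Field 𝕜] {V : Type*} [AddCommGroup V] [Module 𝕜 V]
  {W : Type*} [AddCommGroup W] [Module 𝕜 W]

theorem sgn_congr {a b : ℤ} (h : Even (a - b)) : sgn 𝕜 a = sgn 𝕜 b := by
  have : sgn 𝕜 a = sgn 𝕜 (a - b) * sgn 𝕜 b := by rw [← sgn_add, sub_add_cancel]
  rw [this, sgn_even h, one_mul]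

theorem sgn_neg (a : ℤ) : sgn 𝕜 (-a) = sgn 𝕜 a := sgn_congr ⟨-a, by ring⟩

theorem neg_one_pow_smul (k : ℕ) (v : V) : (-1 : ℤˣ) ^ k • v = sgn 𝕜 k • v := by
  rw [← units_smul_eq_sgn, Int.negOnePow_def, zpow_natCast]

variable {𝒱 : ℤ → Submodule 𝕜 V} {𝒲 : ℤ → Submodule 𝕜 W} [DirectSum.Decomposition 𝒱]
  [DirectSum.Decomposition 𝒲] {κ κ' : ℕ → 𝕜} {F : Ops 𝕜 V W} {f : Tens 𝕜 V →ₗ[𝕜] W}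
  {m : Ops 𝕜 V V} {b : Tens 𝕜 V →ₗ[𝕜] V}

theorem Represents.apply_insert (hf : Represents 𝒱 κ F f) (hb : Represents 𝒱 κ' m b) {j : ℕ}
    (hm : HasDegree 𝒱 𝒱 (m j) (j - 2)) (hj : 1 ≤ j) (s r : ℕ) {d : ℕ → ℤ} {x : ℕ → V}
    (hx : Homogeneous 𝒱 d x) :
    sgn 𝕜 (∑ t ∈ Finset.range s, (d t + 1)) •
      f (word 𝕜 s x * (ι 𝕜 (b (word 𝕜 j (shift s x))) * word 𝕜 r (shift (s + j) x))) =
      (sgn 𝕜 (tw (s + j + r) d) * (κ (s + (1 + r)) * κ' j * sgn 𝕜 (s + r * j))) •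
        insertOp (F (s + (1 + r))) (m j) (j - 2) s d x := by
  have hv := hm _ _ (hx.shift s)
  rw [hb j _ _ (hx.shift s), map_smul, smul_mul_assoc, mul_smul_comm,
    ← word_replaceBlock x s j r (ev (m j) (shift s x)), map_smul, hf _ _ _ (hx.replaceBlock s j hv),
    insertOp, units_smul_eq_sgn (𝕜 := 𝕜), smul_smul, smul_smul, smul_smul, tw_replaceBlock _ _ _ _ _ hj,
    tw_add, tw_add]
  simp only [Finset.sum_range_add, Finset.sum_add_distrib]
  change _ • ev (F (s + (1 + r))) (replaceBlock x s j (ev (m j) (shift s x))) =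
    _ • ev (F (s + (1 + r))) (replaceBlock x s j (ev (m j) (shift s x)))
  congr 1
  set A := ∑ t ∈ Finset.range s, d t
  have hB : ∑ t ∈ Finset.range j, shift s d t = ∑ t ∈ Finset.range j, d (s + t) := rfl
  rw [hB]
  set B := ∑ t ∈ Finset.range j, d (s + t)
  simp only [Finset.sum_const, Finset.card_range, nsmul_eq_mul, mul_one]
  have e : ∀ p q u v z w : ℤ, Even (p + q + u - (v + z + w)) →
      sgn 𝕜 p * (κ' j * sgn 𝕜 q) * (κ (s + (1 + r)) * sgn 𝕜 u) =
      sgn 𝕜 v * (κ (s + (1 + r)) * κ' j * sgn 𝕜 z) * sgn 𝕜 w := by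
    intro p q u v z w h
    have := sgn_congr (𝕜 := 𝕜) h
    rw [sgn_add, sgn_add, sgn_add, sgn_add] at this
    linear_combination κ' j * κ (s + (1 + r)) * this
  refine e _ _ _ _ _ _ ⟨A * (2 - j) - r, ?_⟩
  push_cast
  ring

theorem Represents.apply_cod_word (hf : Represents 𝒱 κ F f) (hb : Represents 𝒱 κ' m b)
    (hm0 : m 0 = 0) (hm : ∀ j : ℕ, HasDegree 𝒱 𝒱 (m j) (j - 2)) (n : ℕ) {d : ℕ → ℤ} {x : ℕ → V}
    (hx : Homogeneous 𝒱 d x) :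
    f (cod (par 𝒱) b (word 𝕜 n x)) = sgn 𝕜 (tw n d) •
      ∑ ij ∈ antidiagonal (n + 1) with 1 ≤ ij.1 ∧ 1 ≤ ij.2,
        ∑ s ∈ Finset.range ij.1, (κ ij.1 * κ' ij.2 * sgn 𝕜 (s + (ij.1 - 1 - s) * ij.2)) •
          insertOp (F ij.1) (m ij.2) (ij.2 - 2) s d x := by
  have hb1 := hb.apply_one hm0
  rw [cod_eq_conv, conv_word, map_sum]
  simp only [conv_word, Finset.mul_sum, map_sum, AlgHom.toLinearMap_apply, tmap_par_word hx,
    smul_mul_assoc, map_smul, LinearMap.comp_apply, LinearMap.id_apply, shift_shift]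
  rw [sum_antidiagonal_antidiagonal n (T := fun s j r => sgn 𝕜 (∑ t ∈ Finset.range s, (d t + 1)) •
      f (word 𝕜 s x * (ι 𝕜 (b (word 𝕜 j (shift s x))) * word 𝕜 r (shift (s + j) x))))
      (fun s r => by simp [hb1]), Finset.smul_sum]
  refine Finset.sum_congr rfl fun ij hij => ?_
  rw [Finset.smul_sum]
  refine Finset.sum_congr rfl fun s hs => ?_
  obtain ⟨i, j⟩ := ij
  simp only [Finset.mem_filter, mem_antidiagonal, Finset.mem_range] at hij hs
  obtain ⟨r, rfl⟩ : ∃ r, i = s + (1 + r) := ⟨i - s - 1, by lia⟩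
  have e1 : s + (1 + r) - 1 - s = r := by lia
  have e2 : n = s + j + r := by lia
  subst e2
  simp only [e1]
  rw [hf.apply_insert hb (hm j) hij.2.2 s r hx, smul_smul]
  congr 4
  push_cast; ring

theorem homDiff_eq (dV : V →ₗ[𝕜] V) (dW : W →ₗ[𝕜] W) {n : ℕ}
    (g : MultilinearMap 𝕜 (fun _ : Fin n => V) W) (p : ℤ) (d : ℕ → ℤ) (x : ℕ → V) :
    homDiff dV dW g p d x = dW (ev g x) - sgn 𝕜 p • ∑ s ∈ Finset.range n,
      insertOp g (MultilinearMap.ofSubsingleton 𝕜 V V (0 : Fin 1) dV) (-1) s d x := by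
  unfold homDiff
  rw [units_smul_eq_sgn (𝕜 := 𝕜)]
  congr 2
  refine Finset.sum_congr rfl fun s _ => ?_
  rw [insertOp, units_smul_eq_sgn (𝕜 := 𝕜), units_smul_eq_sgn (𝕜 := 𝕜), neg_one_mul, sgn_neg]
  congr 2
  funext t
  simp only [replaceBlock, ev, MultilinearMap.ofSubsingleton_apply_apply, Function.update_apply]
  split_ifs with h1 h2 h2
  · lia
  · rfl
  · simp
  · congr 1

/-- The unary operation given by a linear map. -/
theorem ev_ofSubsingleton (g : V →ₗ[𝕜] W) (x : ℕ → V) :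
    ev (MultilinearMap.ofSubsingleton 𝕜 V W (0 : Fin 1) g) x = g (x 0) := by
  simp [ev]

end Insertions

section Compositions

theorem sum_composition_zero {M : Type*} [AddCommMonoid M] (G : List ℕ → M) :
    ∑ c : Composition 0, G c.blocks = G [] := by
  have h : ∀ c : Composition 0, c.blocks = [] := fun c =>
    List.length_eq_zero_iff.1 (Nat.le_zero.1 c.length_le)
  rw [Fintype.sum_eq_single (Composition.ones 0) fun c hc =>
    absurd (Composition.ext ((h c).trans (h _).symm)) hc, h]

theorem sum_composition_succ {M : Type*} [AddCommMonoid M] (n : ℕ) (G : List ℕ → M) :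
    ∑ c : Composition (n + 1), G c.blocks = ∑ p ∈ antidiagonal n,
      ∑ c : Composition p.2, G ((p.1 + 1) :: c.blocks) := by
  rw [Finset.sum_sigma']
  symm
  refine Finset.sum_bij (fun a ha => ⟨(a.1.1 + 1) :: a.2.blocks, ?_, ?_⟩) ?_ ?_ ?_ ?_
  · intro i hi
    rcases List.mem_cons.1 hi with rfl | hi
    · lia
    · exact a.2.blocks_pos hi
  · simp only [Finset.mem_sigma, mem_antidiagonal] at ha
    rw [List.sum_cons, a.2.blocks_sum]; lia
  · intro a ha; exact Finset.mem_univ _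
  · rintro ⟨⟨r, q⟩, c⟩ ha ⟨⟨r', q'⟩, c'⟩ ha' h
    simp only [Composition.mk.injEq, List.cons.injEq] at h
    simp only [Finset.mem_sigma, mem_antidiagonal] at ha ha'
    obtain rfl : r = r' := by lia
    obtain rfl : q = q' := by lia
    obtain rfl : c = c' := Composition.ext h.2
    rfl
  · rintro ⟨l, hl, hs⟩ -
    cases l with
    | nil => simp at hs
    | cons r l =>
      have hr := hl (i := r) (by simp)
      rw [List.sum_cons] at hs
      exact ⟨⟨(r - 1, l.sum), ⟨l, fun {i} hi => hl (by simp [hi]), rfl⟩⟩,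
        by simp only [Finset.mem_sigma, mem_antidiagonal, Finset.mem_univ, and_true]; lia,
        by simp only [Composition.mk.injEq, List.cons.injEq, and_true]; lia⟩
  · intro a ha; rfl

variable {𝕜 : Type*} [Field 𝕜] {V : Type*} [AddCommGroup V] [Module 𝕜 V]
  {W : Type*} [AddCommGroup W] [Module 𝕜 W]

/-- The sequence of the values of `f` at the blocks of `x` of lengths `l`. -/
noncomputable def blockSeq (f : Tens 𝕜 V →ₗ[𝕜] W) (l : List ℕ) (x : ℕ → V) : ℕ → W :=
  fun a => f (word 𝕜 (l.getD a 0) (shift (l.take a).sum x))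

theorem shift_one_blockSeq (f : Tens 𝕜 V →ₗ[𝕜] W) (r : ℕ) (l : List ℕ) (x : ℕ → V) :
    shift 1 (blockSeq f (r :: l) x) = blockSeq f l (shift r x) := by
  funext a
  change blockSeq f (r :: l) x (1 + a) = _
  rw [add_comm 1]
  simp [blockSeq, shift_shift]

theorem coext_word {f : Tens 𝕜 V →ₗ[𝕜] W} (hf : f 1 = 0) {φ : Tens 𝕜 V →ₗ[𝕜] Tens 𝕜 W}
    (hφ : φ = cunit _ + conv (ι 𝕜 ∘ₗ f) φ) (n : ℕ) (x : ℕ → V) :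
    φ (word 𝕜 n x) = ∑ c : Composition n, word 𝕜 c.length (blockSeq f c.blocks x) := by
  have key := fun n x => LinearMap.congr_fun hφ (word 𝕜 n x)
  simp only [LinearMap.add_apply, conv_word, LinearMap.comp_apply] at key
  induction n using Nat.strong_induction_on generalizing x with
  | _ n ih =>
  rw [key]
  cases n with
  | zero =>
    rw [sum_composition_zero fun l => word 𝕜 l.length (blockSeq f l x)]
    simp [hf]
  | succ n =>
    rw [sum_composition_succ n fun l => word 𝕜 l.length (blockSeq f l x),
      cunit_of_mem n.succ_ne_zero (word_mem _ _), zero_add, Finset.Nat.sum_antidiagonal_succ]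
    simp only [word_zero, hf, map_zero, zero_mul, zero_add]
    refine Finset.sum_congr rfl fun p hp => ?_
    rw [mem_antidiagonal] at hp
    rw [ih p.2 (by lia), Finset.mul_sum]
    refine Finset.sum_congr rfl fun c _ => ?_
    rw [List.length_cons, word_succ c.blocks.length, shift_one_blockSeq]
    simp [blockSeq, Composition.length]

/-! ### Signs -/

/-- The degrees of `blockSeq`. -/
def blockDeg (l : List ℕ) (d : ℕ → ℤ) : ℕ → ℤ := fun a =>
  ∑ t ∈ Finset.range (l.getD a 0), shift (l.take a).sum d t + ((l.getD a 0 : ℤ) - 1)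

theorem shift_one_blockDeg (r : ℕ) (l : List ℕ) (d : ℕ → ℤ) :
    shift 1 (blockDeg (r :: l) d) = blockDeg l (shift r d) := by
  funext a
  simp [blockDeg, shift, add_comm 1, add_assoc]

theorem sum_getD (l : List ℕ) : ∑ a ∈ Finset.range l.length, ((l.getD a 0 : ℤ) - 1) =
    l.sum - l.length := by
  induction l with
  | nil => simp
  | cons r l ih =>
    rw [List.length_cons, Finset.sum_range_succ']
    simp only [List.getD_cons_succ, List.getD_cons_zero, ih, List.sum_cons]
    push_cast; ring

theorem tw_blocks (l : List ℕ) (d : ℕ → ℤ) : tw l.sum d = tw l.length (blockDeg l d) +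
    ∑ a ∈ Finset.range l.length, tw (l.getD a 0) (shift (l.take a).sum d) +
    ∑ a ∈ Finset.range l.length, ((l.getD a 0 : ℤ) - 1) * ∑ t ∈ Finset.range (l.take a).sum, d t -
    ∑ a ∈ Finset.range l.length, ((l.length : ℤ) - 1 - a) * ((l.getD a 0 : ℤ) - 1) := by
  induction l generalizing d with
  | nil => simp
  | cons r l ih =>
    have h1 : ∑ a ∈ Finset.range l.length,
        ((l.getD a 0 : ℤ) - 1) * ∑ t ∈ Finset.range (r + (l.take a).sum), d t =
        (l.sum - l.length) * ∑ t ∈ Finset.range r, d t + ∑ a ∈ Finset.range l.length,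
          ((l.getD a 0 : ℤ) - 1) * ∑ t ∈ Finset.range (l.take a).sum, shift r d t := by
      rw [← sum_getD, Finset.sum_mul, ← Finset.sum_add_distrib]
      refine Finset.sum_congr rfl fun a _ => ?_
      rw [Finset.sum_range_add, mul_add]; rfl
    have h2 : blockDeg (r :: l) d 0 = ∑ t ∈ Finset.range r, d t + (r - 1) := by simp [blockDeg, shift]
    rw [List.length_cons, add_comm l.length, tw_add, tw_one, shift_one_blockDeg, List.sum_cons, tw_add,
      ih (shift r d), add_comm 1]
    simp only [Finset.sum_range_succ' _ l.length, List.getD_cons_succ, List.getD_cons_zero,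
      List.take_succ_cons, List.take_zero, List.sum_cons, List.sum_nil, Finset.sum_range_one, h2,
      Finset.sum_range_zero, mul_zero, shift_zero, h1, shift_shift, Nat.cast_add, Nat.cast_one,
      Nat.cast_zero]
    have h3 : ∀ a : ℕ, ((l.length : ℤ) + 1 - 1 - (a + 1)) = (l.length : ℤ) - 1 - a := by intro a; ring
    simp only [h3]
    ring

variable {𝒱 : ℤ → Submodule 𝕜 V} {𝒲 : ℤ → Submodule 𝕜 W} [DirectSum.Decomposition 𝒱]
  [DirectSum.Decomposition 𝒲] {κ κ' : ℕ → 𝕜} {F : Ops 𝕜 V W} {f : Tens 𝕜 V →ₗ[𝕜] W}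
  {l : Ops 𝕜 W W} {b : Tens 𝕜 W →ₗ[𝕜] W}

theorem prod_sgn (n : ℕ) (g : ℕ → ℤ) :
    ∏ a ∈ Finset.range n, sgn 𝕜 (g a) = sgn 𝕜 (∑ a ∈ Finset.range n, g a) := by
  induction n with
  | zero => simp [sgn_zero]
  | succ n ih => rw [Finset.prod_range_succ, Finset.sum_range_succ, ih, sgn_add]

theorem ev_smul {n : ℕ} (g : MultilinearMap 𝕜 (fun _ : Fin n => V) W) (r : ℕ → 𝕜) (x : ℕ → V) :
    ev g (fun t => r t • x t) = (∏ t ∈ Finset.range n, r t) • ev g x := by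
  rw [Finset.prod_range, ev, g.map_smul_univ]; rfl

theorem Represents.apply_blocks (hf : Represents 𝒱 κ F f) (hb : Represents 𝒲 κ' l b)
    (hF : ∀ n : ℕ, HasDegree 𝒱 𝒲 (F n) (n - 1)) {n : ℕ} (c : Composition n) {d : ℕ → ℤ} {x : ℕ → V}
    (hx : Homogeneous 𝒱 d x) :
    b (word 𝕜 c.length (blockSeq f c.blocks x)) = (sgn 𝕜 (tw n d) * (κ' c.length *
      (∏ a : Fin c.length, κ (c.blocksFun a)) *
      sgn 𝕜 (∑ a : Fin c.length, ((c.length : ℤ) - 1 - a) * ((c.blocksFun a : ℤ) - 1)))) •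
        composeOps l F c d x := by
  have hbf : ∀ a : Fin c.length, c.blocksFun a = c.blocks.getD a 0 := fun a =>
    (List.getD_eq_getElem _ _ a.2).symm
  have hom : Homogeneous 𝒲 (blockDeg c.blocks d) (blockSeq f c.blocks x) := fun a =>
    hf.mem (hF _) (hx.shift _)
  have h1 : blockSeq f c.blocks x = fun a =>
      (κ (c.blocks.getD a 0) * sgn 𝕜 (tw (c.blocks.getD a 0) (shift (c.blocks.take a).sum d))) •
        ev (F (c.blocks.getD a 0)) (shift (c.blocks.take a).sum x) := by
    funext a; exact hf _ _ _ (hx.shift _)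
  have h2 := tw_blocks c.blocks d
  rw [c.blocks_sum] at h2
  rw [hb _ _ _ hom, h1, ev_smul, Finset.prod_mul_distrib, prod_sgn, smul_smul, composeOps,
    units_smul_eq_sgn (𝕜 := 𝕜), smul_smul]
  have h3 : ev (l c.length) (fun a => ev (F (c.blocks.getD a 0)) (shift (c.blocks.take a).sum x)) =
      l c.length fun a => ev (F (c.blocksFun a)) fun t => x (c.sizeUpTo a + t) := by
    refine congrArg (l c.length) (funext fun a => ?_)
    rw [hbf a]
    rfl
  rw [h3]
  congr 1
  simp only [hbf]
  rw [← Finset.prod_range (fun a => κ (c.blocks.getD a 0)),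
    ← Finset.sum_range (fun a => ((c.length : ℤ) - 1 - a) * ((c.blocks.getD a 0 : ℤ) - 1))]
  have h4 : ∑ a : Fin c.length, ((c.blocks.getD a 0 : ℤ) - 1) *
      ∑ t ∈ Finset.range (c.sizeUpTo a), d t = ∑ a ∈ Finset.range c.length,
      ((c.blocks.getD a 0 : ℤ) - 1) * ∑ t ∈ Finset.range (c.blocks.take a).sum, d t := by
    rw [Finset.sum_range]; rfl
  rw [h4, h2]
  change _ * sgn 𝕜 (tw c.blocks.length (blockDeg c.blocks d)) *
    (_ * sgn 𝕜 (∑ a ∈ Finset.range c.blocks.length, _)) = _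
  simp only [Composition.blocks_length]
  set S := ∑ a ∈ Finset.range c.length, ((c.blocks.getD a 0 : ℤ) - 1) *
    ∑ t ∈ Finset.range (c.blocks.take a).sum, d t
  set C := ∑ a ∈ Finset.range c.length, ((c.length : ℤ) - 1 - a) * ((c.blocks.getD a 0 : ℤ) - 1)
  rw [sub_eq_add_neg, sgn_add, sgn_add, sgn_add, sgn_neg]
  linear_combination (-1 : 𝕜) * (κ' c.length * sgn 𝕜 (tw c.length (blockDeg c.blocks d)) *
    (∏ a ∈ Finset.range c.length, κ (c.blocks.getD a 0)) * sgn 𝕜 (∑ a ∈ Finset.range c.length,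
      tw (c.blocks.getD a 0) (shift (c.blocks.take a).sum d))) *
    (sgn 𝕜 C * sgn 𝕜 C * sgn_mul_self (𝕜 := 𝕜) S + sgn_mul_self (𝕜 := 𝕜) C)

end Compositions

section Homotopy

/-- The exponent of the sign relating an operation of arity `n` to its suspension. -/
def suspExp (n : ℤ) : ℤ := (n - 1) * (n - 2) / 2

theorem two_mul_suspExp (n : ℤ) : 2 * suspExp n = (n - 1) * (n - 2) :=
  Int.mul_ediv_cancel' (by
    have := Int.even_mul_succ_self (n - 2)
    rw [show n - 2 + 1 = n - 1 by ring, mul_comm] at this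
    exact this.two_dvd)

theorem suspExp_add (a b : ℤ) : suspExp (a + b + 1) = suspExp (a + 1) + suspExp (b + 1) + a * b := by
  refine mul_left_cancel₀ (two_ne_zero (α := ℤ)) ?_
  rw [mul_add, mul_add, two_mul_suspExp, two_mul_suspExp, two_mul_suspExp]; ring

theorem even_suspExp_blocks (l : List ℕ) : Even (suspExp l.length +
    ∑ a ∈ Finset.range l.length, suspExp (l.getD a 0) +
    ∑ a ∈ Finset.range l.length, ((l.length : ℤ) - 1 - a) * ((l.getD a 0 : ℤ) - 1) -
    (suspExp l.sum + ((∑ a : Fin l.length, ∑ b ∈ Finset.Ioi a,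
      l.getD a 0 * (l.getD b 0 + 1) : ℕ) : ℤ))) := by
  induction l with
  | nil => simp
  | cons r l ih =>
    have h1 : ∑ b : Fin l.length, (l.getD b 0 + 1) = l.sum + l.length := by
      rw [← Finset.sum_range (fun b => l.getD b 0 + 1)]
      have := sum_getD l
      rw [Finset.sum_add_distrib, Finset.sum_const, Finset.card_range, smul_eq_mul, mul_one]
      rw [Finset.sum_sub_distrib, Finset.sum_const, Finset.card_range] at this
      simp only [nsmul_eq_mul, mul_one] at this
      have h : ((∑ a ∈ Finset.range l.length, l.getD a 0 : ℕ) : ℤ) = l.sum := by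
        rw [Nat.cast_sum]; linarith
      rw [Nat.cast_inj.1 h]
    have h2 : ∑ a : Fin (l.length + 1), ∑ b ∈ Finset.Ioi a,
        (r :: l).getD a 0 * ((r :: l).getD b 0 + 1) = r * (l.sum + l.length) +
        ∑ a : Fin l.length, ∑ b ∈ Finset.Ioi a, l.getD a 0 * (l.getD b 0 + 1) := by
      rw [Fin.sum_univ_succ, Fin.sum_Ioi_zero, ← h1, Finset.mul_sum]
      simp only [Fin.sum_Ioi_succ, Fin.val_succ, List.getD_cons_succ, Fin.val_zero,
        List.getD_cons_zero]
    have h3 : suspExp ((l.length + 1 : ℕ) : ℤ) = suspExp l.length + (l.length - 1) := by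
      have := suspExp_add ((l.length : ℤ) - 1) 1
      rw [show ((l.length : ℤ) - 1 + 1 + 1) = ((l.length + 1 : ℕ) : ℤ) by push_cast; ring,
        show ((l.length : ℤ) - 1 + 1) = l.length by ring] at this
      rw [this]; simp [suspExp]
    have h4 : suspExp ((r + l.sum : ℕ) : ℤ) = suspExp r + suspExp l.sum + r * l.sum - 1 := by
      refine mul_left_cancel₀ (two_ne_zero (α := ℤ)) ?_
      rw [mul_sub, mul_add, mul_add, two_mul_suspExp, two_mul_suspExp, two_mul_suspExp]
      push_cast; ring
    change Even (suspExp ((l.length + 1 : ℕ) : ℤ) + ∑ a ∈ Finset.range (l.length + 1), _ +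
      ∑ a ∈ Finset.range (l.length + 1), (((l.length + 1 : ℕ) : ℤ) - 1 - a) * _ -
      (_ + ((∑ a : Fin (l.length + 1), ∑ b ∈ Finset.Ioi a, _ : ℕ) : ℤ)))
    rw [h2, List.sum_cons, h3, h4, Finset.sum_range_succ', Finset.sum_range_succ']
    simp only [List.getD_cons_succ, List.getD_cons_zero, Nat.cast_add, Nat.cast_mul, Nat.cast_one,
      Nat.cast_zero]
    have h5 : ∀ a : ℕ, ((l.length : ℤ) + 1 - 1 - (a + 1)) = (l.length : ℤ) - 1 - a := by
      intro a; ring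
    simp only [h5]
    obtain ⟨k, hk⟩ := ih
    refine ⟨k - r * l.sum, ?_⟩
    push_cast at hk ⊢
    linear_combination hk

variable {𝕜 : Type*} [Field 𝕜] {V : Type*} [AddCommGroup V] [Module 𝕜 V]
  {W : Type*} [AddCommGroup W] [Module 𝕜 W]

variable (𝕜) in
/-- The sign relating an operation of arity `n` to its suspension. -/
def suspSgn (n : ℕ) : 𝕜 := sgn 𝕜 (suspExp n)

theorem suspSgn_one : suspSgn 𝕜 1 = 1 := sgn_zero

theorem sgn_ne_zero (p : ℤ) : sgn 𝕜 p ≠ 0 := fun h => by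
  have := sgn_mul_self (𝕜 := 𝕜) p
  rw [h, mul_zero] at this
  exact zero_ne_one this

theorem suspSgn_ne_zero (n : ℕ) : suspSgn 𝕜 n ≠ 0 := sgn_ne_zero _

theorem sum_antidiagonal_split_right {M : Type*} [AddCommMonoid M] {n p : ℕ} (hn : p ≤ n)
    (G : ℕ × ℕ → M) :
    ∑ ij ∈ antidiagonal (n + 1) with p ≤ ij.1 ∧ 1 ≤ ij.2, G ij =
      G (n, 1) + ∑ ij ∈ antidiagonal (n + 1) with p ≤ ij.1 ∧ 2 ≤ ij.2, G ij := by
  rw [← Finset.sum_insert]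
  · refine Finset.sum_congr (Finset.ext fun ij => ?_) fun _ _ => rfl
    obtain ⟨i, j⟩ := ij
    simp only [Finset.mem_filter, Finset.mem_insert, mem_antidiagonal,
      Prod.mk.injEq]
    lia
  · simp

theorem sum_antidiagonal_split_left {M : Type*} [AddCommMonoid M] {n p : ℕ} (hn : p ≤ n)
    (G : ℕ × ℕ → M) :
    ∑ ij ∈ antidiagonal (n + 1) with 1 ≤ ij.1 ∧ p ≤ ij.2, G ij =
      G (1, n) + ∑ ij ∈ antidiagonal (n + 1) with 2 ≤ ij.1 ∧ p ≤ ij.2, G ij := by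
  rw [← Finset.sum_insert]
  · refine Finset.sum_congr (Finset.ext fun ij => ?_) fun _ _ => rfl
    obtain ⟨i, j⟩ := ij
    simp only [Finset.mem_filter, Finset.mem_insert, mem_antidiagonal,
      Prod.mk.injEq]
    lia
  · simp

theorem sum_composition_split {M : Type*} [AddCommMonoid M] {n : ℕ} (hn : 0 < n)
    (G : Composition n → M) : ∑ c : Composition n, G c =
      G (Composition.single n hn) + ∑ c : Composition n with 2 ≤ c.length, G c := by
  classical
  rw [← Finset.sum_insert]
  · refine Finset.sum_congr (Finset.ext fun c => ?_) fun _ _ => rfl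
    simp only [Finset.mem_univ, Finset.mem_insert, Finset.mem_filter, true_and, true_iff,
      Composition.eq_single_iff_length hn]
    have := c.length_pos_of_pos hn
    lia
  · simp [Composition.single_length]

variable {𝒱 : ℤ → Submodule 𝕜 V} {𝒲 : ℤ → Submodule 𝕜 W}

theorem insertOp_one_left {dV : V →ₗ[𝕜] W} {j : ℕ} (g : MultilinearMap 𝕜 (fun _ : Fin j => V) V)
    (p : ℤ) (d : ℕ → ℤ) (x : ℕ → V) :
    insertOp (MultilinearMap.ofSubsingleton 𝕜 V W (0 : Fin 1) dV) g p 0 d x = dV (ev g x) := by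
  simp [insertOp, ev_ofSubsingleton, replaceBlock]

theorem composeOps_single {dW : W →ₗ[𝕜] W} {l : Ops 𝕜 W W} {F : Ops 𝕜 V W}
    (hl : l 1 = MultilinearMap.ofSubsingleton 𝕜 W W (0 : Fin 1) dW) {n : ℕ} (hn : 0 < n)
    (d : ℕ → ℤ) (x : ℕ → V) :
    composeOps l F (Composition.single n hn) d x = dW (ev (F n) x) := by
  have h : ∀ g : Fin 1 → W, l 1 g = dW (g 0) := fun g => by rw [hl]; simp
  have h0 : ∀ t : ℤ, (t - 1) * 0 = 0 := fun t => by ring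
  unfold composeOps
  change (∑ a : Fin 1, _ : ℤ).negOnePow • l 1 (fun a : Fin 1 => _) = _
  rw [h, Fin.sum_univ_one]
  change (((n : ℤ) - 1) * ∑ t ∈ Finset.range 0, d t).negOnePow • dW (ev (F n) fun t => x (0 + t)) = _
  simp

variable [DirectSum.Decomposition 𝒱] [DirectSum.Decomposition 𝒲] {F : Ops 𝕜 V W}
  {f : Tens 𝕜 V →ₗ[𝕜] W} {m : Ops 𝕜 V V} {b : Tens 𝕜 V →ₗ[𝕜] V} {l : Ops 𝕜 W W}
  {c : Tens 𝕜 W →ₗ[𝕜] W} {κ κ' : ℕ → 𝕜} {dV : V →ₗ[𝕜] V} {dW : W →ₗ[𝕜] W}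

theorem suspSgn_insert {n i j s : ℕ} (hij : i + j = n + 1) (hs : s < i) :
    suspSgn 𝕜 i * suspSgn 𝕜 j * sgn 𝕜 ((s : ℤ) + (i - 1 - s) * j) =
      -(suspSgn 𝕜 n * sgn 𝕜 ((i + s * (j + 1) : ℕ) : ℤ)) := by
  have h := suspExp_add ((i : ℤ) - 1) ((j : ℤ) - 1)
  rw [show ((i : ℤ) - 1 + (j - 1) + 1) = n by
      have : (i : ℤ) + j = n + 1 := by exact_mod_cast hij
      linarith, sub_add_cancel, sub_add_cancel] at h
  unfold suspSgn
  rw [← sgn_add, ← sgn_add, ← sgn_add, h, ← neg_one_mul, ← sgn_odd (𝕜 := 𝕜) odd_one, ← sgn_add]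
  refine sgn_congr ⟨-s * j - 1, ?_⟩
  push_cast; ring

theorem Represents.apply_cod_word_suspSgn (hf : Represents 𝒱 (suspSgn 𝕜) F f)
    (hb : Represents 𝒱 (suspSgn 𝕜) m b) (hm0 : m 0 = 0)
    (hm : ∀ j : ℕ, HasDegree 𝒱 𝒱 (m j) (j - 2)) (n : ℕ) {d : ℕ → ℤ} {x : ℕ → V}
    (hx : Homogeneous 𝒱 d x) :
    f (cod (par 𝒱) b (word 𝕜 n x)) = -((sgn 𝕜 (tw n d) * suspSgn 𝕜 n) •
      ∑ ij ∈ antidiagonal (n + 1) with 1 ≤ ij.1 ∧ 1 ≤ ij.2,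
        ∑ s ∈ Finset.range ij.1, (-1 : ℤˣ) ^ (ij.1 + s * (ij.2 + 1)) •
          insertOp (F ij.1) (m ij.2) (ij.2 - 2) s d x) := by
  rw [hf.apply_cod_word hb hm0 hm n hx, mul_smul, ← smul_neg]
  congr 1
  rw [Finset.smul_sum, ← Finset.sum_neg_distrib]
  refine Finset.sum_congr rfl fun ij hij => ?_
  rw [Finset.smul_sum, ← Finset.sum_neg_distrib]
  refine Finset.sum_congr rfl fun s hs => ?_
  simp only [Finset.mem_filter, mem_antidiagonal] at hij
  rw [suspSgn_insert hij.1 (Finset.mem_range.1 hs), neg_one_pow_smul (𝕜 := 𝕜), neg_smul, smul_smul]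

theorem Represents.apply_coext_word_suspSgn (hf : Represents 𝒱 (suspSgn 𝕜) F f)
    (hc : Represents 𝒲 (suspSgn 𝕜) l c) (hF0 : F 0 = 0) (hF : ∀ j : ℕ, HasDegree 𝒱 𝒲 (F j) (j - 1))
    {φ : Tens 𝕜 V →ₗ[𝕜] Tens 𝕜 W} (hφ : φ = cunit _ + conv (ι 𝕜 ∘ₗ f) φ) (n : ℕ)
    {d : ℕ → ℤ} {x : ℕ → V} (hx : Homogeneous 𝒱 d x) :
    c (φ (word 𝕜 n x)) = (sgn 𝕜 (tw n d) * suspSgn 𝕜 n) • ∑ k : Composition n,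
      (-1 : ℤˣ) ^ (∑ a : Fin k.length, ∑ b ∈ Finset.Ioi a,
            k.blocksFun a * (k.blocksFun b + 1)) • composeOps l F k d x := by
  rw [coext_word (hf.apply_one hF0) hφ, map_sum, Finset.smul_sum]
  refine Finset.sum_congr rfl fun k _ => ?_
  rw [hf.apply_blocks hc hF k hx, neg_one_pow_smul (𝕜 := 𝕜), smul_smul]
  congr 1
  have hbf : ∀ a : Fin k.length, k.blocksFun a = k.blocks.getD a 0 := fun a =>
    (List.getD_eq_getElem _ _ a.2).symm
  have h : Even (suspExp k.length + ∑ a ∈ Finset.range k.length, suspExp (k.blocks.getD a 0) +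
      ∑ a ∈ Finset.range k.length, ((k.length : ℤ) - 1 - a) * ((k.blocks.getD a 0 : ℤ) - 1) -
      (suspExp k.blocks.sum + ((∑ a : Fin k.length, ∑ b ∈ Finset.Ioi a,
        k.blocks.getD a 0 * (k.blocks.getD b 0 + 1) : ℕ) : ℤ))) := even_suspExp_blocks k.blocks
  rw [k.blocks_sum] at h
  simp only [hbf]
  rw [← Finset.prod_range (fun a => suspSgn 𝕜 (k.blocks.getD a 0)),
    ← Finset.sum_range (fun a => ((k.length : ℤ) - 1 - a) * ((k.blocks.getD a 0 : ℤ) - 1))]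
  unfold suspSgn
  rw [prod_sgn, mul_assoc (sgn 𝕜 (tw n d)), ← sgn_add, ← sgn_add, sgn_congr h, sgn_add]

/-- The linear map that represents the operations of an `A(K)`-algebra squares to zero in the lengths
in which the relations hold. -/
theorem Represents.apply_sq (hb : Represents 𝒱 (suspSgn 𝕜) m b) (hm0 : m 0 = 0)
    (hm1 : m 1 = MultilinearMap.ofSubsingleton 𝕜 V V (0 : Fin 1) dV)
    (hm : ∀ j : ℕ, HasDegree 𝒱 𝒱 (m j) (j - 2)) {n : ℕ} (hn : 2 ≤ n) {d : ℕ → ℤ} {x : ℕ → V}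
    (hx : Homogeneous 𝒱 d x) :
    b (cod (par 𝒱) b (word 𝕜 n x)) = (sgn 𝕜 (tw n d) * suspSgn 𝕜 n) •
      (homDiff dV dV (m n) (n - 2) d x -
        ∑ ij ∈ antidiagonal (n + 1) with 2 ≤ ij.1 ∧ 2 ≤ ij.2,
          ∑ s ∈ Finset.range ij.1, (-1 : ℤˣ) ^ (ij.1 + s * (ij.2 + 1)) •
            insertOp (m ij.1) (m ij.2) (ij.2 - 2) s d x) := by
  rw [hb.apply_cod_word_suspSgn hb hm0 hm n hx, sum_antidiagonal_split_right (by lia),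
    sum_antidiagonal_split_left hn, ← smul_neg]
  congr 1
  simp only [Finset.sum_range_one, hm1, insertOp_one_left, homDiff_eq]
  rw [Finset.smul_sum]
  have h : ∑ s ∈ Finset.range n, (-1 : ℤˣ) ^ (n + s * (1 + 1)) •
      insertOp (m n) (MultilinearMap.ofSubsingleton 𝕜 V V (0 : Fin 1) dV) ((1 : ℕ) - 2) s d x =
      ∑ s ∈ Finset.range n, sgn 𝕜 ((n : ℤ) - 2) •
        insertOp (m n) (MultilinearMap.ofSubsingleton 𝕜 V V (0 : Fin 1) dV) (-1) s d x := by
    refine Finset.sum_congr rfl fun s _ => ?_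
    rw [neg_one_pow_smul (𝕜 := 𝕜)]
    congr 1
    exact sgn_congr ⟨1 + s, by push_cast; ring⟩
  rw [h]
  have h' : (-1 : ℤˣ) ^ (1 + 0 * (n + 1)) • dV (ev (m n) x) = -dV (ev (m n) x) := by simp
  rw [h']
  abel

/-- The defect of a morphism. -/
theorem Represents.apply_morphism (hf : Represents 𝒱 (suspSgn 𝕜) F f)
    (hb : Represents 𝒱 (suspSgn 𝕜) m b) (hc : Represents 𝒲 (suspSgn 𝕜) l c) (hm0 : m 0 = 0)
    (hm1 : m 1 = MultilinearMap.ofSubsingleton 𝕜 V V (0 : Fin 1) dV)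
    (hm : ∀ j : ℕ, HasDegree 𝒱 𝒱 (m j) (j - 2))
    (hl1 : l 1 = MultilinearMap.ofSubsingleton 𝕜 W W (0 : Fin 1) dW)
    (hF0 : F 0 = 0) (hF : ∀ j : ℕ, HasDegree 𝒱 𝒲 (F j) (j - 1))
    {φ : Tens 𝕜 V →ₗ[𝕜] Tens 𝕜 W} (hφ : φ = cunit _ + conv (ι 𝕜 ∘ₗ f) φ) {n : ℕ} (hn : 1 ≤ n)
    {d : ℕ → ℤ} {x : ℕ → V} (hx : Homogeneous 𝒱 d x) :
    c (φ (word 𝕜 n x)) - f (cod (par 𝒱) b (word 𝕜 n x)) = (sgn 𝕜 (tw n d) * suspSgn 𝕜 n) •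
      (homDiff dV dW (F n) (n - 1) d x - (-(∑ k : Composition n with 2 ≤ k.length,
          (-1 : ℤˣ) ^ (∑ a : Fin k.length, ∑ b ∈ Finset.Ioi a,
            k.blocksFun a * (k.blocksFun b + 1)) • composeOps l F k d x)
      - ∑ ij ∈ antidiagonal (n + 1) with 1 ≤ ij.1 ∧ 2 ≤ ij.2,
          ∑ s ∈ Finset.range ij.1, (-1 : ℤˣ) ^ (ij.1 + s * (ij.2 + 1)) •
            insertOp (F ij.1) (m ij.2) (ij.2 - 2) s d x)) := by
  rw [hf.apply_cod_word_suspSgn hb hm0 hm n hx, sum_antidiagonal_split_right hn,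
    hf.apply_coext_word_suspSgn hc hF0 hF hφ n hx, sum_composition_split hn, sub_neg_eq_add, ← smul_add]
  congr 1
  simp only [hm1, composeOps_single hl1, homDiff_eq]
  rw [Finset.smul_sum]
  have h : ∑ s ∈ Finset.range n, (-1 : ℤˣ) ^ (n + s * (1 + 1)) •
      insertOp (F n) (MultilinearMap.ofSubsingleton 𝕜 V V (0 : Fin 1) dV) ((1 : ℕ) - 2) s d x =
      -∑ s ∈ Finset.range n, sgn 𝕜 ((n : ℤ) - 1) •
        insertOp (F n) (MultilinearMap.ofSubsingleton 𝕜 V V (0 : Fin 1) dV) (-1) s d x := by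
    rw [← Finset.sum_neg_distrib]
    refine Finset.sum_congr rfl fun s _ => ?_
    rw [neg_one_pow_smul (𝕜 := 𝕜), ← neg_smul, ← neg_one_mul, ← sgn_odd (𝕜 := 𝕜) odd_one, ← sgn_add]
    congr 1
    exact sgn_congr ⟨s, by push_cast; ring⟩
  have h' : (∑ a : Fin (Composition.single n hn).length, ∑ b ∈ Finset.Ioi a,
      (Composition.single n hn).blocksFun a * ((Composition.single n hn).blocksFun b + 1)) = 0 := by
    refine Finset.sum_eq_zero fun a _ => Finset.sum_eq_zero fun b hb => ?_
    exact absurd (Finset.mem_Ioi.1 hb) (by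
      have h1 : (a : ℕ) < 1 := a.2
      have h2 : (b : ℕ) < 1 := b.2
      rw [Fin.lt_def]; lia)
  rw [h, h', pow_zero, one_smul]
  abel

end Homotopy

section Families

variable {𝕜 : Type*} [Field 𝕜] {V : Type*} [AddCommGroup V] [Module 𝕜 V]
  {W : Type*} [AddCommGroup W] [Module 𝕜 W] {𝒱 : ℤ → Submodule 𝕜 V} {𝒲 : ℤ → Submodule 𝕜 W}

/-- `M` consists of the differential and of the operations `m` of arity at most `K`. -/
structure IsAlgebraFamily (𝒱 : ℤ → Submodule 𝕜 V) (K : ℕ∞) (dV : V →ₗ[𝕜] V) (m M : Ops 𝕜 V V) :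
    Prop where
  zero : M 0 = 0
  one : M 1 = MultilinearMap.ofSubsingleton 𝕜 V V (0 : Fin 1) dV
  eq : ∀ n : ℕ, 2 ≤ n → (n : ℕ∞) ≤ K → M n = m n
  degree : ∀ n : ℕ, HasDegree 𝒱 𝒱 (M n) (n - 2)
  zero_of_lt : ∀ n : ℕ, 2 ≤ n → K < n → M n = 0

/-- `M` consists of the components `F` of arity at most `K`. -/
structure IsMorphismFamily (𝒱 : ℤ → Submodule 𝕜 V) (𝒲 : ℤ → Submodule 𝕜 W) (K : ℕ∞)
    (F M : Ops 𝕜 V W) : Prop where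
  zero : M 0 = 0
  eq : ∀ n : ℕ, 1 ≤ n → (n : ℕ∞) ≤ K → M n = F n
  degree : ∀ n : ℕ, HasDegree 𝒱 𝒲 (M n) (n - 1)
  zero_of_lt : ∀ n : ℕ, K < n → M n = 0

theorem hasDegree_zero (n : ℕ) (p : ℤ) :
    HasDegree 𝒱 𝒲 (0 : MultilinearMap 𝕜 (fun _ : Fin n => V) W) p := fun _ _ _ => by
  simp [ev]

theorem exists_isAlgebraFamily {K : ℕ∞} {dV : V →ₗ[𝕜] V} {m : Ops 𝕜 V V}
    (hd : IsDifferential 𝒱 dV)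
    (hm : ∀ n : ℕ, 2 ≤ n → (n : ℕ∞) ≤ K → HasDegree 𝒱 𝒱 (m n) ((n : ℤ) - 2)) :
    ∃ M, IsAlgebraFamily 𝒱 K dV m M := by
  classical
  let M : Ops 𝕜 V V := fun n => match n with
    | 0 => 0
    | 1 => MultilinearMap.ofSubsingleton 𝕜 V V (0 : Fin 1) dV
    | n + 2 => if ((n + 2 : ℕ) : ℕ∞) ≤ K then m (n + 2) else 0
  refine ⟨M, rfl, rfl, fun n hn hK => ?_, fun n => ?_, fun n hn hK => ?_⟩
  · obtain ⟨n, rfl⟩ : ∃ k, n = k + 2 := ⟨n - 2, by lia⟩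
    exact if_pos hK
  · match n with
    | 0 => exact hasDegree_zero _ _
    | 1 =>
      intro d x hx
      change ev (MultilinearMap.ofSubsingleton 𝕜 V V (0 : Fin 1) dV) x ∈ _
      rw [ev_ofSubsingleton, Finset.sum_range_one]
      exact hd.degree _ _ (hx 0)
    | n + 2 =>
      change HasDegree 𝒱 𝒱 (if ((n + 2 : ℕ) : ℕ∞) ≤ K then m (n + 2) else 0) _
      split_ifs with h
      exacts [hm _ (by lia) h, hasDegree_zero _ _]
  · obtain ⟨n, rfl⟩ : ∃ k, n = k + 2 := ⟨n - 2, by lia⟩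
    exact if_neg (not_le.2 hK)

theorem exists_isMorphismFamily {K : ℕ∞} {F : Ops 𝕜 V W}
    (hF : ∀ n : ℕ, 1 ≤ n → (n : ℕ∞) ≤ K → HasDegree 𝒱 𝒲 (F n) ((n : ℤ) - 1)) :
    ∃ M, IsMorphismFamily 𝒱 𝒲 K F M := by
  classical
  refine ⟨fun n => if 1 ≤ n ∧ (n : ℕ∞) ≤ K then F n else 0, by simp, fun n hn hK => if_pos ⟨hn, hK⟩,
    fun n => ?_, fun n hn => if_neg fun h => absurd h.2 (not_le.2 hn)⟩
  split_ifs with h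
  exacts [hF n h.1 h.2, hasDegree_zero _ _]

variable [DirectSum.Decomposition 𝒱] [DirectSum.Decomposition 𝒲] {F G : Ops 𝕜 V W}
  {f f' : Tens 𝕜 V →ₗ[𝕜] W} {m M : Ops 𝕜 V V} {b : Tens 𝕜 V →ₗ[𝕜] V} {l L : Ops 𝕜 W W}
  {c : Tens 𝕜 W →ₗ[𝕜] W} {κ κ' : ℕ → 𝕜} {dV : V →ₗ[𝕜] V} {dW : W →ₗ[𝕜] W} {K : ℕ∞}

theorem IsAlgebraFamily.isTDeg (hM : IsAlgebraFamily 𝒱 K dV m M) (hb : Represents 𝒱 κ M b) :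
    IsTDeg (dgr 𝒱) (par 𝒱) (dgr 𝒱) (par 𝒱) (-1) b :=
  hb.isTDeg fun n => by
    have := hM.degree n
    rwa [show (n : ℤ) - 2 = n - 1 + -1 by ring] at this

theorem IsMorphismFamily.isTDeg (hF : IsMorphismFamily 𝒱 𝒲 K F G) (hf : Represents 𝒱 κ G f) :
    IsTDeg (dgr 𝒱) (par 𝒱) (dgr 𝒲) (par 𝒲) 0 f :=
  hf.isTDeg fun n => by simpa using hF.degree n

theorem Represents.apply_ι (hf : Represents 𝒱 κ F f) (hκ : κ 1 = 1) :
    f ∘ₗ ι 𝕜 = linearPart F := by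
  refine graded_ext (𝒱 := 𝒱) fun e v hv => ?_
  have := hf 1 (fun _ => e) (fun _ => v) fun _ => hv
  rw [word_one, hκ, tw_one, sgn_zero, mul_one, one_smul] at this
  rw [LinearMap.comp_apply, this]
  simp only [linearPart, ev, MultilinearMap.ofSubsingleton_symm_apply_apply]

theorem IsAlgebraFamily.comp_ι (hM : IsAlgebraFamily 𝒱 K dV m M) (hb : Represents 𝒱 κ M b)
    (hκ : κ 1 = 1) : b ∘ₗ ι 𝕜 = dV := by
  rw [hb.apply_ι hκ, linearPart, hM.one, Equiv.symm_apply_apply]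

theorem IsMorphismFamily.comp_ι (hF : IsMorphismFamily 𝒱 𝒲 K F G) (hf : Represents 𝒱 κ G f)
    (hκ : κ 1 = 1) (hK : 1 ≤ K) : f ∘ₗ ι 𝕜 = linearPart F := by
  rw [hf.apply_ι hκ, linearPart, hF.eq 1 le_rfl (by exact_mod_cast hK), linearPart]

omit [DirectSum.Decomposition 𝒱] [DirectSum.Decomposition 𝒲] in
theorem isHom_linearPart (hF : HasDegree 𝒱 𝒲 (F 1) 0) : IsHom 𝒱 𝒲 0 (linearPart F) := by
  intro e v hv
  have := hF (fun _ => e) (fun _ => v) fun _ => hv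
  rw [Finset.sum_range_one] at this
  simpa only [linearPart, ev, MultilinearMap.ofSubsingleton_symm_apply_apply] using this

theorem exists_ops_extension [CharZero 𝕜] (hf : Represents 𝒱 κ F f) (hκ : ∀ n, κ n ≠ 0) {N : ℕ}
    (h : AgreeUpTo N f' f) {p : ℤ} (hd : IsTDeg (dgr 𝒱) (par 𝒱) (dgr 𝒲) (par 𝒲) p f')
    (hF : ∀ n : ℕ, HasDegree 𝒱 𝒲 (F n) (n - 1 + p)) :
    ∃ F' : Ops 𝕜 V W, Represents 𝒱 κ F' f' ∧ (∀ n ≤ N, F' n = F n) ∧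
      ∀ n : ℕ, HasDegree 𝒱 𝒲 (F' n) (n - 1 + p) := by
  classical
  refine ⟨fun n => if n ≤ N then F n else toOps 𝒱 (fun n => (κ n)⁻¹) f' n, fun n d x hx => ?_,
    fun n hn => if_pos hn, fun n => ?_⟩
  · dsimp only
    split_ifs with hn
    · rw [h n hn _ (word_mem n x), hf n d x hx]
    · rw [ev_toOps _ _ _ hx, smul_smul, mul_mul_mul_comm, sgn_mul_self, mul_inv_cancel₀ (hκ n),
        one_mul, one_smul]
  · dsimp only
    split_ifs with hn
    · exact hF n
    · intro d x hx
      rw [ev_toOps _ _ _ hx]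
      exact Submodule.smul_mem _ _ (mem_of_isTDeg hd hx)

theorem cod_word_one (θ : V →ₗ[𝕜] V) (hb1 : b 1 = 0) (x : ℕ → V) :
    cod θ b (word 𝕜 1 x) = ι 𝕜 (b (word 𝕜 1 x)) := by
  rw [word_succ, word_zero, cod_ι_mul, conv_ι_mul]
  simp [hb1]

theorem coext_one {φ : Tens 𝕜 V →ₗ[𝕜] Tens 𝕜 W} (hf : f 1 = 0)
    (hφ : φ = cunit _ + conv (ι 𝕜 ∘ₗ f) φ) : φ 1 = 1 := by
  have := LinearMap.congr_fun hφ 1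
  simpa [hf] using this

theorem IsAlgebraFamily.sq_of_lt_two (hM : IsAlgebraFamily 𝒱 K dV m M) (hb : Represents 𝒱 κ M b)
    (hκ : κ 1 = 1) (hd : IsDifferential 𝒱 dV) {n : ℕ} (hn : n < 2) {t : Tens 𝕜 V}
    (ht : t ∈ lenSub 𝕜 V n) : b (cod (par 𝒱) b t) = 0 := by
  refine lenSub_le_of_word (𝒱 := 𝒱) (Q := LinearMap.ker (b ∘ₗ cod (par 𝒱) b)) (fun d x _ => ?_) ht
  rw [LinearMap.mem_ker, LinearMap.comp_apply]
  have hb1 := hb.apply_one hM.zero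
  obtain rfl | rfl : n = 0 ∨ n = 1 := by lia
  · simp [hb1]
  · have hι := hM.comp_ι hb hκ
    have h1 : b (word 𝕜 1 x) = dV (x 0) := by rw [word_one, ← hι]; rfl
    rw [cod_word_one _ hb1, h1, ← LinearMap.comp_apply b, hι, hd.sq_zero]

/-! ### The equations of an `A(K)`-algebra -/

theorem IsAlgebraFamily.sq_iff (hM : IsAlgebraFamily 𝒱 K dV m M)
    (hb : Represents 𝒱 (suspSgn 𝕜) M b) {n : ℕ} (hn : 2 ≤ n) (hK : (n : ℕ∞) ≤ K) :
    (∀ t ∈ lenSub 𝕜 V n, b (cod (par 𝒱) b t) = 0) ↔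
    ∀ d x, Homogeneous 𝒱 d x → homDiff dV dV (m n) ((n : ℤ) - 2) d x =
      ∑ ij ∈ antidiagonal (n + 1) with 2 ≤ ij.1 ∧ 2 ≤ ij.2,
        ∑ s ∈ Finset.range ij.1, (-1 : ℤˣ) ^ (ij.1 + s * (ij.2 + 1)) •
          insertOp (m ij.1) (m ij.2) ((ij.2 : ℤ) - 2) s d x := by
  refine (forall_mem_lenSub_iff (g := b ∘ₗ cod (par 𝒱) b) (h := 0)).trans
    (forall₃_congr fun d x hx => ?_)
  have hle : ∀ i ≤ n, (i : ℕ∞) ≤ K := fun i hi => (Nat.cast_le.2 hi).trans hK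
  rw [LinearMap.comp_apply, LinearMap.zero_apply, hb.apply_sq hM.zero hM.one hM.degree hn hx,
    smul_eq_zero, or_iff_right (mul_ne_zero (sgn_ne_zero _) (suspSgn_ne_zero n)), sub_eq_zero,
    hM.eq n hn hK]
  refine Eq.congr_right (Finset.sum_congr rfl fun ij hij => ?_)
  simp only [Finset.mem_filter, mem_antidiagonal] at hij
  rw [hM.eq _ hij.2.1 (hle _ (by lia)), hM.eq _ hij.2.2 (hle _ (by lia))]

theorem composeOps_congr {n : ℕ} (k : Composition n) (h : L k.length = l k.length)
    (h' : ∀ r, 1 ≤ r → r ≤ n → G r = F r) (d : ℕ → ℤ) (x : ℕ → V) :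
    composeOps L G k d x = composeOps l F k d x := by
  unfold composeOps
  rw [h]
  congr 2
  funext a
  rw [h' _ (k.one_le_blocksFun a) (k.blocksFun_le a)]

theorem IsMorphismFamily.map_iff (hG : IsMorphismFamily 𝒱 𝒲 K F G) (hM : IsAlgebraFamily 𝒱 ⊤ dV m M)
    (hL : IsAlgebraFamily 𝒲 K dW l L) (hf : Represents 𝒱 (suspSgn 𝕜) G f)
    (hb : Represents 𝒱 (suspSgn 𝕜) M b) (hc : Represents 𝒲 (suspSgn 𝕜) L c)
    {φ : Tens 𝕜 V →ₗ[𝕜] Tens 𝕜 W} (hφ : φ = cunit _ + conv (ι 𝕜 ∘ₗ f) φ) {n : ℕ} (hn : 1 ≤ n)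
    (hK : (n : ℕ∞) ≤ K) :
    (∀ t ∈ lenSub 𝕜 V n, c (φ t) = f (cod (par 𝒱) b t)) ↔ ∀ d x, Homogeneous 𝒱 d x →
    homDiff dV dW (F n) ((n : ℤ) - 1) d x =
      - (∑ c : Composition n with 2 ≤ c.length,
          (-1 : ℤˣ) ^ (∑ a : Fin c.length, ∑ b ∈ Finset.Ioi a,
            c.blocksFun a * (c.blocksFun b + 1)) • composeOps l F c d x)
      - ∑ ij ∈ antidiagonal (n + 1) with 1 ≤ ij.1 ∧ 2 ≤ ij.2,
          ∑ s ∈ Finset.range ij.1, (-1 : ℤˣ) ^ (ij.1 + s * (ij.2 + 1)) •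
            insertOp (F ij.1) (m ij.2) ((ij.2 : ℤ) - 2) s d x := by
  refine (forall_mem_lenSub_iff (g := c ∘ₗ φ) (h := f ∘ₗ cod (par 𝒱) b)).trans
    (forall₃_congr fun d x hx => ?_)
  have hle : ∀ i ≤ n, (i : ℕ∞) ≤ K := fun i hi => (Nat.cast_le.2 hi).trans hK
  rw [LinearMap.comp_apply, LinearMap.comp_apply, ← sub_eq_zero, hf.apply_morphism hb hc hM.zero
    hM.one hM.degree hL.one hG.zero hG.degree hφ hn hx, smul_eq_zero,
    or_iff_right (mul_ne_zero (sgn_ne_zero _) (suspSgn_ne_zero n)), sub_eq_zero, hG.eq n hn hK]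
  refine Eq.congr_right (congrArg₂ (fun u v => -u - v) (Finset.sum_congr rfl fun k hk => ?_)
    (Finset.sum_congr rfl fun ij hij => ?_))
  · simp only [Finset.mem_filter, Finset.mem_univ, true_and] at hk
    rw [composeOps_congr k (hL.eq _ hk (hle _ k.length_le)) fun r hr hr' => hG.eq r hr (hle r hr')]
  · simp only [Finset.mem_filter, mem_antidiagonal] at hij
    rw [hG.eq _ hij.2.1 (hle _ (by lia)), hM.eq _ hij.2.2 le_top]

theorem map_of_eq_zero (hf1 : f 1 = 0) (hb1 : b 1 = 0) (hc1 : c 1 = 0) {θ : V →ₗ[𝕜] V}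
    {φ : Tens 𝕜 V →ₗ[𝕜] Tens 𝕜 W} (hφ : φ = cunit _ + conv (ι 𝕜 ∘ₗ f) φ) {t : Tens 𝕜 V}
    (ht : t ∈ lenSub 𝕜 V 0) : c (φ t) = f (cod θ b t) := by
  obtain ⟨r, rfl⟩ := mem_lenSub_zero.1 ht
  simp [coext_one hf1 hφ, hb1, hc1]

variable [CharZero 𝕜] {I : Submodule 𝕜 (Tens 𝕜 V)} {I' : Submodule 𝕜 (Tens 𝕜 W)}

/-- The extension theorem for `A(K)`-algebras with operations that vanish on given tensors. -/
theorem exists_A_extension (hS : IsAdmissible (par 𝒱) (lenSub 𝕜 V) I)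
    (hS' : IsAdmissible (par 𝒲) (lenSub 𝕜 W) I')
    (hSS : IsAdmissibleMap (par 𝒱) (par 𝒲) (lenSub 𝕜 V) (lenSub 𝕜 W) I I')
    (hSS' : IsAdmissibleMap (par 𝒲) (par 𝒱) (lenSub 𝕜 W) (lenSub 𝕜 V) I' I)
    {K : ℕ} (hK : 1 ≤ K) (hq : IsQuasiIso dV dW (linearPart F))
    (hm : IsAAlgebra ⊤ 𝒱 dV m) (hl : IsAAlgebra K 𝒲 dW l) (hF : IsAMorphism K 𝒱 𝒲 dV dW m l F)
    (hmI : ∀ M b, IsAlgebraFamily 𝒱 ⊤ dV m M → Represents 𝒱 (suspSgn 𝕜) M b → ∀ t ∈ I, b t = 0)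
    (hlI : ∀ L c, IsAlgebraFamily 𝒲 K dW l L → Represents 𝒲 (suspSgn 𝕜) L c → ∀ t ∈ I', c t = 0)
    (hFI : ∀ G f, IsMorphismFamily 𝒱 𝒲 K F G → Represents 𝒱 (suspSgn 𝕜) G f → ∀ t ∈ I, f t = 0) :
    ∃ (l' : Ops 𝕜 W W) (F' : Ops 𝕜 V W) (c : Tens 𝕜 W →ₗ[𝕜] W) (f : Tens 𝕜 V →ₗ[𝕜] W),
      (∀ i, 2 ≤ i → i ≤ K → l' i = l i) ∧ (∀ i, 1 ≤ i → i ≤ K → F' i = F i) ∧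
      IsAAlgebra ⊤ 𝒲 dW l' ∧ IsAMorphism ⊤ 𝒱 𝒲 dV dW m l' F' ∧
      Represents 𝒲 (suspSgn 𝕜) l' c ∧ Represents 𝒱 (suspSgn 𝕜) F' f ∧
      (∀ t ∈ I', c t = 0) ∧ ∀ t ∈ I, f t = 0 := by
  obtain ⟨M, hM⟩ := exists_isAlgebraFamily hm.differential hm.degree
  obtain ⟨L, hL⟩ := exists_isAlgebraFamily hl.differential hl.degree
  obtain ⟨G, hG⟩ := exists_isMorphismFamily hF.degree
  obtain ⟨b, hb⟩ := exists_represents (𝒱 := 𝒱) (suspSgn 𝕜) M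
  obtain ⟨c, hc⟩ := exists_represents (𝒱 := 𝒲) (suspSgn 𝕜) L
  obtain ⟨f, hf⟩ := exists_represents (𝒱 := 𝒱) (suspSgn 𝕜) G
  have hb1 := hb.apply_one hM.zero
  have hc1 := hc.apply_one hL.zero
  have hf1 := hf.apply_one hG.zero
  have hbb : ∀ k, ∀ t ∈ lenSub 𝕜 V k, b (cod (par 𝒱) b t) = 0 := fun k => by
    by_cases hk : 2 ≤ k
    · exact (hM.sq_iff hb hk le_top).2 (hm.relation k hk le_top)
    · exact fun t ht => hM.sq_of_lt_two hb suspSgn_one hm.differential (not_le.1 hk) ht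
  have hcc : ∀ k ≤ K, ∀ t ∈ lenSub 𝕜 W k, c (cod (par 𝒲) c t) = 0 := fun k hkK => by
    by_cases hk : 2 ≤ k
    · exact (hL.sq_iff hc hk (Nat.cast_le.2 hkK)).2 (hl.relation k hk (Nat.cast_le.2 hkK))
    · exact fun t ht => hL.sq_of_lt_two hc suspSgn_one hl.differential (not_le.1 hk) ht
  have hr : ∀ k ≤ K, ∀ t ∈ lenSub 𝕜 V k, ∀ φ : Tens 𝕜 V →ₗ[𝕜] Tens 𝕜 W,
      φ = cunit _ + conv (ι 𝕜 ∘ₗ f) φ → c (φ t) = f (cod (par 𝒱) b t) := fun k hkK t ht φ hφ => by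
    by_cases hk : 1 ≤ k
    · refine (hG.map_iff hM hL hf hb hc hφ hk (Nat.cast_le.2 hkK)).2
        (hF.relation k hk (Nat.cast_le.2 hkK)) t ht
    · obtain rfl : k = 0 := by lia
      exact map_of_eq_zero hf1 hb1 hc1 hφ ht
  have hK' : (1 : ℕ∞) ≤ (K : ℕ∞) := by exact_mod_cast hK
  have hF0 : HasDegree 𝒱 𝒲 (F 1) 0 := by simpa using hF.degree 1 le_rfl hK'
  obtain ⟨c', f', hcf, hc', hf'⟩ := exists_infinite_extension hS hS' hSS hSS' (hM.isTDeg hb) hb1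
    (hmI M b hM hb) hm.differential hl.differential (isHom_linearPart hF0) hq
    (hM.comp_ι hb suspSgn_one) hbb hK ⟨hL.isTDeg hc, hG.isTDeg hf, hlI L c hL hc, hFI G f hG hf,
      hc1, hf1, hL.comp_ι hc suspSgn_one, hG.comp_ι hf suspSgn_one hK', hcc, hr⟩
  obtain ⟨L', hcL', hLL', hdL'⟩ := exists_ops_extension hc suspSgn_ne_zero hc' (hcf 0).c_deg
    (fun n => by rw [show (n : ℤ) - 1 + -1 = n - 2 by ring]; exact hL.degree n)
  obtain ⟨G', hfG', hGG', hdG'⟩ := exists_ops_extension hf suspSgn_ne_zero hf' (hcf 0).f_deg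
    (fun n => by rw [add_zero]; exact hG.degree n)
  have hL' : IsAlgebraFamily 𝒲 ⊤ dW L' L' := ⟨(hLL' 0 (by lia)).trans hL.zero,
    (hLL' 1 hK).trans hL.one, fun _ _ _ => rfl,
    fun n => by rw [show (n : ℤ) - 2 = n - 1 + -1 by ring]; exact hdL' n,
    fun n _ h => absurd h (not_lt.2 le_top)⟩
  have hG' : IsMorphismFamily 𝒱 𝒲 ⊤ G' G' := ⟨(hGG' 0 (by lia)).trans hG.zero, fun _ _ _ => rfl,
    fun n => by simpa using hdG' n, fun n h => absurd h (not_lt.2 le_top)⟩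
  obtain ⟨φ, hφ⟩ := exists_coext f' (hcf 0).f_one
  refine ⟨L', G', c', f', fun i h2 hi => (hLL' i hi).trans (hL.eq i h2 (Nat.cast_le.2 hi)),
    fun i h1 hi => (hGG' i hi).trans (hG.eq i h1 (Nat.cast_le.2 hi)),
    ⟨hl.differential, fun n _ _ => hL'.degree n, fun n hn _ =>
      (hL'.sq_iff hcL' hn le_top).1 ((hcf n).c_sq n le_rfl)⟩,
    ⟨fun n _ _ => hG'.degree n, fun n hn _ =>
      (hG'.map_iff hM hL' hfG' hb hcL' hφ hn le_top).1
        fun t ht => (hcf n).f_map n le_rfl t ht φ hφ⟩, hcL', hfG', (hcf 0).c_vanish, (hcf 0).f_vanish⟩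

end Families

section Inversions

variable {M : Type*} [CommMonoid M] {n : ℕ}

/-- The product of `S (σ a) (σ b)` over the inversions `a < b` of `σ`. -/
def invProd (S : ℕ → ℕ → M) (σ : Equiv.Perm (Fin n)) : M :=
  ∏ a, ∏ b, if a < b ∧ σ b < σ a then S (σ a) (σ b) else 1

theorem prod_lt_comp {T : Fin n → Fin n → M} (hT : ∀ p q, T p q = T q p)
    (τ : Equiv.Perm (Fin n)) : (∏ a, ∏ b, if a < b then T (τ a) (τ b) else 1) =
      ∏ a, ∏ b, if a < b then T a b else 1 := by
  rw [← Finset.prod_product', ← Finset.prod_product', ← Finset.prod_filter, ← Finset.prod_filter]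
  refine Finset.prod_nbij' (fun p => if τ p.1 < τ p.2 then (τ p.1, τ p.2) else (τ p.2, τ p.1))
    (fun p => if τ.symm p.1 < τ.symm p.2 then (τ.symm p.1, τ.symm p.2)
      else (τ.symm p.2, τ.symm p.1)) ?_ ?_ ?_ ?_ ?_
  · rintro ⟨a, b⟩ h
    simp only [Finset.univ_product_univ, Finset.mem_filter, Finset.mem_univ, true_and] at h ⊢
    split_ifs with h'
    · exact h'
    · exact lt_of_le_of_ne (not_lt.1 h') fun e => h.ne (τ.injective e).symm
  · rintro ⟨a, b⟩ h
    simp only [Finset.univ_product_univ, Finset.mem_filter, Finset.mem_univ, true_and] at h ⊢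
    split_ifs with h'
    · exact h'
    · exact lt_of_le_of_ne (not_lt.1 h') fun e => h.ne (τ.symm.injective e).symm
  · rintro ⟨a, b⟩ h
    simp only [Finset.univ_product_univ, Finset.mem_filter, Finset.mem_univ, true_and] at h
    dsimp only
    by_cases h' : τ a < τ b
    · simp [h', h]
    · simp [h', not_lt.2 h.le]
  · rintro ⟨a, b⟩ h
    simp only [Finset.univ_product_univ, Finset.mem_filter, Finset.mem_univ, true_and] at h
    dsimp only
    by_cases h' : τ.symm a < τ.symm b
    · simp [h', h]
    · simp [h', not_lt.2 h.le]
  · rintro ⟨a, b⟩ h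
    dsimp only
    split_ifs
    · rfl
    · exact hT _ _

theorem invProd_mul_right (S S' : ℕ → ℕ → M) (σ : Equiv.Perm (Fin n)) :
    invProd (fun p q => S p q * S' p q) σ = invProd S σ * invProd S' σ := by
  unfold invProd
  simp only [← Finset.prod_mul_distrib]
  refine Finset.prod_congr rfl fun a _ => Finset.prod_congr rfl fun b _ => ?_
  split_ifs <;> simp

theorem map_invProd {N : Type*} [CommMonoid N] (f : M →* N) (S : ℕ → ℕ → M)
    (σ : Equiv.Perm (Fin n)) : f (invProd S σ) = invProd (fun p q => f (S p q)) σ := by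
  unfold invProd
  simp only [map_prod]
  refine Finset.prod_congr rfl fun a _ => Finset.prod_congr rfl fun b _ => ?_
  split_ifs <;> simp

theorem invProd_mul {S : ℕ → ℕ → M} (hS : ∀ p q, S p q = S q p) (hS' : ∀ p q, S p q * S p q = 1)
    (σ τ : Equiv.Perm (Fin n)) : invProd S (σ * τ) =
      invProd S σ * invProd (fun p q => S (permSeq σ id p) (permSeq σ id q)) τ := by
  have h := prod_lt_comp (T := fun p q : Fin n => if p < q ∧ σ q < σ p ∨ q < p ∧ σ p < σ q then
    S (σ p) (σ q) else 1) (fun p q => by simp only [or_comm, hS (σ p)]) τ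
  have h1 : invProd S σ = ∏ a : Fin n, ∏ b : Fin n, if a < b then
      (if a < b ∧ σ b < σ a ∨ b < a ∧ σ a < σ b then S (σ a) (σ b) else 1) else 1 := by
    refine Finset.prod_congr rfl fun a _ => Finset.prod_congr rfl fun b _ => ?_
    by_cases hab : a < b
    · simp [hab, not_lt.2 hab.le]
    · simp [hab]
  rw [h1, ← h]
  unfold invProd
  simp only [← Finset.prod_mul_distrib]
  refine Finset.prod_congr rfl fun a _ => Finset.prod_congr rfl fun b _ => ?_
  have hp : ∀ c : Fin n, permSeq σ id (τ c : ℕ) = ((σ (τ c) : Fin n) : ℕ) := fun c => by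
    simp [permSeq]
  simp only [Equiv.Perm.mul_apply, hp]
  by_cases hab : a < b
  · have hne : τ a ≠ τ b := fun e => hab.ne (τ.injective e)
    have hne' : σ (τ a) ≠ σ (τ b) := fun e => hne (σ.injective e)
    rcases lt_or_gt_of_ne hne with h2 | h2 <;> rcases lt_or_gt_of_ne hne' with h3 | h3 <;>
      simp [hab, h2, h3, not_lt.2 h2.le, not_lt.2 h3.le, hS']
  · simp [hab]

theorem invProd_one (S : ℕ → ℕ → M) : invProd S (1 : Equiv.Perm (Fin n)) = 1 := by
  refine Finset.prod_eq_one fun a _ => Finset.prod_eq_one fun b _ => if_neg ?_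
  simp only [Equiv.Perm.one_apply, not_and, not_lt]
  exact fun h => h.le

theorem invProd_swap (S : ℕ → ℕ → M) (i : ℕ) (hi : i + 1 < n) :
    invProd S (Equiv.swap (⟨i, by lia⟩ : Fin n) ⟨i + 1, hi⟩) = S (i + 1) i := by
  unfold invProd
  rw [Finset.prod_eq_single (⟨i, by lia⟩ : Fin n), Finset.prod_eq_single (⟨i + 1, hi⟩ : Fin n)]
  · simp
  · intro b _ hb
    refine if_neg fun h => ?_
    rw [Equiv.swap_apply_left] at h
    by_cases hb' : b = ⟨i, by lia⟩
    · subst hb'; exact lt_irrefl _ h.1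
    rw [Equiv.swap_apply_of_ne_of_ne hb' hb] at h
    simp only [Fin.lt_def, Fin.ext_iff] at h hb
    lia
  · simp
  · intro a _ ha
    refine Finset.prod_eq_one fun b _ => if_neg fun h => ?_
    have ha' : (a : ℕ) ≠ i := fun e => ha (Fin.ext e)
    simp only [Fin.lt_def, Fin.ext_iff, Equiv.swap_apply_def] at h
    split_ifs at h <;> simp_all <;> lia
  · simp

end Inversions

section Signs

variable {n : ℕ} {α : Type*}

theorem permSeq_apply_of_lt (σ : Equiv.Perm (Fin n)) (x : ℕ → α) (a : Fin n) :
    permSeq σ x a = x (σ a) := by simp [permSeq]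

theorem permSeq_apply_of_le (σ : Equiv.Perm (Fin n)) (x : ℕ → α) {t : ℕ} (h : n ≤ t) :
    permSeq σ x t = x t := by simp [permSeq, not_lt.2 h]

theorem permSeq_mul (σ τ : Equiv.Perm (Fin n)) (x : ℕ → α) :
    permSeq (σ * τ) x = permSeq τ (permSeq σ x) := by
  funext t
  by_cases h : t < n
  · have h1 := permSeq_apply_of_lt τ (permSeq σ x) ⟨t, h⟩
    have h2 := permSeq_apply_of_lt (σ * τ) x ⟨t, h⟩
    exact h2.trans (h1.trans (permSeq_apply_of_lt σ x _)).symm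
  · rw [permSeq_apply_of_le _ _ (not_lt.1 h), permSeq_apply_of_le _ _ (not_lt.1 h),
      permSeq_apply_of_le _ _ (not_lt.1 h)]

@[simp] theorem permSeq_one (x : ℕ → α) : permSeq (1 : Equiv.Perm (Fin n)) x = x := by
  funext t; simp [permSeq]

theorem permSeq_comp {β : Type*} (σ : Equiv.Perm (Fin n)) (x : ℕ → α) (g : α → β) (t : ℕ) :
    permSeq σ (fun s => g (x s)) t = g (permSeq σ x t) := by
  unfold permSeq; split_ifs <;> rfl

variable {𝕜 : Type*} [Field 𝕜] {V : Type*} [AddCommGroup V] [Module 𝕜 V]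

theorem Homogeneous.permSeq {𝒱 : ℤ → Submodule 𝕜 V} {d : ℕ → ℤ} {x : ℕ → V}
    (h : Homogeneous 𝒱 d x) (σ : Equiv.Perm (Fin n)) :
    Homogeneous 𝒱 (permSeq σ d) (StrongHomotopy.permSeq σ x) := by
  intro t
  unfold StrongHomotopy.permSeq
  split_ifs
  exacts [h _, h t]

variable (𝕜) in
/-- The Koszul sign of the rearrangement `x 0, …, x (n - 1) ↦ x (σ 0), …, x (σ (n - 1))` of elements
whose suspensions have degrees `d 0 + 1, …, d (n - 1) + 1`. -/
def koszulSgn (σ : Equiv.Perm (Fin n)) (d : ℕ → ℤ) : 𝕜 :=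
  invProd (fun p q => sgn 𝕜 ((d p + 1) * (d q + 1))) σ

theorem koszulSgn_mul (σ τ : Equiv.Perm (Fin n)) (d : ℕ → ℤ) :
    koszulSgn 𝕜 (σ * τ) d = koszulSgn 𝕜 σ d * koszulSgn 𝕜 τ (permSeq σ d) := by
  unfold koszulSgn
  rw [invProd_mul (fun p q => by rw [mul_comm]) (fun p q => sgn_mul_self _)]
  congr 2
  funext p q
  rw [← permSeq_comp σ id d p, ← permSeq_comp σ id d q]
  rfl

@[simp] theorem koszulSgn_one (d : ℕ → ℤ) : koszulSgn 𝕜 (1 : Equiv.Perm (Fin n)) d = 1 :=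
  invProd_one _

theorem koszulSgn_swap (i : ℕ) (hi : i + 1 < n) (d : ℕ → ℤ) :
    koszulSgn 𝕜 (Equiv.swap (⟨i, by lia⟩ : Fin n) ⟨i + 1, hi⟩) d =
      sgn 𝕜 ((d i + 1) * (d (i + 1) + 1)) := by
  unfold koszulSgn; rw [invProd_swap, mul_comm]

theorem sgn_sum {ι : Type*} (s : Finset ι) (g : ι → ℤ) :
    sgn 𝕜 (∑ t ∈ s, g t) = ∏ t ∈ s, sgn 𝕜 (g t) := by
  classical
  induction s using Finset.induction_on with
  | empty => simp
  | insert a s ha ih => rw [Finset.sum_insert ha, Finset.prod_insert ha, sgn_add, ih]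

theorem tw_eq_sum (n : ℕ) (d : ℕ → ℤ) :
    tw n d = ∑ a : Fin n, ∑ b : Fin n, if a < b then d a else 0 := by
  unfold tw
  rw [Finset.sum_range]
  refine Finset.sum_congr rfl fun a _ => ?_
  rw [← Finset.sum_filter, Finset.sum_const, nsmul_eq_mul]
  congr 1
  have : Finset.univ.filter (fun b => a < b) = Finset.Ioi a := by ext; simp
  rw [this, Fin.card_Ioi]
  have := a.2
  rw [Nat.cast_sub (by lia), Nat.cast_sub (by lia)]; simp

theorem sgn_tw (n : ℕ) (d : ℕ → ℤ) :
    sgn 𝕜 (tw n d) = ∏ a : Fin n, ∏ b : Fin n, if a < b then sgn 𝕜 (d a) else 1 := by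
  rw [tw_eq_sum, sgn_sum]
  refine Finset.prod_congr rfl fun a _ => ?_
  rw [sgn_sum]
  refine Finset.prod_congr rfl fun b _ => ?_
  split_ifs <;> simp

theorem invProd_sgn_add (σ : Equiv.Perm (Fin n)) (d : ℕ → ℤ) :
    invProd (fun p q => sgn 𝕜 (d p + d q)) σ = sgn 𝕜 (tw n (permSeq σ d)) * sgn 𝕜 (tw n d) := by
  have h := prod_lt_comp (T := fun p q : Fin n => if p < q then sgn 𝕜 (d p) else
    if q < p then sgn 𝕜 (d q) else 1) (fun p q => by
      rcases lt_trichotomy p q with h | h | h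
      · simp [h, not_lt.2 h.le]
      · simp [h]
      · simp [h, not_lt.2 h.le]) σ
  have h1 : sgn 𝕜 (tw n d) = ∏ a : Fin n, ∏ b : Fin n, if a < b then (if a < b then sgn 𝕜 (d a) else
      if b < a then sgn 𝕜 (d b) else 1) else 1 := by
    rw [sgn_tw]
    refine Finset.prod_congr rfl fun a _ => Finset.prod_congr rfl fun b _ => ?_
    split_ifs <;> rfl
  rw [h1, ← h, sgn_tw]
  unfold invProd
  simp only [← Finset.prod_mul_distrib]
  refine Finset.prod_congr rfl fun a _ => Finset.prod_congr rfl fun b _ => ?_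
  rw [permSeq_apply_of_lt]
  by_cases hab : a < b
  · have hne : σ a ≠ σ b := fun e => hab.ne (σ.injective e)
    rcases lt_or_gt_of_ne hne with h2 | h2 <;>
      simp [hab, h2, not_lt.2 h2.le, sgn_add, sgn_mul_self]
  · simp [hab]

theorem antiKoszulSign_eq (σ : Equiv.Perm (Fin n)) (d : ℕ → ℤ) :
    antiKoszulSign σ d = invProd (fun p q => -(d p * d q).negOnePow) σ := by
  have h : ∀ G : Fin n → Fin n → ℤˣ, (∏ a, ∏ b ∈ Finset.Ioi a, G a b) =
      ∏ a, ∏ b, if a < b then G a b else 1 := fun G =>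
    Finset.prod_congr rfl fun a _ => by
      rw [← Finset.prod_filter]
      refine Finset.prod_congr ?_ fun _ _ => rfl
      ext; simp
  unfold antiKoszulSign
  rw [Equiv.Perm.sign_eq_prod_prod_Ioi, h, h]
  unfold invProd
  simp only [← Finset.prod_mul_distrib]
  refine Finset.prod_congr rfl fun a _ => Finset.prod_congr rfl fun b _ => ?_
  by_cases hab : a < b
  · have hne : σ a ≠ σ b := fun e => hab.ne (σ.injective e)
    rcases lt_or_gt_of_ne hne with h2 | h2 <;> simp [hab, h2, not_lt.2 h2.le]
  · simp [hab]

theorem antiKoszulSign_smul (σ : Equiv.Perm (Fin n)) (d : ℕ → ℤ) (v : V) : antiKoszulSign σ d • v =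
    (koszulSgn 𝕜 σ d * (sgn 𝕜 (tw n (permSeq σ d)) * sgn 𝕜 (tw n d))) • v := by
  let f : ℤˣ →* 𝕜 := (Int.castRingHom 𝕜 : ℤ →* 𝕜).comp (Units.coeHom ℤ)
  have hf : ∀ u : ℤˣ, u • v = f u • v := by
    intro u
    rcases Int.units_eq_one_or u with rfl | rfl <;> simp [f]
  rw [hf, antiKoszulSign_eq, map_invProd, ← invProd_sgn_add, koszulSgn, ← invProd_mul_right]
  congr 2
  funext p q
  rw [← sgn_add]
  have : f (-(d p * d q).negOnePow) = -sgn 𝕜 (d p * d q) := by simp [f, sgn]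
  rw [this, ← neg_one_mul, ← sgn_odd (𝕜 := 𝕜) odd_one, ← sgn_add]
  exact sgn_congr ⟨-d p - d q, by ring⟩

end Signs

section Extend

variable {n : ℕ}

/-- The permutation with `s ↦ q` and `s.succAbove k ↦ q.succAbove (ρ k)`. -/
def extendPerm (s q : Fin (n + 1)) (ρ : Equiv.Perm (Fin n)) : Equiv.Perm (Fin (n + 1)) :=
  (finSuccEquiv' s).trans ((Equiv.optionCongr ρ).trans (finSuccEquiv' q).symm)

@[simp] theorem extendPerm_self (s q : Fin (n + 1)) (ρ : Equiv.Perm (Fin n)) :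
    extendPerm s q ρ s = q := by simp [extendPerm]

@[simp] theorem extendPerm_succAbove (s q : Fin (n + 1)) (ρ : Equiv.Perm (Fin n)) (k : Fin n) :
    extendPerm s q ρ (s.succAbove k) = q.succAbove (ρ k) := by simp [extendPerm]

@[simp] theorem extendPerm_zero_succ (q : Fin (n + 1)) (ρ : Equiv.Perm (Fin n)) (k : Fin n) :
    extendPerm 0 q ρ k.succ = q.succAbove (ρ k) := by
  rw [← Fin.succAbove_zero, extendPerm_succAbove]

theorem extendPerm_injective {s s' q q' : Fin (n + 1)} {ρ ρ' : Equiv.Perm (Fin n)}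
    (h : extendPerm s q ρ = extendPerm s' q' ρ') (hs : s = s' ∨ q = q') :
    s = s' ∧ q = q' ∧ ρ = ρ' := by
  have hsq : s = s' ∧ q = q' := by
    rcases hs with rfl | rfl
    · have := extendPerm_self s q ρ
      rw [h, extendPerm_self] at this
      exact ⟨rfl, this.symm⟩
    · have := extendPerm_self s q ρ
      rw [h] at this
      exact ⟨(extendPerm s' q ρ').injective (this.trans (extendPerm_self s' q ρ').symm), rfl⟩
  obtain ⟨rfl, rfl⟩ := hsq
  refine ⟨rfl, rfl, Equiv.ext fun k => ?_⟩
  have := extendPerm_succAbove s q ρ k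
  rw [h, extendPerm_succAbove] at this
  exact (Fin.succAbove_right_injective this).symm

theorem sum_extendPerm_right {M : Type*} [AddCommMonoid M] (s : Fin (n + 1))
    (G : Equiv.Perm (Fin (n + 1)) → M) : ∑ σ, G σ = ∑ q, ∑ ρ, G (extendPerm s q ρ) := by
  rw [← Finset.sum_product', Finset.univ_product_univ]
  refine (Fintype.sum_bijective (fun p : Fin (n + 1) × Equiv.Perm (Fin n) => extendPerm s p.1 p.2)
    ((Fintype.bijective_iff_injective_and_card _).2 ⟨fun p p' h => ?_, ?_⟩) _ _ fun _ => rfl).symm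
  · have := extendPerm_injective h (Or.inl rfl)
    exact Prod.ext this.2.1 this.2.2
  · simp [Fintype.card_perm, Nat.factorial_succ]

theorem sum_extendPerm_left {M : Type*} [AddCommMonoid M] (q : Fin (n + 1))
    (G : Equiv.Perm (Fin (n + 1)) → M) : ∑ σ, G σ = ∑ s, ∑ ρ, G (extendPerm s q ρ) := by
  rw [← Finset.sum_product', Finset.univ_product_univ]
  refine (Fintype.sum_bijective (fun p : Fin (n + 1) × Equiv.Perm (Fin n) => extendPerm p.1 q p.2)
    ((Fintype.bijective_iff_injective_and_card _).2 ⟨fun p p' h => ?_, ?_⟩) _ _ fun _ => rfl).symm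
  · have := extendPerm_injective h (Or.inr rfl)
    exact Prod.ext this.1 this.2.2
  · simp [Fintype.card_perm, Nat.factorial_succ]

/-- The sequence `x` without the term `x q`. -/
def skip {α : Type*} (q : ℕ) (x : ℕ → α) : ℕ → α := fun t => if t < q then x t else x (t + 1)

theorem apply_succAbove {α : Type*} (x : ℕ → α) (q : Fin (n + 1)) (k : Fin n) :
    x (q.succAbove k) = skip q x k := by
  unfold skip
  split_ifs with h
  · rw [Fin.succAbove_of_castSucc_lt _ _ h]; rfl
  · rw [Fin.succAbove_of_le_castSucc _ _ (not_lt.1 h)]; rfl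

theorem val_succAbove (q : Fin (n + 1)) (k : Fin n) :
    ((q.succAbove k : Fin (n + 1)) : ℕ) = if (k : ℕ) < q then (k : ℕ) else k + 1 :=
  apply_succAbove id q k

theorem permSeq_extendPerm_zero {α : Type*} (q : Fin (n + 1)) (ρ : Equiv.Perm (Fin n))
    (x : ℕ → α) : permSeq (extendPerm 0 q ρ) x = consSeq (x q) (permSeq ρ (skip q x)) := by
  funext t
  cases t with
  | zero => simpa using permSeq_apply_of_lt (extendPerm 0 q ρ) x 0
  | succ t =>
    change _ = permSeq ρ (skip q x) t
    by_cases h : t < n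
    · have h1 := permSeq_apply_of_lt (extendPerm 0 q ρ) x (Fin.succ ⟨t, h⟩)
      have h2 := permSeq_apply_of_lt ρ (skip q x) ⟨t, h⟩
      rw [extendPerm_zero_succ] at h1
      exact (h1.trans (apply_succAbove x q _)).trans h2.symm
    · rw [permSeq_apply_of_le _ _ (by lia), permSeq_apply_of_le _ _ (by lia), skip, if_neg]
      have := q.2; lia

theorem permSeq_extendPerm_left {α : Type*} (s : Fin (n + 1)) (ρ : Equiv.Perm (Fin n))
    (x : ℕ → α) : permSeq (extendPerm s 0 ρ) x =
      replaceBlock (permSeq ρ (shift 1 x)) s 0 (x 0) := by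
  have hs := s.2
  funext t
  by_cases h : t < n + 1
  · obtain ⟨a, rfl⟩ : ∃ a : Fin (n + 1), (a : ℕ) = t := ⟨⟨t, h⟩, rfl⟩
    rw [permSeq_apply_of_lt]
    refine Fin.succAboveCases s ?_ (fun k => ?_) a
    · simp [replaceBlock]
    · rw [extendPerm_succAbove, Fin.succAbove_zero]
      have h1 : replaceBlock (permSeq ρ (shift 1 x)) s 0 (x 0) (s.succAbove k) =
          permSeq ρ (shift 1 x) k := by
        refine (apply_succAbove (replaceBlock (permSeq ρ (shift 1 x)) s 0 (x 0)) s k).trans ?_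
        unfold skip replaceBlock
        split_ifs with h2 h3 h4 <;> first | rfl | (exfalso; lia)
      rw [h1, permSeq_apply_of_lt, shift]
      congr 1
      rw [Fin.val_succ, add_comm]
  · rw [permSeq_apply_of_le _ _ (by lia)]
    unfold replaceBlock
    rw [if_neg (by lia), if_neg (by lia), permSeq_apply_of_le _ _ (by lia), shift]
    congr 1; lia

theorem prod_succAbove_lt {M : Type*} [CommMonoid M] (q : Fin (n + 1)) (G : ℕ → M) :
    (∏ k : Fin n, if q.succAbove k < q then G (q.succAbove k) else 1) = ∏ t ∈ Finset.range q, G t := by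
  have h := Fin.prod_univ_succAbove (fun c : Fin (n + 1) => if c < q then G c else 1) q
  rw [if_neg (lt_irrefl q), one_mul] at h
  rw [← h, ← Finset.prod_filter]
  refine Finset.prod_bij (fun a _ => (a : ℕ)) (fun a ha => ?_) (fun a _ b _ h => Fin.ext h)
    (fun t ht => ?_) fun _ _ => rfl
  · exact Finset.mem_range.2 (Finset.mem_filter.1 ha).2
  · have h1 := Finset.mem_range.1 ht
    have h2 := q.2
    exact ⟨⟨t, by lia⟩, Finset.mem_filter.2 ⟨Finset.mem_univ _, h1⟩, rfl⟩

theorem invProd_extendPerm_zero {M : Type*} [CommMonoid M] (S : ℕ → ℕ → M) (q : Fin (n + 1))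
    (ρ : Equiv.Perm (Fin n)) : invProd S (extendPerm 0 q ρ) =
      (∏ t ∈ Finset.range q, S q t) * invProd (fun a b => S (skip q id a) (skip q id b)) ρ := by
  unfold invProd
  rw [Fin.prod_univ_succ]
  congr 1
  · rw [Fin.prod_univ_succ, if_neg (by simp), one_mul, ← prod_succAbove_lt q (S q),
      ← Equiv.prod_comp ρ fun k => if q.succAbove k < q then S q (q.succAbove k) else 1]
    refine Finset.prod_congr rfl fun k _ => ?_
    simp
  · refine Finset.prod_congr rfl fun a _ => ?_
    rw [Fin.prod_univ_succ, if_neg (by simp), one_mul]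
    refine Finset.prod_congr rfl fun b _ => ?_
    have h := fun c : Fin n => apply_succAbove id q c
    simp only [id] at h
    simp only [extendPerm_zero_succ, Fin.succ_lt_succ_iff, Fin.succAbove_lt_succAbove_iff, h]

theorem invProd_extendPerm_left {M : Type*} [CommMonoid M] (S : ℕ → ℕ → M) (s : Fin (n + 1))
    (ρ : Equiv.Perm (Fin n)) : invProd S (extendPerm s 0 ρ) =
      (∏ t ∈ Finset.range s, S (permSeq ρ (· + 1) t) 0) *
        invProd (fun a b => S (a + 1) (b + 1)) ρ := by
  unfold invProd
  rw [Fin.prod_univ_succAbove _ s, Finset.prod_eq_one (fun b _ => if_neg (by simp)), one_mul,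
    ← prod_succAbove_lt s fun t => S (permSeq ρ (· + 1) t) 0, ← Finset.prod_mul_distrib]
  refine Finset.prod_congr rfl fun a _ => ?_
  rw [Fin.prod_univ_succAbove _ s]
  congr 1
  · by_cases h : s.succAbove a < s
    · have h1 : ((s.succAbove a : Fin (n + 1)) : ℕ) = a := by
        have h2 := val_succAbove s a
        rw [Fin.lt_def, h2] at h
        rw [h2]
        split_ifs at h ⊢ <;> lia
      simp [h, h1, permSeq_apply_of_lt]
    · simp [h]
  · refine Finset.prod_congr rfl fun b _ => ?_
    simp [Fin.succAbove_lt_succAbove_iff]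

variable {𝕜 : Type*} [Field 𝕜]

theorem koszulSgn_extendPerm_zero (q : Fin (n + 1)) (ρ : Equiv.Perm (Fin n)) (d : ℕ → ℤ) :
    koszulSgn 𝕜 (extendPerm 0 q ρ) d =
      sgn 𝕜 ((d q + 1) * ∑ t ∈ Finset.range q, (d t + 1)) * koszulSgn 𝕜 ρ (skip q d) := by
  have h : ∀ t, d (skip (q : ℕ) id t) = skip q d t := fun t => by
    unfold skip; split_ifs <;> rfl
  unfold koszulSgn
  rw [invProd_extendPerm_zero, Finset.mul_sum, sgn_sum]
  simp only [h]

theorem koszulSgn_extendPerm_left (s : Fin (n + 1)) (ρ : Equiv.Perm (Fin n)) (d : ℕ → ℤ) :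
    koszulSgn 𝕜 (extendPerm s 0 ρ) d =
      sgn 𝕜 ((d 0 + 1) * ∑ t ∈ Finset.range s, (permSeq ρ (shift 1 d) t + 1)) *
        koszulSgn 𝕜 ρ (shift 1 d) := by
  have h : ∀ t, d (permSeq ρ (· + 1) t) = permSeq ρ (shift 1 d) t := fun t => by
    rw [← permSeq_comp ρ (· + 1) d]
    congr 1; funext t; rw [shift, add_comm]
  unfold koszulSgn
  rw [invProd_extendPerm_left, Finset.mul_sum, sgn_sum]
  simp only [h, shift, add_comm 1]
  congr 1
  refine Finset.prod_congr rfl fun t _ => ?_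
  rw [mul_comm]

end Extend

section ShuffleWords

variable {𝕜 : Type*} [Field 𝕜] [CharZero 𝕜] {V : Type*} [AddCommGroup V] [Module 𝕜 V]
  {W : Type*} [AddCommGroup W] [Module 𝕜 W]
  {𝒱 : ℤ → Submodule 𝕜 V} [DirectSum.Decomposition 𝒱]

theorem shuffleRight_ι_mul_ι_mul {e : ℤ} {y : V} (hy : y ∈ 𝒱 e) {d : ℕ → ℤ} {x : ℕ → V}
    (hx : Homogeneous 𝒱 d x) (n : ℕ) (v : Tens 𝕜 V) :
    shuffleRight (par 𝒱) (ι 𝕜 y * v) (word 𝕜 (n + 1) x) =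
      ι 𝕜 (x 0) * shuffleRight (par 𝒱) (ι 𝕜 y * v) (word 𝕜 n (shift 1 x)) +
      sgn 𝕜 ((e + 1) * ∑ t ∈ Finset.range (n + 1), (d t + 1)) •
        (ι 𝕜 y * shuffleRight (par 𝒱) v (word 𝕜 (n + 1) x)) := by
  have h : twist (par 𝒱) (par 𝒱) y (shuffleRight (par 𝒱) v) (word 𝕜 (n + 1) x) =
      sgn 𝕜 ((e + 1) * ∑ t ∈ Finset.range (n + 1), (d t + 1)) •
        (ι 𝕜 y * shuffleRight (par 𝒱) v (word 𝕜 (n + 1) x)) := by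
    have hp := par_apply_of_mem hy
    rcases Int.even_or_odd (e + 1) with he | he
    · rw [sgn_even he, one_smul] at hp
      rw [twist_even hp, sgn_even (he.mul_right _), one_smul]; rfl
    · rw [sgn_odd he, neg_smul, one_smul] at hp
      rw [twist_odd hp, LinearMap.comp_apply, LinearMap.comp_apply, AlgHom.toLinearMap_apply,
        tmap_par_word hx, map_smul, map_smul]
      congr 1
      obtain ⟨k, hk⟩ := he
      rw [hk]
      exact sgn_congr ⟨-k * ∑ t ∈ Finset.range (n + 1), (d t + 1), by ring⟩
  rw [shuffleRight_ι_mul, ← h]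
  conv_lhs => rw [word_succ, conv_ι_mul]
  have h1 : (LinearMap.id : Tens 𝕜 V →ₗ[𝕜] Tens 𝕜 V) ∘ₗ LinearMap.mulLeft 𝕜 (ι 𝕜 (x 0)) =
    LinearMap.mulLeft 𝕜 (ι 𝕜 (x 0)) ∘ₗ LinearMap.id := rfl
  rw [h1, mulLeft_conv, LinearMap.id_apply, one_mul, add_comm]
  rfl

/-- `τ` is the inverse of a `(p, n - p)`-unshuffle. -/
def IsShuffle {n : ℕ} (p : ℕ) (τ : Equiv.Perm (Fin n)) : Prop :=
  ∀ s t, τ s < τ t → ((τ t : ℕ) < p ∨ p ≤ (τ s : ℕ)) → s < t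

theorem mem_unshuffles_inv {n p : ℕ} {τ : Equiv.Perm (Fin n)} :
    τ⁻¹ ∈ unshuffles n p ↔ IsShuffle p τ := by
  simp only [unshuffles, Finset.mem_filter, Finset.mem_univ, true_and]
  constructor
  · intro h s t hst hp
    simpa using h _ _ hst hp
  · intro h a b hab hp
    exact h _ _ (by simpa using hab) (by simpa using hp)

theorem isShuffle_extendPerm {n p : ℕ} (q : Fin (n + 1)) (ρ : Equiv.Perm (Fin n)) :
    IsShuffle p (extendPerm 0 q ρ) ↔
      ((q : ℕ) = 0 ∧ 0 < p ∧ IsShuffle (p - 1) ρ) ∨ ((q : ℕ) = p ∧ IsShuffle p ρ) := by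
  have hq := q.2
  have hrest : IsShuffle p (extendPerm 0 q ρ) ↔
      (∀ k : Fin n, q.succAbove k < q → ((q : ℕ) < p ∨ p ≤ (q.succAbove k : ℕ)) → False) ∧
      ∀ k l : Fin n, ρ k < ρ l → ((q.succAbove (ρ l) : ℕ) < p ∨ p ≤ (q.succAbove (ρ k) : ℕ)) →
        k < l := by
    constructor
    · intro h
      refine ⟨fun k hk hp => ?_, fun k l hkl hp => ?_⟩
      · have := h (Fin.succ (ρ.symm k)) 0 (by simpa using hk) (by simpa using hp)
        simp at this
      · have := h k.succ l.succ (by simpa using hkl) (by simpa using hp)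
        simpa using this
    · rintro ⟨h1, h2⟩ s t hst hp
      cases s using Fin.cases with
      | zero =>
        cases t using Fin.cases with
        | zero => exact absurd hst (lt_irrefl _)
        | succ l => exact Fin.succ_pos l
      | succ k =>
        cases t using Fin.cases with
        | zero => exact (h1 (ρ k) (by simpa using hst) (by simpa using hp)).elim
        | succ l => simpa using h2 k l (by simpa using hst) (by simpa using hp)
  have hfirst : (∀ k : Fin n, q.succAbove k < q → ((q : ℕ) < p ∨ p ≤ (q.succAbove k : ℕ)) → False) ↔
      ((q : ℕ) = 0 ∧ 0 < p) ∨ (q : ℕ) = p := by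
    simp only [Fin.lt_def, val_succAbove]
    constructor
    · intro h
      by_cases h0 : (q : ℕ) = 0
      · lia
      · have := h ⟨q - 1, by lia⟩
        simp only at this
        rw [if_pos (by lia)] at this
        lia
    · intro h k
      split_ifs <;> lia
  have hsnd : ∀ v : Fin n, ((q : ℕ) = 0 → ((q.succAbove v : Fin (n + 1)) : ℕ) = v + 1) ∧
      ((q : ℕ) = p → (((q.succAbove v : Fin (n + 1)) : ℕ) < p ↔ (v : ℕ) < p) ∧
        (p ≤ (q.succAbove v : Fin (n + 1)) ↔ p ≤ (v : ℕ))) := fun v => by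
    rw [val_succAbove]
    split_ifs <;> lia
  rw [hrest, hfirst, or_and_right]
  refine or_congr ?_ ?_
  · rw [and_assoc]
    refine and_congr_right fun h0 => and_congr_right fun hp => ?_
    refine forall_congr' fun k => forall_congr' fun l => imp_congr_right fun _ => ?_
    rw [(hsnd _).1 h0, (hsnd _).1 h0]
    exact imp_congr_left (by lia)
  · refine and_congr_right fun hp => ?_
    refine forall_congr' fun k => forall_congr' fun l => imp_congr_right fun _ => ?_
    rw [((hsnd _).2 hp).1, ((hsnd _).2 hp).2]

theorem shift_skip {α : Type*} (p : ℕ) (x : ℕ → α) : shift p (skip p x) = shift (p + 1) x := by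
  funext t
  rw [shift, skip, if_neg (by lia), shift]
  congr 1; lia

theorem word_skip (p : ℕ) (x : ℕ → V) : word 𝕜 p (skip p x) = word 𝕜 p x :=
  word_congr fun t ht => by rw [skip, if_pos ht]

omit [CharZero 𝕜] [DirectSum.Decomposition 𝒱] in
theorem Homogeneous.skip {d : ℕ → ℤ} {x : ℕ → V} (h : Homogeneous 𝒱 d x) (p : ℕ) :
    Homogeneous 𝒱 (skip p d) (StrongHomotopy.skip p x) := by
  intro t
  unfold StrongHomotopy.skip
  split_ifs
  exacts [h _, h _]

theorem skip_zero {α : Type*} (x : ℕ → α) : skip 0 x = shift 1 x := by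
  funext t; simp [skip, shift, add_comm]

theorem sum_shuffles {d : ℕ → ℤ} {x : ℕ → V} (hx : Homogeneous 𝒱 d x) {n p : ℕ} (hp : p ≤ n) :
    ∑ σ ∈ unshuffles n p, koszulSgn 𝕜 σ⁻¹ d • word 𝕜 n (permSeq σ⁻¹ x) =
      shuffleRight (par 𝒱) (word 𝕜 (n - p) (shift p x)) (word 𝕜 p x) := by
  classical
  have h : ∀ (n p : ℕ) (d : ℕ → ℤ) (x : ℕ → V),
      ∑ σ ∈ unshuffles n p, koszulSgn 𝕜 σ⁻¹ d • word 𝕜 n (permSeq σ⁻¹ x) =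
      ∑ τ : Equiv.Perm (Fin n),
        if IsShuffle p τ then koszulSgn 𝕜 τ d • word 𝕜 n (permSeq τ x) else 0 := by
    intro n p d x
    rw [← Finset.sum_filter]
    refine Finset.sum_nbij' (fun σ => σ⁻¹) (fun σ => σ⁻¹) (fun σ hσ => ?_) (fun σ hσ => ?_)
      (fun σ _ => inv_inv σ) (fun σ _ => inv_inv σ) fun σ _ => rfl
    · rw [Finset.mem_filter, ← mem_unshuffles_inv, inv_inv]
      exact ⟨Finset.mem_univ _, hσ⟩
    · exact mem_unshuffles_inv.2 (Finset.mem_filter.1 hσ).2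
  rw [h]
  induction n generalizing p d x with
  | zero =>
    obtain rfl : p = 0 := by lia
    have : IsShuffle 0 (1 : Equiv.Perm (Fin 0)) := fun s => s.elim0
    simp [this]
  | succ n ih =>
    rw [sum_extendPerm_right 0]
    have hterm : ∀ (q : Fin (n + 1)) (ρ : Equiv.Perm (Fin n)),
        koszulSgn 𝕜 (extendPerm 0 q ρ) d • word 𝕜 (n + 1) (permSeq (extendPerm 0 q ρ) x) =
        sgn 𝕜 ((d q + 1) * ∑ t ∈ Finset.range q, (d t + 1)) • (ι 𝕜 (x q) *
          (koszulSgn 𝕜 ρ (skip q d) • word 𝕜 n (permSeq ρ (skip q x)))) := by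
      intro q ρ
      rw [permSeq_extendPerm_zero, koszulSgn_extendPerm_zero, word_succ, shift_one_consSeq,
        consSeq_zero, mul_smul, mul_smul_comm]
    have hsum : ∀ (p' : ℕ) (q : Fin (n + 1)), (∑ ρ : Equiv.Perm (Fin n), if IsShuffle p' ρ then
        koszulSgn 𝕜 (extendPerm 0 q ρ) d • word 𝕜 (n + 1) (permSeq (extendPerm 0 q ρ) x) else 0) =
        sgn 𝕜 ((d q + 1) * ∑ t ∈ Finset.range q, (d t + 1)) • (ι 𝕜 (x q) *
          ∑ ρ : Equiv.Perm (Fin n), if IsShuffle p' ρ then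
            koszulSgn 𝕜 ρ (skip q d) • word 𝕜 n (permSeq ρ (skip q x)) else 0) := by
      intro p' q
      have hq := hterm q
      generalize sgn 𝕜 ((d q + 1) * ∑ t ∈ Finset.range q, (d t + 1)) = r at hq ⊢
      rw [Finset.mul_sum, Finset.smul_sum]
      refine Finset.sum_congr rfl fun ρ _ => ?_
      split_ifs
      · exact hq ρ
      · rw [mul_zero, smul_zero]
    have hsplit : ∀ (q : Fin (n + 1)), (∑ ρ : Equiv.Perm (Fin n),
        if IsShuffle p (extendPerm 0 q ρ) then
        koszulSgn 𝕜 (extendPerm 0 q ρ) d • word 𝕜 (n + 1) (permSeq (extendPerm 0 q ρ) x) else 0) =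
        (if q = 0 then if 0 < p then ι 𝕜 (x 0) *
          (∑ ρ : Equiv.Perm (Fin n), if IsShuffle (p - 1) ρ then
            koszulSgn 𝕜 ρ (shift 1 d) • word 𝕜 n (permSeq ρ (shift 1 x)) else 0) else 0 else 0) +
        if (q : ℕ) = p then sgn 𝕜 ((d p + 1) * ∑ t ∈ Finset.range p, (d t + 1)) • (ι 𝕜 (x p) *
          ∑ ρ : Equiv.Perm (Fin n), if IsShuffle p ρ then
            koszulSgn 𝕜 ρ (skip p d) • word 𝕜 n (permSeq ρ (skip p x)) else 0) else 0 := by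
      intro q
      simp only [isShuffle_extendPerm]
      by_cases h0 : (q : ℕ) = 0 ∧ 0 < p
      · obtain rfl : q = 0 := Fin.ext h0.1
        have hne : ¬ 0 = p := h0.2.ne
        simp only [h0.1, h0.2, hne, true_and, false_and, or_false, if_true, if_false, add_zero, hsum]
        simp [skip_zero]
      · have h1 : ∀ ρ : Equiv.Perm (Fin n), ((q : ℕ) = 0 ∧ 0 < p ∧ IsShuffle (p - 1) ρ) ↔ False :=
          fun ρ => iff_false_intro fun h => h0 ⟨h.1, h.2.1⟩
        have h2 : (if q = 0 then if 0 < p then ι 𝕜 (x 0) *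
          (∑ ρ : Equiv.Perm (Fin n), if IsShuffle (p - 1) ρ then
            koszulSgn 𝕜 ρ (shift 1 d) • word 𝕜 n (permSeq ρ (shift 1 x)) else 0) else 0 else 0) = 0 := by
          split_ifs with h3 h4
          · exact absurd ⟨by rw [h3]; rfl, h4⟩ h0
          · rfl
          · rfl
        simp only [h1, false_or, h2, zero_add]
        by_cases h3 : (q : ℕ) = p
        · subst h3
          simp only [true_and, if_true, hsum]
        · simp [h3]
    simp only [hsplit]
    rw [Finset.sum_add_distrib, Finset.sum_ite_eq' Finset.univ (0 : Fin (n + 1)),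
      if_pos (Finset.mem_univ _)]
    have hq : ∀ Y : Tens 𝕜 V, (∑ q : Fin (n + 1), if (q : ℕ) = p then Y else 0) =
        if p ≤ n then Y else 0 := by
      intro Y
      split_ifs with hpn
      · rw [Finset.sum_eq_single (⟨p, by lia⟩ : Fin (n + 1))]
        · simp
        · exact fun q _ hq => if_neg fun e => hq (Fin.ext e)
        · simp
      · exact Finset.sum_eq_zero fun q _ => if_neg (by have := q.2; lia)
    rw [hq]
    rcases Nat.eq_zero_or_pos p with rfl | hp0
    · rw [if_neg (lt_irrefl 0), if_pos (Nat.zero_le n), skip_zero, skip_zero,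
        ih (hx.shift 1) (Nat.zero_le n)]
      simp [one_shuffleRight, word_succ]
    · obtain ⟨p, rfl⟩ : ∃ p', p = p' + 1 := ⟨p - 1, by lia⟩
      rw [if_pos hp0, add_tsub_cancel_right, ih (hx.shift 1) (by lia), shift_shift]
      by_cases hpn : p + 1 ≤ n
      · have h1 : word 𝕜 (n - p) (shift (p + 1) x) =
            ι 𝕜 (x (p + 1)) * word 𝕜 (n - (p + 1)) (shift (p + 1 + 1) x) := by
          rw [show n - p = (n - (p + 1)) + 1 by lia, word_succ, shift_shift]; rfl
        rw [if_pos hpn, ih (hx.skip _) hpn, shift_skip, word_skip, Nat.add_sub_add_right, add_comm 1 p,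
          h1, shuffleRight_ι_mul_ι_mul (hx (p + 1)) hx]
      · obtain rfl : n = p := by lia
        simp [hpn, word_succ]

end ShuffleWords

section Balanced

variable {𝕜 : Type*} [Field 𝕜] [CharZero 𝕜] {V : Type*} [AddCommGroup V] [Module 𝕜 V]
  {W : Type*} [AddCommGroup W] [Module 𝕜 W]
  {𝒱 : ℤ → Submodule 𝕜 V} [DirectSum.Decomposition 𝒱]
  {F : Ops 𝕜 V W} {f : Tens 𝕜 V →ₗ[𝕜] W} {κ : ℕ → 𝕜}

theorem Represents.apply_shuffle (hf : Represents 𝒱 κ F f) {n p : ℕ} (hp : p ≤ n) {d : ℕ → ℤ}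
    {x : ℕ → V} (hx : Homogeneous 𝒱 d x) :
    f (shuffleRight (par 𝒱) (word 𝕜 (n - p) (shift p x)) (word 𝕜 p x)) =
      (κ n * sgn 𝕜 (tw n d)) •
        ∑ σ ∈ unshuffles n p, antiKoszulSign σ⁻¹ d • ev (F n) (permSeq σ⁻¹ x) := by
  rw [← sum_shuffles hx hp, map_sum, Finset.smul_sum]
  refine Finset.sum_congr rfl fun σ _ => ?_
  rw [map_smul, hf n _ _ (hx.permSeq σ⁻¹), antiKoszulSign_smul (𝕜 := 𝕜), smul_smul, smul_smul]
  congr 1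
  have := sgn_mul_self (𝕜 := 𝕜) (tw n d)
  linear_combination (-(koszulSgn 𝕜 σ⁻¹ d * κ n * sgn 𝕜 (tw n (permSeq σ⁻¹ d)))) * this

theorem Represents.vanishesOnShuffles (hf : Represents 𝒱 κ F f) {n : ℕ} (hκ : κ n ≠ 0)
    (h : ∀ t ∈ posShuffles (par 𝒱), f t = 0) : VanishesOnShuffles 𝒱 (F n) := by
  intro p hp hpn d x hx
  have h1 := hf.apply_shuffle hpn.le hx
  have h2 : ∀ (k : ℕ) (y : ℕ → V), 0 < k → eps (word 𝕜 k y) = 0 := by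
    intro k y hk
    obtain ⟨k, rfl⟩ : ∃ k', k = k' + 1 := ⟨k - 1, by lia⟩
    rw [word_succ, eps_ι_mul]
  rw [h _ (shuffleRight_mem_posShuffles _ (h2 _ _ hp) (h2 _ _ (by lia)))] at h1
  exact (smul_eq_zero.1 h1.symm).resolve_left (mul_ne_zero hκ (sgn_ne_zero _))

theorem Represents.apply_eq_zero_of_mem_posShuffles (hf : Represents 𝒱 κ F f)
    (h : ∀ n, VanishesOnShuffles 𝒱 (F n)) {t : Tens 𝕜 V} (ht : t ∈ posShuffles (par 𝒱)) :
    f t = 0 := by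
  let r : Tens 𝕜 V →ₗ[𝕜] Tens 𝕜 V :=
    LinearMap.id - (Algebra.linearMap 𝕜 (Tens 𝕜 V)) ∘ₗ eps.toLinearMap
  have hr : ∀ u, eps u = 0 → r u = u := fun u hu => by simp [r, hu]
  have hr0 : ∀ y : ℕ → V, r (word 𝕜 0 y) = 0 := fun y => by simp [r]
  have hrs : ∀ (k : ℕ) (y : ℕ → V), r (word 𝕜 (k + 1) y) = word 𝕜 (k + 1) y := fun k y =>
    hr _ (by rw [word_succ, eps_ι_mul])
  have key : ∀ (p q : ℕ) d x, Homogeneous 𝒱 d x → ∀ e y, Homogeneous 𝒱 e y →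
      f (shuffleRight (par 𝒱) (word 𝕜 (q + 1) y) (word 𝕜 (p + 1) x)) = 0 := by
    intro p q d x hx e y hy
    let z : ℕ → V := fun t => if t < p + 1 then x t else y (t - (p + 1))
    let d' : ℕ → ℤ := fun t => if t < p + 1 then d t else e (t - (p + 1))
    have hz : Homogeneous 𝒱 d' z := fun t => by
      simp only [z, d']
      split_ifs
      exacts [hx t, hy _]
    have h1 : word 𝕜 (p + 1) z = word 𝕜 (p + 1) x := word_congr fun t ht => if_pos ht
    have h2 : shift (p + 1) z = y := by
      funext t
      simp only [shift, z]
      rw [if_neg (by lia), add_tsub_cancel_left]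
    have h3 := hf.apply_shuffle (n := p + 1 + (q + 1)) (p := p + 1) (by lia) hz
    rw [h _ (p + 1) (by lia) (by lia) d' z hz, smul_zero, h1, h2, add_tsub_cancel_left] at h3
    exact h3
  have hB : ∀ u v, f (shuffleRight (par 𝒱) (r v) (r u)) = 0 := by
    intro u
    have h1 : ∀ v, f (shuffleRight (par 𝒱) (r v) (r u)) =
      ((sandwich f r ∘ₗ shuffleRight (par 𝒱)) ∘ₗ r) v u := fun v => rfl
    have h2 : ((sandwich f r ∘ₗ shuffleRight (par 𝒱)) ∘ₗ r) = 0 := by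
      refine word_ext 𝒱 fun q e y hy => word_ext 𝒱 fun p d x hx => ?_
      change f (shuffleRight (par 𝒱) (r (word 𝕜 q y)) (r (word 𝕜 p x))) = 0
      cases q with
      | zero => rw [hr0, map_zero, LinearMap.zero_apply, map_zero]
      | succ q =>
        cases p with
        | zero => rw [hr0, map_zero, map_zero]
        | succ p => rw [hrs, hrs]; exact key p q d x hx e y hy
    intro v
    rw [h1, h2]; rfl
  refine posShuffles_le (Q := LinearMap.ker f) (fun u v hu hv => ?_) ht
  rw [LinearMap.mem_ker, ← hr u hu, ← hr v hv]
  exact hB u v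

omit [CharZero 𝕜] [DirectSum.Decomposition 𝒱] in
theorem vanishesOnShuffles_zero (n : ℕ) :
    VanishesOnShuffles 𝒱 (0 : MultilinearMap 𝕜 (fun _ : Fin n => V) W) :=
  fun p _ _ d x _ => Finset.sum_eq_zero fun σ _ => by simp [ev]

omit [CharZero 𝕜] [DirectSum.Decomposition 𝒱] in
theorem IsAlgebraFamily.vanishesOnShuffles {K : ℕ∞} {dV : V →ₗ[𝕜] V} {m M : Ops 𝕜 V V}
    (hM : IsAlgebraFamily 𝒱 K dV m M)
    (h : ∀ n : ℕ, 2 ≤ n → (n : ℕ∞) ≤ K → VanishesOnShuffles 𝒱 (m n)) (n : ℕ) :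
    VanishesOnShuffles 𝒱 (M n) := by
  by_cases hn : 2 ≤ n
  · rcases le_or_gt (n : ℕ∞) K with hK | hK
    · rw [hM.eq n hn hK]; exact h n hn hK
    · rw [hM.zero_of_lt n hn hK]; exact vanishesOnShuffles_zero n
  · exact fun p hp hpn => by lia

variable {𝒲 : ℤ → Submodule 𝕜 W} [DirectSum.Decomposition 𝒲]

omit [CharZero 𝕜] [DirectSum.Decomposition 𝒱] [DirectSum.Decomposition 𝒲] in
theorem IsMorphismFamily.vanishesOnShuffles {K : ℕ∞} {G : Ops 𝕜 V W}
    (hG : IsMorphismFamily 𝒱 𝒲 K F G)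
    (h : ∀ n : ℕ, 1 ≤ n → (n : ℕ∞) ≤ K → VanishesOnShuffles 𝒱 (F n)) (n : ℕ) :
    VanishesOnShuffles 𝒱 (G n) := by
  by_cases hn : 1 ≤ n
  · rcases le_or_gt (n : ℕ∞) K with hK | hK
    · rw [hG.eq n hn hK]; exact h n hn hK
    · rw [hG.zero_of_lt n hK]; exact vanishesOnShuffles_zero n
  · exact fun p hp hpn => by lia

variable {dV : V →ₗ[𝕜] V} {dW : W →ₗ[𝕜] W} {m : Ops 𝕜 V V} {l : Ops 𝕜 W W} {K : ℕ}

theorem exists_extension_A (hK : 1 ≤ K) (hq : IsQuasiIso dV dW (linearPart F))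
    (hm : IsAAlgebra ⊤ 𝒱 dV m) (hl : IsAAlgebra K 𝒲 dW l) (hF : IsAMorphism K 𝒱 𝒲 dV dW m l F) :
    ∃ (l' : Ops 𝕜 W W) (F' : Ops 𝕜 V W),
      (∀ i, 2 ≤ i → i ≤ K → l' i = l i) ∧ (∀ i, 1 ≤ i → i ≤ K → F' i = F i) ∧
      IsAAlgebra ⊤ 𝒲 dW l' ∧ IsAMorphism ⊤ 𝒱 𝒲 dV dW m l' F' := by
  obtain ⟨l', F', -, -, h1, h2, h3, h4, -⟩ := exists_A_extension
    (isStable_lenSub (par 𝒱)).isAdmissible_bot (isStable_lenSub (par 𝒲)).isAdmissible_bot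
    (isCompatible_lenSub _ _).isAdmissibleMap_bot (isCompatible_lenSub _ _).isAdmissibleMap_bot
    hK hq hm hl hF (fun _ b _ _ t ht => by rw [(Submodule.mem_bot 𝕜).1 ht, map_zero])
    (fun _ b _ _ t ht => by rw [(Submodule.mem_bot 𝕜).1 ht, map_zero])
    (fun _ b _ _ t ht => by rw [(Submodule.mem_bot 𝕜).1 ht, map_zero])
  exact ⟨l', F', h1, h2, h3, h4⟩

theorem exists_extension_C (hK : 1 ≤ K) (hq : IsQuasiIso dV dW (linearPart F))
    (hm : IsCAlgebra ⊤ 𝒱 dV m) (hl : IsCAlgebra K 𝒲 dW l) (hF : IsCMorphism K 𝒱 𝒲 dV dW m l F) :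
    ∃ (l' : Ops 𝕜 W W) (F' : Ops 𝕜 V W),
      (∀ i, 2 ≤ i → i ≤ K → l' i = l i) ∧ (∀ i, 1 ≤ i → i ≤ K → F' i = F i) ∧
      IsCAlgebra ⊤ 𝒲 dW l' ∧ IsCMorphism ⊤ 𝒱 𝒲 dV dW m l' F' := by
  obtain ⟨l', F', c, f, h1, h2, h3, h4, h5, h6, h7, h8⟩ := exists_A_extension
    (isAdmissible_posShuffles (par_par _)) (isAdmissible_posShuffles (par_par _))
    (isAdmissibleMap_posShuffles (par_par _)) (isAdmissibleMap_posShuffles (par_par _))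
    hK hq hm.toIsAAlgebra hl.toIsAAlgebra hF.toIsAMorphism
    (fun M b hM hb t ht => hb.apply_eq_zero_of_mem_posShuffles
      (hM.vanishesOnShuffles hm.balanced) ht)
    (fun M b hM hb t ht => hb.apply_eq_zero_of_mem_posShuffles
      (hM.vanishesOnShuffles hl.balanced) ht)
    (fun M b hM hb t ht => hb.apply_eq_zero_of_mem_posShuffles
      (hM.vanishesOnShuffles hF.balanced) ht)
  exact ⟨l', F', h1, h2, ⟨h3, fun n _ _ => h5.vanishesOnShuffles (suspSgn_ne_zero n) h7⟩,
    ⟨h4, fun n _ _ => h6.vanishesOnShuffles (suspSgn_ne_zero n) h8⟩⟩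

end Balanced

section Cosets

variable {n : ℕ} {ι : Type*} [LinearOrder ι]

theorem eq_one_of_strictMono {σ : Equiv.Perm (Fin n)} (h : StrictMono σ) : σ = 1 := by
  refine Equiv.ext fun a => ?_
  have : (h.orderIsoOfSurjective _ σ.surjective) = OrderIso.refl _ := Subsingleton.elim _ _
  exact congrArg (fun e : Fin n ≃o Fin n => e a) this

theorem perm_induction_of_monotone {g : Fin n → ι} (hg : Monotone g) {P : Equiv.Perm (Fin n) → Prop}
    (one : P 1) (step : ∀ (ρ : Equiv.Perm (Fin n)) (i : ℕ) (hi : i + 1 < n),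
      g ⟨i, by lia⟩ = g ⟨i + 1, hi⟩ → P ρ → P (ρ * Equiv.swap ⟨i, by lia⟩ ⟨i + 1, hi⟩))
    (ρ : Equiv.Perm (Fin n)) (hρ : g ∘ ρ = g) : P ρ := by
  classical
  induction hN : ∑ a : Fin n, (n - a) * (ρ a : ℕ) using Nat.strong_induction_on
    generalizing ρ with
  | _ N ih =>
  by_cases h1 : ∃ (i : ℕ) (hi : i + 1 < n), ρ ⟨i + 1, hi⟩ < ρ ⟨i, by lia⟩
  · obtain ⟨i, hi, h1⟩ := h1
    have hgi : g ⟨i, by lia⟩ = g ⟨i + 1, hi⟩ := by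
      refine le_antisymm (hg (by simp [Fin.le_def])) ?_
      rw [← congrFun hρ ⟨i, by lia⟩, ← congrFun hρ ⟨i + 1, hi⟩]
      exact hg h1.le
    set s := Equiv.swap (⟨i, by lia⟩ : Fin n) ⟨i + 1, hi⟩ with hs
    have h2 := step (ρ * s) i hi hgi
    rw [mul_assoc, Equiv.swap_mul_self, mul_one] at h2
    refine h2 (ih _ ?_ (ρ * s) ?_ rfl)
    · rw [← hN, ← Equiv.sum_comp s]
      have h3 : ∀ a, (ρ * s) (s a) = ρ a := fun a => by simp [hs]
      simp only [h3]
      have h4 : ∑ a : Fin n, (((n - s a : ℕ) : ℤ) - ((n - a : ℕ) : ℤ)) * (ρ a : ℤ) =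
          -1 * (ρ ⟨i, by lia⟩ : ℤ) + 1 * (ρ ⟨i + 1, hi⟩ : ℤ) := by
        rw [Fintype.sum_eq_add (⟨i, by lia⟩ : Fin n) ⟨i + 1, hi⟩ (by simp [Fin.ext_iff])
          fun a ha => by rw [hs, Equiv.swap_apply_of_ne_of_ne ha.1 ha.2, sub_self, zero_mul]]
        rw [hs, Equiv.swap_apply_left, Equiv.swap_apply_right]
        congr 2 <;> (simp only; lia)
      have h5 : (ρ ⟨i + 1, hi⟩ : ℤ) < ρ ⟨i, by lia⟩ := by exact_mod_cast h1
      simp only [sub_mul, Finset.sum_sub_distrib] at h4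
      zify
      lia
    · funext a
      change g (ρ (s a)) = g a
      have h3 : g (ρ (s a)) = g (s a) := congrFun hρ (s a)
      rw [h3, hs, Equiv.swap_apply_def]
      split_ifs with e1 e2
      · rw [e1, hgi]
      · rw [e2, hgi]
      · rfl
  · have : ρ = 1 := by
      refine eq_one_of_strictMono ?_
      push Not at h1
      cases n with
      | zero => exact fun a => a.elim0
      | succ n =>
      refine Fin.strictMono_iff_lt_succ.2 fun a => lt_of_le_of_ne (h1 a (by simp)) fun e => ?_
      have := ρ.injective e
      simp [Fin.ext_iff] at this
    rw [this]; exact one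

theorem sum_eq_card_mul_sum [Fintype ι] {M : Type*} [AddCommMonoid M] {g : Fin n → ι}
    (hg : Monotone g) {h : Equiv.Perm (Fin n) → M} (hh : ∀ (σ ρ : Equiv.Perm (Fin n)), g ∘ ρ = g → h (σ * ρ) = h σ)
    (R : Finset (Equiv.Perm (Fin n)))
    (hR : ∀ σ, σ ∈ R ↔ ∀ a b, a < b → g a = g b → σ a < σ b) :
    ∑ σ, h σ = (∏ i : ι, (Fintype.card {a // g a = i}).factorial) • ∑ σ ∈ R, h σ := by
  classical
  rw [← DomMulAct.stabilizer_card g, ← Finset.card_univ, ← Finset.sum_const, ← Finset.sum_product']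
  symm
  refine Finset.sum_bij (fun x _ => x.2 * x.1.1) (fun _ _ => Finset.mem_univ _) ?_ ?_
    fun x _ => (hh _ _ x.1.2).symm
  · rintro ⟨⟨ρ, hρ⟩, σ⟩ hσ ⟨⟨ρ', hρ'⟩, σ'⟩ hσ' e
    simp only [Finset.mem_product, Finset.mem_univ, true_and, hR] at hσ hσ' e
    have e1 : σ' * (ρ' * ρ⁻¹) = σ := by rw [← mul_assoc, ← e, mul_inv_cancel_right]
    have hρi : ∀ a, g (ρ⁻¹ a) = g a := fun a => by
      have := congrFun hρ (ρ⁻¹ a)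
      simpa using this.symm
    have e2 : ∀ a, g ((ρ' * ρ⁻¹) a) = g a := fun a => (congrFun hρ' (ρ⁻¹ a)).trans (hρi a)
    have e3 : ρ' * ρ⁻¹ = 1 := by
      refine eq_one_of_strictMono fun a b hab => ?_
      rcases (hg hab.le).lt_or_eq with h1 | h1
      · refine lt_of_not_ge fun h2 => absurd (hg h2) (not_le.2 ?_)
        rwa [e2, e2]
      · have h2 := hσ a b hab h1
        rw [← e1] at h2
        refine lt_of_not_ge fun h3 => absurd h2 (not_lt.2 ?_)
        rcases h3.lt_or_eq with h4 | h4
        · exact (hσ' _ _ h4 (by rw [e2, e2, h1])).le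
        · rw [Equiv.Perm.mul_apply, Equiv.Perm.mul_apply σ', h4]
    rw [e3, mul_one] at e1
    have e4 := mul_inv_eq_one.1 e3
    simp [e1, e4]
  · intro τ _
    let key : Fin n → ι ×ₗ Fin n := fun t => toLex (g t, τ t)
    let ρ := Tuple.sort key
    have hk : Monotone (key ∘ ρ) := Tuple.monotone_sort key
    have hgρ : g ∘ ρ = g := by
      have h1 : Monotone (g ∘ ρ) := fun a b hab => Prod.Lex.monotone_fst _ _ (hk hab)
      exact Tuple.unique_monotone (f := g) (σ := ρ) (τ := 1) h1 hg
    have hgi : g ∘ ⇑ρ⁻¹ = g := by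
      funext a
      have := congrFun hgρ (ρ⁻¹ a)
      simpa using this.symm
    refine ⟨(⟨ρ⁻¹, hgi⟩, τ * ρ), ?_, by simp⟩
    simp only [Finset.mem_product, Finset.mem_univ, true_and, hR]
    intro a b hab hgab
    refine lt_of_le_of_ne ?_ fun e => hab.ne ((τ * ρ).injective e)
    have h1 := hk hab.le
    simp only [Function.comp_apply, key, Prod.Lex.toLex_le_toLex] at h1
    rcases h1 with h1 | h1
    · have h2 := congrFun hgρ a
      have h3 := congrFun hgρ b
      simp only [Function.comp_apply] at h2 h3
      rw [h2, h3, hgab] at h1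
      exact absurd h1 (lt_irrefl _)
    · exact h1.2

theorem composition_index_monotone {n : ℕ} (c : Composition n) : Monotone c.index := by
  intro a b hab
  by_contra h
  have h1 : (c.index b : ℕ) + 1 ≤ c.index a := Fin.lt_def.1 (not_le.1 h)
  have h2 := c.monotone_sizeUpTo h1
  have h3 := c.sizeUpTo_index_le a
  have h4 := c.lt_sizeUpTo_index_succ b
  rw [Fin.val_succ] at h4
  have h5 : (a : ℕ) ≤ b := hab
  lia

theorem composition_card_index {n : ℕ} (c : Composition n) (i : Fin c.length) :
    Fintype.card {a // c.index a = i} = c.blocksFun i := by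
  rw [← Fintype.card_fin (c.blocksFun i)]
  refine (Fintype.card_of_bijective (f := fun k => ⟨c.embedding i k, c.index_embedding i k⟩)
    ⟨fun k k' h => (c.embedding i).injective (congrArg Subtype.val h), ?_⟩).symm
  rintro ⟨a, rfl⟩
  exact ⟨c.invEmbedding a, Subtype.ext (c.embedding_comp_inv a)⟩

end Cosets

section Symm

variable {𝕜 : Type*} [Field 𝕜] {V : Type*} [AddCommGroup V] [Module 𝕜 V]
  {W : Type*} [AddCommGroup W] [Module 𝕜 W] {N : Type*} [AddCommGroup N] [Module 𝕜 N]
  {𝒱 : ℤ → Submodule 𝕜 V}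

/-- `g` is symmetric, in the sense of the degrees in the suspension. -/
def IsSymm (𝒱 : ℤ → Submodule 𝕜 V) (g : Tens 𝕜 V →ₗ[𝕜] N) : Prop :=
  ∀ (n : ℕ) (σ : Equiv.Perm (Fin n)) d x, Homogeneous 𝒱 d x →
    g (word 𝕜 n (permSeq σ x)) = koszulSgn 𝕜 σ d • g (word 𝕜 n x)

theorem koszulSgn_mul_self {n : ℕ} (σ : Equiv.Perm (Fin n)) (d : ℕ → ℤ) :
    koszulSgn 𝕜 σ d * koszulSgn 𝕜 σ d = 1 := by
  unfold koszulSgn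
  rw [← invProd_mul_right]
  simp only [sgn_mul_self]
  exact Finset.prod_eq_one fun a _ => Finset.prod_eq_one fun b _ => by split_ifs <;> rfl

theorem permSeq_swap {α : Type*} {n i : ℕ} (hi : i + 1 < n) (x : ℕ → α) (t : ℕ) :
    permSeq (Equiv.swap (⟨i, by lia⟩ : Fin n) ⟨i + 1, hi⟩) x t =
      if t = i then x (i + 1) else if t = i + 1 then x i else x t := by
  unfold permSeq
  split_ifs with h1 h2 h3 h2 h3
  · subst h2; rw [Equiv.swap_apply_left]
  · subst h3; rw [Equiv.swap_apply_right]
  · rw [Equiv.swap_apply_of_ne_of_ne (by simpa [Fin.ext_iff]) (by simpa [Fin.ext_iff])]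
  · lia
  · lia
  · rfl

theorem IsSymm.apply_swap {g : Tens 𝕜 V →ₗ[𝕜] N} (hg : IsSymm 𝒱 g) {n i s r : ℕ} (hi : i + 1 < n)
    (hs : s ≤ i) (hr : i + 1 < s + r) {d : ℕ → ℤ} {x : ℕ → V} (hx : Homogeneous 𝒱 d x) :
    g (word 𝕜 r (shift s (permSeq (Equiv.swap (⟨i, by lia⟩ : Fin n) ⟨i + 1, hi⟩) x))) =
      sgn 𝕜 ((d i + 1) * (d (i + 1) + 1)) • g (word 𝕜 r (shift s x)) := by
  obtain ⟨k, rfl⟩ := Nat.exists_eq_add_of_le hs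
  have h := hg r (Equiv.swap ⟨k, by lia⟩ ⟨k + 1, by lia⟩) _ _ (hx.shift s)
  rw [koszulSgn_swap] at h
  refine Eq.trans (congrArg g (word_congr fun t ht => ?_)) h
  rw [shift, permSeq_swap, permSeq_swap]
  simp only [shift, add_assoc, add_right_inj]

theorem word_shift_swap {n i s r : ℕ} (hi : i + 1 < n) (h : i + 1 < s ∨ s + r ≤ i) (x : ℕ → V) :
    word 𝕜 r (shift s (permSeq (Equiv.swap (⟨i, by lia⟩ : Fin n) ⟨i + 1, hi⟩) x)) =
      word 𝕜 r (shift s x) :=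
  word_congr fun t ht => by
    rw [shift, permSeq_swap, if_neg (by lia), if_neg (by lia), shift]

theorem sum_perm_eq {n : ℕ} {ι : Type*} [LinearOrder ι] [Fintype ι] {g : Fin n → ι}
    (hg : Monotone g) {G : (ℕ → V) → N} (hG : ∀ (i : ℕ) (hi : i + 1 < n),
      g ⟨i, by lia⟩ = g ⟨i + 1, hi⟩ → ∀ d x, Homogeneous 𝒱 d x →
      G (permSeq (Equiv.swap (⟨i, by lia⟩ : Fin n) ⟨i + 1, hi⟩) x) =
        sgn 𝕜 ((d i + 1) * (d (i + 1) + 1)) • G x) (R : Finset (Equiv.Perm (Fin n)))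
    (hR : ∀ σ, σ ∈ R ↔ ∀ a b, a < b → g a = g b → σ a < σ b) {d : ℕ → ℤ} {x : ℕ → V}
    (hx : Homogeneous 𝒱 d x) :
    ∑ σ : Equiv.Perm (Fin n), koszulSgn 𝕜 σ d • G (permSeq σ x) =
      ((∏ i : ι, (Fintype.card {a // g a = i}).factorial : ℕ) : 𝕜) •
        ∑ σ ∈ R, koszulSgn 𝕜 σ d • G (permSeq σ x) := by
  rw [Nat.cast_smul_eq_nsmul]
  refine sum_eq_card_mul_sum hg (fun σ ρ hρ => ?_) R hR
  refine perm_induction_of_monotone hg (P := fun ρ => koszulSgn 𝕜 (σ * ρ) d • G (permSeq (σ * ρ) x) =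
    koszulSgn 𝕜 σ d • G (permSeq σ x)) (by simp) (fun ρ i hi hgi h => ?_) ρ hρ
  rw [← h, ← mul_assoc, koszulSgn_mul, permSeq_mul _ _ x, hG i hi hgi _ _ (hx.permSeq _),
    koszulSgn_swap, smul_smul, mul_assoc, sgn_mul_self, mul_one]

theorem sum_perm_eq_unshuffles {n j r : ℕ} (hn : j + r = n) {G : (ℕ → V) → N}
    (hG : ∀ (i : ℕ) (hi : i + 1 < n), (i + 1 < j ∨ j ≤ i) → ∀ d x, Homogeneous 𝒱 d x →
      G (permSeq (Equiv.swap (⟨i, by lia⟩ : Fin n) ⟨i + 1, hi⟩) x) =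
        sgn 𝕜 ((d i + 1) * (d (i + 1) + 1)) • G x) {d : ℕ → ℤ} {x : ℕ → V}
    (hx : Homogeneous 𝒱 d x) :
    ∑ σ : Equiv.Perm (Fin n), koszulSgn 𝕜 σ d • G (permSeq σ x) =
      ((j.factorial : 𝕜) * r.factorial) •
        ∑ σ ∈ unshuffles n j, koszulSgn 𝕜 σ d • G (permSeq σ x) := by
  have hg : Monotone fun t : Fin n => decide (j ≤ (t : ℕ)) := fun a b hab => by
    have : (a : ℕ) ≤ b := hab
    by_cases h : j ≤ (a : ℕ)
    · simp [h, h.trans this]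
    · simp [h]
  have h := sum_perm_eq (𝕜 := 𝕜) hg (fun i hi h => hG i hi (by
    simp only [decide_eq_decide] at h; lia)) (unshuffles n j) (fun σ => ?_) hx
  · rw [h, Fintype.prod_bool]
    congr 1
    have h1 : Fintype.card {a : Fin n // decide (j ≤ (a : ℕ)) = true} = r := by
      have : Fintype.card {a : Fin n // j ≤ (a : ℕ)} = r := by
        rw [Fintype.card_subtype, Finset.card_filter, Fin.sum_univ_eq_sum_range
          (fun a => if j ≤ a then 1 else 0), ← hn, Finset.sum_range_add]
        rw [Finset.sum_eq_zero fun a ha => if_neg (by have := Finset.mem_range.1 ha; lia)]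
        simp
      simpa using this
    have h2 : Fintype.card {a : Fin n // decide (j ≤ (a : ℕ)) = false} = j := by
      have : Fintype.card {a : Fin n // (a : ℕ) < j} = j := by
        rw [Fintype.card_subtype, Finset.card_filter, Fin.sum_univ_eq_sum_range
          (fun a => if a < j then 1 else 0), ← hn, Finset.sum_range_add, add_comm]
        rw [Finset.sum_eq_zero fun a ha => if_neg (by lia)]
        rw [Finset.sum_congr rfl fun a ha => if_pos (Finset.mem_range.1 ha)]
        simp
      simpa using this
    rw [h1, h2, Nat.cast_mul, mul_comm]
  · simp only [unshuffles, Finset.mem_filter, Finset.mem_univ, true_and, decide_eq_decide]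
    refine forall_congr' fun a => forall_congr' fun b => forall_congr' fun hab => imp_congr_left ?_
    have : (a : ℕ) < b := hab
    lia

theorem sum_perm_eq_blockUnshuffles {n : ℕ} (c : Composition n) {G : (ℕ → V) → N}
    (hG : ∀ (i : ℕ) (hi : i + 1 < n), c.index ⟨i, by lia⟩ = c.index ⟨i + 1, hi⟩ →
      ∀ d x, Homogeneous 𝒱 d x →
      G (permSeq (Equiv.swap (⟨i, by lia⟩ : Fin n) ⟨i + 1, hi⟩) x) =
        sgn 𝕜 ((d i + 1) * (d (i + 1) + 1)) • G x) {d : ℕ → ℤ} {x : ℕ → V}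
    (hx : Homogeneous 𝒱 d x) :
    ∑ σ : Equiv.Perm (Fin n), koszulSgn 𝕜 σ d • G (permSeq σ x) =
      ((∏ a : Fin c.length, (c.blocksFun a).factorial : ℕ) : 𝕜) •
        ∑ σ ∈ blockUnshuffles c, koszulSgn 𝕜 σ d • G (permSeq σ x) := by
  rw [sum_perm_eq (composition_index_monotone c) hG (blockUnshuffles c)
    (fun σ => by simp [blockUnshuffles]) hx]
  simp only [composition_card_index]

variable [DirectSum.Decomposition 𝒱] {F : Ops 𝕜 V W} {f : Tens 𝕜 V →ₗ[𝕜] W} {κ : ℕ → 𝕜}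

theorem Represents.isSymm (hf : Represents 𝒱 κ F f) (hF : ∀ n, GradedAntisymmetric 𝒱 (F n)) :
    IsSymm 𝒱 f := by
  intro n σ d x hx
  rw [hf n _ _ (hx.permSeq σ), hf n _ _ hx, hF n σ d x hx, antiKoszulSign_smul (𝕜 := 𝕜), smul_smul,
    smul_smul]
  congr 1
  have := sgn_mul_self (𝕜 := 𝕜) (tw n (permSeq σ d))
  linear_combination (κ n * koszulSgn 𝕜 σ d * sgn 𝕜 (tw n d)) * this

theorem Represents.gradedAntisymmetric (hf : Represents 𝒱 κ F f) (hfs : IsSymm 𝒱 f) {n : ℕ}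
    (hκ : κ n ≠ 0) : GradedAntisymmetric 𝒱 (F n) := by
  intro σ d x hx
  have h := hfs n σ d x hx
  rw [hf n _ _ (hx.permSeq σ), hf n _ _ hx, smul_smul] at h
  refine smul_right_injective _ (mul_ne_zero hκ (sgn_ne_zero (tw n (permSeq σ d)))) (h.trans ?_)
  dsimp only
  rw [antiKoszulSign_smul (𝕜 := 𝕜), smul_smul]
  congr 1
  have := sgn_mul_self (𝕜 := 𝕜) (tw n (permSeq σ d))
  linear_combination (-(κ n * koszulSgn 𝕜 σ d * sgn 𝕜 (tw n d))) * this

/-! ### Symmetrization -/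

theorem exists_symmetrizer (β : V →ₗ[𝕜] V) : ∃ r : Tens 𝕜 V →ₗ[𝕜] Tens 𝕜 V,
    r 1 = 1 ∧ ∀ x w, r (ι 𝕜 x * w) = insertLin β x (r w) :=
  exists_fold 1 (LinearMap.mk₂ 𝕜
    (fun x (z : Tens 𝕜 V × Tens 𝕜 V) => insertLin β x z.2)
    (by intro x y z; simp) (by intro r x z; simp) (by intro x y z; simp) (by intro r x z; simp))

/-- The sum of all graded permutations of a tensor. -/
noncomputable def symmetrizer (β : V →ₗ[𝕜] V) : Tens 𝕜 V →ₗ[𝕜] Tens 𝕜 V :=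
  (exists_symmetrizer β).choose

@[simp] theorem symmetrizer_one (β : V →ₗ[𝕜] V) : symmetrizer β 1 = 1 :=
  (exists_symmetrizer β).choose_spec.1

theorem symmetrizer_ι_mul (β : V →ₗ[𝕜] V) (x : V) (w : Tens 𝕜 V) :
    symmetrizer β (ι 𝕜 x * w) = insertLin β x (symmetrizer β w) :=
  (exists_symmetrizer β).choose_spec.2 x w

variable [CharZero 𝕜]

theorem insertLin_of_parity {β θ : V →ₗ[𝕜] V} {y : V} (hy : IsParity β θ y) :
    insertLin β y = insertLetter θ y := by
  have h0 : ∀ θ : V →ₗ[𝕜] V, ∀ w, insertLetter θ 0 w = 0 := fun θ w => by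
    rw [insertLetter_eq_conv]; simp
  ext w
  rw [insertLin_eq]
  rcases hy with ⟨rfl, hy⟩ | ⟨rfl, hy⟩
  · rw [evenPart_of_even hy, oddPart_of_even hy, h0, add_zero]
  · rw [evenPart_of_odd hy, oddPart_of_odd hy, h0, zero_add]

theorem insertLin_word {e : ℤ} {y : V} (hy : y ∈ 𝒱 e) {d : ℕ → ℤ} {x : ℕ → V}
    (hx : Homogeneous 𝒱 d x) (n : ℕ) : insertLin (par 𝒱) y (word 𝕜 n x) =
      ∑ s : Fin (n + 1), sgn 𝕜 ((e + 1) * ∑ t ∈ Finset.range s, (d t + 1)) •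
        word 𝕜 (n + 1) (replaceBlock x s 0 y) := by
  have hp := par_apply_of_mem hy
  obtain ⟨θ, hθ, hs⟩ : ∃ θ, IsParity (par 𝒱) θ y ∧ ∀ s, tmap θ (word 𝕜 s x) =
      sgn 𝕜 ((e + 1) * ∑ t ∈ Finset.range s, (d t + 1)) • word 𝕜 s x := by
    rcases Int.even_or_odd (e + 1) with he | he
    · rw [sgn_even he, one_smul] at hp
      exact ⟨_, Or.inl ⟨rfl, hp⟩, fun s => by
        rw [sgn_even (he.mul_right _), one_smul, tmap_id]; rfl⟩
    · rw [sgn_odd he, neg_smul, one_smul] at hp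
      refine ⟨_, Or.inr ⟨rfl, hp⟩, fun s => ?_⟩
      rw [tmap_par_word hx]
      congr 1
      obtain ⟨k, hk⟩ := he
      rw [hk]
      exact sgn_congr ⟨-k * ∑ t ∈ Finset.range s, (d t + 1), by ring⟩
  rw [insertLin_of_parity hθ, insertLetter_eq_conv, conv_word,
    Finset.Nat.sum_antidiagonal_eq_sum_range_succ_mk, Finset.sum_range]
  refine Finset.sum_congr rfl fun s _ => ?_
  have h1 := s.2
  have h2 := word_replaceBlock (𝕜 := 𝕜) x s 0 (n - s) y
  rw [show (s : ℕ) + (1 + (n - s)) = n + 1 by lia] at h2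
  rw [h2, AlgHom.toLinearMap_apply, hs, smul_mul_assoc]
  rfl

theorem symmetrizer_word {d : ℕ → ℤ} {x : ℕ → V} (hx : Homogeneous 𝒱 d x) (n : ℕ) :
    symmetrizer (par 𝒱) (word 𝕜 n x) =
      ∑ σ : Equiv.Perm (Fin n), koszulSgn 𝕜 σ d • word 𝕜 n (permSeq σ x) := by
  induction n generalizing d x with
  | zero => simp
  | succ n ih =>
    rw [word_succ, symmetrizer_ι_mul, ih (hx.shift 1), map_sum, sum_extendPerm_left 0,
      Finset.sum_comm]
    refine Finset.sum_congr rfl fun ρ _ => ?_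
    rw [map_smul, insertLin_word (hx 0) ((hx.shift 1).permSeq ρ), Finset.smul_sum]
    refine Finset.sum_congr rfl fun s _ => ?_
    rw [koszulSgn_extendPerm_left, permSeq_extendPerm_left, smul_smul, mul_comm]

theorem isSymm_symmetrizer : IsSymm 𝒱 (symmetrizer (par 𝒱)) := by
  intro n σ d x hx
  rw [symmetrizer_word (hx.permSeq σ), symmetrizer_word hx, Finset.smul_sum]
  refine Eq.trans ?_ (Equiv.sum_comp (Equiv.mulLeft σ) _)
  refine Finset.sum_congr rfl fun π _ => ?_
  rw [Equiv.coe_mulLeft, koszulSgn_mul, smul_smul, ← mul_assoc, koszulSgn_mul_self, one_mul,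
    permSeq_mul _ _ x]

theorem IsSymm.apply_symmetrizer {g : Tens 𝕜 V →ₗ[𝕜] N} (hg : IsSymm 𝒱 g) {n : ℕ} {t : Tens 𝕜 V}
    (ht : t ∈ lenSub 𝕜 V n) : g (symmetrizer (par 𝒱) t) = (n.factorial : 𝕜) • g t := by
  refine lenSub_le_of_word (𝒱 := 𝒱) (Q := LinearMap.eqLocus (g ∘ₗ symmetrizer (par 𝒱))
    ((n.factorial : 𝕜) • g)) (fun d x hx => ?_) ht
  rw [LinearMap.mem_eqLocus, LinearMap.comp_apply, LinearMap.smul_apply, symmetrizer_word hx, map_sum]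
  have h : ∀ σ : Equiv.Perm (Fin n),
      g (koszulSgn 𝕜 σ d • word 𝕜 n (permSeq σ x)) = g (word 𝕜 n x) := fun σ => by
    rw [map_smul, hg n σ d x hx, smul_smul, koszulSgn_mul_self, one_smul]
  simp only [h, Finset.sum_const, Finset.card_univ, Fintype.card_perm, Fintype.card_fin,
    Nat.cast_smul_eq_nsmul]

theorem IsSymm.apply_insertLin {g : Tens 𝕜 V →ₗ[𝕜] N} (hg : IsSymm 𝒱 g) (y : V) {n : ℕ}
    {w : Tens 𝕜 V} (hw : w ∈ lenSub 𝕜 V n) :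
    g (insertLin (par 𝒱) y w) = ((n + 1 : ℕ) : 𝕜) • g (ι 𝕜 y * w) := by
  induction y using graded_induction (𝒱 := 𝒱) with
  | zero => simp
  | add y z hy hz => rw [map_add, map_add, LinearMap.add_apply, add_mul, map_add, map_add, hy, hz, smul_add]
  | mem e y hy =>
  refine lenSub_le_of_word (𝒱 := 𝒱) (Q := LinearMap.eqLocus (g ∘ₗ insertLin (par 𝒱) y)
    (((n + 1 : ℕ) : 𝕜) • (g ∘ₗ LinearMap.mulLeft 𝕜 (ι 𝕜 y)))) (fun d x hx => ?_) hw
  have h : ∀ s : Fin (n + 1), g (sgn 𝕜 ((e + 1) * ∑ t ∈ Finset.range s, (d t + 1)) •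
      word 𝕜 (n + 1) (replaceBlock x s 0 y)) = g (ι 𝕜 y * word 𝕜 n x) := by
    intro s
    have h1 := hg (n + 1) (extendPerm s 0 1) _ _ (hx.consSeq hy)
    have hw : word 𝕜 (n + 1) (consSeq y x) = ι 𝕜 y * word 𝕜 n x := by
      rw [word_succ, shift_one_consSeq, consSeq_zero]
    rw [permSeq_extendPerm_left, koszulSgn_extendPerm_left, koszulSgn_one, mul_one, permSeq_one,
      permSeq_one, shift_one_consSeq, shift_one_consSeq, hw] at h1
    rw [map_smul]
    refine (congrArg _ h1).trans ?_
    rw [smul_smul]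
    exact (congrArg (· • _) (sgn_mul_self _)).trans (one_smul _ _)
  rw [LinearMap.mem_eqLocus, LinearMap.comp_apply, insertLin_word hy hx, map_sum]
  simp only [h, Finset.sum_const, Finset.card_univ, Fintype.card_fin, ← Nat.cast_smul_eq_nsmul 𝕜]
  rfl

end Symm

section Symmetrizer

theorem skip_zero_consSeq {α : Type*} (v : α) (x : ℕ → α) : skip 0 (consSeq v x) = x := by
  funext t; simp [skip, consSeq]

variable {𝕜 : Type*} [Field 𝕜] {V : Type*} [AddCommGroup V] [Module 𝕜 V]
  {N : Type*} [AddCommGroup N] [Module 𝕜 N] {β : V →ₗ[𝕜] V} {𝒱 : ℤ → Submodule 𝕜 V}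

theorem IsSymm.comp_mulLeft {g : Tens 𝕜 V →ₗ[𝕜] N} (hg : IsSymm 𝒱 g) {e : ℤ} {v : V}
    (hv : v ∈ 𝒱 e) : IsSymm 𝒱 (g ∘ₗ LinearMap.mulLeft 𝕜 (ι 𝕜 v)) := by
  intro n σ d x hx
  have h := hg (n + 1) (extendPerm 0 0 σ) _ _ (hx.consSeq hv)
  rw [permSeq_extendPerm_zero, koszulSgn_extendPerm_zero] at h
  simp only [Fin.val_zero, Finset.sum_range_zero, mul_zero, sgn_zero, one_mul, consSeq_zero,
    skip_zero_consSeq, word_succ, shift_one_consSeq] at h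
  exact h

variable [CharZero 𝕜]

theorem cod_linear_insertLin (hβ : β ∘ₗ β = LinearMap.id) {g : V →ₗ[𝕜] V} (hg : g ∘ₗ β = -(β ∘ₗ g))
    (x : V) (w : Tens 𝕜 V) : cod β (g ∘ₗ proj1) (insertLin β x w) =
      insertLin β (g x) w + insertLin β (β x) (cod β (g ∘ₗ proj1) w) := by
  have hg' : ∀ y, β (g y) = -g (β y) := fun y => by
    have := LinearMap.congr_fun hg y
    simp only [LinearMap.comp_apply, LinearMap.neg_apply] at this
    rw [this, neg_neg]
  have aux : ∀ (θ : V →ₗ[𝕜] V) (y : V) (s : 𝕜), s * s = 1 → θ ∘ₗ β = β ∘ₗ θ →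
      (g ∘ₗ proj1) ∘ₗ (tmap θ).toLinearMap = s • (θ ∘ₗ (g ∘ₗ proj1)) → y = s • β y →
      cod β (g ∘ₗ proj1) (insertLetter θ y w) = insertLetter (β ∘ₗ θ) (g y) w +
        s • insertLetter θ y (cod β (g ∘ₗ proj1) w) := by
    intro θ y s hs h1 h2 h3
    have h := LinearMap.congr_fun (cod_comp_cod_sub (b' := epsSmul y) hs h1 h2 (by
      ext w
      simp only [epsSmul_apply, eps_tmap, LinearMap.comp_apply, LinearMap.smul_apply,
        AlgHom.toLinearMap_apply, map_smul]
      rw [smul_comm, ← h3])) w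
    have h4 : epsSmul y ∘ₗ cod β (g ∘ₗ proj1) = 0 := by
      rw [epsSmul, LinearMap.comp_assoc, eps_comp_cod, LinearMap.comp_zero]
    have h5 : (g ∘ₗ proj1) ∘ₗ cod θ (epsSmul y) = epsSmul (g y) := by
      rw [LinearMap.comp_assoc, proj1_comp_cod]
      ext w; simp [epsSmul_apply]
    rw [h4, smul_zero, sub_zero, h5, LinearMap.sub_apply, sub_eq_iff_eq_add] at h
    exact h
  have key : ∀ θ y, IsParity β θ y → cod β (g ∘ₗ proj1) (insertLin β y w) =
      insertLin β (g y) w + insertLin β (β y) (cod β (g ∘ₗ proj1) w) := by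
    intro θ y hy
    rw [insertLin_of_parity hy]
    rcases hy with ⟨rfl, hy⟩ | ⟨rfl, hy⟩
    · rw [aux LinearMap.id y 1 (one_mul 1) rfl (by ext; simp [tmap_id]) (by simp [hy]), hy,
        insertLin_of_parity (Or.inl ⟨rfl, hy⟩ : IsParity β LinearMap.id y),
        insertLin_of_parity (Or.inr ⟨rfl, by rw [hg', hy]⟩ : IsParity β β (g y)), one_smul]
      rfl
    · rw [aux θ y (-1) (by simp) rfl (by
          rw [comp_proj1_comp_tmap, hg, neg_smul, one_smul, LinearMap.neg_comp, LinearMap.comp_assoc])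
          (by simp [hy]), hβ, hy, map_neg, LinearMap.neg_apply,
        insertLin_of_parity (Or.inr ⟨rfl, hy⟩ : IsParity θ θ y),
        insertLin_of_parity (Or.inl ⟨rfl, by rw [hg', hy, map_neg, neg_neg]⟩ :
          IsParity θ LinearMap.id (g y)), neg_smul, one_smul]
  have h1 := key _ _ (Or.inl ⟨rfl, apply_evenPart hβ x⟩)
  have h2 := key _ _ (Or.inr ⟨rfl, apply_oddPart hβ x⟩)
  rw [← evenPart_add_oddPart β x]
  simp only [map_add, LinearMap.add_apply, h1, h2]
  abel

theorem cod_linear_symmetrizer (hβ : β ∘ₗ β = LinearMap.id) {g : V →ₗ[𝕜] V}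
    (hg : g ∘ₗ β = -(β ∘ₗ g)) (w : Tens 𝕜 V) :
    cod β (g ∘ₗ proj1) (symmetrizer β w) = symmetrizer β (cod β (g ∘ₗ proj1) w) := by
  induction w using tens_induction with
  | one => simp
  | zero => simp
  | add a b ha hb => simp only [map_add, ha, hb]
  | smul r a ha => simp only [map_smul, ha]
  | mul x w hw =>
    rw [symmetrizer_ι_mul, cod_linear_insertLin hβ hg, hw, cod_linear_ι_mul, map_add, symmetrizer_ι_mul,
      symmetrizer_ι_mul]

variable [DirectSum.Decomposition 𝒱]

theorem symmetrizer_mem {n : ℕ} {w : Tens 𝕜 V} (hw : w ∈ lenSub 𝕜 V n) :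
    symmetrizer (par 𝒱) w ∈ symTens (par 𝒱) n := by
  induction n generalizing w with
  | zero =>
    obtain ⟨r, rfl⟩ := mem_lenSub_zero.1 hw
    rw [map_smul, symmetrizer_one]; exact hw
  | succ n ih =>
    refine lenSub_succ_le (Q := (symTens (par 𝒱) (n + 1)).comap (symmetrizer (par 𝒱)))
      (fun x w hw => ?_) hw
    rw [Submodule.mem_comap, symmetrizer_ι_mul, insertLin_eq]
    exact add_mem (insertLetter_mem_symTens (Or.inl ⟨rfl, apply_evenPart (par_par 𝒱) x⟩) (ih hw))
      (insertLetter_mem_symTens (Or.inr ⟨rfl, apply_oddPart (par_par 𝒱) x⟩) (ih hw))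

theorem symmetrizer_of_mem {n : ℕ} {t : Tens 𝕜 V} (ht : t ∈ symTens (par 𝒱) n) :
    symmetrizer (par 𝒱) t = (n.factorial : 𝕜) • t := by
  induction n generalizing t with
  | zero =>
    obtain ⟨r, rfl⟩ := mem_lenSub_zero.1 ht
    simp
  | succ n ih =>
    refine symTens_succ_le (Q := LinearMap.eqLocus (symmetrizer (par 𝒱))
      (((n + 1).factorial : 𝕜) • LinearMap.id)) (fun θ y hy s hs => ?_) ht
    rw [LinearMap.mem_eqLocus, ← insertLin_of_parity hy,
      isSymm_symmetrizer.apply_insertLin y (symTens_le n hs), symmetrizer_ι_mul, ih hs, map_smul,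
      smul_smul, ← Nat.cast_mul, ← Nat.factorial_succ]
    rfl

theorem symTens_le_of_word {n : ℕ} {Q : Submodule 𝕜 (Tens 𝕜 V)}
    (h : ∀ d x, Homogeneous 𝒱 d x → symmetrizer (par 𝒱) (word 𝕜 n x) ∈ Q) :
    symTens (par 𝒱) n ≤ Q := fun t ht => by
  have h1 := lenSub_le_of_word (𝒱 := 𝒱) (Q := Q.comap (symmetrizer (par 𝒱))) h (symTens_le n ht)
  rw [Submodule.mem_comap, symmetrizer_of_mem ht] at h1
  exact (Submodule.smul_mem_iff _ (Nat.cast_ne_zero.2 n.factorial_ne_zero)).1 h1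

theorem forall_mem_symTens_iff {g h : Tens 𝕜 V →ₗ[𝕜] N} {n : ℕ} :
    (∀ t ∈ symTens (par 𝒱) n, g t = h t) ↔ ∀ d x, Homogeneous 𝒱 d x →
      g (symmetrizer (par 𝒱) (word 𝕜 n x)) = h (symmetrizer (par 𝒱) (word 𝕜 n x)) :=
  ⟨fun H _ x _ => H _ (symmetrizer_mem (word_mem n x)),
    symTens_le_of_word (Q := LinearMap.eqLocus g h)⟩

variable (𝒱) in
/-- The projection onto the symmetric tensors. -/
noncomputable def symProj : Tens 𝕜 V →ₗ[𝕜] Tens 𝕜 V :=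
  glue fun n => (n.factorial : 𝕜)⁻¹ • symmetrizer (par 𝒱)

theorem symProj_of_mem {n : ℕ} {t : Tens 𝕜 V} (ht : t ∈ symTens (par 𝒱) n) : symProj 𝒱 t = t := by
  rw [symProj, glue_of_mem _ (symTens_le n ht), LinearMap.smul_apply, symmetrizer_of_mem ht,
    inv_smul_smul₀ (Nat.cast_ne_zero.2 n.factorial_ne_zero)]

theorem symProj_mem {n : ℕ} {t : Tens 𝕜 V} (ht : t ∈ lenSub 𝕜 V n) :
    symProj 𝒱 t ∈ symTens (par 𝒱) n := by
  rw [symProj, glue_of_mem _ ht]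
  exact Submodule.smul_mem _ _ (symmetrizer_mem ht)

theorem symProj_word (n : ℕ) (x : ℕ → V) :
    symProj 𝒱 (word 𝕜 n x) = (n.factorial : 𝕜)⁻¹ • symmetrizer (par 𝒱) (word 𝕜 n x) :=
  glue_of_mem _ (word_mem n x)

theorem isSymm_comp_symProj (g : Tens 𝕜 V →ₗ[𝕜] N) : IsSymm 𝒱 (g ∘ₗ symProj 𝒱) := by
  intro n σ d x hx
  rw [LinearMap.comp_apply, LinearMap.comp_apply, symProj_word, symProj_word,
    isSymm_symmetrizer n σ d x hx, smul_comm, map_smul]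

theorem IsSymm.apply_symProj {g : Tens 𝕜 V →ₗ[𝕜] N} (hg : IsSymm 𝒱 g) {n : ℕ} {t : Tens 𝕜 V}
    (ht : t ∈ lenSub 𝕜 V n) : g (symProj 𝒱 t) = g t := by
  rw [symProj, glue_of_mem _ ht, LinearMap.smul_apply, map_smul, hg.apply_symmetrizer ht,
    inv_smul_smul₀ (Nat.cast_ne_zero.2 n.factorial_ne_zero)]

theorem isTDeg_comp_symProj {W : Type*} [AddCommGroup W] [Module 𝕜 W] {𝒲 : ℤ → Submodule 𝕜 W}
    [DirectSum.Decomposition 𝒲] {g : Tens 𝕜 V →ₗ[𝕜] W} {p : ℤ}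
    (hg : IsTDeg (dgr 𝒱) (par 𝒱) (dgr 𝒲) (par 𝒲) p g) :
    IsTDeg (dgr 𝒱) (par 𝒱) (dgr 𝒲) (par 𝒲) p (g ∘ₗ symProj 𝒱) :=
  isTDeg_of_mem fun n d x hx => by
    rw [LinearMap.comp_apply, symProj_word, symmetrizer_word hx, map_smul, map_sum]
    refine Submodule.smul_mem _ _ (Submodule.sum_mem _ fun σ _ => ?_)
    rw [map_smul]
    have h := mem_of_isTDeg hg (hx.permSeq σ) (n := n)
    have hs : ∑ t ∈ Finset.range n, permSeq σ d t = ∑ t ∈ Finset.range n, d t := by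
      rw [Finset.sum_range, Finset.sum_range]
      simp only [permSeq_apply_of_lt]
      exact Equiv.sum_comp σ fun t => d t
    rw [hs] at h
    exact Submodule.smul_mem _ _ h

end Symmetrizer

section Lie

variable {𝕜 : Type*} [Field 𝕜] {V : Type*} [AddCommGroup V] [Module 𝕜 V]
  {W : Type*} [AddCommGroup W] [Module 𝕜 W] {𝒱 : ℤ → Submodule 𝕜 V} {𝒲 : ℤ → Submodule 𝕜 W}

variable (𝕜) in
/-- The inverse of the factorial. -/
noncomputable def invFact (n : ℕ) : 𝕜 := (n.factorial : 𝕜)⁻¹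

theorem invFact_one : invFact 𝕜 1 = 1 := by simp [invFact]

theorem gradedAntisymmetric_of_lt_two {n : ℕ} (hn : n < 2)
    (g : MultilinearMap 𝕜 (fun _ : Fin n => V) W) : GradedAntisymmetric 𝒱 g := by
  intro σ d x _
  have : Subsingleton (Fin n) := Fin.subsingleton_iff_le_one.2 (by lia)
  rw [Subsingleton.elim σ 1, permSeq_one, antiKoszulSign_smul (𝕜 := 𝕜), koszulSgn_one, permSeq_one,
    one_mul, sgn_mul_self, one_smul]

theorem word_smul_entry {n a : ℕ} (ha : a < n) {r : 𝕜} {x y : ℕ → V} (h : y a = r • x a)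
    (h' : ∀ t < n, t ≠ a → y t = x t) : word 𝕜 n y = r • word 𝕜 n x := by
  induction n generalizing a x y with
  | zero => lia
  | succ n ih =>
    rw [word_succ, word_succ]
    cases a with
    | zero =>
      rw [h, map_smul, smul_mul_assoc,
        word_congr (x := shift 1 y) fun t ht => h' (1 + t) (by lia) (by lia)]
      rfl
    | succ a =>
      rw [h' 0 (by lia) (by lia), ih (a := a) (x := shift 1 x) (y := shift 1 y) (by lia)
        (by simpa [shift, add_comm 1] using h) (fun t ht hta => h' (1 + t) (by lia) (by lia)),
        mul_smul_comm]

variable [CharZero 𝕜] [DirectSum.Decomposition 𝒱] [DirectSum.Decomposition 𝒲] {F : Ops 𝕜 V W}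
  {f : Tens 𝕜 V →ₗ[𝕜] W} {m : Ops 𝕜 V V} {b : Tens 𝕜 V →ₗ[𝕜] V} {l : Ops 𝕜 W W}
  {c : Tens 𝕜 W →ₗ[𝕜] W} {dV : V →ₗ[𝕜] V} {dW : W →ₗ[𝕜] W}

theorem factorial_mul_invFact (n : ℕ) : (n.factorial : 𝕜) * invFact 𝕜 n = 1 :=
  mul_inv_cancel₀ (Nat.cast_ne_zero.2 n.factorial_ne_zero)

theorem invFact_ne_zero (n : ℕ) : invFact 𝕜 n ≠ 0 :=
  inv_ne_zero (Nat.cast_ne_zero.2 n.factorial_ne_zero)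

theorem Represents.apply_cod_symmetrizer (hf : Represents 𝒱 (invFact 𝕜) F f) (hfs : IsSymm 𝒱 f)
    (hb : Represents 𝒱 (invFact 𝕜) m b) (hbs : IsSymm 𝒱 b) (hm0 : m 0 = 0)
    (hm : ∀ j : ℕ, HasDegree 𝒱 𝒱 (m j) (j - 2)) (n : ℕ) {d : ℕ → ℤ} {x : ℕ → V}
    (hx : Homogeneous 𝒱 d x) :
    f (cod (par 𝒱) b (symmetrizer (par 𝒱) (word 𝕜 n x))) = sgn 𝕜 (tw n d) •
      ∑ ij ∈ antidiagonal (n + 1) with 1 ≤ ij.1 ∧ 1 ≤ ij.2,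
        (-1 : ℤˣ) ^ (ij.2 * (ij.1 - 1)) • ∑ σ ∈ unshuffles n ij.2, antiKoszulSign σ d •
          insertOp (F ij.1) (m ij.2) ((ij.2 : ℤ) - 2) 0 (permSeq σ d) (permSeq σ x) := by
  have hb1 := hb.apply_one hm0
  have hbp : b ∘ₗ (tmap (par 𝒱)).toLinearMap = -(par 𝒱 ∘ₗ b) :=
    (hb.isTDeg (p := -1) fun n => by
      rw [show (n : ℤ) - 1 + -1 = n - 2 by ring]; exact hm n).par_odd (by decide)
  rw [cod_apply_symTens (par_par 𝒱) hbp (symmetrizer_mem (word_mem n x)), symmetrizer_word hx,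
    Finset.smul_sum, Finset.sum_filter, Finset.Nat.sum_antidiagonal_succ, if_neg (by simp), zero_add,
    ← Finset.Nat.sum_antidiagonal_swap]
  simp only [map_sum, map_smul, deconc_word, TensorProduct.lift.tmul, LinearMap.compl₁₂_apply,
    LinearMap.id_apply, hfs.apply_insertLin _ (word_mem _ _), Finset.smul_sum]
  rw [Finset.sum_comm]
  refine Finset.sum_congr rfl fun p hp => ?_
  obtain ⟨j, r⟩ := p
  obtain rfl := mem_antidiagonal.1 hp
  simp only [Prod.swap, le_add_iff_nonneg_left, zero_le, true_and]
  split_ifs with hj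
  swap
  · obtain rfl : j = 0 := by lia
    simp [hb1]
  have hG : ∀ (i : ℕ) (hi : i + 1 < j + r), (i + 1 < j ∨ j ≤ i) → ∀ d x, Homogeneous 𝒱 d x →
      (fun y => f (ι 𝕜 (b (word 𝕜 j y)) * word 𝕜 r (shift j y)))
        (permSeq (Equiv.swap (⟨i, by lia⟩ : Fin (j + r)) ⟨i + 1, hi⟩) x) =
      sgn 𝕜 ((d i + 1) * (d (i + 1) + 1)) •
        f (ι 𝕜 (b (word 𝕜 j x)) * word 𝕜 r (shift j x)) := by
    intro i hi h d x hx
    rcases h with h | h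
    · have h1 := hbs.apply_swap hi (Nat.zero_le i) (r := j) (by lia) hx
      rw [shift_zero, shift_zero] at h1
      dsimp only
      rw [h1, word_shift_swap hi (Or.inl h), map_smul, smul_mul_assoc, map_smul]
    · have h1 := word_shift_swap (𝕜 := 𝕜) (s := 0) (r := j) hi (Or.inr (by lia)) x
      rw [shift_zero, shift_zero] at h1
      dsimp only
      rw [h1]
      exact (hfs.comp_mulLeft (hb.mem (hm j) hx)).apply_swap hi h (by lia) hx
  simp only [smul_comm (koszulSgn 𝕜 _ d) ((r + 1 : ℕ) : 𝕜)]
  have hs := sum_perm_eq_unshuffles rfl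
    (G := fun y => f (ι 𝕜 (b (word 𝕜 j y)) * word 𝕜 r (shift j y))) hG hx
  rw [← Finset.smul_sum, hs, smul_smul, Finset.smul_sum]
  refine Finset.sum_congr rfl fun σ _ => ?_
  have h := hf.apply_insert hb (hm j) hj 0 r (hx.permSeq σ)
  rw [show 0 + (1 + r) = r + 1 by lia] at h
  simp only [Finset.sum_range_zero, sgn_zero, one_smul, word_zero, one_mul, shift_zero, zero_add,
    Nat.cast_zero] at h
  rw [h, antiKoszulSign_smul (𝕜 := 𝕜), neg_one_pow_smul (𝕜 := 𝕜), smul_smul, smul_smul, smul_smul,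
    smul_smul]
  congr 1
  have e1 := sgn_mul_self (𝕜 := 𝕜) (tw (j + r) d)
  have e2 : ((r + 1 : ℕ) : 𝕜) * r.factorial * invFact 𝕜 (r + 1) = 1 := by
    rw [← Nat.cast_mul, ← Nat.factorial_succ, factorial_mul_invFact]
  have e3 := factorial_mul_invFact (𝕜 := 𝕜) j
  have e4 : sgn 𝕜 ((j * (r + 1 - 1) : ℕ) : ℤ) = sgn 𝕜 ((r : ℤ) * j) := by
    rw [add_tsub_cancel_right]; push_cast; rw [mul_comm]
  rw [e4]
  set A := koszulSgn 𝕜 σ d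
  set B := sgn 𝕜 (tw (j + r) (permSeq σ d))
  set C := sgn 𝕜 ((r : ℤ) * j)
  linear_combination A * B * C * e2 + A * B * C * (((r + 1 : ℕ) : 𝕜) * r.factorial * invFact 𝕜 (r + 1))
    * e3 - A * B * C * e1

theorem Represents.sum_unshuffles_one (hf : Represents 𝒱 (invFact 𝕜) F f) (hfs : IsSymm 𝒱 f)
    (hd : IsDifferential 𝒱 dV) {n : ℕ} (hn : 1 ≤ n) {d : ℕ → ℤ} {x : ℕ → V}
    (hx : Homogeneous 𝒱 d x) :
    (-1 : ℤˣ) ^ (1 * (n - 1)) • ∑ σ ∈ unshuffles n 1, antiKoszulSign σ d •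
      insertOp (F n) (MultilinearMap.ofSubsingleton 𝕜 V V (0 : Fin 1) dV) (((1 : ℕ) : ℤ) - 2) 0
        (permSeq σ d) (permSeq σ x) = sgn 𝕜 ((n : ℤ) - 1) • ∑ s ∈ Finset.range n,
      insertOp (F n) (MultilinearMap.ofSubsingleton 𝕜 V V (0 : Fin 1) dV) (-1) s d x := by
  obtain ⟨M, hM⟩ := exists_isAlgebraFamily (K := 1) (m := 0) hd fun _ _ _ => hasDegree_zero _ _
  have hM0 : ∀ j, 2 ≤ j → M j = 0 := fun j hj =>
    hM.zero_of_lt j hj (by exact_mod_cast (by lia : 1 < j))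
  have hb : Represents 𝒱 (invFact 𝕜) M (dV ∘ₗ proj1) := by
    intro k d x _
    match k with
    | 0 => simp [hM.zero, ev]
    | 1 => rw [hM.one, ev_ofSubsingleton, invFact_one, tw_one, sgn_zero]; simp
    | k + 2 => simp [hM0 (k + 2) (by lia), ev, word_succ, proj1_ι_mul, eps_ι_mul]
  have hbs := hb.isSymm fun k => by
    by_cases hk : k < 2
    · exact gradedAntisymmetric_of_lt_two hk _
    · rw [hM0 k (by lia)]; intro σ d x _; simp [ev]
  have h1 := hf.apply_cod_symmetrizer hfs hb hbs hM.zero hM.degree n hx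
  have h2 := hf.apply_cod_word hb hM.zero hM.degree n hx
  have z : ∀ (i j : ℕ) (s : ℕ) (d : ℕ → ℤ) (x : ℕ → V), 2 ≤ j → s < i →
      insertOp (F i) (M j) ((j : ℤ) - 2) s d x = 0 := fun i j s d x hj hs => by
    rw [insertOp, hM0 j hj, ev, MultilinearMap.map_coord_zero _ ⟨s, hs⟩ (by simp [replaceBlock, ev]),
      smul_zero]
  rw [sum_antidiagonal_split_right hn, Finset.sum_eq_zero
    (s := {ij ∈ antidiagonal (n + 1) | 1 ≤ ij.1 ∧ 2 ≤ ij.2}), add_zero] at h1 h2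
  rotate_left
  · intro ij hij
    simp only [Finset.mem_filter] at hij
    exact Finset.sum_eq_zero fun s hs => by rw [z _ _ _ _ _ hij.2.2 (Finset.mem_range.1 hs), smul_zero]
  · intro ij hij
    simp only [Finset.mem_filter] at hij
    rw [Finset.sum_eq_zero fun σ _ => by rw [z _ _ _ _ _ hij.2.2 hij.2.1, smul_zero], smul_zero]
  have h3 := (congrArg f (cod_linear_symmetrizer (par_par 𝒱)
    (IsHom.comp_par_odd (𝒱 := 𝒱) (𝒲 := 𝒱) hd.degree (by decide)) (word 𝕜 n x))).trans
      (hfs.apply_symmetrizer (cod_linear_mem _ _ (word_mem n x)))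
  rw [h1, h2, smul_comm (n.factorial : 𝕜)] at h3
  have h4 := smul_right_injective _ (sgn_ne_zero (𝕜 := 𝕜) (tw n d)) h3
  dsimp only at h4
  rw [hM.one] at h4
  rw [h4, Finset.smul_sum, Finset.smul_sum]
  refine Finset.sum_congr rfl fun s hs => ?_
  rw [smul_smul, invFact_one, mul_one, ← mul_assoc, factorial_mul_invFact, one_mul]
  congr 2
  push_cast; ring

theorem Represents.apply_coext_symmetrizer (hf : Represents 𝒱 (invFact 𝕜) F f) (hfs : IsSymm 𝒱 f)
    (hc : Represents 𝒲 (invFact 𝕜) l c) (hF0 : F 0 = 0) (hF : ∀ j : ℕ, HasDegree 𝒱 𝒲 (F j) (j - 1))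
    {φ : Tens 𝕜 V →ₗ[𝕜] Tens 𝕜 W} (hφ : φ = cunit _ + conv (ι 𝕜 ∘ₗ f) φ) (n : ℕ)
    {d : ℕ → ℤ} {x : ℕ → V} (hx : Homogeneous 𝒱 d x) :
    c (φ (symmetrizer (par 𝒱) (word 𝕜 n x))) = sgn 𝕜 (tw n d) • ∑ k : Composition n,
      ((k.length.factorial : 𝕜)⁻¹) •
        (-1 : ℤˣ) ^ (∑ a : Fin k.length, (k.length - 1 - (a : ℕ)) * (k.blocksFun a - 1)) •
          ∑ σ ∈ blockUnshuffles k, antiKoszulSign σ d •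
            composeOps l F k (permSeq σ d) (permSeq σ x) := by
  rw [symmetrizer_word hx, Finset.smul_sum]
  simp only [map_sum, map_smul, coext_word (hf.apply_one hF0) hφ, Finset.smul_sum]
  rw [Finset.sum_comm]
  refine Finset.sum_congr rfl fun k _ => ?_
  have hbf : ∀ a : Fin k.length, k.blocks.getD a 0 = k.blocksFun a := fun a =>
    List.getD_eq_getElem _ _ a.2
  have hG : ∀ (i : ℕ) (hi : i + 1 < n), k.index ⟨i, by lia⟩ = k.index ⟨i + 1, hi⟩ →
      ∀ d x, Homogeneous 𝒱 d x → (fun y => c (word 𝕜 k.length (blockSeq f k.blocks y)))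
        (permSeq (Equiv.swap (⟨i, by lia⟩ : Fin n) ⟨i + 1, hi⟩) x) =
      sgn 𝕜 ((d i + 1) * (d (i + 1) + 1)) • c (word 𝕜 k.length (blockSeq f k.blocks x)) := by
    intro i hi h d x hx
    dsimp only
    have h1 := k.sizeUpTo_index_le ⟨i, by lia⟩
    have h2 := k.lt_sizeUpTo_index_succ ⟨i + 1, hi⟩
    rw [← h] at h2
    set a₀ := k.index ⟨i, by lia⟩
    rw [Fin.val_succ] at h2
    have h3 : ∀ a : Fin k.length, k.sizeUpTo (a + 1) = k.sizeUpTo a + k.blocks.getD a 0 := fun a => by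
      rw [k.sizeUpTo_succ' a, hbf]
    rw [word_smul_entry a₀.2 (x := blockSeq f k.blocks x) (r := sgn 𝕜 ((d i + 1) * (d (i + 1) + 1))),
      map_smul]
    · rw [h3] at h2
      exact hfs.apply_swap hi h1 h2 hx
    · intro a ha haa
      refine congrArg f (word_shift_swap hi ?_ x)
      change i + 1 < k.sizeUpTo a ∨ k.sizeUpTo a + _ ≤ i
      rw [← h3 ⟨a, ha⟩]
      rcases Nat.lt_or_gt_of_ne haa with h4 | h4
      · exact Or.inr ((k.monotone_sizeUpTo h4).trans h1)
      · exact Or.inl (lt_of_lt_of_le h2 (k.monotone_sizeUpTo h4))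
  have hs := sum_perm_eq_blockUnshuffles k
    (G := fun y => c (word 𝕜 k.length (blockSeq f k.blocks y))) hG hx
  rw [hs, Finset.smul_sum]
  refine Finset.sum_congr rfl fun σ _ => ?_
  rw [hf.apply_blocks hc hF k (hx.permSeq σ), antiKoszulSign_smul (𝕜 := 𝕜),
    neg_one_pow_smul (𝕜 := 𝕜), smul_smul, smul_smul, smul_smul, smul_smul, smul_smul]
  congr 1
  have e1 := sgn_mul_self (𝕜 := 𝕜) (tw n d)
  have e2 : ((∏ a : Fin k.length, (k.blocksFun a).factorial : ℕ) : 𝕜) *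
      ∏ a : Fin k.length, invFact 𝕜 (k.blocksFun a) = 1 := by
    rw [Nat.cast_prod, ← Finset.prod_mul_distrib]
    exact Finset.prod_eq_one fun a _ => factorial_mul_invFact _
  have e3 : (∑ a : Fin k.length, ((k.length : ℤ) - 1 - a) * ((k.blocksFun a : ℤ) - 1)) =
      ((∑ a : Fin k.length, (k.length - 1 - (a : ℕ)) * (k.blocksFun a - 1) : ℕ) : ℤ) := by
    rw [Nat.cast_sum]
    refine Finset.sum_congr rfl fun a _ => ?_
    have h1 := a.2
    have h2 := k.one_le_blocksFun a
    rw [Nat.cast_mul, Nat.cast_sub (by lia), Nat.cast_sub (by lia), Nat.cast_sub h2, Nat.cast_one]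
  rw [e3, show (k.length.factorial : 𝕜)⁻¹ = invFact 𝕜 k.length from rfl]
  set A := koszulSgn 𝕜 σ d
  set B := sgn 𝕜 (tw n (permSeq σ d))
  set C := sgn 𝕜 ((∑ a : Fin k.length, (k.length - 1 - (a : ℕ)) * (k.blocksFun a - 1) : ℕ) : ℤ)
  linear_combination invFact 𝕜 k.length * A * B * C * (e2 - e1)

end Lie

section LieExtension

variable {𝕜 : Type*} [Field 𝕜] {V : Type*} [AddCommGroup V] [Module 𝕜 V]
  {W : Type*} [AddCommGroup W] [Module 𝕜 W] {𝒱 : ℤ → Submodule 𝕜 V} {𝒲 : ℤ → Submodule 𝕜 W}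

theorem antiKoszulSign_one (n : ℕ) (d : ℕ → ℤ) : antiKoszulSign (1 : Equiv.Perm (Fin n)) d = 1 := by
  unfold antiKoszulSign
  rw [Equiv.Perm.sign_one, one_mul]
  exact Finset.prod_eq_one fun a _ => Finset.prod_eq_one fun b hb =>
    if_neg (not_lt.2 (Finset.mem_Ioi.1 hb).le)

theorem unshuffles_self (n : ℕ) : unshuffles n n = {1} := by
  ext σ
  simp only [unshuffles, Finset.mem_filter, Finset.mem_univ, true_and, Finset.mem_singleton]
  exact ⟨fun h => eq_one_of_strictMono fun a b hab => h a b hab (Or.inl b.2), fun h a b hab _ => by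
    rwa [h]⟩

theorem blockUnshuffles_single {n : ℕ} (hn : 0 < n) :
    blockUnshuffles (Composition.single n hn) = {1} := by
  ext σ
  simp only [blockUnshuffles, Finset.mem_filter, Finset.mem_univ, true_and, Finset.mem_singleton]
  refine ⟨fun h => eq_one_of_strictMono fun a b hab => h a b hab ?_, fun h a b hab _ => by rwa [h]⟩
  exact (Subsingleton.elim (α := Fin 1) _ _ :)

variable [CharZero 𝕜] [DirectSum.Decomposition 𝒱] [DirectSum.Decomposition 𝒲] {F G : Ops 𝕜 V W}
  {f : Tens 𝕜 V →ₗ[𝕜] W} {m M : Ops 𝕜 V V} {b : Tens 𝕜 V →ₗ[𝕜] V} {l L : Ops 𝕜 W W}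
  {c : Tens 𝕜 W →ₗ[𝕜] W} {dV : V →ₗ[𝕜] V} {dW : W →ₗ[𝕜] W} {K : ℕ∞}

omit [CharZero 𝕜] [DirectSum.Decomposition 𝒱] in
theorem IsAlgebraFamily.gradedAntisymmetric (hM : IsAlgebraFamily 𝒱 K dV m M)
    (h : ∀ n : ℕ, 2 ≤ n → (n : ℕ∞) ≤ K → GradedAntisymmetric 𝒱 (m n)) (n : ℕ) :
    GradedAntisymmetric 𝒱 (M n) := by
  by_cases hn : n < 2
  · exact gradedAntisymmetric_of_lt_two hn _
  · by_cases hK : (n : ℕ∞) ≤ K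
    · rw [hM.eq n (by lia) hK]; exact h n (by lia) hK
    · rw [hM.zero_of_lt n (by lia) (not_le.1 hK)]; intro σ d x _; simp [ev]

omit [CharZero 𝕜] [DirectSum.Decomposition 𝒱] [DirectSum.Decomposition 𝒲] in
theorem IsMorphismFamily.gradedAntisymmetric (hG : IsMorphismFamily 𝒱 𝒲 K F G)
    (h : ∀ n : ℕ, 1 ≤ n → (n : ℕ∞) ≤ K → GradedAntisymmetric 𝒱 (F n)) (n : ℕ) :
    GradedAntisymmetric 𝒱 (G n) := by
  by_cases hn : n < 2
  · exact gradedAntisymmetric_of_lt_two hn _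
  · by_cases hK : (n : ℕ∞) ≤ K
    · rw [hG.eq n (by lia) hK]; exact h n (by lia) hK
    · rw [hG.zero_of_lt n (not_le.1 hK)]; intro σ d x _; simp [ev]

theorem IsAlgebraFamily.sym_sq_iff (hM : IsAlgebraFamily 𝒱 K dV m M) (hd : IsDifferential 𝒱 dV)
    (hb : Represents 𝒱 (invFact 𝕜) M b) (hbs : IsSymm 𝒱 b) {n : ℕ} (hn : 2 ≤ n)
    (hK : (n : ℕ∞) ≤ K) :
    (∀ t ∈ symTens (par 𝒱) n, b (cod (par 𝒱) b t) = 0) ↔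
    ∀ d x, Homogeneous 𝒱 d x → homDiff dV dV (m n) ((n : ℤ) - 2) d x +
      ∑ ij ∈ antidiagonal (n + 1) with 2 ≤ ij.1 ∧ 2 ≤ ij.2,
        (-1 : ℤˣ) ^ (ij.2 * (ij.1 - 1)) • ∑ σ ∈ unshuffles n ij.2, antiKoszulSign σ d •
          insertOp (m ij.1) (m ij.2) ((ij.2 : ℤ) - 2) 0 (permSeq σ d) (permSeq σ x) = 0 := by
  refine (forall_mem_symTens_iff (g := b ∘ₗ cod (par 𝒱) b) (h := 0)).trans
    (forall₃_congr fun d x hx => ?_)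
  have hle : ∀ i ≤ n, (i : ℕ∞) ≤ K := fun i hi => (Nat.cast_le.2 hi).trans hK
  have h1 := hb.sum_unshuffles_one hbs hd (by lia : 1 ≤ n) hx
  have h2 : sgn 𝕜 ((n : ℤ) - 1) = -sgn 𝕜 ((n : ℤ) - 2) := by
    rw [← neg_one_mul, ← sgn_odd (𝕜 := 𝕜) odd_one, ← sgn_add]
    congr 1; ring
  rw [LinearMap.comp_apply, LinearMap.zero_apply, hb.apply_cod_symmetrizer hbs hb hbs hM.zero hM.degree n hx,
    sum_antidiagonal_split_right (by lia), sum_antidiagonal_split_left hn,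
    smul_eq_zero, or_iff_right (sgn_ne_zero _)]
  refine Eq.congr_left ?_
  dsimp only
  rw [hM.one, h1, unshuffles_self, Finset.sum_singleton, antiKoszulSign_one, permSeq_one,
    permSeq_one, insertOp_one_left, Nat.sub_self, mul_zero, pow_zero, one_smul, one_smul, ← add_assoc,
    homDiff_eq, hM.eq n hn hK, h2, neg_smul, neg_add_eq_sub]
  refine congrArg _ (Finset.sum_congr rfl fun ij hij => ?_)
  simp only [Finset.mem_filter, mem_antidiagonal] at hij
  rw [hM.eq _ hij.2.1 (hle _ (by lia)), hM.eq _ hij.2.2 (hle _ (by lia))]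

theorem IsMorphismFamily.sym_map_iff (hG : IsMorphismFamily 𝒱 𝒲 K F G)
    (hM : IsAlgebraFamily 𝒱 ⊤ dV m M) (hd : IsDifferential 𝒱 dV) (hL : IsAlgebraFamily 𝒲 K dW l L)
    (hf : Represents 𝒱 (invFact 𝕜) G f) (hfs : IsSymm 𝒱 f) (hb : Represents 𝒱 (invFact 𝕜) M b)
    (hbs : IsSymm 𝒱 b) (hc : Represents 𝒲 (invFact 𝕜) L c)
    {φ : Tens 𝕜 V →ₗ[𝕜] Tens 𝕜 W} (hφ : φ = cunit _ + conv (ι 𝕜 ∘ₗ f) φ) {n : ℕ} (hn : 1 ≤ n)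
    (hK : (n : ℕ∞) ≤ K) :
    (∀ t ∈ symTens (par 𝒱) n, c (φ t) = f (cod (par 𝒱) b t)) ↔ ∀ d x, Homogeneous 𝒱 d x →
    homDiff dV dW (F n) ((n : ℤ) - 1) d x +
      ∑ c : Composition n with 2 ≤ c.length, ((c.length.factorial : 𝕜)⁻¹) •
        (-1 : ℤˣ) ^ (∑ a : Fin c.length, (c.length - 1 - (a : ℕ)) * (c.blocksFun a - 1)) •
          ∑ σ ∈ blockUnshuffles c, antiKoszulSign σ d •
            composeOps l F c (permSeq σ d) (permSeq σ x) =
      ∑ ij ∈ antidiagonal (n + 1) with 1 ≤ ij.1 ∧ 2 ≤ ij.2,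
        (-1 : ℤˣ) ^ (ij.2 * (ij.1 - 1)) • ∑ σ ∈ unshuffles n ij.2, antiKoszulSign σ d •
          insertOp (F ij.1) (m ij.2) ((ij.2 : ℤ) - 2) 0 (permSeq σ d) (permSeq σ x) := by
  refine (forall_mem_symTens_iff (g := c ∘ₗ φ) (h := f ∘ₗ cod (par 𝒱) b)).trans
    (forall₃_congr fun d x hx => ?_)
  have hle : ∀ i ≤ n, (i : ℕ∞) ≤ K := fun i hi => (Nat.cast_le.2 hi).trans hK
  have h1 := hf.sum_unshuffles_one hfs hd hn hx
  have h2 : ∑ a : Fin (Composition.single n hn).length, ((Composition.single n hn).length - 1 -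
      (a : ℕ)) * ((Composition.single n hn).blocksFun a - 1) = 0 :=
    Finset.sum_eq_zero fun a _ => mul_eq_zero.2 (Or.inl (by
      have := Composition.single_length hn
      lia))
  rw [LinearMap.comp_apply, LinearMap.comp_apply, ← sub_eq_zero, hf.apply_cod_symmetrizer hfs hb hbs hM.zero hM.degree n hx, sum_antidiagonal_split_right hn,
    hf.apply_coext_symmetrizer hfs hc hG.zero hG.degree hφ n hx, sum_composition_split hn, ← smul_sub,
    smul_eq_zero, or_iff_right (sgn_ne_zero _)]
  refine Iff.trans (Eq.congr_left ?_) sub_eq_zero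
  dsimp only
  rw [hM.one, h1, h2, blockUnshuffles_single, Finset.sum_singleton, antiKoszulSign_one, permSeq_one,
    permSeq_one, composeOps_single hL.one, Composition.single_length, Nat.factorial_one, Nat.cast_one,
    inv_one, pow_zero, one_smul, one_smul, one_smul, homDiff_eq, hG.eq n hn hK, ← sub_sub,
    add_sub_right_comm]
  refine congrArg₂ _ (congrArg _ (Finset.sum_congr rfl fun k hk => ?_))
    (Finset.sum_congr rfl fun ij hij => ?_)
  · simp only [Finset.mem_filter, Finset.mem_univ, true_and] at hk
    simp only [composeOps_congr k (hL.eq _ hk (hle _ k.length_le))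
      fun r hr hr' => hG.eq r hr (hle r hr')]
  · simp only [Finset.mem_filter, mem_antidiagonal] at hij
    rw [hG.eq _ hij.2.1 (hle _ (by lia)), hM.eq _ hij.2.2 le_top]

theorem eq_of_mem_iSup_symTens {g : Tens 𝕜 V →ₗ[𝕜] W} {t : Tens 𝕜 V}
    (ht : t ∈ ⨆ k, symTens (par 𝒱) k) : (g ∘ₗ symProj 𝒱) t = g t :=
  (iSup_le fun _ _ ht => congrArg g (symProj_of_mem ht) :
    ⨆ k, symTens (par 𝒱) k ≤ LinearMap.eqLocus (g ∘ₗ symProj 𝒱) g) ht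

theorem AgreeUpTo.comp_symProj {K : ℕ} {g g' : Tens 𝕜 V →ₗ[𝕜] W} (h : AgreeUpTo K g' g)
    (hg : IsSymm 𝒱 g) : AgreeUpTo K (g' ∘ₗ symProj 𝒱) g := fun k hk t ht => by
  rw [LinearMap.comp_apply, h k hk _ (symTens_le k (symProj_mem ht)), hg.apply_symProj ht]

theorem exists_extension_L {K : ℕ} (hK : 1 ≤ K) (hq : IsQuasiIso dV dW (linearPart F))
    (hm : IsLAlgebra ⊤ 𝒱 dV m) (hl : IsLAlgebra K 𝒲 dW l) (hF : IsLMorphism K 𝒱 𝒲 dV dW m l F) :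
    ∃ (l' : Ops 𝕜 W W) (F' : Ops 𝕜 V W),
      (∀ i, 2 ≤ i → i ≤ K → l' i = l i) ∧ (∀ i, 1 ≤ i → i ≤ K → F' i = F i) ∧
      IsLAlgebra ⊤ 𝒲 dW l' ∧ IsLMorphism ⊤ 𝒱 𝒲 dV dW m l' F' := by
  obtain ⟨M, hM⟩ := exists_isAlgebraFamily hm.differential hm.degree
  obtain ⟨L, hL⟩ := exists_isAlgebraFamily hl.differential hl.degree
  obtain ⟨G, hG⟩ := exists_isMorphismFamily hF.degree
  obtain ⟨b, hb⟩ := exists_represents (𝒱 := 𝒱) (invFact 𝕜) M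
  obtain ⟨c, hc⟩ := exists_represents (𝒱 := 𝒲) (invFact 𝕜) L
  obtain ⟨f, hf⟩ := exists_represents (𝒱 := 𝒱) (invFact 𝕜) G
  have hbs := hb.isSymm (hM.gradedAntisymmetric hm.antisymm)
  have hcs := hc.isSymm (hL.gradedAntisymmetric hl.antisymm)
  have hfs := hf.isSymm (hG.gradedAntisymmetric hF.antisymm)
  have hb1 := hb.apply_one hM.zero
  have hc1 := hc.apply_one hL.zero
  have hf1 := hf.apply_one hG.zero
  have hbb : ∀ k, ∀ t ∈ symTens (par 𝒱) k, b (cod (par 𝒱) b t) = 0 := fun k => by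
    by_cases hk : 2 ≤ k
    · exact (hM.sym_sq_iff hm.differential hb hbs hk le_top).2 (hm.relation k hk le_top)
    · exact fun t ht => hM.sq_of_lt_two hb invFact_one hm.differential (not_le.1 hk) (symTens_le k ht)
  have hcc : ∀ k ≤ K, ∀ t ∈ symTens (par 𝒲) k, c (cod (par 𝒲) c t) = 0 := fun k hkK => by
    by_cases hk : 2 ≤ k
    · exact (hL.sym_sq_iff hl.differential hc hcs hk (Nat.cast_le.2 hkK)).2
        (hl.relation k hk (Nat.cast_le.2 hkK))
    · exact fun t ht => hL.sq_of_lt_two hc invFact_one hl.differential (not_le.1 hk) (symTens_le k ht)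
  have hr : ∀ k ≤ K, ∀ t ∈ symTens (par 𝒱) k, ∀ φ : Tens 𝕜 V →ₗ[𝕜] Tens 𝕜 W,
      φ = cunit _ + conv (ι 𝕜 ∘ₗ f) φ → c (φ t) = f (cod (par 𝒱) b t) := fun k hkK t ht φ hφ => by
    by_cases hk : 1 ≤ k
    · exact (hG.sym_map_iff hM hm.differential hL hf hfs hb hbs hc hφ hk (Nat.cast_le.2 hkK)).2
        (hF.relation k hk (Nat.cast_le.2 hkK)) t ht
    · obtain rfl : k = 0 := by lia
      exact map_of_eq_zero hf1 hb1 hc1 hφ ht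
  have hK' : (1 : ℕ∞) ≤ (K : ℕ∞) := by exact_mod_cast hK
  have hF0 : HasDegree 𝒱 𝒲 (F 1) 0 := by simpa using hF.degree 1 le_rfl hK'
  have hS := isStable_symTens (par_par 𝒱)
  have hS' := isStable_symTens (par_par 𝒲)
  have hSS := isCompatible_symTens (par_par 𝒱) (par_par 𝒲)
  obtain ⟨c', f', hcf, hc', hf'⟩ := exists_infinite_extension hS.isAdmissible_bot
    hS'.isAdmissible_bot hSS.isAdmissibleMap_bot
    (isCompatible_symTens (par_par 𝒲) (par_par 𝒱)).isAdmissibleMap_bot (hM.isTDeg hb) hb1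
    (by rintro t rfl; exact map_zero b) hm.differential hl.differential (isHom_linearPart hF0) hq
    (hM.comp_ι hb invFact_one) hbb hK ⟨hL.isTDeg hc, hG.isTDeg hf, by rintro t rfl; exact map_zero c,
      by rintro t rfl; exact map_zero f,
      hc1, hf1, hL.comp_ι hc invFact_one, hG.comp_ι hf invFact_one hK', hcc, hr⟩
  have hcA := hc'.comp_symProj hcs
  have hfA := hf'.comp_symProj hfs
  have hf1' := hfA.one.trans hf1
  obtain ⟨L', hcL', hLL', hdL'⟩ := exists_ops_extension hc invFact_ne_zero hcA
    (isTDeg_comp_symProj (hcf 0).c_deg)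
    (fun n => by rw [show (n : ℤ) - 1 + -1 = n - 2 by ring]; exact hL.degree n)
  obtain ⟨G', hfG', hGG', hdG'⟩ := exists_ops_extension hf invFact_ne_zero hfA
    (isTDeg_comp_symProj (hcf 0).f_deg) (fun n => by rw [add_zero]; exact hG.degree n)
  have hcs' := isSymm_comp_symProj (𝒱 := 𝒲) c'
  have hfs' := isSymm_comp_symProj (𝒱 := 𝒱) f'
  have hL' : IsAlgebraFamily 𝒲 ⊤ dW L' L' := ⟨(hLL' 0 (by lia)).trans hL.zero,
    (hLL' 1 hK).trans hL.one, fun _ _ _ => rfl,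
    fun n => by rw [show (n : ℤ) - 2 = n - 1 + -1 by ring]; exact hdL' n,
    fun n _ h => absurd h (not_lt.2 le_top)⟩
  have hG' : IsMorphismFamily 𝒱 𝒲 ⊤ G' G' := ⟨(hGG' 0 (by lia)).trans hG.zero, fun _ _ _ => rfl,
    fun n => by simpa using hdG' n, fun n h => absurd h (not_lt.2 le_top)⟩
  obtain ⟨φ, hφ⟩ := exists_coext f' (hcf 0).f_one
  obtain ⟨ψ, hψ⟩ := exists_coext (f' ∘ₗ symProj 𝒱) hf1'
  refine ⟨L', G', fun i h2 hi => (hLL' i hi).trans (hL.eq i h2 (Nat.cast_le.2 hi)),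
    fun i h1 hi => (hGG' i hi).trans (hG.eq i h1 (Nat.cast_le.2 hi)),
    ⟨hl.differential, fun n _ _ => hL'.degree n,
      fun n _ _ => hcL'.gradedAntisymmetric hcs' (invFact_ne_zero n), fun n hn _ =>
      (hL'.sym_sq_iff hl.differential hcL' hcs' hn le_top).1 fun t ht => ?_⟩,
    ⟨fun n _ _ => hG'.degree n, fun n _ _ => hfG'.gradedAntisymmetric hfs' (invFact_ne_zero n),
      fun n hn _ => (hG'.sym_map_iff hM hm.differential hL' hfG' hfs' hb hbs hcL' hψ hn le_top).1
        fun t ht => ?_⟩⟩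
  · rw [hS'.cod_congr _ (fun k _ t ht => eq_of_mem_iSup_symTens (Submodule.mem_iSup_of_mem k ht)) ht,
      eq_of_mem_iSup_symTens (hS'.cod_mem _ ((hcf 0).c_deg.par_odd (by decide)) n t ht)]
    exact (hcf n).c_sq n le_rfl t ht
  · rw [hS.coext_congr hf1' (hcf 0).f_one hψ hφ
      (fun k _ t ht => eq_of_mem_iSup_symTens (Submodule.mem_iSup_of_mem k ht)) ht,
      eq_of_mem_iSup_symTens (hSS f' φ (hcf 0).f_one (hcf 0).f_deg.par_even hφ n t ht),
      eq_of_mem_iSup_symTens (hS.cod_mem _ ((hM.isTDeg hb).par_odd (by decide)) n t ht)]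
    exact (hcf n).f_map n le_rfl t ht φ hφ

end LieExtension

end StrongHomotopy

theorem mainTheorem4 {𝕜 : Type*} [Field 𝕜] [CharZero 𝕜]
    {V : Type*} [AddCommGroup V] [Module 𝕜 V] (𝒱 : ℤ → Submodule 𝕜 V) [DirectSum.Decomposition 𝒱]
    {W : Type*} [AddCommGroup W] [Module 𝕜 W] (𝒲 : ℤ → Submodule 𝕜 W) [DirectSum.Decomposition 𝒲]
    (dV : V →ₗ[𝕜] V) (dW : W →ₗ[𝕜] W)
    (m : StrongHomotopy.Ops 𝕜 V V) (l : StrongHomotopy.Ops 𝕜 W W) (F : StrongHomotopy.Ops 𝕜 V W)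
    (K : ℕ) (hK : 1 ≤ K)
    (hqis : StrongHomotopy.IsQuasiIso dV dW (StrongHomotopy.linearPart F)) :
    (StrongHomotopy.IsAAlgebra ⊤ 𝒱 dV m → StrongHomotopy.IsAAlgebra K 𝒲 dW l →
      StrongHomotopy.IsAMorphism K 𝒱 𝒲 dV dW m l F →
      ∃ (l' : StrongHomotopy.Ops 𝕜 W W) (F' : StrongHomotopy.Ops 𝕜 V W),
        (∀ i, 2 ≤ i → i ≤ K → l' i = l i) ∧ (∀ i, 1 ≤ i → i ≤ K → F' i = F i) ∧
        StrongHomotopy.IsAAlgebra ⊤ 𝒲 dW l' ∧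
        StrongHomotopy.IsAMorphism ⊤ 𝒱 𝒲 dV dW m l' F') ∧
    (StrongHomotopy.IsCAlgebra ⊤ 𝒱 dV m → StrongHomotopy.IsCAlgebra K 𝒲 dW l →
      StrongHomotopy.IsCMorphism K 𝒱 𝒲 dV dW m l F →
      ∃ (l' : StrongHomotopy.Ops 𝕜 W W) (F' : StrongHomotopy.Ops 𝕜 V W),
        (∀ i, 2 ≤ i → i ≤ K → l' i = l i) ∧ (∀ i, 1 ≤ i → i ≤ K → F' i = F i) ∧
        StrongHomotopy.IsCAlgebra ⊤ 𝒲 dW l' ∧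
        StrongHomotopy.IsCMorphism ⊤ 𝒱 𝒲 dV dW m l' F') ∧
    (StrongHomotopy.IsLAlgebra ⊤ 𝒱 dV m → StrongHomotopy.IsLAlgebra K 𝒲 dW l →
      StrongHomotopy.IsLMorphism K 𝒱 𝒲 dV dW m l F →
      ∃ (l' : StrongHomotopy.Ops 𝕜 W W) (F' : StrongHomotopy.Ops 𝕜 V W),
        (∀ i, 2 ≤ i → i ≤ K → l' i = l i) ∧ (∀ i, 1 ≤ i → i ≤ K → F' i = F i) ∧
        StrongHomotopy.IsLAlgebra ⊤ 𝒲 dW l' ∧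
        StrongHomotopy.IsLMorphism ⊤ 𝒱 𝒲 dV dW m l' F') :=
  ⟨fun hm hl hF => StrongHomotopy.exists_extension_A hK hqis hm hl hF,
    fun hm hl hF => StrongHomotopy.exists_extension_C hK hqis hm hl hF,
    fun hm hl hF => StrongHomotopy.exists_extension_L hK hqis hm hl hF⟩
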